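/- **Setting.** Let $J\subset\mathbb R$ be an open interval containing $0$, $U\subset\mathbb C$ an open set with stereographic coordinate $\zeta=x^1+ix^2$, and $R$ a continuous real function on $\mathscr I=J\times U$. The bulk is the region with coordinates $(u,r,x^A)$, $A=1,2$, where $(u,x)\in\mathscr I$ and $r>R(u,x)$. Write $O(r^n)$, $o(r^n)$ for bounds as $r\to\infty$ that hold locally uniformly in $(u,x)$ and may be differentiated any number of times ($\partial_u,\partial_A$ preserve the order, each $\partial_r$ lowers it by one). An asymptotically flat Newman–Unti (NU) metric is a smooth Lorentzian metric on the bulk $$ds^2=W\,du^2-2\,dr\,du+g_{AB}(dx^A-V^Adu)(dx^B-V^Bdu),$$ with $g_{AB}$ positive definite, $g_{AB}=r^2\bar\gamma_{AB}+rC_{AB}+o(r)$, $\bar\gamma_{AB}dx^Adx^B=e^{2\tilde\varphi}d\zeta d\bar\zeta$, $C^A_A=0$, $V^A=O(r^{-2})$ and $W=-2r\partial_u\tilde\varphi+\bar\Delta\tilde\varphi+O(r^{-1})$, where $\tilde\varphi$ and $C_{AB}$ are smooth functions on $\mathscr I$ and $\bar\Delta=4e^{-2\tilde\varphi}\partial_\zeta\partial_{\bar\zeta}$.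 A smooth vector field $\xi$ on the bulk is an infinitesimal NU transformation with rescaling $\tilde\omega\in C^\infty(\mathscr I)$ if $$\mathcal L_\xi g^{uu}=\mathcal L_\xi g^{uA}=\mathcal L_\xi g^{ur}=0,\qquad \partial_r\Big[\tfrac1{\sqrt{|g|}}\partial_\rho(\sqrt{|g|}\,\xi^\rho)\Big]=o(r^{-2}),$$ $$\mathcal L_\xi g^{rA}=O(r^{-2}),\quad \mathcal L_\xi g^{AB}=-2\tilde\omega g^{AB}+O(r^{-3}),\quad \mathcal L_\xi g^{rr}=2r\partial_u\tilde\omega+2\tilde\omega\bar\Delta\tilde\varphi-\bar\Delta\tilde\omega+O(r^{-1}).$$ For a smooth conformal Killing vector $Y=Y^A\partial_A$ on $U$ (equivalently $Y^\zeta$ is holomorphic), a supertranslation $\tilde T\in C^\infty(U)$ and $\tilde\omega\in C^\infty(\mathscr I)$, all real, put $\psi=\partial_AY^A+2Y^A\partial_A\tilde\varphi$ and $f=e^{\tilde\varphi}\big[\tilde T+\tfrac12\int_0^u du'\,e^{-\tilde\varphi}(\psi-2\tilde\omega)\big]$, and let $\xi=\xi[Y,\tilde T,\tilde\omega;g]$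 be the vector field $$\xi^u=f,\qquad \xi^A=Y^A-\partial_Bf\int_r^\infty dr'\,g^{AB},\qquad \xi^r=-r\partial_uf+\tfrac12\bar\Delta f+\partial_Af\int_r^\infty dr'\,V^A,$$ where $\tilde\varphi$ is regarded as the functional of $g$ given by $e^{2\tilde\varphi}=\lim_{r\to\infty}\tfrac1{2r^2}(g_{11}+g_{22})$. For metric-dependent vector fields let $[\xi_1,\xi_2]_M=[\xi_1,\xi_2]-\delta_{\xi_1}\xi_2+\delta_{\xi_2}\xi_1$, where $\delta_{\xi_1}\xi_2=\frac{d}{ds}\big|_{s=0}\xi_2[g+s\mathcal L_{\xi_1}g]$ at fixed parameters $Y_2,\tilde T_2,\tilde\omega_2$. Let $\mathfrak{bms}_4$ be the real Lie algebra of pairs $(Y,\tilde T)$ with bracket $[(Y_1,\tilde T_1),(Y_2,\tilde T_2)]=(\hat Y,\hat{\tilde T})$, $$\hat Y^A=Y_1^B\partial_BY_2^A-Y_2^B\partial_BY_1^A,\qquad \hat{\tilde T}=Y_1^A\partial_A\tilde T_2-Y_2^A\partial_A\tilde T_1+\tfrac12(\tilde T_1\partial_AY_2^A-\tilde T_2\partial_AY_1^A),$$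 and let the extended $\mathfrak{bms}_4$ algebra be its direct sum with the abelian Lie algebra $C^\infty(\mathscr I)$ of conformal rescalings $\tilde\omega$. **Theorem.** Let $g$ be an asymptotically flat NU metric. 1. Every $\xi[Y,\tilde T,\tilde\omega;g]$ is an infinitesimal NU transformation with rescaling $\tilde\omega$. 2. At every point of the bulk the variations $\delta_{\xi_1}\xi_2$ exist and $$\big[\xi[Y_1,\tilde T_1,\tilde\omega_1;g],\,\xi[Y_2,\tilde T_2,\tilde\omega_2;g]\big]_M=\xi[\hat Y,\hat{\tilde T},0;g].$$ 3. The map $(Y,\tilde T,\tilde\omega)\mapsto\xi[Y,\tilde T,\tilde\omega;g]$ is linear and injective, and its image is the set of all infinitesimal NU transformations (for all $\tilde\omega$). 4. In particular, for a fixed conformal factor ($\tilde\omega=0$), $(Y,\tilde T)\mapsto\xi[Y,\tilde T,0;g]$ is a linear bijection from $\mathfrak{bms}_4$ onto the infinitesimal NU transformations with $\tilde\omega=0$ that carries the bracket of $\mathfrak{bms}_4$ to $[\cdot,\cdot]_M$; so for every conformal factor the symmetry algebra is isomorphic to $\mathfrak{bms}_4$. -/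

import Mathlib

open Filter Topology

noncomputable section

namespace NewmanUnti

/-! ## Coordinates

Spacetime coordinates are `(u, r, x¹, x²)`, indexed by `Fin 4` (so `0 = u`, `1 = r` and the angular
index `A : Fin 2` is `A.succ.succ`).  Coordinates on Scri are `(u, x¹, x²)`, indexed by `Fin 3`
(so `0 = u` and the angular index `A` is `A.succ`).  The angular coordinates are the real and
imaginary parts of the stereographic coordinate, `ζ = x¹ + i x²`, whence `dζ dζ̄ = (dx¹)² + (dx²)²`
and `4 ∂ ∂̄ = (∂₁)² + (∂₂)²`. -/

/-- The angular coordinate plane, `ζ = x 0 + i x 1`. -/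
abbrev Ang := Fin 2 → ℝ
/-- Points of Scri, `(u, x¹, x²)`. -/
abbrev ScriPt := Fin 3 → ℝ
/-- Points of spacetime, `(u, r, x¹, x²)`. -/
abbrev Pt := Fin 4 → ℝ
/-- Vector fields on spacetime, `ξ p μ = ξ^μ(p)`. -/
abbrev VField := Pt → Pt
/-- Covariant two-tensor fields on spacetime, `g p μ ν = g_{μν}(p)`. -/
abbrev Tensor2 := Pt → Matrix (Fin 4) (Fin 4) ℝ

/-- The partial derivative `∂_i F`. -/
def pd {n : ℕ} {E : Type*} [NormedAddCommGroup E] [NormedSpace ℝ E] (i : Fin n)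
    (F : (Fin n → ℝ) → E) (x : Fin n → ℝ) : E :=
  fderiv ℝ F x (Pi.single i 1)

/-- The iterated partial derivative `∂_{i₁} ⋯ ∂_{i_k} F` for `l = [i₁, …, i_k]`. -/
def iterPd {n : ℕ} (l : List (Fin n)) (F : (Fin n → ℝ) → ℝ) : (Fin n → ℝ) → ℝ :=
  l.foldr (fun i G => pd i G) F

/-- The point of Scri below a spacetime point: forget `r`. -/
def toScri (p : Pt) : ScriPt := ![p 0, p 2, p 3]
/-- The spacetime point with radial coordinate `r` over a point of Scri. -/
def lift (q : ScriPt) (r : ℝ) : Pt := ![q 0, r, q 1, q 2]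
/-- The angular coordinates of a point of Scri. -/
def ang (q : ScriPt) : Ang := fun A => q A.succ

/-! ## The region near null infinity -/

/-- A coordinate region near null infinity: retarded time `u` ranges over an open interval `J`
containing `0`, the stereographic coordinate over an open set `U`, and `r > R(u, x)`. -/
structure Region where
  J : Set ℝ
  U : Set Ang
  R : ScriPt → ℝ
  isOpen_J : IsOpen J
  ordConnected_J : J.OrdConnected
  zero_mem_J : (0 : ℝ) ∈ J
  isOpen_U : IsOpen U
  continuousOn_R : ContinuousOn R {q | q 0 ∈ J ∧ ang q ∈ U}

namespace Region
variable (D : Region)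

/-- The coordinate domain on Scri. -/
def scri : Set ScriPt := {q | q 0 ∈ D.J ∧ ang q ∈ D.U}
/-- The coordinate domain in spacetime. -/
def bulk : Set Pt := {p | toScri p ∈ D.scri ∧ D.R (toScri p) < p 1}

end Region

/-- The filter `r → ∞`, `(u, x) → q`. -/
def nearScri (q : ScriPt) : Filter Pt :=
  comap (fun p : Pt => p 1) atTop ⊓ comap toScri (𝓝 q)

/-- `F = O(r^n)`, locally uniformly in `(u, x)`, in the sense that may be differentiated term by
term: `∂_u` and `∂_A` preserve the order and each `∂_r` lowers it by one. -/
def BigO (D : Region) (n : ℤ) (F : Pt → ℝ) : Prop :=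
  ∀ q ∈ D.scri, ∀ l : List (Fin 4),
    iterPd l F =O[nearScri q] fun p => p 1 ^ (n - (l.count 1 : ℤ))

/-- `F = o(r^n)`, in the same sense. -/
def SmallO (D : Region) (n : ℤ) (F : Pt → ℝ) : Prop :=
  ∀ q ∈ D.scri, ∀ l : List (Fin 4),
    iterPd l F =o[nearScri q] fun p => p 1 ^ (n - (l.count 1 : ℤ))

/-! ## Newman–Unti metrics -/

/-- The Laplacian `Δ̄ F = e^{-2φ} (∂₁² + ∂₂²) F = 4 e^{-2φ} ∂ ∂̄ F` of `γ̄ = e^{2φ} dζ dζ̄`. -/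
def lap (φ F : ScriPt → ℝ) (q : ScriPt) : ℝ :=
  Real.exp (-2 * φ q) * ∑ A : Fin 2, pd A.succ (pd A.succ F) q

/-- The one-form `dx^μ`. -/
def dx (μ : Fin 4) : Fin 4 → ℝ := Pi.single μ 1

/-- The line element `W du² - 2 dr du + h_{AB} (dx^A - V^A du) (dx^B - V^B du)`. -/
def nuMetric (W : Pt → ℝ) (V : Pt → Fin 2 → ℝ) (h : Pt → Matrix (Fin 2) (Fin 2) ℝ) : Tensor2 :=
  fun p => Matrix.of fun μ ν =>
    W p * dx 0 μ * dx 0 ν - (dx 1 μ * dx 0 ν + dx 0 μ * dx 1 ν)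
      + ∑ A : Fin 2, ∑ B : Fin 2, h p A B * (dx A.succ.succ μ - V p A * dx 0 μ)
          * (dx B.succ.succ ν - V p B * dx 0 ν)

/-- Asymptotically flat metrics in the sense of Newman and Unti, with conformal factor `e^{2φ}`.
Since `γ̄` is a multiple of the identity matrix, `C^A_A = 0` means that `C` has trace zero. -/
structure NUMetric (D : Region) where
  W : Pt → ℝ
  V : Pt → Fin 2 → ℝ
  h : Pt → Matrix (Fin 2) (Fin 2) ℝ
  φ : ScriPt → ℝ
  C : ScriPt → Matrix (Fin 2) (Fin 2) ℝ
  smooth_W : ContDiffOn ℝ (⊤ : ℕ∞) W D.bulk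
  smooth_V : ContDiffOn ℝ (⊤ : ℕ∞) V D.bulk
  smooth_h : ∀ A B, ContDiffOn ℝ (⊤ : ℕ∞) (fun p => h p A B) D.bulk
  smooth_φ : ContDiffOn ℝ (⊤ : ℕ∞) φ D.scri
  smooth_C : ∀ A B, ContDiffOn ℝ (⊤ : ℕ∞) (fun q => C q A B) D.scri
  posDef_h : ∀ p ∈ D.bulk, (h p).PosDef
  trace_C : ∀ q ∈ D.scri, (C q).trace = 0
  falloff_h : ∀ A B, SmallO D 1 fun p =>
    h p A B - (p 1 ^ 2 * (if A = B then Real.exp (2 * φ (toScri p)) else 0)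
      + p 1 * C (toScri p) A B)
  falloff_V : ∀ A, BigO D (-2) fun p => V p A
  falloff_W : BigO D (-1) fun p =>
    W p - (-2 * p 1 * pd 0 φ (toScri p) + lap φ φ (toScri p))

/-- The spacetime metric `g_{μν}`. -/
def NUMetric.g {D : Region} (M : NUMetric D) : Tensor2 := nuMetric M.W M.V M.h

/-! ## Lie derivatives and the symmetry conditions -/

/-- `(L_ξ g)_{μν}`. -/
def lieMetric (ξ : VField) (g : Tensor2) : Tensor2 := fun p => Matrix.of fun μ ν =>
  ∑ ρ, (ξ p ρ * pd ρ (fun x => g x μ ν) p + g p ρ ν * pd μ ξ p ρ + g p μ ρ * pd ν ξ p ρ)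

/-- `(L_ξ g)^{μν}`, the Lie derivative of the inverse metric. -/
def lieInv (ξ : VField) (g : Tensor2) (μ ν : Fin 4) (p : Pt) : ℝ :=
  ∑ ρ, (ξ p ρ * pd ρ (fun x => (g x)⁻¹ μ ν) p
    - (g p)⁻¹ ρ ν * pd ρ ξ p μ - (g p)⁻¹ μ ρ * pd ρ ξ p ν)

/-- `|g|^{-1/2} ∂_ρ (|g|^{1/2} ξ^ρ)`. -/
def divergence (g : Tensor2) (ξ : VField) (p : Pt) : ℝ :=
  (Real.sqrt |(g p).det|)⁻¹ * ∑ ρ, pd ρ (fun x => Real.sqrt |(g x).det| * ξ x ρ) p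

/-- `ξ` is an infinitesimal Newman–Unti transformation of the spacetime `M`, up to the rescaling
`δφ = ω` of the conformal factor. -/
structure IsNUSymmetry {D : Region} (M : NUMetric D) (ω : ScriPt → ℝ) (ξ : VField) : Prop where
  smooth : ContDiffOn ℝ (⊤ : ℕ∞) ξ D.bulk
  uu : ∀ p ∈ D.bulk, lieInv ξ M.g 0 0 p = 0
  uA : ∀ p ∈ D.bulk, ∀ A : Fin 2, lieInv ξ M.g 0 A.succ.succ p = 0
  ur : ∀ p ∈ D.bulk, lieInv ξ M.g 0 1 p = 0
  div : SmallO D (-2) (pd 1 (divergence M.g ξ))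
  rA : ∀ A : Fin 2, BigO D (-2) (lieInv ξ M.g 1 A.succ.succ)
  AB : ∀ A B : Fin 2, BigO D (-3) fun p =>
    lieInv ξ M.g A.succ.succ B.succ.succ p
      - (-2 * ω (toScri p) * (M.g p)⁻¹ A.succ.succ B.succ.succ)
  rr : BigO D (-1) fun p =>
    lieInv ξ M.g 1 1 p
      - (2 * p 1 * pd 0 ω (toScri p) + 2 * ω (toScri p) * lap M.φ M.φ (toScri p)
          - lap M.φ ω (toScri p))

/-! ## The extended `bms₄` algebra

A function on an open set is represented by its extension by zero. -/

/-- The coordinate divergence `∂_A Y^A`. -/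
def flatDiv (Y : Ang → Ang) (x : Ang) : ℝ := ∑ A, pd A Y x A

/-- The conformal Killing vectors on `U`.  The conformal Killing equation depends on the conformal
class only, so it is written for `dζ dζ̄`. -/
def ckv (D : Region) : Submodule ℝ (Ang → Ang) where
  carrier := {Y | ContDiffOn ℝ (⊤ : ℕ∞) Y D.U ∧ (∀ x ∉ D.U, Y x = 0) ∧
    ∀ x ∈ D.U, ∀ A B, pd A Y x B + pd B Y x A = if A = B then flatDiv Y x else 0}
  zero_mem' := by
    refine ⟨contDiffOn_const, fun _ _ => rfl, fun x _ A B => ?_⟩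
    have : pd (n := 2) (E := Ang) = fun i F x => fderiv ℝ F x (Pi.single i 1) := rfl
    simp [flatDiv, this]
  add_mem' := by
    rintro Y Z ⟨hY, hY0, hYc⟩ ⟨hZ, hZ0, hZc⟩
    refine ⟨hY.add hZ, fun x hx => by simp [hY0 x hx, hZ0 x hx], fun x hx A B => ?_⟩
    have dY := (hY.contDiffAt (D.isOpen_U.mem_nhds hx)).differentiableAt (by simp)
    have dZ := (hZ.contDiffAt (D.isOpen_U.mem_nhds hx)).differentiableAt (by simp)
    have key : ∀ i, pd i (Y + Z) x = pd i Y x + pd i Z x := fun i => by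
      simp [pd, fderiv_add dY dZ]
    have h1 := hYc x hx A B
    have h2 := hZc x hx A B
    simp only [flatDiv, key, Pi.add_apply, Finset.sum_add_distrib] at h1 h2 ⊢
    split_ifs at * <;> linarith
  smul_mem' := by
    rintro c Y ⟨hY, hY0, hYc⟩
    refine ⟨hY.const_smul c, fun x hx => by simp [hY0 x hx], fun x hx A B => ?_⟩
    have dY := (hY.contDiffAt (D.isOpen_U.mem_nhds hx)).differentiableAt (by simp)
    have key : ∀ i, pd i (c • Y) x = c • pd i Y x := fun i => by
      simp [pd, fderiv_const_smul dY c]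
    have h1 := hYc x hx A B
    simp only [flatDiv, key, Pi.smul_apply, smul_eq_mul, ← Finset.mul_sum, ← mul_add, h1]
    split_ifs <;> simp

/-- The smooth functions on an open set. -/
def smoothFns {n : ℕ} (S : Set (Fin n → ℝ)) : Submodule ℝ ((Fin n → ℝ) → ℝ) where
  carrier := {T | ContDiffOn ℝ (⊤ : ℕ∞) T S ∧ ∀ x ∉ S, T x = 0}
  zero_mem' := ⟨contDiffOn_const, fun _ _ => rfl⟩
  add_mem' := by
    rintro S T ⟨hS, hS0⟩ ⟨hT, hT0⟩
    exact ⟨hS.add hT, fun x hx => by simp [hS0 x hx, hT0 x hx]⟩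
  smul_mem' := by
    rintro c T ⟨hT, hT0⟩
    exact ⟨hT.const_smul c, fun x hx => by simp [hT0 x hx]⟩

/-- `Y₁^A ∂_A T₂ - Y₂^A ∂_A T₁ + ½ (T₁ ∂_A Y₂^A - T₂ ∂_A Y₁^A)`. -/
def stBracket (Y₁ : Ang → Ang) (T₁ : Ang → ℝ) (Y₂ : Ang → Ang) (T₂ : Ang → ℝ) (x : Ang) : ℝ :=
  ∑ A, (Y₁ x A * pd A T₂ x - Y₂ x A * pd A T₁ x)
    + 1 / 2 * (T₁ x * flatDiv Y₂ x - T₂ x * flatDiv Y₁ x)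

section algebra
variable {D : Region}

theorem two_le_smooth : (1 + 1 : WithTop ℕ∞) ≤ ((⊤ : ℕ∞) : WithTop ℕ∞) :=
  WithTop.coe_le_coe.2 (le_top : (1 + 1 : ℕ∞) ≤ ⊤)

theorem ckv_contDiffAt {Y : Ang → Ang} (hY : Y ∈ ckv D) {x : Ang} (hx : x ∈ D.U) :
    ContDiffAt ℝ (⊤ : ℕ∞) Y x :=
  hY.1.contDiffAt (D.isOpen_U.mem_nhds hx)

theorem fderiv_lieBracket {Y Z : Ang → Ang} {x : Ang} (hY : ContDiffAt ℝ (⊤ : ℕ∞) Y x)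
    (hZ : ContDiffAt ℝ (⊤ : ℕ∞) Z x) (v : Ang) :
    fderiv ℝ (VectorField.lieBracket ℝ Y Z) x v
      = fderiv ℝ (fderiv ℝ Z) x (Y x) v - fderiv ℝ (fderiv ℝ Y) x (Z x) v
        + fderiv ℝ Z x (fderiv ℝ Y x v) - fderiv ℝ Y x (fderiv ℝ Z x v) := by
  have dY := hY.differentiableAt (by simp)
  have dZ := hZ.differentiableAt (by simp)
  have ddY := (hY.fderiv_right (m := 1) two_le_smooth).differentiableAt (by simp)
  have ddZ := (hZ.fderiv_right (m := 1) two_le_smooth).differentiableAt (by simp)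
  have sY := (hY.isSymmSndFDerivAt (by simpa [one_add_one_eq_two] using two_le_smooth)).eq
  have sZ := (hZ.isSymmSndFDerivAt (by simpa [one_add_one_eq_two] using two_le_smooth)).eq
  have : VectorField.lieBracket ℝ Y Z
      = fun y => fderiv ℝ Z y (Y y) - fderiv ℝ Y y (Z y) := rfl
  rw [this, fderiv_fun_sub (ddZ.clm_apply dY) (ddY.clm_apply dZ), fderiv_clm_apply ddZ dY,
    fderiv_clm_apply ddY dZ]
  simp only [sub_apply, add_apply, ContinuousLinearMap.comp_apply, ContinuousLinearMap.flip_apply]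
  rw [sZ v, sY v]
  abel

/-- The entries of the derivative of the Jacobian matrix of `Y` are derivatives of its entries. -/
theorem fderiv_pd {Y : Ang → Ang} {x : Ang} (hY : ContDiffAt ℝ (⊤ : ℕ∞) Y x)
    (A B : Fin 2) :
    HasFDerivAt (𝕜 := ℝ) (fun y => pd A Y y B)
      ((ContinuousLinearMap.proj (R := ℝ) (φ := fun _ : Fin 2 => ℝ) B).comp
        ((ContinuousLinearMap.apply ℝ Ang (Pi.single A 1 : Ang)).comp
          (fderiv ℝ (fderiv ℝ Y) x))) x := by
  have ddY := (hY.fderiv_right (m := 1) two_le_smooth).differentiableAt (by simp)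
  have h1 := (ContinuousLinearMap.apply ℝ Ang (Pi.single A 1 : Ang)).hasFDerivAt.comp x
    ddY.hasFDerivAt
  exact (ContinuousLinearMap.proj (R := ℝ) (φ := fun _ : Fin 2 => ℝ) B).hasFDerivAt.comp x h1

theorem clm_ang (L : Ang →L[ℝ] Ang) (v : Ang) (B : Fin 2) :
    L v B = v 0 * L (Pi.single 0 1) B + v 1 * L (Pi.single 1 1) B := by
  have : v = v 0 • (Pi.single 0 1 : Ang) + v 1 • (Pi.single 1 1 : Ang) := by
    ext i; fin_cases i <;> simp
  conv_lhs => rw [this]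
  simp

theorem flatDiv_hasFDerivAt {Y : Ang → Ang} {x : Ang} (hY : ContDiffAt ℝ (⊤ : ℕ∞) Y x) (v : Ang) :
    fderiv ℝ (flatDiv Y) x v
      = ∑ A, fderiv ℝ (fderiv ℝ Y) x v (Pi.single A 1) A := by
  have h : HasFDerivAt (fun y => ∑ A, pd A Y y A) _ x :=
    HasFDerivAt.fun_sum (u := Finset.univ) fun A _ => fderiv_pd hY A A
  have e : flatDiv Y = fun y => ∑ A, pd A Y y A := rfl
  rw [e, h.fderiv]
  simp

/-- `∂_A [Y, Z]^A = Y^B ∂_B ∂_A Z^A - Z^B ∂_B ∂_A Y^A`. -/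
theorem flatDiv_lieBracket {Y Z : Ang → Ang} {x : Ang} (hY : ContDiffAt ℝ (⊤ : ℕ∞) Y x)
    (hZ : ContDiffAt ℝ (⊤ : ℕ∞) Z x) :
    flatDiv (VectorField.lieBracket ℝ Y Z) x
      = fderiv ℝ (flatDiv Z) x (Y x) - fderiv ℝ (flatDiv Y) x (Z x) := by
  rw [flatDiv_hasFDerivAt hY, flatDiv_hasFDerivAt hZ]
  simp only [flatDiv, pd, fderiv_lieBracket hY hZ, Fin.sum_univ_two, Pi.add_apply, Pi.sub_apply]
  rw [clm_ang (fderiv ℝ Z x) (fderiv ℝ Y x _), clm_ang (fderiv ℝ Z x) (fderiv ℝ Y x _),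
    clm_ang (fderiv ℝ Y x) (fderiv ℝ Z x _), clm_ang (fderiv ℝ Y x) (fderiv ℝ Z x _)]
  ring

theorem lieBracket_mem_ckv {Y Z : Ang → Ang} (hY : Y ∈ ckv D) (hZ : Z ∈ ckv D) :
    VectorField.lieBracket ℝ Y Z ∈ ckv D := by
  refine ⟨fun x hx => ?_, fun x hx => ?_, fun x hx A B => ?_⟩
  · exact ((ckv_contDiffAt hY hx).lieBracket_vectorField (ckv_contDiffAt hZ hx)
      (by simp)).contDiffWithinAt
  · exact VectorField.lieBracket_eq_zero_of_eq_zero (hY.2.1 x hx) (hZ.2.1 x hx)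
  · have cY := ckv_contDiffAt hY hx
    have cZ := ckv_contDiffAt hZ hx
    have second : ∀ X ∈ ckv D, ∀ v : Ang, ∀ A B,
        fderiv ℝ (fderiv ℝ X) x v (Pi.single A 1) B + fderiv ℝ (fderiv ℝ X) x v (Pi.single B 1) A
          = if A = B then ∑ C, fderiv ℝ (fderiv ℝ X) x v (Pi.single C 1) C else 0 := by
      intro X hX v A B
      have cX := ckv_contDiffAt hX hx
      have h1 := (fderiv_pd cX A B).fun_add (fderiv_pd cX B A)
      have ev : (fun y => pd A X y B + pd B X y A)
          =ᶠ[𝓝 x] fun y => if A = B then flatDiv X y else 0 := by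
        filter_upwards [D.isOpen_U.mem_nhds hx] with y hy using hX.2.2 y hy A B
      have h2 := ev.fderiv_eq (𝕜 := ℝ)
      rw [h1.fderiv] at h2
      have h3 := congrArg (fun L : Ang →L[ℝ] ℝ => L v) h2
      split_ifs with hAB
      · simp only [hAB, if_true] at h3
        have e : (fun y => flatDiv X y) = flatDiv X := rfl
        rw [e, flatDiv_hasFDerivAt cX] at h3
        simpa [hAB] using h3
      · simpa [hAB] using h3
    have a1 := hY.2.2 x hx
    have a2 := hZ.2.2 x hx
    have b1 := second Y hY (Z x)
    have b2 := second Z hZ (Y x)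
    simp only [flatDiv, pd, fderiv_lieBracket cY cZ, Fin.sum_univ_two, Pi.add_apply,
      Pi.sub_apply] at a1 a2 b1 b2 ⊢
    simp only [clm_ang (fderiv ℝ Z x) (fderiv ℝ Y x _), clm_ang (fderiv ℝ Y x) (fderiv ℝ Z x _)]
    have a1' := a1 0 0
    have a1'' := a1 0 1
    have a2' := a2 0 0
    have a2'' := a2 0 1
    have b1' := b1 0 0
    have b1'' := b1 0 1
    have b2' := b2 0 0
    have b2'' := b2 0 1
    simp only [if_true, zero_ne_one, if_false] at a1' a1'' a2' a2'' b1' b1'' b2' b2''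
    have e1 : fderiv ℝ Y x (Pi.single 0 1) 0 = fderiv ℝ Y x (Pi.single 1 1) 1 := by linarith
    have e2 : fderiv ℝ Y x (Pi.single 0 1) 1 = - fderiv ℝ Y x (Pi.single 1 1) 0 := by linarith
    have e3 : fderiv ℝ Z x (Pi.single 0 1) 0 = fderiv ℝ Z x (Pi.single 1 1) 1 := by linarith
    have e4 : fderiv ℝ Z x (Pi.single 0 1) 1 = - fderiv ℝ Z x (Pi.single 1 1) 0 := by linarith
    fin_cases A <;> fin_cases B <;> simp [e1, e2, e3, e4] <;> linarith

theorem flatDiv_contDiffAt {Y : Ang → Ang} {x : Ang} (hY : ContDiffAt ℝ (⊤ : ℕ∞) Y x) :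
    ContDiffAt ℝ (⊤ : ℕ∞) (flatDiv Y) x := by
  have h := hY.fderiv_right (m := (⊤ : ℕ∞)) (by simp)
  refine ContDiffAt.sum fun A _ => ?_
  have h2 : ContDiffAt ℝ (⊤ : ℕ∞) (fun y => fderiv ℝ Y y (Pi.single A 1)) x :=
    h.clm_apply contDiffAt_const
  exact contDiffAt_pi.1 h2 A

theorem sum_pd {T : Ang → ℝ} (x v : Ang) : ∑ A, v A * pd A T x = fderiv ℝ T x v := by
  have : v = v 0 • (Pi.single 0 1 : Ang) + v 1 • (Pi.single 1 1 : Ang) := by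
    ext i; fin_cases i <;> simp
  conv_rhs => rw [this]
  simp [pd]

theorem stBracket_eq (Y₁ : Ang → Ang) (T₁ : Ang → ℝ) (Y₂ : Ang → Ang) (T₂ : Ang → ℝ) :
    stBracket Y₁ T₁ Y₂ T₂ = fun x => fderiv ℝ T₂ x (Y₁ x) - fderiv ℝ T₁ x (Y₂ x)
      + 1 / 2 * (T₁ x * flatDiv Y₂ x - T₂ x * flatDiv Y₁ x) := by
  funext x
  simp only [stBracket, Finset.sum_sub_distrib, sum_pd]

theorem fns_contDiffAt {T : Ang → ℝ} (hT : T ∈ smoothFns D.U) {x : Ang} (hx : x ∈ D.U) :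
    ContDiffAt ℝ (⊤ : ℕ∞) T x :=
  hT.1.contDiffAt (D.isOpen_U.mem_nhds hx)

theorem fderiv_apply_contDiffAt {T : Ang → ℝ} {Y : Ang → Ang} {x : Ang}
    (hT : ContDiffAt ℝ (⊤ : ℕ∞) T x) (hY : ContDiffAt ℝ (⊤ : ℕ∞) Y x) :
    ContDiffAt ℝ (⊤ : ℕ∞) (fun y => fderiv ℝ T y (Y y)) x :=
  (hT.fderiv_right (m := (⊤ : ℕ∞)) (by simp)).clm_apply hY

theorem stBracket_mem {Y₁ Y₂ : Ang → Ang} {T₁ T₂ : Ang → ℝ} (hY₁ : Y₁ ∈ ckv D)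
    (hT₁ : T₁ ∈ smoothFns D.U) (hY₂ : Y₂ ∈ ckv D) (hT₂ : T₂ ∈ smoothFns D.U) :
    stBracket Y₁ T₁ Y₂ T₂ ∈ smoothFns D.U := by
  refine ⟨fun x hx => ContDiffAt.contDiffWithinAt ?_, fun x hx => ?_⟩
  · rw [stBracket_eq]
    have c1 := ckv_contDiffAt hY₁ hx
    have c2 := ckv_contDiffAt hY₂ hx
    have t1 := fns_contDiffAt hT₁ hx
    have t2 := fns_contDiffAt hT₂ hx
    exact ((fderiv_apply_contDiffAt t2 c1).sub (fderiv_apply_contDiffAt t1 c2)).add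
      (contDiffAt_const.mul ((t1.mul (flatDiv_contDiffAt c2)).sub
        (t2.mul (flatDiv_contDiffAt c1))))
  · simp [stBracket, hY₁.2.1 x hx, hY₂.2.1 x hx, hT₁.2 x hx, hT₂.2 x hx]

/-- The first-order operator `T ↦ Y^A ∂_A T - ½ T ∂_A Y^A` on supertranslations. -/
def act (Y : Ang → Ang) (T : Ang → ℝ) (x : Ang) : ℝ :=
  fderiv ℝ T x (Y x) - 1 / 2 * (T x * flatDiv Y x)

theorem stBracket_eq_act (Y₁ : Ang → Ang) (T₁ : Ang → ℝ) (Y₂ : Ang → Ang) (T₂ : Ang → ℝ) :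
    stBracket Y₁ T₁ Y₂ T₂ = fun x => act Y₁ T₂ x - act Y₂ T₁ x := by
  rw [stBracket_eq]; funext x; simp only [act]; ring

theorem act_contDiffAt {T : Ang → ℝ} {Y : Ang → Ang} {x : Ang}
    (hT : ContDiffAt ℝ (⊤ : ℕ∞) T x) (hY : ContDiffAt ℝ (⊤ : ℕ∞) Y x) :
    ContDiffAt ℝ (⊤ : ℕ∞) (act Y T) x :=
  (fderiv_apply_contDiffAt hT hY).sub (contDiffAt_const.mul (hT.mul (flatDiv_contDiffAt hY)))

theorem act_sub {S T : Ang → ℝ} (Y : Ang → Ang) {x : Ang}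
    (hS : ContDiffAt ℝ (⊤ : ℕ∞) S x) (hT : ContDiffAt ℝ (⊤ : ℕ∞) T x) :
    act Y (fun y => S y - T y) x = act Y S x - act Y T x := by
  simp only [act]
  rw [fderiv_fun_sub (hS.differentiableAt (by simp)) (hT.differentiableAt (by simp))]
  simp only [sub_apply]
  ring

theorem act_lieBracket {Y Z : Ang → Ang} {T : Ang → ℝ} {x : Ang}
    (hY : ContDiffAt ℝ (⊤ : ℕ∞) Y x) (hZ : ContDiffAt ℝ (⊤ : ℕ∞) Z x)
    (hT : ContDiffAt ℝ (⊤ : ℕ∞) T x) :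
    act (VectorField.lieBracket ℝ Y Z) T x = act Y (act Z T) x - act Z (act Y T) x := by
  have dY := hY.differentiableAt (by simp)
  have dZ := hZ.differentiableAt (by simp)
  have dT := hT.differentiableAt (by simp)
  have step : ∀ {X X' : Ang → Ang}, ContDiffAt ℝ (⊤ : ℕ∞) X x →
      fderiv ℝ (act X T) x (X' x) = fderiv ℝ (fun y => fderiv ℝ T y (X y)) x (X' x)
        - 1 / 2 * (T x * fderiv ℝ (flatDiv X) x (X' x) + flatDiv X x * fderiv ℝ T x (X' x)) := by
    intro X X' hX
    have d1 := (fderiv_apply_contDiffAt hT hX).differentiableAt (by simp)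
    have d2 := (flatDiv_contDiffAt hX).differentiableAt (by simp)
    have e : act X T = fun y => fderiv ℝ T y (X y) - 1 / 2 * (T y * flatDiv X y) := rfl
    rw [e, fderiv_fun_sub d1 ((dT.fun_mul d2).const_mul _), fderiv_const_mul (dT.fun_mul d2),
      fderiv_fun_mul dT d2]
    simp
    ring
  have h1 := VectorField.fderiv_apply_lieBracket hT
    (by simpa [one_add_one_eq_two] using two_le_smooth) dZ dY
  have h2 : ∀ (X : Ang → Ang) (S : Ang → ℝ),
      act X S x = fderiv ℝ S x (X x) - 1 / 2 * (S x * flatDiv X x) := fun _ _ => rfl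
  rw [h2 (VectorField.lieBracket ℝ Y Z), h1, flatDiv_lieBracket hY hZ, h2 Y (act Z T),
    h2 Z (act Y T), step hZ, step hY, h2 Z T, h2 Y T]
  ring

end algebra

/-- `bms₄`: pairs `(Y, T)` of a conformal Killing vector and a supertranslation. -/
def BMS4 (D : Region) : Type := ckv D × smoothFns D.U

namespace BMS4
variable {D : Region}

instance : AddCommGroup (BMS4 D) := inferInstanceAs (AddCommGroup (ckv D × smoothFns D.U))
instance : Module ℝ (BMS4 D) := inferInstanceAs (Module ℝ (ckv D × smoothFns D.U))

/-- The conformal Killing vector. -/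
def Y (a : BMS4 D) : Ang → Ang := a.1.1
/-- The supertranslation. -/
def T (a : BMS4 D) : Ang → ℝ := a.2.1

theorem ext' {a b : BMS4 D} (hY : a.Y = b.Y) (hT : a.T = b.T) : a = b :=
  Prod.ext (Subtype.ext hY) (Subtype.ext hT)

/-- `[(Y₁, T₁), (Y₂, T₂)] = (Ŷ, T̂)` with `Ŷ^A = Y₁^B ∂_B Y₂^A - Y₂^B ∂_B Y₁^A` and
`T̂ = Y₁^A ∂_A T₂ - Y₂^A ∂_A T₁ + ½ (T₁ ∂_A Y₂^A - T₂ ∂_A Y₁^A)`. -/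
instance : Bracket (BMS4 D) (BMS4 D) where
  bracket a b :=
    (⟨VectorField.lieBracket ℝ a.Y b.Y, lieBracket_mem_ckv a.1.2 b.1.2⟩,
      ⟨stBracket a.Y a.T b.Y b.T, stBracket_mem a.1.2 a.2.2 b.1.2 b.2.2⟩)

theorem Y_lie (a b : BMS4 D) : ⁅a, b⁆.Y = VectorField.lieBracket ℝ a.Y b.Y := rfl
theorem T_lie (a b : BMS4 D) : ⁅a, b⁆.T = stBracket a.Y a.T b.Y b.T := rfl
theorem Y_add (a b : BMS4 D) : (a + b).Y = a.Y + b.Y := rfl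
theorem T_add (a b : BMS4 D) : (a + b).T = a.T + b.T := rfl
theorem Y_smul (c : ℝ) (a : BMS4 D) : (c • a).Y = c • a.Y := rfl
theorem T_smul (c : ℝ) (a : BMS4 D) : (c • a).T = c • a.T := rfl

theorem Y_smooth (a : BMS4 D) {x : Ang} (hx : x ∈ D.U) : ContDiffAt ℝ (⊤ : ℕ∞) a.Y x :=
  ckv_contDiffAt a.1.2 hx
theorem T_smooth (a : BMS4 D) {x : Ang} (hx : x ∈ D.U) : ContDiffAt ℝ (⊤ : ℕ∞) a.T x :=
  fns_contDiffAt a.2.2 hx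
theorem Y_off (a : BMS4 D) {x : Ang} (hx : x ∉ D.U) : a.Y x = 0 := a.1.2.2.1 x hx
theorem T_off (a : BMS4 D) {x : Ang} (hx : x ∉ D.U) : a.T x = 0 := a.2.2.2 x hx

/-- Two elements agree as soon as they agree on `U`. -/
theorem ext_on {a b : BMS4 D} (hY : ∀ x ∈ D.U, a.Y x = b.Y x) (hT : ∀ x ∈ D.U, a.T x = b.T x) :
    a = b := by
  refine ext' (funext fun x => ?_) (funext fun x => ?_)
  · by_cases hx : x ∈ D.U
    · exact hY x hx
    · rw [Y_off a hx, Y_off b hx]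
  · by_cases hx : x ∈ D.U
    · exact hT x hx
    · rw [T_off a hx, T_off b hx]

theorem skew (a b : BMS4 D) : ⁅a, b⁆ = -⁅b, a⁆ := by
  refine ext' ?_ ?_
  · exact funext fun x => VectorField.lieBracket_swap
  · change stBracket a.Y a.T b.Y b.T = -stBracket b.Y b.T a.Y a.T
    funext x
    simp only [stBracket_eq, Pi.neg_apply]
    ring

theorem add_lie' (a b c : BMS4 D) : ⁅a + b, c⁆ = ⁅a, c⁆ + ⁅b, c⁆ := by
  refine ext_on (fun x hx => ?_) (fun x hx => ?_)
  · have d1 := (a.Y_smooth hx).differentiableAt (by simp)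
    have d2 := (b.Y_smooth hx).differentiableAt (by simp)
    rw [Y_lie, Y_add, Y_add, VectorField.lieBracket_add_left d1 d2]
    rfl
  · have d1 := (a.Y_smooth hx).differentiableAt (by simp)
    have d2 := (b.Y_smooth hx).differentiableAt (by simp)
    have t1 := (a.T_smooth hx).differentiableAt (by simp)
    have t2 := (b.T_smooth hx).differentiableAt (by simp)
    have e : flatDiv (a.Y + b.Y) x = flatDiv a.Y x + flatDiv b.Y x := by
      simp [flatDiv, pd, fderiv_add d1 d2]
      ring
    rw [T_add]
    simp only [T_lie, Y_add, T_add, stBracket_eq, Pi.add_apply, e, fderiv_add t1 t2, map_add,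
      add_apply]
    ring

theorem smul_lie' (t : ℝ) (a c : BMS4 D) : ⁅t • a, c⁆ = t • ⁅a, c⁆ := by
  refine ext_on (fun x hx => ?_) (fun x hx => ?_)
  · have d1 := (a.Y_smooth hx).differentiableAt (by simp)
    rw [Y_lie, Y_smul, Y_smul, VectorField.lieBracket_const_smul_left d1]
    rfl
  · have d1 := (a.Y_smooth hx).differentiableAt (by simp)
    have t1 := (a.T_smooth hx).differentiableAt (by simp)
    have e : flatDiv (t • a.Y) x = t * flatDiv a.Y x := by
      simp [flatDiv, pd, fderiv_const_smul d1 t]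
      ring
    rw [T_smul]
    simp only [T_lie, Y_smul, T_smul, stBracket_eq, Pi.smul_apply, e, fderiv_const_smul t1 t,
      map_smul, smul_apply, smul_eq_mul]
    ring

instance : LieRing (BMS4 D) where
  add_lie := add_lie'
  lie_add a b c := by
    rw [skew a (b + c), add_lie', skew a b, skew a c]
    abel
  lie_self a := by
    refine ext' ?_ ?_
    · exact VectorField.lieBracket_self
    · change stBracket a.Y a.T a.Y a.T = 0
      funext x
      simp [stBracket_eq]
  leibniz_lie a b c := by
    refine ext_on (fun x hx => ?_) (fun x hx => ?_)
    · exact VectorField.leibniz_identity_lieBracket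
        (by simpa [one_add_one_eq_two] using two_le_smooth)
        (a.Y_smooth hx) (b.Y_smooth hx) (c.Y_smooth hx)
    · have ca := a.Y_smooth hx
      have cb := b.Y_smooth hx
      have cc := c.Y_smooth hx
      have ta := a.T_smooth hx
      have tb := b.T_smooth hx
      have tc := c.T_smooth hx
      rw [T_add]
      simp only [T_lie, Y_lie, stBracket_eq_act, Pi.add_apply]
      rw [act_lieBracket cb cc ta, act_lieBracket ca cb tc, act_lieBracket ca cc tb,
        act_sub _ (act_contDiffAt tc cb) (act_contDiffAt tb cc),
        act_sub _ (act_contDiffAt tb ca) (act_contDiffAt ta cb),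
        act_sub _ (act_contDiffAt tc ca) (act_contDiffAt ta cc)]
      ring

instance : LieAlgebra ℝ (BMS4 D) where
  lie_smul t a b := by
    rw [skew a (t • b), smul_lie', skew a b, smul_neg]

end BMS4

/-- The abelian Lie algebra of infinitesimal conformal rescalings: smooth functions on Scri. -/
def Rescaling (D : Region) : Type := smoothFns D.scri

namespace Rescaling
variable {D : Region}

instance : AddCommGroup (Rescaling D) := inferInstanceAs (AddCommGroup (smoothFns D.scri))
instance : Module ℝ (Rescaling D) := inferInstanceAs (Module ℝ (smoothFns D.scri))
instance : Bracket (Rescaling D) (Rescaling D) where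
  bracket _ _ := 0

theorem lie_eq_zero (a b : Rescaling D) : ⁅a, b⁆ = 0 := rfl

instance : LieRing (Rescaling D) where
  add_lie _ _ _ := by simp [lie_eq_zero]
  lie_add _ _ _ := by simp [lie_eq_zero]
  lie_self _ := rfl
  leibniz_lie _ _ _ := by simp [lie_eq_zero]

instance : LieAlgebra ℝ (Rescaling D) where
  lie_smul _ _ _ := by simp [lie_eq_zero]

/-- The underlying function `ω(u, x)`. -/
def fn (w : Rescaling D) : ScriPt → ℝ := w.1

end Rescaling

/-- Extended `bms₄`: the direct sum of the Lie algebras `bms₄` and of conformal rescalings. -/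
abbrev ExtBMS4 (D : Region) : Type := BMS4 D × Rescaling D

/-! ## The asymptotic Killing vectors `ξ[Y, T, ω; g]` -/

/-- The conformal factor `φ` read off from the metric: `e^{2φ} = lim r⁻² ½ (g₁₁ + g₂₂)`, the
limit `r → ∞` being taken along the ray over `q`. -/
def confFactor (g : Tensor2) (q : ScriPt) : ℝ :=
  1 / 2 * Real.log (limUnder atTop fun r : ℝ => (g (lift q r) 2 2 + g (lift q r) 3 3) / (2 * r ^ 2))

/-- `ψ = D̄_A Y^A = ∂_A Y^A + 2 Y^A ∂_A φ`. -/
def psi (Y : Ang → Ang) (φ : ScriPt → ℝ) (q : ScriPt) : ℝ :=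
  flatDiv Y (ang q) + 2 * ∑ A : Fin 2, Y (ang q) A * pd A.succ φ q

/-- `f = e^φ [T + ½ ∫₀^u du' e^{-φ} (ψ - 2 ω)]`. -/
def fFun (Y : Ang → Ang) (T : Ang → ℝ) (ω φ : ScriPt → ℝ) (q : ScriPt) : ℝ :=
  Real.exp (φ q) * (T (ang q) + 1 / 2 * ∫ v in (0 : ℝ)..q 0,
    Real.exp (-φ (Function.update q 0 v))
      * (psi Y φ (Function.update q 0 v) - 2 * ω (Function.update q 0 v)))

/-- The vector field with `ξ^u = f`, `ξ^r = -r ∂_u f + ½ Δ̄ f + ∂_A f ∫_r^∞ V^A dr'` and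
`ξ^A = Y^A - ∂_B f ∫_r^∞ g^{AB} dr'`, where `V^A = -g^{rA}`. -/
def killing (Y : Ang → Ang) (φ f : ScriPt → ℝ) (g : Tensor2) : VField := fun p =>
  Matrix.vecCons (f (toScri p)) <|
  Matrix.vecCons
    (-p 1 * pd 0 f (toScri p) + 1 / 2 * lap φ f (toScri p)
      + ∑ A : Fin 2, pd A.succ f (toScri p)
          * ∫ s in Set.Ioi (p 1), -(g (Function.update p 1 s))⁻¹ 1 A.succ.succ) <|
  fun A : Fin 2 =>
    Y (ang (toScri p)) A - ∑ B : Fin 2, pd B.succ f (toScri p)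
      * ∫ s in Set.Ioi (p 1), (g (Function.update p 1 s))⁻¹ A.succ.succ B.succ.succ

/-- `ξ[Y, T, ω; g]` as a function of the metric. -/
def akv {D : Region} (a : ExtBMS4 D) (g : Tensor2) : VField :=
  killing a.1.Y (confFactor g) (fFun a.1.Y a.1.T a.2.fn (confFactor g)) g

/-! ## The modified Lie bracket -/

/-- The variation of the metric-dependent vector field `X` when the metric `g` is varied by `h`. -/
def variation (X : Tensor2 → VField) (g h : Tensor2) (p : Pt) : Pt :=
  deriv (fun s : ℝ => X (g + s • h) p) 0

/-- `[X₁, X₂]_M = [X₁, X₂] - δ_{X₁} X₂ + δ_{X₂} X₁`, where `δ_X g = L_X g`. -/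
def modBracket (X₁ X₂ : Tensor2 → VField) (g : Tensor2) (p : Pt) : Pt :=
  VectorField.lieBracket ℝ (X₁ g) (X₂ g) p
    - variation X₂ g (lieMetric (X₁ g) g) p + variation X₁ g (lieMetric (X₂ g) g) p

end NewmanUnti

end

/-! Since g^{uμ} is constant, the gauge conditions on L_ξ g^{uu}, L_ξ g^{ur} and L_ξ g^{uA} say
exactly that ∂_r ξ^μ = g^{μν} ∂_ν ξ^u (`gauge_iff`). These are ordinary differential equations along
the rays: ξ^u = f does not depend on r, and the other components follow by integrating metric
functions inward from r = ∞, up to integration functions Z and Y^A on Scri. Every solution is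
therefore one of the fields `gen f Z Y` (`exists_gen`).

The remaining conditions concern a few coefficients in an expansion in r. The one on g^{rA} says ∂_u
Y^A = 0, the one on the divergence says Z = ½ Δ̄ f, and the one on g^{AB} says that Y is conformal
Killing and that ∂_u f = f ∂_u φ + ½ ψ - ω. This linear equation has the integrating factor e^{-φ};
its solutions are the functions f of the theorem, with T as initial value at u = 0. The condition on
g^{rr} is then automatic: its coefficient of r is the u-derivative of the evolution equation, and
its coefficient of r⁰ follows from the equation and its Laplacian, because ∂_A Y^A is harmonic
(`isNUSymmetry_gen`). Conversely, a function a on Scri with r^n a = o(r^n) vanishes, which recovers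
the conditions from the fall-offs (`conditions_of_isNUSymmetry`). The condition C^A_A = 0 enters
through det h, whose r³ term it removes (`asym_d`).

For the bracket, the variation L_ξ g has no r-components and rescales the conformal factor by ω, so
δ_a ξ_b is a field of the shape `gen` built from δ_a f_b, minus a ray integral of L_ξ g^{-1}
(`hasDerivAt_akv`). The identity [X, g^{-1} df] = (L_X g^{-1}) df + g^{-1} d(X f) shows that this
ray integral is just what makes the modified bracket satisfy the gauge conditions
(`pd_one_modBracket`). Its u-component solves the evolution equation with ω = 0 and has the value
e^φ T̂ at u = 0, so it is the function f of the algebraic bracket (`G_sub_G`). Two fields in gauge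
with the same u-component differ by something constant along the rays; here the difference is
O(r⁻¹), hence zero (`modBracket_akv`).

The analysis rests on the predicate `Asym`, which is stable under products, derivatives and ray
integrals, and on dominated convergence for derivatives of ray integrals, both in the coordinates
and in the parameter s of the metric g + s L_ξ g. -/

namespace NewmanUnti

/-! ## Partial derivatives -/

section pd
variable {n : ℕ} {Ω : Set (Fin n → ℝ)} {F G : (Fin n → ℝ) → ℝ} {p : Fin n → ℝ}

theorem pd_add (i : Fin n) (hF : DifferentiableAt ℝ F p) (hG : DifferentiableAt ℝ G p) :
    pd i (fun x => F x + G x) p = pd i F p + pd i G p := by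
  simp [pd, fderiv_fun_add hF hG]

theorem pd_sub (i : Fin n) (hF : DifferentiableAt ℝ F p) (hG : DifferentiableAt ℝ G p) :
    pd i (fun x => F x - G x) p = pd i F p - pd i G p := by
  simp [pd, fderiv_fun_sub hF hG]

theorem pd_neg (i : Fin n) (F : (Fin n → ℝ) → ℝ) (p : Fin n → ℝ) :
    pd i (fun x => -F x) p = -pd i F p := by
  simp [pd, fderiv_fun_neg]

theorem pd_mul (i : Fin n) (hF : DifferentiableAt ℝ F p) (hG : DifferentiableAt ℝ G p) :
    pd i (fun x => F x * G x) p = pd i F p * G p + F p * pd i G p := by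
  simp [pd, fderiv_fun_mul hF hG]
  ring

theorem pd_const_mul (i : Fin n) (c : ℝ) (hF : DifferentiableAt ℝ F p) :
    pd i (fun x => c * F x) p = c * pd i F p := by
  simp [pd, fderiv_const_mul hF]

theorem pd_const (i : Fin n) (c : ℝ) : pd i (fun _ : Fin n → ℝ => c) p = 0 := by
  simp [pd]

theorem pd_coord (i j : Fin n) : pd i (fun x : Fin n → ℝ => x j) p = if j = i then 1 else 0 := by
  have : HasFDerivAt (fun x : Fin n → ℝ => x j)
    (ContinuousLinearMap.proj (R := ℝ) (φ := fun _ : Fin n => ℝ) j) p :=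
    (ContinuousLinearMap.proj (R := ℝ) (φ := fun _ : Fin n => ℝ) j).hasFDerivAt
  simp [pd, this.fderiv, Pi.single_apply]

theorem pd_sum {ι : Type*} (s : Finset ι) (i : Fin n) {F : ι → (Fin n → ℝ) → ℝ}
    (hF : ∀ a ∈ s, DifferentiableAt ℝ (F a) p) :
    pd i (fun x => ∑ a ∈ s, F a x) p = ∑ a ∈ s, pd i (F a) p := by
  simp [pd, fderiv_fun_sum hF]

theorem pd_inv (i : Fin n) (hF : DifferentiableAt ℝ F p) (h0 : F p ≠ 0) :
    pd i (fun x => (F x)⁻¹) p = -pd i F p * ((F p)⁻¹ * (F p)⁻¹) := by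
  have := (hasDerivAt_inv h0).comp_hasFDerivAt p hF.hasFDerivAt
  have h2 : fderiv ℝ (fun x => (F x)⁻¹) p = _ := this.fderiv
  simp [pd, h2]
  ring

theorem pd_comp_deriv (i : Fin n) {φ : ℝ → ℝ} {φ' : ℝ} (hφ : HasDerivAt φ φ' (F p))
    (hF : DifferentiableAt ℝ F p) : pd i (fun x => φ (F x)) p = φ' * pd i F p := by
  have := hφ.comp_hasFDerivAt p hF.hasFDerivAt
  have h2 : fderiv ℝ (fun x => φ (F x)) p = _ := this.fderiv
  simp [pd, h2]

theorem pd_exp (i : Fin n) (hF : DifferentiableAt ℝ F p) :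
    pd i (fun x => Real.exp (F x)) p = Real.exp (F p) * pd i F p :=
  pd_comp_deriv i (Real.hasDerivAt_exp _) hF

theorem pd_congr_nhds (i : Fin n) (h : F =ᶠ[𝓝 p] G) : pd i F p = pd i G p := by
  simp [pd, h.fderiv_eq]

theorem pd_congr (hΩ : IsOpen Ω) (i : Fin n) (h : ∀ x ∈ Ω, F x = G x) (hp : p ∈ Ω) :
    pd i F p = pd i G p :=
  pd_congr_nhds i (by filter_upwards [hΩ.mem_nhds hp] with x hx using h x hx)

theorem pd_apply {m : ℕ} {X : (Fin n → ℝ) → Fin m → ℝ} (i : Fin n) (j : Fin m)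
    (hX : DifferentiableAt ℝ X p) : pd i X p j = pd i (fun x => X x j) p := by
  have := (hasFDerivAt_pi'.1 hX.hasFDerivAt j).fderiv
  simp only [pd]
  rw [this]
  rfl

/-- A linear functional is determined by its values on the coordinate vectors. -/
theorem clm_eq_sum {E : Type*} [NormedAddCommGroup E] [NormedSpace ℝ E]
    (L : (Fin n → ℝ) →L[ℝ] E) (v : Fin n → ℝ) : L v = ∑ i, v i • L (Pi.single i 1) := by
  conv_lhs => rw [pi_eq_sum_univ' v]
  simp only [map_sum, map_smul]

theorem fderiv_eq_sum_pd (F : (Fin n → ℝ) → ℝ) (p v : Fin n → ℝ) :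
    fderiv ℝ F p v = ∑ i, v i * pd i F p := by
  rw [clm_eq_sum]
  rfl

theorem hasDerivAt_pd (i : Fin n) (hF : DifferentiableAt ℝ F p) :
    HasDerivAt (fun t => F (Function.update p i t)) (pd i F p) (p i) := by
  have h1 : HasDerivAt (fun t => Function.update p i t) (Pi.single i (1 : ℝ)) (p i) :=
    hasDerivAt_update p i (p i)
  have h2 : HasFDerivAt F (fderiv ℝ F p) (Function.update p i (p i)) := by
    simpa using hF.hasFDerivAt
  exact h2.comp_hasDerivAt (p i) h1

theorem smooth_diff (hΩ : IsOpen Ω) (hF : ContDiffOn ℝ (⊤ : ℕ∞) F Ω) (hp : p ∈ Ω) :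
    DifferentiableAt ℝ F p :=
  (hF.contDiffAt (hΩ.mem_nhds hp)).differentiableAt (by simp)

theorem smooth_pd (hΩ : IsOpen Ω) (i : Fin n) (hF : ContDiffOn ℝ (⊤ : ℕ∞) F Ω) :
    ContDiffOn ℝ (⊤ : ℕ∞) (pd i F) Ω :=
  (hF.fderiv_of_isOpen hΩ (m := (⊤ : ℕ∞)) (by simp)).clm_apply contDiffOn_const

theorem pd_comm (hΩ : IsOpen Ω) (i j : Fin n) (hF : ContDiffOn ℝ (⊤ : ℕ∞) F Ω) (hp : p ∈ Ω) :
    pd i (pd j F) p = pd j (pd i F) p := by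
  have c := hF.contDiffAt (hΩ.mem_nhds hp)
  have dd := (c.fderiv_right (m := 1) two_le_smooth).differentiableAt (by simp)
  have s := (c.isSymmSndFDerivAt (by simpa [one_add_one_eq_two] using two_le_smooth)).eq
  have key : ∀ i j : Fin n, pd i (pd j F) p
      = fderiv ℝ (fderiv ℝ F) p (Pi.single i 1) (Pi.single j 1) := by
    intro i j
    have e : pd j F = fun y => fderiv ℝ F y (Pi.single j 1) := rfl
    rw [e, pd, fderiv_clm_apply dd (differentiableAt_const _)]
    simp
  rw [key, key, s]

/-- A function with `C^k` partial derivatives is `C^{k+1}`. -/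
theorem contDiffOn_succ_of_pd (hΩ : IsOpen Ω) {k : ℕ} (hd : ∀ p ∈ Ω, DifferentiableAt ℝ F p)
    (h : ∀ i, ContDiffOn ℝ k (pd i F) Ω) : ContDiffOn ℝ (k + 1 : ℕ) F Ω := by
  rw [Nat.cast_add, Nat.cast_one, contDiffOn_succ_iff_fderiv_of_isOpen hΩ]
  refine ⟨fun p hp => (hd p hp).differentiableWithinAt, by simp, ?_⟩
  have e : fderiv ℝ F = fun p => ∑ i, pd i F p •
      (ContinuousLinearMap.proj (R := ℝ) (φ := fun _ : Fin n => ℝ) i) := by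
    funext p
    ext v
    simp only [sum_apply, smul_apply,
      ContinuousLinearMap.proj_apply, smul_eq_mul]
    rw [fderiv_eq_sum_pd]
    exact Finset.sum_congr rfl fun i _ => mul_comm _ _
  rw [e]
  exact ContDiffOn.sum fun i _ => (h i).smul contDiffOn_const

/-- Turns bounds on the partial derivatives into a bound on the Fréchet derivative, the form in
which differentiation under the integral sign asks for domination. -/
theorem norm_fderiv_le (F : (Fin n → ℝ) → ℝ) (p : Fin n → ℝ) :
    ‖fderiv ℝ F p‖ ≤ ∑ i, |pd i F p| := by
  refine ContinuousLinearMap.opNorm_le_bound _ (Finset.sum_nonneg fun i _ => abs_nonneg _)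
    fun v => ?_
  rw [fderiv_eq_sum_pd, Finset.sum_mul]
  refine (norm_sum_le _ _).trans (Finset.sum_le_sum fun i _ => ?_)
  rw [norm_mul, mul_comm, Real.norm_eq_abs (pd i F p)]
  exact mul_le_mul_of_nonneg_left (norm_le_pi_norm v i) (abs_nonneg _)

end pd

/-! ## The geometry of the region -/

/-- The index of spacetime coordinates belonging to a coordinate on Scri. -/
def up : Fin 3 → Fin 4 := ![0, 2, 3]

@[simp] theorem up_zero : up 0 = 0 := rfl
@[simp] theorem up_one : up 1 = 2 := rfl
@[simp] theorem up_two : up 2 = 3 := rfl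
@[simp] theorem up_succ (A : Fin 2) : up A.succ = A.succ.succ := by fin_cases A <;> rfl

@[simp] theorem toScri_lift (q : ScriPt) (r : ℝ) : toScri (lift q r) = q := by
  ext i; fin_cases i <;> rfl
@[simp] theorem lift_apply_one (q : ScriPt) (r : ℝ) : lift q r 1 = r := rfl
@[simp] theorem lift_toScri (p : Pt) : lift (toScri p) (p 1) = p := by
  ext i; fin_cases i <;> rfl
theorem toScri_update_one (p : Pt) (s : ℝ) : toScri (Function.update p 1 s) = toScri p := by
  ext i; fin_cases i <;> simp [toScri]
theorem update_one_eq_lift (p : Pt) (s : ℝ) : Function.update p 1 s = lift (toScri p) s := by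
  ext i; fin_cases i <;> simp [toScri, lift]
theorem update_lift_zero (q : ScriPt) (r v : ℝ) :
    Function.update (lift q r) 0 v = lift (Function.update q 0 v) r := by
  ext i; fin_cases i <;> simp [lift]
theorem ang_update_zero (q : ScriPt) (v : ℝ) : ang (Function.update q 0 v) = ang q := by
  ext i; fin_cases i <;> simp [ang]

/-- `toScri` as a continuous linear map. -/
def toScriL : Pt →L[ℝ] ScriPt :=
  ContinuousLinearMap.pi fun i => ContinuousLinearMap.proj (R := ℝ) (φ := fun _ : Fin 4 => ℝ) (up i)

theorem toScriL_apply (p : Pt) : toScriL p = toScri p := by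
  ext i; fin_cases i <;> rfl

theorem coe_toScriL : (toScriL : Pt → ScriPt) = toScri := funext toScriL_apply

/-- `ang` as a continuous linear map. -/
def angL : ScriPt →L[ℝ] Ang :=
  ContinuousLinearMap.pi fun A => ContinuousLinearMap.proj (R := ℝ) (φ := fun _ : Fin 3 => ℝ) A.succ

theorem coe_angL : (angL : ScriPt → Ang) = ang := rfl

theorem contDiff_toScri : ContDiff ℝ (⊤ : ℕ∞) toScri := coe_toScriL ▸ toScriL.contDiff
theorem contDiff_ang : ContDiff ℝ (⊤ : ℕ∞) ang := coe_angL ▸ angL.contDiff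
theorem continuous_toScri : Continuous toScri := contDiff_toScri.continuous
theorem continuous_ang : Continuous ang := contDiff_ang.continuous

theorem contDiff_lift : ContDiff ℝ (⊤ : ℕ∞) (fun x : ScriPt × ℝ => lift x.1 x.2) := by
  rw [contDiff_pi]
  intro i
  fin_cases i
  · exact (contDiff_apply ℝ ℝ (0 : Fin 3)).comp contDiff_fst
  · exact contDiff_snd
  · exact (contDiff_apply ℝ ℝ (1 : Fin 3)).comp contDiff_fst
  · exact (contDiff_apply ℝ ℝ (2 : Fin 3)).comp contDiff_fst

theorem continuous_lift : Continuous (fun x : ScriPt × ℝ => lift x.1 x.2) :=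
  contDiff_lift.continuous

/-- Partial derivatives of a function on Scri regarded as a function in spacetime. -/
theorem pd_comp_toScri {a : ScriPt → ℝ} {p : Pt} (i : Fin 3)
    (ha : DifferentiableAt ℝ a (toScri p)) :
    pd (up i) (fun x => a (toScri x)) p = pd i a (toScri p) := by
  have h1 : HasFDerivAt toScri toScriL p := coe_toScriL ▸ toScriL.hasFDerivAt
  have h2 : fderiv ℝ (fun x => a (toScri x)) p = _ := (ha.hasFDerivAt.comp p h1).fderiv
  simp only [pd, h2, ContinuousLinearMap.comp_apply]
  congr 1
  ext j
  fin_cases i <;> fin_cases j <;> simp [toScriL, up]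

theorem pd_one_comp_toScri {a : ScriPt → ℝ} {p : Pt} (ha : DifferentiableAt ℝ a (toScri p)) :
    pd 1 (fun x => a (toScri x)) p = 0 := by
  have h1 : HasFDerivAt toScri toScriL p := coe_toScriL ▸ toScriL.hasFDerivAt
  have h2 : fderiv ℝ (fun x => a (toScri x)) p = _ := (ha.hasFDerivAt.comp p h1).fderiv
  have : toScriL (Pi.single 1 1) = 0 := by
    ext j
    fin_cases j <;> simp [toScriL, up]
  simp [pd, h2, this]

/-- The linear part of `q ↦ lift q r`. -/
def liftL : ScriPt →L[ℝ] Pt :=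
  ContinuousLinearMap.pi fun j : Fin 4 => (![ContinuousLinearMap.proj 0, 0,
    ContinuousLinearMap.proj 1, ContinuousLinearMap.proj 2] j : ScriPt →L[ℝ] ℝ)

/-- Partial derivatives of a function in spacetime restricted to a slice of constant `r`. -/
theorem pd_comp_lift {H : Pt → ℝ} {q : ScriPt} {r : ℝ} (i : Fin 3)
    (hH : DifferentiableAt ℝ H (lift q r)) :
    pd i (fun x => H (lift x r)) q = pd (up i) H (lift q r) := by
  have h0 : (fun x : ScriPt => lift x r) = fun x => liftL x + Pi.single 1 r := by
    funext x
    ext j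
    fin_cases j <;> simp [lift, liftL]
  have h1 : HasFDerivAt (fun x : ScriPt => lift x r) liftL q := by
    rw [h0]
    exact liftL.hasFDerivAt.add_const _
  have h2 : fderiv ℝ (fun x => H (lift x r)) q = _ := (hH.hasFDerivAt.comp q h1).fderiv
  simp only [pd, h2, ContinuousLinearMap.comp_apply]
  congr 1
  ext j
  fin_cases i <;> fin_cases j <;> simp [up, liftL]

theorem pd_succ_comp_ang {T : Ang → ℝ} {q : ScriPt} (A : Fin 2)
    (hT : DifferentiableAt ℝ T (ang q)) :
    pd A.succ (fun x => T (ang x)) q = pd A T (ang q) := by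
  have h1 : HasFDerivAt ang angL q := coe_angL ▸ angL.hasFDerivAt
  have h2 : fderiv ℝ (fun x => T (ang x)) q = _ := (hT.hasFDerivAt.comp q h1).fderiv
  simp only [pd, h2, ContinuousLinearMap.comp_apply]
  congr 1
  ext j
  fin_cases A <;> fin_cases j <;> simp [angL]

theorem pd_zero_comp_ang {T : Ang → ℝ} {q : ScriPt} (hT : DifferentiableAt ℝ T (ang q)) :
    pd 0 (fun x => T (ang x)) q = 0 := by
  have h1 : HasFDerivAt ang angL q := coe_angL ▸ angL.hasFDerivAt
  have h2 : fderiv ℝ (fun x => T (ang x)) q = _ := (hT.hasFDerivAt.comp q h1).fderiv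
  have : angL (Pi.single 0 1) = 0 := by
    ext j
    fin_cases j <;> simp [angL]
  simp [pd, h2, this]

namespace Region
variable (D : Region)

theorem isOpen_scri : IsOpen D.scri :=
  (D.isOpen_J.preimage (continuous_apply 0)).inter (D.isOpen_U.preimage continuous_ang)

theorem continuousOn_R' : ContinuousOn D.R D.scri := D.continuousOn_R

theorem isOpen_bulk : IsOpen D.bulk := by
  have h1 : IsOpen (toScri ⁻¹' D.scri) := D.isOpen_scri.preimage continuous_toScri
  have h2 : ContinuousOn (fun p : Pt => p 1 - D.R (toScri p)) (toScri ⁻¹' D.scri) :=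
    (continuous_apply 1).continuousOn.sub
      (D.continuousOn_R'.comp continuous_toScri.continuousOn fun _ h => h)
  have h3 := h2.isOpen_inter_preimage h1 (isOpen_Ioi (a := (0 : ℝ)))
  convert! h3 using 1
  ext p
  simp [bulk]

variable {D}

theorem update_zero_mem {q : ScriPt} (hq : q ∈ D.scri) {v : ℝ} (hv : v ∈ D.J) :
    Function.update q 0 v ∈ D.scri :=
  ⟨by simpa using hv, by rw [ang_update_zero]; exact hq.2⟩

theorem mem_J_of_mem_uIcc {u v : ℝ} (hu : u ∈ D.J) (hv : v ∈ Set.uIcc 0 u) : v ∈ D.J :=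
  D.ordConnected_J.uIcc_subset D.zero_mem_J hu hv

theorem update_one_mem {p : Pt} (hp : p ∈ D.bulk) {s : ℝ} (hs : p 1 ≤ s) :
    Function.update p 1 s ∈ D.bulk := by
  refine ⟨by rw [toScri_update_one]; exact hp.1, ?_⟩
  rw [toScri_update_one]
  simpa using hp.2.trans_le hs

theorem lift_mem {q : ScriPt} (hq : q ∈ D.scri) {r : ℝ} (hr : D.R q < r) : lift q r ∈ D.bulk :=
  ⟨by simpa using hq, by simpa using hr⟩

variable (D) in
/-- The part `r > 1` of the region. -/
@[reducible] noncomputable def pos : Region where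
  J := D.J
  U := D.U
  -- `J` and `U` are unchanged, so both regions have the same Scri and data there carry over without
  -- conversion; r > 1 makes r⁻¹ smooth.
  R q := max (D.R q) 1
  isOpen_J := D.isOpen_J
  ordConnected_J := D.ordConnected_J
  zero_mem_J := D.zero_mem_J
  isOpen_U := D.isOpen_U
  continuousOn_R := D.continuousOn_R.sup continuousOn_const

theorem bulk_pos_subset : D.pos.bulk ⊆ D.bulk :=
  fun _ hp => ⟨hp.1, (le_max_left _ _).trans_lt hp.2⟩

theorem one_lt_of_mem_pos {p : Pt} (hp : p ∈ D.pos.bulk) : 1 < p 1 :=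
  (le_max_right _ _).trans_lt hp.2

end Region

/-! ## The filter at null infinity -/

theorem hasBasis_nearScri (q : ScriPt) :
    (nearScri q).HasBasis (fun x : ℝ × Set ScriPt => x.2 ∈ 𝓝 q)
      fun x => {p | x.1 ≤ p 1 ∧ toScri p ∈ x.2} := by
  have := ((atTop_basis (α := ℝ)).comap (fun p : Pt => p 1)).inf ((𝓝 q).basis_sets.comap toScri)
  simp only [true_and] at this
  exact this

theorem eventually_nearScri {q : ScriPt} {P : Pt → Prop} :
    (∀ᶠ p in nearScri q, P p) ↔
      ∃ r : ℝ, ∃ N ∈ 𝓝 q, ∀ p : Pt, r ≤ p 1 → toScri p ∈ N → P p := by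
  rw [(hasBasis_nearScri q).eventually_iff]
  constructor
  · rintro ⟨⟨r, N⟩, hN, h⟩
    exact ⟨r, N, hN, fun p h1 h2 => h ⟨h1, h2⟩⟩
  · rintro ⟨r, N, hN, h⟩
    exact ⟨⟨r, N⟩, hN, fun p hp => h p hp.1 hp.2⟩

/-- By continuity `D.R` stays below `D.R q + 1` near `q`, so a fixed radius suffices over a whole
neighbourhood. -/
theorem eventually_bulk {D : Region} {q : ScriPt} (hq : q ∈ D.scri) :
    ∀ᶠ p in nearScri q, p ∈ D.bulk := by
  have h1 := (D.continuousOn_R'.continuousAt (D.isOpen_scri.mem_nhds hq)).eventually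
    (gt_mem_nhds (lt_add_one (D.R q)))
  rw [eventually_nearScri]
  refine ⟨D.R q + 1, _, inter_mem h1 (D.isOpen_scri.mem_nhds hq), fun p hp hN => ⟨hN.2, ?_⟩⟩
  exact lt_of_lt_of_le hN.1 hp

theorem eventually_gt_nearScri (q : ScriPt) (c : ℝ) : ∀ᶠ p in nearScri q, c < p 1 := by
  rw [eventually_nearScri]
  exact ⟨c + 1, Set.univ, univ_mem, fun p hp _ => by linarith⟩

theorem tendsto_nearScri_one (q : ScriPt) : Tendsto (fun p : Pt => p 1) (nearScri q) atTop :=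
  tendsto_comap.mono_left inf_le_left

theorem tendsto_nearScri_toScri (q : ScriPt) : Tendsto toScri (nearScri q) (𝓝 q) :=
  tendsto_comap.mono_left inf_le_right

theorem tendsto_lift (q : ScriPt) : Tendsto (lift q) atTop (nearScri q) := by
  rw [nearScri, tendsto_inf, tendsto_comap_iff, tendsto_comap_iff]
  refine ⟨tendsto_id, ?_⟩
  have : toScri ∘ lift q = fun _ => q := by funext r; simp
  rw [this]
  exact tendsto_const_nhds

end NewmanUnti

namespace NewmanUnti

/-! ## Functions with an asymptotic order at null infinity -/

/-- `F = O(r^n)` near the point `q` of Scri, or `F = o(r^n)` if `b` is true. -/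
def Bd (b : Bool) (q : ScriPt) (n : ℤ) (F : Pt → ℝ) : Prop :=
  cond b (F =o[nearScri q] fun p => p 1 ^ n) (F =O[nearScri q] fun p => p 1 ^ n)

/-- Bounds on the derivatives of order up to `k`. -/
def DBd (D : Region) (b : Bool) : ℕ → ℤ → (Pt → ℝ) → Prop
  | 0, n, F => ∀ q ∈ D.scri, Bd b q n F
  | k + 1, n, F => (∀ q ∈ D.scri, Bd b q n F) ∧
      ∀ i, DBd D b k (n - if i = 1 then 1 else 0) (pd i F)

/-- Smooth functions of order `O(r^n)`, or `o(r^n)` if `b` is true, with all derivatives. -/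
def Asym (D : Region) (b : Bool) (n : ℤ) (F : Pt → ℝ) : Prop :=
  ContDiffOn ℝ (⊤ : ℕ∞) F D.bulk ∧ ∀ k, DBd D b k n F

/-! ### Bounds with finitely many derivatives -/

section bounds
variable {D : Region} {b c : Bool} {q : ScriPt} {m n : ℤ} {k : ℕ} {F G : Pt → ℝ}

theorem zpow_isBigO_zpow (q : ScriPt) (h : m ≤ n) :
    (fun p : Pt => p 1 ^ m) =O[nearScri q] fun p => p 1 ^ n := by
  refine Asymptotics.IsBigO.of_bound 1 ?_
  filter_upwards [eventually_gt_nearScri q 1] with p hp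
  have h0 : (0 : ℝ) < p 1 := by linarith
  rw [Real.norm_of_nonneg (by positivity), Real.norm_of_nonneg (by positivity), one_mul]
  exact zpow_le_zpow_right₀ hp.le h

theorem zpow_isLittleO_zpow (q : ScriPt) (h : m < n) :
    (fun p : Pt => p 1 ^ m) =o[nearScri q] fun p => p 1 ^ n := by
  have h1 : (fun p : Pt => p 1 ^ (-1 : ℤ)) =o[nearScri q] fun _ => (1 : ℝ) := by
    rw [Asymptotics.isLittleO_one_iff]
    simp only [zpow_neg, zpow_one]
    exact tendsto_inv_atTop_zero.comp (tendsto_nearScri_one q)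
  have h2 := h1.mul_isBigO (zpow_isBigO_zpow q (show m + 1 ≤ n by omega))
  refine (h2.congr' ?_ ?_)
  · filter_upwards [eventually_gt_nearScri q 1] with p hp
    have h0 : p 1 ≠ 0 := by linarith
    rw [← zpow_add₀ h0]
    congr 1
    ring
  · exact Eventually.of_forall fun p => by simp

theorem Bd.isBigO (h : Bd b q n F) : F =O[nearScri q] fun p => p 1 ^ n := by
  cases b
  · exact h
  · exact Asymptotics.IsLittleO.isBigO h

theorem Bd.congr (h : Bd b q n F) (e : F =ᶠ[nearScri q] G) : Bd b q n G := by
  cases b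
  · exact Asymptotics.IsBigO.congr' h e EventuallyEq.rfl
  · exact Asymptotics.IsLittleO.congr' h e EventuallyEq.rfl

theorem Bd.add (hF : Bd b q n F) (hG : Bd b q n G) : Bd b q n fun p => F p + G p := by
  cases b
  · exact Asymptotics.IsBigO.add hF hG
  · exact Asymptotics.IsLittleO.add hF hG

theorem Bd.zero : Bd b q n fun _ => 0 := by
  cases b
  · exact Asymptotics.isBigO_zero _ _
  · exact Asymptotics.isLittleO_zero _ _

theorem Bd.mul (hF : Bd b q m F) (hG : Bd c q n G) :
    Bd (b || c) q (m + n) fun p => F p * G p := by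
  have e : (fun p : Pt => p 1 ^ m * p 1 ^ n) =ᶠ[nearScri q] fun p => p 1 ^ (m + n) := by
    filter_upwards [eventually_gt_nearScri q 1] with p hp
    rw [zpow_add₀ (by linarith)]
  cases b <;> cases c
  · exact (Asymptotics.IsBigO.mul hF hG).congr' EventuallyEq.rfl e
  · exact (Asymptotics.IsBigO.mul_isLittleO hF hG).congr' EventuallyEq.rfl e
  · exact (Asymptotics.IsLittleO.mul_isBigO hF hG).congr' EventuallyEq.rfl e
  · exact (Asymptotics.IsLittleO.mul hF hG).congr' EventuallyEq.rfl e

/-- A gap between integer orders turns O into o, so the flag in the conclusion is free. -/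
theorem Bd.of_lt (h : Bd b q m F) (hmn : m < n) : Bd c q n F := by
  have : F =o[nearScri q] fun p => p 1 ^ n := h.isBigO.trans_isLittleO (zpow_isLittleO_zpow q hmn)
  cases c
  · exact this.isBigO
  · exact this

theorem DBd.congr (h : DBd D b k n F) (e : ∀ p ∈ D.bulk, F p = G p) : DBd D b k n G := by
  have key : ∀ {n : ℤ} {F G : Pt → ℝ}, (∀ q ∈ D.scri, Bd b q n F) →
      (∀ p ∈ D.bulk, F p = G p) → ∀ q ∈ D.scri, Bd b q n G := fun h e q hq =>
    (h q hq).congr (by filter_upwards [eventually_bulk hq] with p hp using e p hp)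
  induction k generalizing n F G with
  | zero => exact key h e
  | succ k ih =>
    exact ⟨key h.1 e, fun i => ih (h.2 i) fun p hp => pd_congr D.isOpen_bulk i e hp⟩

theorem DBd.mono_order (h : DBd D b (k + 1) n F) : DBd D b k n F := by
  induction k generalizing n F with
  | zero => exact h.1
  | succ k ih => exact ⟨h.1, fun i => ih (h.2 i)⟩

theorem DBd.of_lt (h : DBd D b k m F) (hmn : m < n) : DBd D c k n F := by
  induction k generalizing m n F with
  | zero => exact fun q hq => (h q hq).of_lt hmn
  | succ k ih => exact ⟨fun q hq => (h.1 q hq).of_lt hmn, fun i => ih (h.2 i) (by omega)⟩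

theorem DBd.isBigO (h : DBd D b k n F) : DBd D false k n F := by
  induction k generalizing n F with
  | zero => exact fun q hq => (h q hq).isBigO
  | succ k ih => exact ⟨fun q hq => (h.1 q hq).isBigO, fun i => ih (h.2 i)⟩

theorem DBd.zero : DBd D b k n fun _ => 0 := by
  induction k generalizing n with
  | zero => exact fun q _ => Bd.zero
  | succ k ih => exact ⟨fun q _ => Bd.zero, fun i => ih.congr fun p _ => (pd_const i 0).symm⟩

theorem DBd.const (a : ℝ) : DBd D false k 0 fun _ => a := by
  have base : ∀ q ∈ D.scri, Bd false q 0 fun _ => a := fun q _ => by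
    have := Asymptotics.isBigO_const_const a (one_ne_zero (α := ℝ)) (nearScri q)
    simpa only [Bd, cond, zpow_zero] using this
  cases k with
  | zero => exact base
  | succ k => exact ⟨base, fun i => DBd.zero.congr fun p _ => (pd_const i _).symm⟩

theorem DBd.add (sF : ContDiffOn ℝ (⊤ : ℕ∞) F D.bulk) (sG : ContDiffOn ℝ (⊤ : ℕ∞) G D.bulk)
    (hF : DBd D b k n F) (hG : DBd D b k n G) : DBd D b k n fun p => F p + G p := by
  induction k generalizing n F G with
  | zero => exact fun q hq => (hF q hq).add (hG q hq)
  | succ k ih =>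
    refine ⟨fun q hq => (hF.1 q hq).add (hG.1 q hq), fun i => ?_⟩
    refine (ih (smooth_pd D.isOpen_bulk i sF) (smooth_pd D.isOpen_bulk i sG)
      (hF.2 i) (hG.2 i)).congr fun p hp => ?_
    rw [pd_add i (smooth_diff D.isOpen_bulk sF hp) (smooth_diff D.isOpen_bulk sG hp)]

/-- Leibniz rule: in each term one factor stays undifferentiated, and for it `mono_order` discards
the superfluous top-order bound. One factor with o suffices for the product to have o. -/
theorem DBd.mul (sF : ContDiffOn ℝ (⊤ : ℕ∞) F D.bulk) (sG : ContDiffOn ℝ (⊤ : ℕ∞) G D.bulk)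
    (hF : DBd D b k m F) (hG : DBd D c k n G) :
    DBd D (b || c) k (m + n) fun p => F p * G p := by
  induction k generalizing m n F G with
  | zero => exact fun q hq => (hF q hq).mul (hG q hq)
  | succ k ih =>
    refine ⟨fun q hq => (hF.1 q hq).mul (hG.1 q hq), fun i => ?_⟩
    have dF := smooth_pd D.isOpen_bulk i sF
    have dG := smooth_pd D.isOpen_bulk i sG
    have h1 := ih dF sG (hF.2 i) hG.mono_order
    have h2 := ih sF dG hF.mono_order (hG.2 i)
    rw [show m - (if i = 1 then 1 else 0) + n = m + n - if i = 1 then 1 else 0 by ring] at h1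
    rw [show m + (n - if i = 1 then 1 else 0) = m + n - if i = 1 then 1 else 0 by ring] at h2
    refine (DBd.add (dF.mul sG) (sF.mul dG) h1 h2).congr fun p hp => ?_
    rw [pd_mul i (smooth_diff D.isOpen_bulk sF hp) (smooth_diff D.isOpen_bulk sG hp)]

/-- By ∂(1/F) = -∂F · F⁻² the derivatives reduce to those of F and to lower derivatives of 1/F, so
only F itself needs a bound from below. -/
theorem DBd.inv (sF : ContDiffOn ℝ (⊤ : ℕ∞) F D.bulk) (h0 : ∀ p ∈ D.bulk, F p ≠ 0)
    (hF : DBd D false k n F)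
    (hb : ∀ q ∈ D.scri, (fun p : Pt => p 1 ^ n) =O[nearScri q] F) :
    DBd D false k (-n) fun p => (F p)⁻¹ := by
  have base : ∀ q ∈ D.scri, Bd false q (-n) fun p => (F p)⁻¹ := by
    intro q hq
    have := (hb q hq).inv_rev (by
      filter_upwards [eventually_gt_nearScri q 1] with p hp h
      exact absurd h (zpow_ne_zero _ (by linarith)))
    refine this.congr_right fun p => ?_
    simp
  induction k with
  | zero => exact base
  | succ k ih =>
    refine ⟨base, fun i => ?_⟩
    have dF := smooth_pd D.isOpen_bulk i sF
    have iF : ContDiffOn ℝ (⊤ : ℕ∞) (fun p => (F p)⁻¹) D.bulk := sF.inv h0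
    have h1 := ih hF.mono_order
    have h2 := DBd.mul (dF.neg) (iF.mul iF) (b := false) (m := n - if i = 1 then 1 else 0)
      ?_ (DBd.mul iF iF h1 h1)
    · rw [show n - (if i = 1 then 1 else 0) + (-n + -n) = -n - if i = 1 then 1 else 0 by ring]
        at h2
      refine h2.congr fun p hp => ?_
      rw [pd_inv i (smooth_diff D.isOpen_bulk sF hp) (h0 p hp)]
    · have h3 := DBd.mul (D := D) (b := false) (c := false) (k := k) (m := 0) (F := fun _ => -1)
        contDiffOn_const dF ?_ (hF.2 i)
      · rw [zero_add] at h3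
        exact h3.congr fun p _ => by simp
      · exact DBd.const (-1)

/-- `DBd` peels off the innermost derivative and `iterPd` the outermost one, so the induction on
lists runs from the right; appending 1 to the list accounts for the order lost by ∂_r. -/
theorem forall_DBd_iff : (∀ k, DBd D b k n F) ↔
    ∀ q ∈ D.scri, ∀ l : List (Fin 4), Bd b q (n - (l.count 1 : ℤ)) (iterPd l F) := by
  constructor
  · intro h q hq l
    induction l using List.reverseRecOn generalizing n F with
    | nil => simpa [iterPd] using (h 0) q hq
    | append_singleton l i ih =>
      have h2 := ih (n := n - if i = 1 then 1 else 0) (F := pd i F) fun k => (h (k + 1)).2 i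
      have e : iterPd (l ++ [i]) F = iterPd l (pd i F) := by simp [iterPd]
      rw [e]
      convert! h2 using 1
      by_cases hi : i = 1 <;> simp [hi]
      ring
  · intro h k
    have base : ∀ q ∈ D.scri, Bd b q n F := fun q hq => by simpa [iterPd] using h q hq []
    induction k generalizing n F with
    | zero => exact base
    | succ k ih =>
      refine ⟨base, fun i => ?_⟩
      have key : ∀ q ∈ D.scri, ∀ l : List (Fin 4),
          Bd b q (n - (if i = 1 then 1 else 0) - (l.count 1 : ℤ)) (iterPd l (pd i F)) := by
        intro q hq l
        have h2 := h q hq (l ++ [i])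
        have e : iterPd (l ++ [i]) F = iterPd l (pd i F) := by simp [iterPd]
        rw [e] at h2
        convert! h2 using 1
        by_cases hi : i = 1 <;> simp [hi]
        ring
      exact ih key fun q hq => by simpa [iterPd] using key q hq []

theorem bigO_iff : BigO D n F ↔ ∀ k, DBd D false k n F :=
  (forall_DBd_iff (b := false)).symm
theorem smallO_iff : SmallO D n F ↔ ∀ k, DBd D true k n F :=
  (forall_DBd_iff (b := true)).symm

end bounds

/-! ### Calculus of asymptotic orders -/

namespace Asym
variable {D : Region} {b c : Bool} {q : ScriPt} {m n : ℤ} {k : ℕ} {F G : Pt → ℝ}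

theorem bigO (h : Asym D false n F) : BigO D n F := bigO_iff.2 h.2
theorem smallO (h : Asym D true n F) : SmallO D n F := smallO_iff.2 h.2

theorem diff (h : Asym D b n F) {p : Pt} (hp : p ∈ D.bulk) : DifferentiableAt ℝ F p :=
  smooth_diff D.isOpen_bulk h.1 hp

theorem congr (h : Asym D b n F) (e : ∀ p ∈ D.bulk, G p = F p) : Asym D b n G :=
  ⟨h.1.congr e, fun k => (h.2 k).congr fun p hp => (e p hp).symm⟩

theorem zero : Asym D b n fun _ => 0 := ⟨contDiffOn_const, fun _ => DBd.zero⟩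

theorem add (hF : Asym D b n F) (hG : Asym D b n G) : Asym D b n fun p => F p + G p :=
  ⟨hF.1.add hG.1, fun k => DBd.add hF.1 hG.1 (hF.2 k) (hG.2 k)⟩

theorem mul (hF : Asym D b m F) (hG : Asym D c n G) :
    Asym D (b || c) (m + n) fun p => F p * G p :=
  ⟨hF.1.mul hG.1, fun k => DBd.mul hF.1 hG.1 (hF.2 k) (hG.2 k)⟩

theorem of_lt (h : Asym D b m F) (hmn : m < n) : Asym D c n F :=
  ⟨h.1, fun k => (h.2 k).of_lt hmn⟩

theorem isBigO (h : Asym D b n F) : Asym D false n F := ⟨h.1, fun k => (h.2 k).isBigO⟩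

theorem mono (h : Asym D b m F) (hmn : m ≤ n) : Asym D b n F := by
  rcases hmn.lt_or_eq with h1 | rfl
  · exact h.of_lt h1
  · exact h

/-- For numerical orders the default proof of `hl` lets the target order be read off from the
expected type. -/
theorem mulO (hF : Asym D false m F) (hG : Asym D b n G) {l : ℤ} (hl : m + n ≤ l := by norm_num) :
    Asym D b l fun p => F p * G p :=
  (hF.mul hG).mono hl

theorem pd (h : Asym D b n F) (i : Fin 4) :
    Asym D b (n - if i = 1 then 1 else 0) (pd i F) :=
  ⟨smooth_pd D.isOpen_bulk i h.1, fun k => (h.2 (k + 1)).2 i⟩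

theorem pd_ne (h : Asym D b n F) {i : Fin 4} (hi : i ≠ 1) : Asym D b n (NewmanUnti.pd i F) := by
  simpa [hi] using h.pd i

theorem pd_one (h : Asym D b n F) : Asym D b (n - 1) (NewmanUnti.pd 1 F) := by
  simpa using h.pd 1

theorem inv (hF : Asym D false n F) (h0 : ∀ p ∈ D.bulk, F p ≠ 0)
    (hb : ∀ q ∈ D.scri, (fun p : Pt => p 1 ^ n) =O[nearScri q] F) :
    Asym D false (-n) fun p => (F p)⁻¹ :=
  ⟨hF.1.inv h0, fun k => DBd.inv hF.1 h0 (hF.2 k) hb⟩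

/-- Functions on Scri have order zero. -/
theorem comp_toScri {a : ScriPt → ℝ} (ha : ContDiffOn ℝ (⊤ : ℕ∞) a D.scri) :
    Asym D false 0 fun p => a (toScri p) := by
  refine ⟨ha.comp contDiff_toScri.contDiffOn fun p hp => hp.1, fun k => ?_⟩
  have base : ∀ {a : ScriPt → ℝ}, ContDiffOn ℝ (⊤ : ℕ∞) a D.scri →
      ∀ q ∈ D.scri, Bd false q 0 fun p => a (toScri p) := by
    intro a ha q hq
    have h1 := (ha.continuousOn.continuousAt (D.isOpen_scri.mem_nhds hq)).tendsto.comp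
      (tendsto_nearScri_toScri q)
    have h2 := h1.isBigO_one ℝ
    simpa [Bd] using h2
  induction k generalizing a with
  | zero => exact base ha
  | succ k ih =>
    refine ⟨base ha, fun i => ?_⟩
    have key : ∀ j : Fin 3, DBd D false k 0 (NewmanUnti.pd (up j) fun p => a (toScri p)) :=
      fun j => (ih (smooth_pd D.isOpen_scri j ha)).congr fun p hp =>
        (pd_comp_toScri j (smooth_diff D.isOpen_scri ha hp.1)).symm
    fin_cases i
    · exact key 0
    · exact DBd.zero.congr fun p hp =>
        (pd_one_comp_toScri (smooth_diff D.isOpen_scri ha hp.1)).symm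
    · exact key 1
    · exact key 2

theorem const (a : ℝ) : Asym D false 0 fun _ => a :=
  comp_toScri (a := fun _ => a) contDiffOn_const

theorem const_mul (a : ℝ) (h : Asym D b n F) : Asym D b n fun p => a * F p := by
  simpa using (const a).mul h

theorem neg (h : Asym D b n F) : Asym D b n fun p => -F p := by
  simpa using h.const_mul (-1)

theorem sub (hF : Asym D b n F) (hG : Asym D b n G) : Asym D b n fun p => F p - G p := by
  simpa [sub_eq_add_neg] using hF.add hG.neg

theorem sum {ι : Type*} (s : Finset ι) {F : ι → Pt → ℝ} (h : ∀ i ∈ s, Asym D b n (F i)) :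
    Asym D b n fun p => ∑ i ∈ s, F i p := by
  classical
  induction s using Finset.induction_on with
  | empty => simpa using zero
  | insert i s hi ih =>
    simp only [Finset.sum_insert hi]
    exact (h i (Finset.mem_insert_self i s)).add
      (ih fun j hj => h j (Finset.mem_insert_of_mem hj))

theorem scri_mul {a : ScriPt → ℝ} (ha : ContDiffOn ℝ (⊤ : ℕ∞) a D.scri) (h : Asym D b n F) :
    Asym D b n fun p => a (toScri p) * F p := by
  simpa using (comp_toScri ha).mul h

/-- The radial coordinate has order one. -/
theorem radius : Asym D false 1 fun p => p 1 := by
  refine ⟨(contDiff_apply ℝ ℝ (1 : Fin 4)).contDiffOn, fun k => ?_⟩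
  have base : ∀ q ∈ D.scri, Bd false q 1 fun p => p 1 := fun q _ => by
    simpa [Bd] using Asymptotics.isBigO_refl _ _
  cases k with
  | zero => exact base
  | succ k =>
    refine ⟨base, fun i => ?_⟩
    by_cases hi : i = 1
    · subst hi
      refine DBd.congr (F := fun _ => 1) ?_ fun p _ => by rw [pd_coord]; simp
      simpa using (const (D := D) 1).2 k
    · refine DBd.congr (F := fun _ => 0) DBd.zero fun p _ => ?_
      rw [pd_coord, if_neg (Ne.symm hi)]

/-- The inverse radial coordinate has order minus one where `r > 1`. -/
theorem radius_inv : Asym D.pos false (-1) fun p => (p 1)⁻¹ :=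
  radius.inv (fun p hp => by have := Region.one_lt_of_mem_pos hp; linarith) fun q _ => by
    simpa using Asymptotics.isBigO_refl _ _

/-- The bounds only concern r → ∞ over the common Scri of the two regions; only the domain of
smoothness shrinks. -/
theorem mono_pos (h : Asym D b n F) : Asym D.pos b n F := by
  refine ⟨h.1.mono Region.bulk_pos_subset, ?_⟩
  exact forall_DBd_iff.2 (forall_DBd_iff (D := D).1 h.2)

theorem tendsto_zero (h : Asym D false (-1) F) (hq : q ∈ D.scri) :
    Tendsto (fun r => F (lift q r)) atTop (𝓝 0) := by
  have h1 : Bd true q 0 F := ((h.2 0) q hq).of_lt (by norm_num)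
  have h2 : F =o[nearScri q] fun _ => (1 : ℝ) := by simpa [Bd] using h1
  exact ((Asymptotics.isLittleO_one_iff ℝ).1 h2).comp (tendsto_lift q)

/-- A function on Scri that is `o(1)` vanishes. -/
theorem eq_zero_of_bd {a : ScriPt → ℝ} (h : Bd true q 0 fun p => a (toScri p)) :
    a q = 0 := by
  have h2 : (fun p => a (toScri p)) =o[nearScri q] fun _ => (1 : ℝ) := by simpa [Bd] using h
  have h3 := ((Asymptotics.isLittleO_one_iff ℝ).1 h2).comp (tendsto_lift q)
  have : ((fun p => a (toScri p)) ∘ lift q) = fun _ => a q := by funext r; simp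
  rw [this] at h3
  exact tendsto_nhds_unique tendsto_const_nhds h3

/-- A coefficient `a` with `r^n a = o(r^n)` vanishes. -/
theorem coeff_eq_zero {a : ScriPt → ℝ} (hq : q ∈ D.scri)
    (h : ∀ k, DBd D true k n fun p => p 1 ^ n * a (toScri p)) : a q = 0 := by
  have h1 : Bd true q n fun p => p 1 ^ n * a (toScri p) := (h 0) q hq
  have h2 : Bd false q (-n) fun p : Pt => p 1 ^ (-n) := Asymptotics.isBigO_refl _ _
  have h3 := h2.mul h1
  rw [neg_add_cancel] at h3
  refine eq_zero_of_bd (h3.congr ?_)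
  filter_upwards [eventually_gt_nearScri q 1] with p hp
  have : p 1 ≠ 0 := by linarith
  rw [← mul_assoc, ← zpow_add₀ this]
  simp

end Asym

end NewmanUnti

namespace NewmanUnti

open MeasureTheory

/-! ## Integrals along the rays of constant `(u, x)` -/

/-- `∫_r^∞ F dr'`. -/
noncomputable def tail (F : Pt → ℝ) (p : Pt) : ℝ :=
  ∫ s in Set.Ioi (p 1), F (Function.update p 1 s)

/-- Translation along a ray. -/
def shift (t : ℝ) (p : Pt) : Pt := p + t • (Pi.single 1 1 : Pt)

theorem update_one_eq_shift (p : Pt) (t : ℝ) : Function.update p 1 (p 1 + t) = shift t p := by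
  ext i
  fin_cases i <;> simp [shift]

@[simp] theorem shift_one (p : Pt) (t : ℝ) : shift t p 1 = p 1 + t := by simp [shift]

@[simp] theorem toScri_shift (p : Pt) (t : ℝ) : toScri (shift t p) = toScri p := by
  rw [← update_one_eq_shift, toScri_update_one]

theorem continuous_shift : Continuous fun x : Pt × ℝ => shift x.2 x.1 := by
  unfold shift; fun_prop

theorem continuous_shift_left (p : Pt) : Continuous fun t : ℝ => shift t p := by
  unfold shift; fun_prop

theorem shift_mem {D : Region} {p : Pt} (hp : p ∈ D.bulk) {t : ℝ} (ht : 0 ≤ t) :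
    shift t p ∈ D.bulk := by
  rw [← update_one_eq_shift]
  exact Region.update_one_mem hp (by linarith)

theorem setIntegral_Ioi_add (f : ℝ → ℝ) (a : ℝ) :
    ∫ s in Set.Ioi a, f s = ∫ t in Set.Ioi (0 : ℝ), f (a + t) := by
  have h := (measurePreserving_add_left volume a).setIntegral_preimage_emb
    (measurableEmbedding_addLeft a) f (Set.Ioi a)
  rw [← h]
  congr 2
  ext t
  simp

/-- The substitution s = r + t moves the dependence on the point from the limit of integration into
the integrand, so that all coordinate derivatives, ∂_r included, are taken under the integral sign.
-/
theorem tail_eq (F : Pt → ℝ) (p : Pt) : tail F p = ∫ t in Set.Ioi (0 : ℝ), F (shift t p) := by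
  rw [tail, setIntegral_Ioi_add]
  simp only [update_one_eq_shift]

section
variable {D : Region} {F G : Pt → ℝ} {p : Pt} {b : Bool} {n : ℤ}

/-- A function decaying like `r⁻²` is dominated by an integrable function along the rays, locally
uniformly. -/
theorem exists_dominated (hc : ContinuousOn F D.bulk)
    (hO : ∀ q ∈ D.scri, F =O[nearScri q] fun p => p 1 ^ (-2 : ℤ)) (hp : p ∈ D.bulk) :
    ∃ s ∈ 𝓝 p, s ⊆ D.bulk ∧ ∃ C, ∀ x ∈ s, ∀ t, 0 ≤ t → |F (shift t x)| ≤ C * (1 + t ^ 2)⁻¹ := by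
  obtain ⟨C, hC⟩ := (hO _ hp.1).bound
  obtain ⟨r₀, N, hN, hb⟩ := eventually_nearScri.1 hC
  obtain ⟨ε, ε0, hε⟩ := Metric.nhds_basis_closedBall.mem_iff.1
    (inter_mem (D.isOpen_bulk.mem_nhds hp) (continuous_toScri.continuousAt.preimage_mem_nhds hN))
  set δ := min ε 1
  have δ0 : 0 < δ := lt_min ε0 one_pos
  have hδ : ∀ x ∈ Metric.closedBall p δ, x ∈ D.bulk ∧ toScri x ∈ N ∧ p 1 - 1 ≤ x 1 := by
    intro x hx
    have h1 := hε (Metric.closedBall_subset_closedBall (min_le_left _ _) hx)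
    refine ⟨h1.1, h1.2, ?_⟩
    have h2 : dist (x 1) (p 1) ≤ 1 :=
      (dist_le_pi_dist x p 1).trans ((Metric.mem_closedBall.1 hx).trans (min_le_right _ _))
    rw [Real.dist_eq, abs_le] at h2
    linarith
  -- For t ≤ τ compactness gives a bound. For t > τ the first entry puts the shifted point at radius
  -- at least r₀, and the second gives x¹ + t ≥ (1 + t)/2 for the radius x¹ ≥ p¹ - 1 of any point of
  -- the ball, whence 1 + t² ≤ 4 (x¹ + t)².
  set τ := max (r₀ - p 1 + 1) (3 - 2 * p 1)
  have hK : IsCompact ((fun x : Pt × ℝ => shift x.2 x.1) ''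
      (Metric.closedBall p δ ×ˢ Set.Icc 0 τ)) :=
    ((isCompact_closedBall p δ).prod isCompact_Icc).image continuous_shift
  obtain ⟨B, hB⟩ := hK.exists_bound_of_continuousOn (hc.mono (by
    rintro _ ⟨⟨x, t⟩, ⟨hx, ht⟩, rfl⟩
    exact shift_mem (hδ x hx).1 ht.1))
  refine ⟨Metric.closedBall p δ, Metric.closedBall_mem_nhds p δ0, fun x hx => (hδ x hx).1,
    max (|B| * (1 + τ ^ 2)) (4 * |C|), fun x hx t ht => ?_⟩
  have ht2 : 0 < 1 + t ^ 2 := by positivity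
  rw [← div_eq_mul_inv, le_div_iff₀ ht2]
  by_cases htτ : t ≤ τ
  · have h1 := hB (shift t x) ⟨(x, t), ⟨hx, ht, htτ⟩, rfl⟩
    rw [Real.norm_eq_abs] at h1
    refine le_trans ?_ (le_max_left _ _)
    exact mul_le_mul (h1.trans (le_abs_self B)) (by gcongr) ht2.le (abs_nonneg _)
  · push Not at htτ
    obtain ⟨_, hxN, hx1⟩ := hδ x hx
    have h2 : r₀ - p 1 + 1 < t := (le_max_left _ _).trans_lt htτ
    have h3 : 3 - 2 * p 1 < t := (le_max_right _ _).trans_lt htτ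
    have h4 := hb (shift t x) (by rw [shift_one]; linarith) (by simpa using hxN)
    rw [shift_one, Real.norm_eq_abs, Real.norm_eq_abs] at h4
    have h5 : (1 + t) / 2 ≤ x 1 + t := by linarith
    have h5' : 0 < (1 + t) / 2 := by linarith
    have h6 : |(x 1 + t) ^ (-2 : ℤ)| = ((x 1 + t) ^ 2)⁻¹ := by
      rw [zpow_neg, abs_of_nonneg]
      · norm_cast
      · positivity
    rw [h6] at h4
    have h7 : ((1 + t) / 2) ^ 2 ≤ (x 1 + t) ^ 2 := by gcongr
    have h8 : (1 + t ^ 2) ≤ 4 * (x 1 + t) ^ 2 := by nlinarith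
    have h9 : 0 < (x 1 + t) ^ 2 := lt_of_lt_of_le (by positivity) h7
    refine le_trans ?_ (le_max_right _ _)
    calc |F (shift t x)| * (1 + t ^ 2)
        ≤ (|C| * ((x 1 + t) ^ 2)⁻¹) * (4 * (x 1 + t) ^ 2) := by
          refine mul_le_mul (h4.trans ?_) h8 ht2.le (by positivity)
          exact mul_le_mul_of_nonneg_right (le_abs_self C) (by positivity)
      _ = 4 * |C| := by
          have : x 1 + t ≠ 0 := by linarith
          field_simp

theorem integrableOn_bound (C : ℝ) :
    IntegrableOn (fun t : ℝ => C * (1 + t ^ 2)⁻¹) (Set.Ioi 0) :=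
  (integrable_inv_one_add_sq.const_mul C).integrableOn

theorem aestronglyMeasurable_shift {E : Type*} [NormedAddCommGroup E] {F : Pt → E}
    (hc : ContinuousOn F D.bulk) (hp : p ∈ D.bulk) :
    AEStronglyMeasurable (fun t => F (shift t p)) (volume.restrict (Set.Ioi (0 : ℝ))) := by
  refine ContinuousOn.aestronglyMeasurable ?_ measurableSet_Ioi
  exact hc.comp (continuous_shift_left p).continuousOn fun t ht => shift_mem hp (le_of_lt ht)

theorem integrableOn_shift (hc : ContinuousOn F D.bulk)
    (hO : ∀ q ∈ D.scri, F =O[nearScri q] fun p => p 1 ^ (-2 : ℤ)) (hp : p ∈ D.bulk) :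
    IntegrableOn (fun t => F (shift t p)) (Set.Ioi 0) := by
  obtain ⟨s, hs, -, C, hC⟩ := exists_dominated hc hO hp
  refine (integrableOn_bound C).mono' (aestronglyMeasurable_shift hc hp) ?_
  exact (ae_restrict_mem measurableSet_Ioi).mono fun t ht =>
    hC p (mem_of_mem_nhds hs) t (le_of_lt ht)

theorem Asym.bd_neg_two (h : Asym D b n F) (hn : n ≤ -2) :
    ∀ q ∈ D.scri, F =O[nearScri q] fun p => p 1 ^ (-2 : ℤ) :=
  fun q hq => ((h.2 0) q hq).isBigO.trans (zpow_isBigO_zpow q hn)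

theorem Asym.integrableOn_shift (h : Asym D b n F) (hn : n ≤ -2) (hp : p ∈ D.bulk) :
    IntegrableOn (fun t => F (shift t p)) (Set.Ioi 0) :=
  NewmanUnti.integrableOn_shift h.1.continuousOn (h.bd_neg_two hn) hp

/-- Dominated convergence. Derivatives of F are again of order at most -2, so `exists_dominated`
bounds each of them by a multiple of (1 + t²)⁻¹ uniformly near `p`. -/
theorem hasFDerivAt_tail (h : Asym D b n F) (hn : n ≤ -2) (hp : p ∈ D.bulk) :
    HasFDerivAt (tail F) (∫ t in Set.Ioi (0 : ℝ), fderiv ℝ F (shift t p)) p := by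
  have e : tail F = fun p => ∫ t in Set.Ioi (0 : ℝ), F (shift t p) := funext (tail_eq F)
  rw [e]
  have hd : ∀ i, ∃ s ∈ 𝓝 p, s ⊆ D.bulk ∧ ∃ C, ∀ x ∈ s, ∀ t, 0 ≤ t →
      |pd i F (shift t x)| ≤ C * (1 + t ^ 2)⁻¹ := fun i =>
    exists_dominated (h.pd i).1.continuousOn ((h.pd i).bd_neg_two (by split_ifs <;> omega)) hp
  choose s hs hsD C hC using hd
  have hfc : ContinuousOn (fderiv ℝ F) D.bulk :=
    (h.1.fderiv_of_isOpen D.isOpen_bulk (m := (⊤ : ℕ∞)) (by simp)).continuousOn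
  have hS : (⋂ i, s i) ∈ 𝓝 p := (iInter_mem).2 hs
  refine hasFDerivAt_integral_of_dominated_of_fderiv_le (s := ⋂ i, s i)
    (bound := fun t => (∑ i, C i) * (1 + t ^ 2)⁻¹)
    (F' := fun x t => fderiv ℝ F (shift t x)) hS ?_ (h.integrableOn_shift hn hp)
    (aestronglyMeasurable_shift hfc hp) ?_ (integrableOn_bound _) ?_
  · filter_upwards [D.isOpen_bulk.mem_nhds hp] with x hx using
      aestronglyMeasurable_shift h.1.continuousOn hx
  · refine (ae_restrict_mem measurableSet_Ioi).mono fun t ht x hx => ?_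
    refine (norm_fderiv_le F _).trans ?_
    rw [Finset.sum_mul]
    exact Finset.sum_le_sum fun i _ => hC i x (Set.mem_iInter.1 hx i) t (le_of_lt ht)
  · refine (ae_restrict_mem measurableSet_Ioi).mono fun t ht x hx => ?_
    have h1 := (h.diff (shift_mem (hsD 0 (Set.mem_iInter.1 hx 0)) (le_of_lt ht))).hasFDerivAt
    have h2 : HasFDerivAt (shift t) (ContinuousLinearMap.id ℝ Pt) x :=
      (hasFDerivAt_id x).add_const _
    exact h1.comp x h2

theorem integrable_fderiv_shift (h : Asym D b n F) (hn : n ≤ -2) (hp : p ∈ D.bulk) :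
    IntegrableOn (fun t => fderiv ℝ F (shift t p)) (Set.Ioi 0) := by
  have hd : ∀ i, IntegrableOn (fun t => pd i F (shift t p)) (Set.Ioi 0) := fun i =>
    (h.pd i).integrableOn_shift (by split_ifs <;> omega) hp
  have hfc : ContinuousOn (fderiv ℝ F) D.bulk :=
    (h.1.fderiv_of_isOpen D.isOpen_bulk (m := (⊤ : ℕ∞)) (by simp)).continuousOn
  refine Integrable.mono' (g := fun t => ∑ i, |pd i F (shift t p)|)
    (integrable_finsetSum _ fun i _ => (hd i).abs) (aestronglyMeasurable_shift hfc hp) ?_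
  exact Eventually.of_forall fun t => norm_fderiv_le F _

/-- Differentiation under the integral sign. -/
theorem pd_tail (h : Asym D b n F) (hn : n ≤ -2) (hp : p ∈ D.bulk) (i : Fin 4) :
    pd i (tail F) p = tail (pd i F) p := by
  rw [pd, (hasFDerivAt_tail h hn hp).fderiv, tail_eq,
    ContinuousLinearMap.integral_apply (integrable_fderiv_shift h hn hp)]
  rfl

/-- Since ∂_i of a ray integral is the ray integral of ∂_i F, and differentiation never raises the
order above -2, smoothness follows by induction over all F and n at once. -/
theorem contDiffOn_tail (h : Asym D b n F) (hn : n ≤ -2) :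
    ContDiffOn ℝ (⊤ : ℕ∞) (tail F) D.bulk := by
  refine contDiffOn_infty.2 fun k => ?_
  induction k generalizing n F with
  | zero =>
    exact contDiffOn_zero.2 fun p hp =>
      (hasFDerivAt_tail h hn hp).continuousAt.continuousWithinAt
  | succ k ih =>
    refine contDiffOn_succ_of_pd D.isOpen_bulk
      (fun p hp => (hasFDerivAt_tail h hn hp).differentiableAt) fun i => ?_
    exact (ih (h.pd i) (by split_ifs <;> omega)).congr fun p hp => pd_tail h hn hp i

theorem integral_Ioi_zpow (hn : n ≤ -2) {r : ℝ} (hr : 0 < r) :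
    IntegrableOn (fun s : ℝ => s ^ n) (Set.Ioi r) ∧
      ∫ s in Set.Ioi r, s ^ n = r ^ (n + 1) / (-(n + 1 : ℤ) : ℝ) := by
  have hn' : (n : ℝ) < -1 := by
    have : (n : ℝ) ≤ -2 := by exact_mod_cast hn
    linarith
  have h1 := integrableOn_Ioi_rpow_of_lt hn' hr
  have h2 := integral_Ioi_rpow_of_lt hn' hr
  simp only [Real.rpow_intCast] at h1 h2
  refine ⟨h1, ?_⟩
  rw [h2, ← Real.rpow_intCast]
  push_cast
  rw [div_neg, neg_div]

theorem integrable_shift_zpow (hn : n ≤ -2) (hp : 0 < p 1) :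
    IntegrableOn (fun t : ℝ => (shift t p 1) ^ n) (Set.Ioi 0) := by
  have h2 := ((measurePreserving_add_left volume (p 1)).integrableOn_comp_preimage
    (measurableEmbedding_addLeft (p 1)) (f := fun s : ℝ => s ^ n) (s := Set.Ioi (p 1))).2
      (integral_Ioi_zpow hn hp).1
  have e : (p 1 + ·) ⁻¹' Set.Ioi (p 1) = Set.Ioi (0 : ℝ) := by ext t; simp
  rw [e] at h2
  refine h2.congr_fun (fun t _ => ?_) measurableSet_Ioi
  simp

/-- The integral of a bound `C r^n` along a ray. -/
theorem abs_tail_le {C r₀ : ℝ} {N : Set ScriPt} (hC : 0 ≤ C) (hn : n ≤ -2)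
    (hb : ∀ x : Pt, r₀ ≤ x 1 → toScri x ∈ N → ‖F x‖ ≤ C * ‖x 1 ^ n‖)
    (hr : r₀ ≤ p 1) (h0 : 0 < p 1) (hN : toScri p ∈ N) :
    ‖tail F p‖ ≤ C * ‖p 1 ^ (n + 1)‖ := by
  rw [tail_eq]
  have h1 : ∀ᵐ t ∂volume.restrict (Set.Ioi (0 : ℝ)), ‖F (shift t p)‖ ≤ C * (shift t p 1) ^ n := by
    refine (ae_restrict_mem measurableSet_Ioi).mono fun t (ht : 0 < t) => ?_
    have h2 := hb (shift t p) (by simp; linarith) (by simpa using hN)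
    rwa [Real.norm_of_nonneg (r := shift t p 1 ^ n)] at h2
    have : 0 < shift t p 1 := by simp; linarith
    positivity
  refine (norm_integral_le_of_norm_le ((integrable_shift_zpow hn h0).const_mul C) h1).trans ?_
  rw [integral_const_mul]
  refine mul_le_mul_of_nonneg_left ?_ hC
  have h3 : ∫ t in Set.Ioi (0 : ℝ), (shift t p 1) ^ n = ∫ s in Set.Ioi (p 1), s ^ n := by
    rw [setIntegral_Ioi_add (fun s => s ^ n) (p 1)]
    simp
  rw [h3, (integral_Ioi_zpow hn h0).2, Real.norm_of_nonneg (by positivity)]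
  -- The factor 1/(-(n+1)) produced by the integration is at most 1 because n ≤ -2, so the constant
  -- C is kept.
  refine div_le_self (by positivity) ?_
  have : ((n + 1 : ℤ) : ℝ) ≤ -1 := by exact_mod_cast (by omega : n + 1 ≤ -1)
  linarith

/-- The pointwise bound integrates with the same constant C, so the argument serves O and o alike.
Radii are kept at least 1 so that the powers are positive. -/
theorem bd_tail {q : ScriPt} (hn : n ≤ -2) (h : Bd b q n F) : Bd b q (n + 1) (tail F) := by
  cases b
  · obtain ⟨C, hC, hb⟩ := Asymptotics.IsBigO.exists_nonneg h
    obtain ⟨r₀, N, hN, hb⟩ := eventually_nearScri.1 hb.bound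
    refine Asymptotics.IsBigO.of_bound C (eventually_nearScri.2 ⟨max r₀ 1, N, hN, ?_⟩)
    intro p hp hpN
    exact abs_tail_le hC hn hb ((le_max_left _ _).trans hp)
      (lt_of_lt_of_le one_pos ((le_max_right _ _).trans hp)) hpN
  · refine Asymptotics.IsLittleO.of_bound fun C hC => ?_
    obtain ⟨r₀, N, hN, hb⟩ := eventually_nearScri.1 (Asymptotics.IsLittleO.bound h hC)
    refine eventually_nearScri.2 ⟨max r₀ 1, N, hN, ?_⟩
    intro p hp hpN
    exact abs_tail_le hC.le hn hb ((le_max_left _ _).trans hp)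
      (lt_of_lt_of_le one_pos ((le_max_right _ _).trans hp)) hpN

theorem Asym.tail (h : Asym D b n F) (hn : n ≤ -2) : Asym D b (n + 1) (tail F) := by
  refine ⟨contDiffOn_tail h hn, fun k => ?_⟩
  have base : ∀ {n : ℤ} {F : Pt → ℝ}, Asym D b n F → n ≤ -2 →
      ∀ q ∈ D.scri, Bd b q (n + 1) (NewmanUnti.tail F) := fun h hn q hq =>
    bd_tail hn ((h.2 0) q hq)
  induction k generalizing n F with
  | zero => exact base h hn
  | succ k ih =>
    refine ⟨base h hn, fun i => ?_⟩
    have h1 := ih (h.pd i) (by split_ifs <;> omega)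
    rw [show n - (if i = 1 then 1 else 0) + 1 = n + 1 - if i = 1 then 1 else 0 by ring] at h1
    exact h1.congr fun p hp => (pd_tail h hn hp i).symm

/-- The fundamental theorem of calculus along a ray. -/
theorem pd_one_tail (h : Asym D b n F) (hn : n ≤ -2) (hp : p ∈ D.bulk) :
    pd 1 (NewmanUnti.tail F) p = -F p := by
  rw [pd_tail h hn hp, tail_eq]
  have hd : ∀ t ∈ Set.Ici (0 : ℝ), HasDerivAt (fun t => F (shift t p)) (pd 1 F (shift t p)) t := by
    intro t ht
    have h1 := hasDerivAt_pd 1 (h.diff (shift_mem hp ht))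
    have h2 : HasDerivAt (fun t : ℝ => p 1 + t) 1 t := by
      simpa using (hasDerivAt_id t).const_add (p 1)
    rw [shift_one] at h1
    have h3 := h1.comp t h2
    rw [mul_one] at h3
    convert! h3 using 1
    funext s
    simp only [Function.comp, ← update_one_eq_shift, Function.update_idem]
  have hl : Tendsto (fun t => F (shift t p)) atTop (𝓝 0) := by
    have h1 : Asym D false (-1) F := h.of_lt (by omega)
    have h2 := (h1.tendsto_zero hp.1).comp (tendsto_atTop_add_const_left atTop (p 1) tendsto_id)
    refine h2.congr fun t => ?_
    simp [← update_one_eq_shift, update_one_eq_lift]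
  have hi := (h.pd 1).integrableOn_shift (by simp; omega) hp
  rw [integral_Ioi_of_hasDerivAt_of_tendsto' hd hi hl]
  simp [shift]

theorem tail_congr (e : ∀ p ∈ D.bulk, F p = G p) (hp : p ∈ D.bulk) : tail F p = tail G p := by
  rw [tail_eq, tail_eq]
  exact setIntegral_congr_fun measurableSet_Ioi fun t ht => e _ (shift_mem hp (le_of_lt ht))

theorem tail_add {c : Bool} {m : ℤ} (hF : Asym D b n F) (hn : n ≤ -2) (hG : Asym D c m G)
    (hm : m ≤ -2) (hp : p ∈ D.bulk) : tail (fun x => F x + G x) p = tail F p + tail G p := by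
  rw [tail_eq, tail_eq, tail_eq]
  exact integral_add (hF.integrableOn_shift hn hp) (hG.integrableOn_shift hm hp)

theorem tail_inv_sq (a : ScriPt → ℝ) (hp : 0 < p 1) :
    tail (fun x => ((x 1)⁻¹) ^ 2 * a (toScri x)) p = (p 1)⁻¹ * a (toScri p) := by
  have h := (integral_Ioi_zpow (n := -2) le_rfl hp).2
  rw [tail]
  simp only [toScri_update_one, Function.update_self]
  rw [integral_mul_const]
  congr 1
  rw [show (-2 : ℤ) + 1 = -1 by norm_num] at h
  simpa [zpow_neg] using h

end

/-- A function is constant along the rays if its `r`-derivative vanishes. -/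
theorem eq_of_pd_one_eq_zero {D : Region} {F : Pt → ℝ} (hF : ContDiffOn ℝ (⊤ : ℕ∞) F D.bulk)
    (h : ∀ p ∈ D.bulk, pd 1 F p = 0) {q : ScriPt} (hq : q ∈ D.scri) {r s : ℝ} (hr : D.R q < r)
    (hs : D.R q < s) : F (lift q r) = F (lift q s) := by
  have hd : ∀ t ∈ Set.Ioi (D.R q), HasDerivAt (fun t => F (lift q t)) 0 t := by
    intro t ht
    have hm := Region.lift_mem hq ht
    have h1 := hasDerivAt_pd 1 (smooth_diff D.isOpen_bulk hF hm)
    rw [h _ hm] at h1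
    simpa [update_one_eq_lift] using h1
  exact (isOpen_Ioi).is_const_of_deriv_eq_zero isPreconnected_Ioi
    (fun t ht => (hd t ht).differentiableAt.differentiableWithinAt)
    (fun t ht => (hd t ht).deriv) hr hs

end NewmanUnti

namespace NewmanUnti

open MeasureTheory

/-! ## Integrals over retarded time -/

section uInt
variable {n : ℕ} {Ω : Set (Fin (n + 1) → ℝ)} {F G : (Fin (n + 1) → ℝ) → ℝ} {p : Fin (n + 1) → ℝ}

theorem continuous_update_zero (p : Fin (n + 1) → ℝ) : Continuous (Function.update p 0) :=
  continuous_const.update 0 continuous_id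

/-- `∫₀^u F du'`, where `u` is the coordinate with index zero. -/
noncomputable def uInt (F : (Fin (n + 1) → ℝ) → ℝ) (p : Fin (n + 1) → ℝ) : ℝ :=
  ∫ v in (0 : ℝ)..p 0, F (Function.update p 0 v)

/-- The map `p ↦ (t p⁰, p¹, …)`. -/
def squeeze (t : ℝ) : (Fin (n + 1) → ℝ) →L[ℝ] (Fin (n + 1) → ℝ) :=
  ContinuousLinearMap.id ℝ _ + ((t - 1) • ContinuousLinearMap.proj (R := ℝ)
    (φ := fun _ : Fin (n + 1) => ℝ) 0).smulRight (Pi.single 0 1)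

theorem squeeze_apply (t : ℝ) (p : Fin (n + 1) → ℝ) :
    squeeze t p = Function.update p 0 (t * p 0) := by
  ext i
  refine Fin.cases ?_ (fun j => ?_) i
  · simp [squeeze]
    ring
  · simp [squeeze]

theorem continuous_squeeze :
    Continuous fun t : ℝ => (squeeze t : (Fin (n + 1) → ℝ) →L[ℝ] (Fin (n + 1) → ℝ)) := by
  unfold squeeze
  refine continuous_const.add ?_
  have h := (ContinuousLinearMap.smulRightL ℝ (Fin (n + 1) → ℝ) (Fin (n + 1) → ℝ)).flip
    (Pi.single 0 1)
  have h1 : Continuous fun t : ℝ => (t - 1) • ContinuousLinearMap.proj (R := ℝ)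
    (φ := fun _ : Fin (n + 1) => ℝ) 0 := by fun_prop
  exact ((ContinuousLinearMap.smulRightL ℝ (Fin (n + 1) → ℝ) (Fin (n + 1) → ℝ)).flip
    (Pi.single 0 1)).continuous.comp h1

theorem continuous_squeeze_apply :
    Continuous fun x : (Fin (n + 1) → ℝ) × ℝ => squeeze x.2 x.1 :=
  (continuous_squeeze.comp continuous_snd).clm_apply continuous_fst

/-- The points joined to the hypersurface `u = 0` inside `Ω` along a line of constant `x`. -/
def star (Ω : Set (Fin (n + 1) → ℝ)) : Set (Fin (n + 1) → ℝ) :=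
  {p | ∀ t ∈ Set.Icc (0 : ℝ) 1, squeeze t p ∈ Ω}

/-- Tube lemma: the condition ranges over the compact parameter interval [0, 1]. -/
theorem isOpen_star (hΩ : IsOpen Ω) : IsOpen (star Ω) := by
  rw [isOpen_iff_mem_nhds]
  intro p hp
  refine isCompact_Icc.eventually_forall_of_forall_eventually fun t ht => ?_
  exact continuous_squeeze_apply.continuousAt.eventually (hΩ.mem_nhds (hp t ht))

theorem star_subset : star Ω ⊆ Ω := fun p hp => by
  have := hp 1 (by simp)
  rwa [squeeze_apply, one_mul, Function.update_eq_self] at this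

theorem update_mem_star (hp : p ∈ star Ω) {v : ℝ} (hv : v ∈ Set.uIcc 0 (p 0)) :
    Function.update p 0 v ∈ Ω := by
  rw [← segment_eq_uIcc, segment_eq_image] at hv
  obtain ⟨t, ht, rfl⟩ := hv
  have := hp t ht
  rw [squeeze_apply] at this
  simpa using this

/-- Weighted integrals over `u`, rescaled to the unit interval. -/
noncomputable def wInt (m : ℕ) (F : (Fin (n + 1) → ℝ) → ℝ) (p : Fin (n + 1) → ℝ) : ℝ :=
  ∫ t in (0 : ℝ)..1, t ^ m * F (squeeze t p)

/-- The substitution v = t u fixes the limits of integration, so that smoothness in all coordinates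
becomes a question about a parameter integral over [0, 1]. -/
theorem uInt_eq (F : (Fin (n + 1) → ℝ) → ℝ) (p : Fin (n + 1) → ℝ) :
    uInt F p = p 0 * wInt 0 F p := by
  have h := intervalIntegral.smul_integral_comp_mul_right (a := 0) (b := 1)
    (fun v => F (Function.update p 0 v)) (p 0)
  simp only [zero_mul, one_mul, smul_eq_mul] at h
  rw [uInt, ← h]
  simp [wInt, squeeze_apply]

theorem continuousOn_squeeze {E : Type*} [NormedAddCommGroup E]
    {F : (Fin (n + 1) → ℝ) → E} (hF : ContinuousOn F Ω) (hp : p ∈ star Ω) :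
    ContinuousOn (fun t => F (squeeze t p)) (Set.uIcc (0 : ℝ) 1) := by
  rw [Set.uIcc_of_le zero_le_one]
  refine hF.comp (Continuous.continuousOn ?_) fun t ht => hp t ht
  exact continuous_squeeze.clm_apply continuous_const

theorem intervalIntegrable_squeeze (m : ℕ) (hF : ContinuousOn F Ω) (hp : p ∈ star Ω) :
    IntervalIntegrable (fun t => t ^ m * F (squeeze t p)) volume 0 1 :=
  (ContinuousOn.mul (by fun_prop) (continuousOn_squeeze hF hp)).intervalIntegrable

theorem continuousOn_fderiv_squeeze (hΩ : IsOpen Ω) (hF : ContDiffOn ℝ (⊤ : ℕ∞) F Ω) (m : ℕ) :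
    ContinuousOn (fun x : (Fin (n + 1) → ℝ) × ℝ =>
      x.2 ^ m • (fderiv ℝ F (squeeze x.2 x.1)).comp (squeeze x.2)) (star Ω ×ˢ Set.Icc 0 1) := by
  have hfc : ContinuousOn (fderiv ℝ F) Ω :=
    (hF.fderiv_of_isOpen hΩ (m := (⊤ : ℕ∞)) (by simp)).continuousOn
  refine ContinuousOn.smul (continuous_snd.pow m).continuousOn (ContinuousOn.clm_comp ?_ ?_)
  · exact hfc.comp continuous_squeeze_apply.continuousOn fun x hx => hx.1 x.2 hx.2
  · exact (continuous_squeeze.comp continuous_snd).continuousOn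

theorem continuousOn_fderiv_squeeze_right (hΩ : IsOpen Ω) (hF : ContDiffOn ℝ (⊤ : ℕ∞) F Ω)
    (m : ℕ) (hp : p ∈ star Ω) :
    ContinuousOn (fun t : ℝ => t ^ m • (fderiv ℝ F (squeeze t p)).comp (squeeze t))
      (Set.uIcc 0 1) := by
  have h := (continuousOn_fderiv_squeeze hΩ hF m).comp (f := fun t : ℝ => (p, t))
    (s := Set.uIcc 0 1) (by fun_prop)
    (by rw [Set.uIcc_of_le zero_le_one]; exact fun t ht => ⟨hp, ht⟩)
  exact h

theorem hasFDerivAt_wInt (hΩ : IsOpen Ω) (hF : ContDiffOn ℝ (⊤ : ℕ∞) F Ω) (m : ℕ)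
    (hp : p ∈ star Ω) :
    HasFDerivAt (wInt m F)
      (∫ t in (0 : ℝ)..1, t ^ m • (fderiv ℝ F (squeeze t p)).comp (squeeze t)) p := by
  obtain ⟨ε, ε0, hε⟩ := Metric.nhds_basis_closedBall.mem_iff.1 ((isOpen_star hΩ).mem_nhds hp)
  obtain ⟨C, hC⟩ := ((isCompact_closedBall p ε).prod
    (isCompact_Icc (a := (0 : ℝ)) (b := 1))).exists_bound_of_continuousOn
    ((continuousOn_fderiv_squeeze hΩ hF m).mono (Set.prod_mono hε subset_rfl))
  have hI : ∀ t ∈ Set.uIoc (0 : ℝ) 1, t ∈ Set.Icc (0 : ℝ) 1 := fun t ht => by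
    rw [Set.uIoc_of_le zero_le_one] at ht
    exact ⟨ht.1.le, ht.2⟩
  refine intervalIntegral.hasFDerivAt_integral_of_dominated_of_fderiv_le
    (s := Metric.closedBall p ε) (bound := fun _ => C)
    (F' := fun x t => t ^ m • (fderiv ℝ F (squeeze t x)).comp (squeeze t))
    (Metric.closedBall_mem_nhds p ε0) ?_
    (intervalIntegrable_squeeze m hF.continuousOn hp) ?_ ?_ intervalIntegrable_const ?_
  · filter_upwards [(isOpen_star hΩ).mem_nhds hp] with x hx
    exact (intervalIntegrable_iff.1
      (intervalIntegrable_squeeze m hF.continuousOn hx)).aestronglyMeasurable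
  · exact (intervalIntegrable_iff.1 (continuousOn_fderiv_squeeze_right hΩ hF m
      hp).intervalIntegrable).aestronglyMeasurable
  · exact Eventually.of_forall fun t ht x hx => hC (x, t) ⟨hx, hI t ht⟩
  · refine Eventually.of_forall fun t ht x hx => ?_
    have h1 := (smooth_diff hΩ hF (hε hx t (hI t ht))).hasFDerivAt
    have h2 := (h1.comp x (squeeze t).hasFDerivAt).const_smul (t ^ m)
    exact h2

theorem squeeze_single_zero (t : ℝ) :
    squeeze t (Pi.single 0 1 : Fin (n + 1) → ℝ) = t • Pi.single 0 1 := by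
  rw [squeeze_apply]
  ext i
  refine Fin.cases ?_ (fun j => ?_) i <;> simp

theorem squeeze_single_succ (t : ℝ) (j : Fin n) :
    squeeze t (Pi.single j.succ 1 : Fin (n + 1) → ℝ) = Pi.single j.succ 1 := by
  rw [squeeze_apply]
  simp

/-- The chain rule through u ↦ t u produces one more factor t; the weights t^m are there to make the
family of integrals closed under ∂_u. -/
theorem pd_zero_wInt (hΩ : IsOpen Ω) (hF : ContDiffOn ℝ (⊤ : ℕ∞) F Ω) (m : ℕ)
    (hp : p ∈ star Ω) : pd 0 (wInt m F) p = wInt (m + 1) (pd 0 F) p := by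
  rw [pd, (hasFDerivAt_wInt hΩ hF m hp).fderiv, ContinuousLinearMap.intervalIntegral_apply
    (continuousOn_fderiv_squeeze_right hΩ hF m hp).intervalIntegrable]
  refine intervalIntegral.integral_congr fun t _ => ?_
  simp [squeeze_single_zero, pd]
  ring

theorem pd_succ_wInt (hΩ : IsOpen Ω) (hF : ContDiffOn ℝ (⊤ : ℕ∞) F Ω) (m : ℕ)
    (hp : p ∈ star Ω) (j : Fin n) : pd j.succ (wInt m F) p = wInt m (pd j.succ F) p := by
  rw [pd, (hasFDerivAt_wInt hΩ hF m hp).fderiv, ContinuousLinearMap.intervalIntegral_apply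
    (continuousOn_fderiv_squeeze_right hΩ hF m hp).intervalIntegrable]
  refine intervalIntegral.integral_congr fun t _ => ?_
  simp [squeeze_single_succ, pd]

/-- Induction on the order of differentiability, for all weights and integrands at once, since each
partial derivative is again a weighted integral. -/
theorem contDiffOn_wInt (hΩ : IsOpen Ω) (hF : ContDiffOn ℝ (⊤ : ℕ∞) F Ω) (m : ℕ) :
    ContDiffOn ℝ (⊤ : ℕ∞) (wInt m F) (star Ω) := by
  refine contDiffOn_infty.2 fun k => ?_
  induction k generalizing m F with
  | zero =>
    exact contDiffOn_zero.2 fun p hp =>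
      (hasFDerivAt_wInt hΩ hF m hp).continuousAt.continuousWithinAt
  | succ k ih =>
    refine contDiffOn_succ_of_pd (isOpen_star hΩ)
      (fun p hp => (hasFDerivAt_wInt hΩ hF m hp).differentiableAt) fun i => ?_
    refine Fin.cases ?_ (fun j => ?_) i
    · exact (ih (smooth_pd hΩ 0 hF) (m + 1)).congr fun p hp => pd_zero_wInt hΩ hF m hp
    · exact (ih (smooth_pd hΩ j.succ hF) m).congr fun p hp => pd_succ_wInt hΩ hF m hp j

theorem contDiffOn_uInt (hΩ : IsOpen Ω) (hF : ContDiffOn ℝ (⊤ : ℕ∞) F Ω) :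
    ContDiffOn ℝ (⊤ : ℕ∞) (uInt F) (star Ω) := by
  have e : uInt F = fun p => p 0 * wInt 0 F p := funext (uInt_eq F)
  rw [e]
  exact (contDiff_apply ℝ ℝ (0 : Fin (n + 1))).contDiffOn.mul (contDiffOn_wInt hΩ hF 0)

theorem pd_succ_uInt (hΩ : IsOpen Ω) (hF : ContDiffOn ℝ (⊤ : ℕ∞) F Ω)
    (hp : p ∈ star Ω) (j : Fin n) : pd j.succ (uInt F) p = uInt (pd j.succ F) p := by
  have e : uInt F = fun p => p 0 * wInt 0 F p := funext (uInt_eq F)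
  rw [e, pd_mul _ (differentiableAt_apply 0 p)
    (hasFDerivAt_wInt hΩ hF 0 hp).differentiableAt, pd_succ_wInt hΩ hF 0 hp, uInt_eq, pd_coord,
    if_neg (Fin.succ_ne_zero j).symm]
  ring

/-- Smoothness being known, the partial derivative is the derivative along the line of constant x,
where the fundamental theorem of calculus applies. -/
theorem pd_zero_uInt (hΩ : IsOpen Ω) (hF : ContDiffOn ℝ (⊤ : ℕ∞) F Ω)
    (hp : p ∈ star Ω) : pd 0 (uInt F) p = F p := by
  have h1 := hasDerivAt_pd 0 (smooth_diff (isOpen_star hΩ) (contDiffOn_uInt hΩ hF) hp)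
  have hc : ContinuousOn (fun v => F (Function.update p 0 v)) (Set.uIcc 0 (p 0)) :=
    hF.continuousOn.comp (continuous_update_zero p).continuousOn
      fun v hv => update_mem_star hp hv
  have hO : IsOpen {v : ℝ | Function.update p 0 v ∈ Ω} :=
    hΩ.preimage (continuous_update_zero p)
  have hm : p 0 ∈ {v : ℝ | Function.update p 0 v ∈ Ω} := update_mem_star hp Set.right_mem_uIcc
  have hcO : ContinuousOn (fun v => F (Function.update p 0 v))
      {v : ℝ | Function.update p 0 v ∈ Ω} :=
    hF.continuousOn.comp (continuous_update_zero p).continuousOn fun v hv => hv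
  have h2 := intervalIntegral.integral_hasDerivAt_right hc.intervalIntegrable
    (hcO.stronglyMeasurableAtFilter hO _ hm) (hcO.continuousAt (hO.mem_nhds hm))
  have e : (fun t => uInt F (Function.update p 0 t))
      = fun u => ∫ v in (0 : ℝ)..u, F (Function.update p 0 v) := by
    funext t
    simp [uInt]
  rw [e] at h1
  simpa using h1.unique h2

theorem uInt_congr (h : ∀ x ∈ Ω, F x = G x) (hp : p ∈ star Ω) : uInt F p = uInt G p :=
  intervalIntegral.integral_congr fun _ hv => h _ (update_mem_star hp hv)

theorem intervalIntegrable_uInt (hF : ContinuousOn F Ω) (hp : p ∈ star Ω) :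
    IntervalIntegrable (fun v => F (Function.update p 0 v)) volume 0 (p 0) :=
  (hF.comp (continuous_update_zero p).continuousOn
    fun _ hv => update_mem_star hp hv).intervalIntegrable

theorem uInt_add (hF : ContinuousOn F Ω) (hG : ContinuousOn G Ω) (hp : p ∈ star Ω) :
    uInt (fun x => F x + G x) p = uInt F p + uInt G p :=
  intervalIntegral.integral_add (intervalIntegrable_uInt hF hp) (intervalIntegrable_uInt hG hp)

theorem uInt_const_mul (c : ℝ) (F : (Fin (n + 1) → ℝ) → ℝ) (p : Fin (n + 1) → ℝ) :
    uInt (fun x => c * F x) p = c * uInt F p :=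
  intervalIntegral.integral_const_mul _ _

end uInt

/-- `J` is an interval containing 0, so the segment down to u = 0 stays in Scri. -/
theorem mem_star_scri {D : Region} {q : ScriPt} (hq : q ∈ D.scri) : q ∈ star D.scri := by
  intro t ht
  rw [squeeze_apply]
  refine Region.update_zero_mem hq (Region.mem_J_of_mem_uIcc hq.1 ?_)
  rw [← segment_eq_uIcc, segment_eq_image]
  exact ⟨t, ht, by simp⟩

/-- Functions on Scri that agree at `u = 0` and have the same `u`-derivative agree. -/
theorem eq_of_pd_zero_eq {D : Region} {a : ScriPt → ℝ}
    (ha : ContDiffOn ℝ (⊤ : ℕ∞) a D.scri) (h : ∀ q ∈ D.scri, pd 0 a q = 0) {q : ScriPt}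
    (hq : q ∈ D.scri) : a q = a (Function.update q 0 0) := by
  have hd : ∀ v ∈ D.J, HasDerivAt (fun v => a (Function.update q 0 v)) 0 v := by
    intro v hv
    have hm := Region.update_zero_mem hq hv
    have h1 := hasDerivAt_pd 0 (smooth_diff D.isOpen_scri ha hm)
    rw [h _ hm] at h1
    simpa using h1
  have := D.isOpen_J.is_const_of_deriv_eq_zero D.ordConnected_J.isPreconnected
    (fun t ht => (hd t ht).differentiableAt.differentiableWithinAt)
    (fun t ht => (hd t ht).deriv) hq.1 D.zero_mem_J
  simpa using this

end NewmanUnti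

namespace NewmanUnti

/-! ## The inverse of a metric in Newman–Unti form -/

/-- The inverse of a symmetric matrix with `G_{rr} = G_{rA} = 0` and `G_{ur} = -1`. -/
theorem inv_of_nuForm {G : Matrix (Fin 4) (Fin 4) ℝ} (hs : ∀ μ ν, G μ ν = G ν μ)
    (h01 : G 0 1 = -1) (h11 : G 1 1 = 0) (h12 : G 1 2 = 0) (h13 : G 1 3 = 0) {d : ℝ}
    (hd : d * (G 2 2 * G 3 3 - G 2 3 * G 2 3) = 1) :
    G⁻¹ = !![0, -1, 0, 0;
      -1, -G 0 0 + (G 3 3 * G 0 2 - G 2 3 * G 0 3) * d * G 0 2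
          + (G 2 2 * G 0 3 - G 2 3 * G 0 2) * d * G 0 3,
        (G 3 3 * G 0 2 - G 2 3 * G 0 3) * d, (G 2 2 * G 0 3 - G 2 3 * G 0 2) * d;
      0, (G 3 3 * G 0 2 - G 2 3 * G 0 3) * d, G 3 3 * d, -G 2 3 * d;
      0, (G 2 2 * G 0 3 - G 2 3 * G 0 2) * d, -G 2 3 * d, G 2 2 * d] := by
  refine Matrix.inv_eq_right_inv ?_
  have h10 := hs 1 0
  have h20 := hs 2 0
  have h30 := hs 3 0
  have h21 := hs 2 1
  have h31 := hs 3 1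
  have h32 := hs 3 2
  rw [h01] at h10
  rw [h12] at h21
  rw [h13] at h31
  ext i j
  fin_cases i <;> fin_cases j <;>
    simp [Matrix.mul_apply, Fin.sum_univ_four, h01, h10, h11, h12, h13, h20, h30, h21, h31, h32]
  all_goals first
    | ring1
    | linear_combination hd
    | linear_combination G 0 2 * hd
    | linear_combination G 0 3 * hd

namespace NUMetric
variable {D : Region} (M : NUMetric D) {p : Pt}

/-- The determinant of the angular part of the metric. -/
def dh (p : Pt) : ℝ := M.h p 0 0 * M.h p 1 1 - M.h p 0 1 * M.h p 0 1

/-- The inverse of the angular part of the metric. -/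
noncomputable def hInv (A B : Fin 2) (p : Pt) : ℝ :=
  (!![M.h p 1 1, -M.h p 0 1; -M.h p 0 1, M.h p 0 0] : Matrix (Fin 2) (Fin 2) ℝ) A B * (M.dh p)⁻¹

theorem h_symm (hp : p ∈ D.bulk) : M.h p 1 0 = M.h p 0 1 := by
  simpa using (M.posDef_h p hp).isHermitian.apply 0 1

theorem dh_pos (hp : p ∈ D.bulk) : 0 < M.dh p := by
  have h := (M.posDef_h p hp).det_pos
  rw [Matrix.det_fin_two, M.h_symm hp] at h
  exact h

theorem hInv_symm (A B : Fin 2) (p : Pt) : M.hInv A B p = M.hInv B A p := by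
  fin_cases A <;> fin_cases B <;> simp [hInv]

theorem g_eq (hp : p ∈ D.bulk) : M.g p =
    !![M.W p + (M.h p 0 0 * M.V p 0 * M.V p 0 + 2 * M.h p 0 1 * M.V p 0 * M.V p 1
          + M.h p 1 1 * M.V p 1 * M.V p 1), -1, -(M.h p 0 0 * M.V p 0 + M.h p 0 1 * M.V p 1),
        -(M.h p 0 1 * M.V p 0 + M.h p 1 1 * M.V p 1);
      -1, 0, 0, 0;
      -(M.h p 0 0 * M.V p 0 + M.h p 0 1 * M.V p 1), 0, M.h p 0 0, M.h p 0 1;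
      -(M.h p 0 1 * M.V p 0 + M.h p 1 1 * M.V p 1), 0, M.h p 0 1, M.h p 1 1] := by
  have hs := M.h_symm hp
  ext i j
  fin_cases i <;> fin_cases j <;>
    simp [NUMetric.g, nuMetric, dx, Fin.sum_univ_two, Pi.single_apply, hs] <;> ring

/-- The inverse metric, `g^{ur} = -1`, `g^{rr} = -W`, `g^{rA} = -V^A`, `g^{AB} = h^{AB}`. -/
noncomputable def ginv (μ ν : Fin 4) (p : Pt) : ℝ :=
  (!![0, -1, 0, 0; -1, -M.W p, -M.V p 0, -M.V p 1; 0, -M.V p 0, M.hInv 0 0 p, M.hInv 0 1 p;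
    0, -M.V p 1, M.hInv 0 1 p, M.hInv 1 1 p] : Matrix (Fin 4) (Fin 4) ℝ) μ ν

theorem inv_g (hp : p ∈ D.bulk) (μ ν : Fin 4) : (M.g p)⁻¹ μ ν = M.ginv μ ν p := by
  have hg := M.g_eq hp
  have hd := M.dh_pos hp
  have key := inv_of_nuForm (G := M.g p) (d := (M.dh p)⁻¹)
    (by intro μ ν; rw [hg]; fin_cases μ <;> fin_cases ν <;> rfl)
    (by rw [hg]; rfl) (by rw [hg]; rfl) (by rw [hg]; rfl) (by rw [hg]; rfl)
    (by rw [hg]; exact inv_mul_cancel₀ hd.ne')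
  rw [key, hg]
  have e := inv_mul_cancel₀ hd.ne'
  have e2 : M.dh p = M.h p 0 0 * M.h p 1 1 - M.h p 0 1 * M.h p 0 1 := rfl
  set d := (M.dh p)⁻¹ with hdd
  rw [e2] at e
  fin_cases μ <;> fin_cases ν <;> simp [ginv, hInv, ← hdd]
  · linear_combination (M.V p 0 * (M.h p 0 0 * M.V p 0 + M.h p 0 1 * M.V p 1)
      + M.V p 1 * (M.h p 0 1 * M.V p 0 + M.h p 1 1 * M.V p 1)) * e
  · linear_combination -M.V p 0 * e
  · linear_combination -M.V p 1 * e
  · linear_combination -M.V p 0 * e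
  · linear_combination -M.V p 1 * e

theorem det_g (hp : p ∈ D.bulk) : (M.g p).det = -M.dh p := by
  rw [M.g_eq hp]
  simp [Matrix.det_succ_row_zero, Fin.sum_univ_succ, dh, Fin.succAbove]
  ring

theorem ginv_symm (μ ν : Fin 4) (p : Pt) : M.ginv μ ν p = M.ginv ν μ p := by
  fin_cases μ <;> fin_cases ν <;> simp [ginv]

theorem isUnit_det (hp : p ∈ D.bulk) : IsUnit (M.g p).det := by
  rw [M.det_g hp]
  exact (neg_ne_zero.2 (M.dh_pos hp).ne').isUnit

theorem g_symm (hp : p ∈ D.bulk) (μ ν : Fin 4) : M.g p μ ν = M.g p ν μ := by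
  rw [M.g_eq hp]
  fin_cases μ <;> fin_cases ν <;> rfl

@[simp] theorem ginv_00 : M.ginv 0 0 = fun _ => 0 := rfl
@[simp] theorem ginv_01 : M.ginv 0 1 = fun _ => -1 := rfl
@[simp] theorem ginv_10 : M.ginv 1 0 = fun _ => -1 := rfl
@[simp] theorem ginv_11 : M.ginv 1 1 = fun p => -M.W p := rfl
@[simp] theorem ginv_0A (A : Fin 2) : M.ginv 0 A.succ.succ = fun _ => 0 := by
  fin_cases A <;> rfl
@[simp] theorem ginv_A0 (A : Fin 2) : M.ginv A.succ.succ 0 = fun _ => 0 := by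
  fin_cases A <;> rfl
@[simp] theorem ginv_1A (A : Fin 2) : M.ginv 1 A.succ.succ = fun p => -M.V p A := by
  fin_cases A <;> rfl
@[simp] theorem ginv_A1 (A : Fin 2) : M.ginv A.succ.succ 1 = fun p => -M.V p A := by
  fin_cases A <;> rfl
@[simp] theorem ginv_AB (A B : Fin 2) : M.ginv A.succ.succ B.succ.succ = M.hInv A B := by
  fin_cases A <;> fin_cases B <;> rfl

/-! ### Smoothness -/

theorem smooth_V' (A : Fin 2) : ContDiffOn ℝ (⊤ : ℕ∞) (fun p => M.V p A) D.bulk :=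
  contDiffOn_pi.1 M.smooth_V A

theorem smooth_dh : ContDiffOn ℝ (⊤ : ℕ∞) M.dh D.bulk :=
  ((M.smooth_h 0 0).mul (M.smooth_h 1 1)).sub ((M.smooth_h 0 1).mul (M.smooth_h 0 1))

theorem smooth_hInv (A B : Fin 2) : ContDiffOn ℝ (⊤ : ℕ∞) (M.hInv A B) D.bulk := by
  have h : ContDiffOn ℝ (⊤ : ℕ∞) (fun p => (M.dh p)⁻¹) D.bulk :=
    M.smooth_dh.inv fun p hp => (M.dh_pos hp).ne'
  fin_cases A <;> fin_cases B
  · exact (M.smooth_h 1 1).mul h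
  · exact (M.smooth_h 0 1).neg.mul h
  · exact (M.smooth_h 0 1).neg.mul h
  · exact (M.smooth_h 0 0).mul h

theorem forall_fin_four {P : Fin 4 → Prop} : (∀ μ, P μ) ↔ P 0 ∧ P 1 ∧ ∀ A : Fin 2, P A.succ.succ := by
  rw [Fin.forall_fin_succ, Fin.forall_fin_succ]
  rfl

theorem smooth_ginv (μ ν : Fin 4) : ContDiffOn ℝ (⊤ : ℕ∞) (M.ginv μ ν) D.bulk := by
  revert μ ν
  simp only [forall_fin_four, ginv_00, ginv_01, ginv_10, ginv_11, ginv_0A, ginv_A0, ginv_1A,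
    ginv_A1, ginv_AB]
  exact ⟨⟨contDiffOn_const, contDiffOn_const, fun _ => contDiffOn_const⟩,
    ⟨contDiffOn_const, M.smooth_W.neg, fun A => (M.smooth_V' A).neg⟩,
    fun A => ⟨contDiffOn_const, (M.smooth_V' A).neg, M.smooth_hInv A⟩⟩

theorem smooth_g (μ ν : Fin 4) : ContDiffOn ℝ (⊤ : ℕ∞) (fun p => M.g p μ ν) D.bulk := by
  simp only [NUMetric.g, nuMetric, Matrix.of_apply]
  have hW := M.smooth_W
  have hV := M.smooth_V'
  have hh := M.smooth_h
  refine ((((hW.mul contDiffOn_const).mul contDiffOn_const).sub contDiffOn_const)).add ?_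
  refine ContDiffOn.sum fun A _ => ContDiffOn.sum fun B _ => ?_
  exact ((hh A B).mul (contDiffOn_const.sub ((hV A).mul contDiffOn_const))).mul
    (contDiffOn_const.sub ((hV B).mul contDiffOn_const))

end NUMetric

/-! ## Lie derivatives in components -/

section lie
variable {D : Region} {M : NUMetric D} {ξ : VField} {p : Pt}

theorem smooth_comp (hξ : ContDiffOn ℝ (⊤ : ℕ∞) ξ D.bulk) (μ : Fin 4) :
    ContDiffOn ℝ (⊤ : ℕ∞) (fun p => ξ p μ) D.bulk := contDiffOn_pi.1 hξ μ

theorem pd_comp (hξ : ContDiffOn ℝ (⊤ : ℕ∞) ξ D.bulk) (hp : p ∈ D.bulk) (ρ μ : Fin 4) :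
    pd ρ ξ p μ = pd ρ (fun x => ξ x μ) p :=
  pd_apply ρ μ ((hξ.contDiffAt (D.isOpen_bulk.mem_nhds hp)).differentiableAt (by simp))

theorem lieInv_eq (hξ : ContDiffOn ℝ (⊤ : ℕ∞) ξ D.bulk) (hp : p ∈ D.bulk) (μ ν : Fin 4) :
    lieInv ξ M.g μ ν p = ∑ ρ, (ξ p ρ * pd ρ (M.ginv μ ν) p
      - M.ginv ρ ν p * pd ρ (fun x => ξ x μ) p - M.ginv μ ρ p * pd ρ (fun x => ξ x ν) p) := by
  refine Finset.sum_congr rfl fun ρ _ => ?_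
  rw [M.inv_g hp, M.inv_g hp, pd_comp hξ hp, pd_comp hξ hp,
    pd_congr D.isOpen_bulk ρ (fun x hx => M.inv_g hx μ ν) hp]

theorem sum_four (F : Fin 4 → ℝ) : ∑ ρ, F ρ = F 0 + F 1 + ∑ A : Fin 2, F A.succ.succ := by
  rw [Fin.sum_univ_succ, Fin.sum_univ_succ, add_assoc]
  rfl

theorem lieInv_smooth (hξ : ContDiffOn ℝ (⊤ : ℕ∞) ξ D.bulk) (μ ν : Fin 4) :
    ContDiffOn ℝ (⊤ : ℕ∞) (lieInv ξ M.g μ ν) D.bulk := by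
  refine ContDiffOn.congr ?_ fun p hp => lieInv_eq hξ hp μ ν
  refine ContDiffOn.sum fun ρ _ => ?_
  have d : ∀ ρ μ, ContDiffOn ℝ (⊤ : ℕ∞) (pd ρ fun x => ξ x μ) D.bulk := fun ρ μ =>
    smooth_pd D.isOpen_bulk ρ (smooth_comp hξ μ)
  exact (((smooth_comp hξ ρ).mul (smooth_pd D.isOpen_bulk ρ (M.smooth_ginv μ ν))).sub
    ((M.smooth_ginv ρ ν).mul (d ρ μ))).sub ((M.smooth_ginv μ ρ).mul (d ρ ν))

/-- The components g^{uμ} are constant, so the transport term drops out; in the term g^{uρ} ∂_ρ ξ^μ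
only ρ = r survives, with coefficient -1. -/
theorem lieInv_zero (hξ : ContDiffOn ℝ (⊤ : ℕ∞) ξ D.bulk) (hp : p ∈ D.bulk) (μ : Fin 4) :
    lieInv ξ M.g 0 μ p
      = pd 1 (fun x => ξ x μ) p - ∑ ν, M.ginv μ ν p * pd ν (fun x => ξ x 0) p := by
  rw [lieInv_eq hξ hp]
  have h : ∀ ρ, pd ρ (M.ginv 0 μ) p = 0 := by
    intro ρ
    revert μ
    rw [NUMetric.forall_fin_four]
    simp only [NUMetric.ginv_00, NUMetric.ginv_01, NUMetric.ginv_0A, pd_const, implies_true,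
      and_self]
  simp only [h, mul_zero, zero_sub, Finset.sum_sub_distrib, Finset.sum_neg_distrib]
  have h2 : ∑ ρ, M.ginv 0 ρ p * pd ρ (fun x => ξ x μ) p = -pd 1 (fun x => ξ x μ) p := by
    rw [sum_four]
    simp
  rw [h2]
  have h3 : ∀ ρ, M.ginv ρ μ p = M.ginv μ ρ p := fun ρ => M.ginv_symm ρ μ p
  simp only [h3]
  ring

theorem lieInv_symm (hξ : ContDiffOn ℝ (⊤ : ℕ∞) ξ D.bulk) (hp : p ∈ D.bulk) (μ ν : Fin 4) :
    lieInv ξ M.g μ ν p = lieInv ξ M.g ν μ p := by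
  rw [lieInv_eq hξ hp, lieInv_eq hξ hp]
  refine Finset.sum_congr rfl fun ρ _ => ?_
  rw [show M.ginv μ ν = M.ginv ν μ from funext (M.ginv_symm μ ν), M.ginv_symm ρ ν p,
    M.ginv_symm ρ μ p]
  ring

/-- The gauge conditions amount to `∂_r ξ^μ = g^{μν} ∂_ν ξ^u`. -/
theorem gauge_iff (hξ : ContDiffOn ℝ (⊤ : ℕ∞) ξ D.bulk) (hp : p ∈ D.bulk) :
    (lieInv ξ M.g 0 0 p = 0 ∧ lieInv ξ M.g 0 1 p = 0 ∧
      ∀ A : Fin 2, lieInv ξ M.g 0 A.succ.succ p = 0) ↔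
    ∀ μ, pd 1 (fun x => ξ x μ) p = ∑ ν, M.ginv μ ν p * pd ν (fun x => ξ x 0) p := by
  rw [← NUMetric.forall_fin_four (P := fun μ => lieInv ξ M.g 0 μ p = 0)]
  simp only [lieInv_zero hξ hp, sub_eq_zero]

theorem lieInv_11 (hξ : ContDiffOn ℝ (⊤ : ℕ∞) ξ D.bulk) (hp : p ∈ D.bulk) :
    lieInv ξ M.g 1 1 p = -(ξ p 0 * pd 0 M.W p + ξ p 1 * pd 1 M.W p
        + ∑ A : Fin 2, ξ p A.succ.succ * pd A.succ.succ M.W p)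
      + 2 * (pd 0 (fun x => ξ x 1) p + M.W p * pd 1 (fun x => ξ x 1) p
        + ∑ A : Fin 2, M.V p A * pd A.succ.succ (fun x => ξ x 1) p) := by
  rw [lieInv_eq hξ hp, sum_four]
  simp only [NUMetric.ginv_11, NUMetric.ginv_01, NUMetric.ginv_10, NUMetric.ginv_1A,
    NUMetric.ginv_A1, pd_neg, Fin.sum_univ_two]
  ring

theorem lieInv_1A (hξ : ContDiffOn ℝ (⊤ : ℕ∞) ξ D.bulk) (hp : p ∈ D.bulk) (A : Fin 2) :
    lieInv ξ M.g 1 A.succ.succ p = -(ξ p 0 * pd 0 (fun x => M.V x A) p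
        + ξ p 1 * pd 1 (fun x => M.V x A) p
        + ∑ B : Fin 2, ξ p B.succ.succ * pd B.succ.succ (fun x => M.V x A) p)
      + (M.V p A * pd 1 (fun x => ξ x 1) p
        - ∑ B : Fin 2, M.hInv A B p * pd B.succ.succ (fun x => ξ x 1) p)
      + (pd 0 (fun x => ξ x A.succ.succ) p + M.W p * pd 1 (fun x => ξ x A.succ.succ) p
        + ∑ B : Fin 2, M.V p B * pd B.succ.succ (fun x => ξ x A.succ.succ) p) := by
  rw [lieInv_eq hξ hp, sum_four]
  simp only [NUMetric.ginv_11, NUMetric.ginv_10, NUMetric.ginv_1A, NUMetric.ginv_0A,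
    NUMetric.ginv_AB, pd_neg, Fin.sum_univ_two]
  rw [M.hInv_symm 0 A, M.hInv_symm 1 A]
  ring

theorem lieInv_AB (hξ : ContDiffOn ℝ (⊤ : ℕ∞) ξ D.bulk) (hp : p ∈ D.bulk) (A B : Fin 2) :
    lieInv ξ M.g A.succ.succ B.succ.succ p = (ξ p 0 * pd 0 (M.hInv A B) p
        + ξ p 1 * pd 1 (M.hInv A B) p
        + ∑ C : Fin 2, ξ p C.succ.succ * pd C.succ.succ (M.hInv A B) p)
      + (M.V p B * pd 1 (fun x => ξ x A.succ.succ) p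
        - ∑ C : Fin 2, M.hInv B C p * pd C.succ.succ (fun x => ξ x A.succ.succ) p)
      + (M.V p A * pd 1 (fun x => ξ x B.succ.succ) p
        - ∑ C : Fin 2, M.hInv A C p * pd C.succ.succ (fun x => ξ x B.succ.succ) p) := by
  rw [lieInv_eq hξ hp, sum_four]
  simp only [NUMetric.ginv_A1, NUMetric.ginv_1A, NUMetric.ginv_0A, NUMetric.ginv_A0,
    NUMetric.ginv_AB, Fin.sum_univ_two]
  rw [M.hInv_symm 0 B, M.hInv_symm 1 B]
  ring

/-- The divergence, with `½ ∂ log |g|` written as `½ (det h)⁻¹ ∂ (det h)`. -/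
theorem divergence_eq (hξ : ContDiffOn ℝ (⊤ : ℕ∞) ξ D.bulk) (hp : p ∈ D.bulk) :
    divergence M.g ξ p = ∑ ρ, (pd ρ (fun x => ξ x ρ) p
      + 1 / 2 * (M.dh p)⁻¹ * pd ρ M.dh p * ξ p ρ) := by
  have h0 := M.dh_pos hp
  have hsq : 0 < Real.sqrt (M.dh p) := Real.sqrt_pos.2 h0
  have e : ∀ x ∈ D.bulk, Real.sqrt |(M.g x).det| = Real.sqrt (M.dh x) := fun x hx => by
    rw [M.det_g hx, abs_neg, abs_of_pos (M.dh_pos hx)]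
  rw [divergence, e p hp, Finset.mul_sum]
  refine Finset.sum_congr rfl fun ρ _ => ?_
  rw [pd_congr D.isOpen_bulk ρ (F := fun x => Real.sqrt |(M.g x).det| * ξ x ρ)
    (G := fun x => Real.sqrt (M.dh x) * ξ x ρ) (fun x hx => by rw [e x hx]) hp]
  have d1 := smooth_diff D.isOpen_bulk M.smooth_dh hp
  have d2 := smooth_diff D.isOpen_bulk (smooth_comp hξ ρ) hp
  have d3 : DifferentiableAt ℝ (fun x => Real.sqrt (M.dh x)) p := d1.sqrt h0.ne'
  rw [pd_mul ρ d3 d2, pd_comp_deriv ρ (Real.hasDerivAt_sqrt h0.ne') d1]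
  have h1 : M.dh p = Real.sqrt (M.dh p) * Real.sqrt (M.dh p) := (Real.mul_self_sqrt h0.le).symm
  have h2 : (M.dh p)⁻¹ = (Real.sqrt (M.dh p))⁻¹ * (Real.sqrt (M.dh p))⁻¹ := by
    rw [← mul_inv, ← h1]
  rw [h2]
  field_simp
  ring

end lie

end NewmanUnti

namespace NewmanUnti

/-! ## Asymptotic expansion of the metric -/

theorem pd_zero_scri {a : ScriPt → ℝ} {p : Pt} (ha : DifferentiableAt ℝ a (toScri p)) :
    pd 0 (fun x => a (toScri x)) p = pd 0 a (toScri p) := pd_comp_toScri 0 ha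

theorem pd_ang_scri {a : ScriPt → ℝ} {p : Pt} (A : Fin 2) (ha : DifferentiableAt ℝ a (toScri p)) :
    pd A.succ.succ (fun x => a (toScri x)) p = pd A.succ a (toScri p) := by
  rw [← pd_comp_toScri A.succ ha, up_succ]

theorem smooth_lap {D : Region} {φ F : ScriPt → ℝ} (hφ : ContDiffOn ℝ (⊤ : ℕ∞) φ D.scri)
    (hF : ContDiffOn ℝ (⊤ : ℕ∞) F D.scri) : ContDiffOn ℝ (⊤ : ℕ∞) (lap φ F) D.scri :=
  (contDiffOn_const.mul hφ).exp.mul (ContDiffOn.sum fun _ _ =>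
    smooth_pd D.isOpen_scri _ (smooth_pd D.isOpen_scri _ hF))

theorem succ_succ_ne_one : ∀ A : Fin 2, A.succ.succ ≠ 1 := by decide

theorem Asym.pd_zero {D : Region} {b : Bool} {n : ℤ} {F : Pt → ℝ} (h : Asym D b n F) :
    Asym D b n (NewmanUnti.pd 0 F) := h.pd_ne (by decide)

theorem Asym.pd_ang {D : Region} {b : Bool} {n : ℤ} {F : Pt → ℝ} (h : Asym D b n F) (A : Fin 2) :
    Asym D b n (NewmanUnti.pd A.succ.succ F) := h.pd_ne (succ_succ_ne_one A)

namespace NUMetric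
variable {D : Region} (M : NUMetric D) {p : Pt}

theorem asym_V (A : Fin 2) : Asym D false (-2) fun p => M.V p A :=
  ⟨M.smooth_V' A, bigO_iff.1 (M.falloff_V A)⟩

/-- The conformal factor `e^{-2φ}` of the inverse metric on Scri. -/
noncomputable def m (q : ScriPt) : ℝ := Real.exp (-2 * M.φ q)

theorem smooth_m : ContDiffOn ℝ (⊤ : ℕ∞) M.m D.scri := (contDiffOn_const.mul M.smooth_φ).exp

theorem pd_m {q : ScriPt} (hq : q ∈ D.scri) (i : Fin 3) :
    pd i M.m q = -2 * pd i M.φ q * M.m q := by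
  have d := smooth_diff D.isOpen_scri M.smooth_φ hq
  have : M.m = fun q => Real.exp (-2 * M.φ q) := rfl
  rw [this, pd_exp i (d.const_mul _), pd_const_mul i _ d]
  ring

/-- The remainder in the expansion of `W`. -/
noncomputable def wRem (p : Pt) : ℝ :=
  M.W p - (-2 * p 1 * pd 0 M.φ (toScri p) + lap M.φ M.φ (toScri p))

theorem smooth_pdφ (i : Fin 3) : ContDiffOn ℝ (⊤ : ℕ∞) (pd i M.φ) D.scri :=
  smooth_pd D.isOpen_scri i M.smooth_φ

theorem smooth_K : ContDiffOn ℝ (⊤ : ℕ∞) (lap M.φ M.φ) D.scri := smooth_lap M.smooth_φ M.smooth_φ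

theorem asym_w : Asym D false (-1) M.wRem := by
  refine ⟨M.smooth_W.sub (ContDiffOn.add ?_ ?_), bigO_iff.1 M.falloff_W⟩
  · exact (contDiffOn_const.mul (contDiff_apply ℝ ℝ (1 : Fin 4)).contDiffOn).mul
      (Asym.comp_toScri (M.smooth_pdφ 0)).1
  · exact (Asym.comp_toScri M.smooth_K).1

theorem W_eq (p : Pt) :
    M.W p = -2 * p 1 * pd 0 M.φ (toScri p) + lap M.φ M.φ (toScri p) + M.wRem p := by
  simp [wRem]

theorem diff_φ {q : ScriPt} (hq : q ∈ D.scri) (i : Fin 3) : DifferentiableAt ℝ (pd i M.φ) q :=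
  smooth_diff D.isOpen_scri (M.smooth_pdφ i) hq

theorem pd_W (hp : p ∈ D.bulk) (i : Fin 4) :
    pd i M.W p = -2 * (pd i (fun x => x 1) p * pd 0 M.φ (toScri p)
      + p 1 * pd i (fun x => pd 0 M.φ (toScri x)) p)
      + pd i (fun x => lap M.φ M.φ (toScri x)) p + pd i M.wRem p := by
  have e : M.W = fun p => -2 * (p 1 * pd 0 M.φ (toScri p)) + lap M.φ M.φ (toScri p) + M.wRem p := by
    funext p; rw [M.W_eq p]; ring
  have d1 := (Asym.comp_toScri (M.smooth_pdφ 0)).diff hp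
  have d2 := (Asym.comp_toScri M.smooth_K).diff hp
  have d3 := M.asym_w.diff hp
  have d4 : DifferentiableAt ℝ (fun x : Pt => x 1) p := differentiableAt_apply 1 p
  have d5 := d4.fun_mul d1
  rw [e, pd_add i ((d5.const_mul _).fun_add d2) d3, pd_add i (d5.const_mul _) d2,
    pd_const_mul i _ d5, pd_mul i d4 d1]

/-- The remainder of order `o(r)` in the expansion of the angular metric. -/
noncomputable def sRem (A B : Fin 2) (p : Pt) : ℝ :=
  M.h p A B - (p 1 ^ 2 * (if A = B then Real.exp (2 * M.φ (toScri p)) else 0)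
      + p 1 * M.C (toScri p) A B)

theorem smooth_exp : ContDiffOn ℝ (⊤ : ℕ∞) (fun q => Real.exp (2 * M.φ q)) D.scri :=
  (contDiffOn_const.mul M.smooth_φ).exp

theorem asym_delta (A B : Fin 2) : Asym D false 2 fun p =>
    p 1 ^ 2 * (if A = B then Real.exp (2 * M.φ (toScri p)) else 0) := by
  by_cases h : A = B
  · simp only [h, if_true, sq]
    exact (Asym.radius.mul Asym.radius).mul (Asym.comp_toScri M.smooth_exp)
  · simp only [h, if_false, mul_zero]
    exact Asym.zero

theorem asym_C (A B : Fin 2) : Asym D false 1 fun p => p 1 * M.C (toScri p) A B :=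
  Asym.radius.mulO (Asym.comp_toScri (M.smooth_C A B))

theorem asym_s (A B : Fin 2) : Asym D true 1 (M.sRem A B) :=
  ⟨(M.smooth_h A B).sub ((M.asym_delta A B).1.add (M.asym_C A B).1),
    smallO_iff.1 (M.falloff_h A B)⟩

theorem h_eq (A B : Fin 2) (p : Pt) :
    M.h p A B = p 1 ^ 2 * (if A = B then Real.exp (2 * M.φ (toScri p)) else 0)
      + p 1 * M.C (toScri p) A B + M.sRem A B p := by
  simp [sRem]

theorem asym_h (A B : Fin 2) : Asym D false 2 fun p => M.h p A B :=
  (((M.asym_delta A B).add ((M.asym_C A B).of_lt (by norm_num))).add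
    ((M.asym_s A B).of_lt (by norm_num))).congr fun p _ => M.h_eq A B p

/-- The remainder of order `O(r)` in the expansion of the angular metric. -/
theorem asym_hRem (A B : Fin 2) : Asym D false 1 fun p => M.h p A B
    - p 1 ^ 2 * (if A = B then Real.exp (2 * M.φ (toScri p)) else 0) :=
  ((M.asym_C A B).add (M.asym_s A B).isBigO).congr fun p _ => by rw [M.h_eq A B p]; ring

theorem asym_h01 : Asym D false 1 fun p => M.h p 0 1 :=
  (M.asym_hRem 0 1).congr fun p _ => by simp

/-- The remainder in the expansion of the determinant of the angular metric. -/
noncomputable def dRem (p : Pt) : ℝ := M.dh p - p 1 ^ 4 * Real.exp (2 * M.φ (toScri p)) ^ 2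

/-- The r³ term of det h is e^{2φ} times the trace of C, which vanishes; products of two C-terms and
of off-diagonal entries are only O(r²). This is what keeps a logarithmic derivative of the
determinant from contributing to the r⁻² term of the divergence condition. -/
theorem asym_d : Asym D true 3 M.dRem := by
  have h1 : Asym D true 3 fun p => M.sRem 0 0 p * M.h p 1 1 :=
    (M.asym_s 0 0).mul (M.asym_h 1 1)
  have h2 : Asym D true 3 fun p => (p 1 ^ 2 * (if (0 : Fin 2) = 0 then
      Real.exp (2 * M.φ (toScri p)) else 0) + p 1 * M.C (toScri p) 0 0) * M.sRem 1 1 p :=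
    ((M.asym_delta 0 0).add ((M.asym_C 0 0).of_lt (by norm_num))).mulO (M.asym_s 1 1)
  have h3 : Asym D true 3 fun p => (p 1 * M.C (toScri p) 0 0) * (p 1 * M.C (toScri p) 1 1) :=
    ((M.asym_C 0 0).mul (M.asym_C 1 1)).of_lt (by norm_num)
  have h4 : Asym D true 3 fun p => M.h p 0 1 * M.h p 0 1 :=
    (M.asym_h01.mul M.asym_h01).of_lt (by norm_num)
  refine (((h1.add h2).add h3).sub h4).congr fun p hp => ?_
  have ht := M.trace_C _ hp.1
  rw [Matrix.trace_fin_two] at ht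
  have e0 := M.h_eq 0 0 p
  have e1 := M.h_eq 1 1 p
  simp only [if_true] at e0 e1 ⊢
  rw [dRem, dh, e0, e1]
  linear_combination (p 1 ^ 3 * Real.exp (2 * M.φ (toScri p))) * ht

theorem asym_dh : Asym D false 4 M.dh := by
  have h1 : Asym D false 4 fun p => p 1 ^ 4 * Real.exp (2 * M.φ (toScri p)) ^ 2 :=
    ((M.asym_delta 0 0).mulO (M.asym_delta 0 0)).congr fun p _ => by simp; ring
  exact (h1.add (M.asym_d.of_lt (by norm_num))).congr fun p _ => by simp [dRem]

/-- The lower bound on det h comes from its leading term: e^{-4φ} is locally bounded, so r⁴ = O(r⁴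
e^{4φ}), and the remainder is o of this term. -/
theorem asym_dh_inv : Asym D false (-4) fun p => (M.dh p)⁻¹ := by
  refine M.asym_dh.inv (fun p hp => (M.dh_pos hp).ne') fun q hq => ?_
  have c : ContDiffOn ℝ (⊤ : ℕ∞) (fun q => (Real.exp (2 * M.φ q) ^ 2)⁻¹) D.scri :=
    ContDiffOn.inv (M.smooth_exp.pow 2) fun q _ => by positivity
  have h1 : (fun p : Pt => p 1 ^ (4 : ℤ)) =O[nearScri q]
      fun p => p 1 ^ 4 * Real.exp (2 * M.φ (toScri p)) ^ 2 := by
    have h2 := (((Asym.comp_toScri c).2 0) q hq).isBigO.mul (Asymptotics.isBigO_refl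
      (fun p : Pt => p 1 ^ 4 * Real.exp (2 * M.φ (toScri p)) ^ 2) (nearScri q))
    refine h2.congr (fun p => ?_) fun p => by simp
    have : Real.exp (2 * M.φ (toScri p)) ≠ 0 := (Real.exp_pos _).ne'
    field_simp
  have h3 : M.dRem =o[nearScri q] fun p : Pt => p 1 ^ (4 : ℤ) :=
    (((M.asym_d).of_lt (c := true) (n := 4) (by norm_num)).2 0) q hq
  have h4 := (h3.trans_isBigO h1).right_isBigO_add
  refine h1.trans (h4.congr_right fun p => ?_)
  simp [dRem]

theorem asym_hInv (A B : Fin 2) : Asym D false (-2) (M.hInv A B) := by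
  have h := M.asym_dh_inv
  fin_cases A <;> fin_cases B
  · exact (M.asym_h 1 1).mulO h
  · exact (M.asym_h01.neg).mulO h
  · exact (M.asym_h01.neg).mulO h
  · exact (M.asym_h 0 0).mulO h

/-- The remainder in the expansion of the inverse angular metric. -/
noncomputable def eRem (A B : Fin 2) (p : Pt) : ℝ :=
  M.hInv A B p - (p 1)⁻¹ ^ 2 * (if A = B then M.m (toScri p) else 0)

theorem hInv_eq (A B : Fin 2) (p : Pt) :
    M.hInv A B p = (p 1)⁻¹ ^ 2 * (if A = B then M.m (toScri p) else 0) + M.eRem A B p := by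
  simp [eRem]

theorem m_mul_exp (q : ScriPt) : M.m q * Real.exp (2 * M.φ q) = 1 := by
  rw [m, ← Real.exp_add]
  simp

theorem asym_r2 : Asym D.pos false (-2) fun p => (p 1)⁻¹ ^ 2 :=
  (Asym.radius_inv.mulO Asym.radius_inv).congr fun p _ => sq _

theorem asym_e (A B : Fin 2) : Asym D.pos false (-3) (M.eRem A B) := by
  have hd := M.asym_dh_inv.mono_pos
  have diag : ∀ (A A' : Fin 2), (∀ p, M.hInv A A p = M.h p A' A' * (M.dh p)⁻¹) →
      Asym D.pos false (-3) (M.eRem A A) := by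
    intro A A' he
    -- The numerator of the remainder over det h is h - r⁻² m det h. Because m e^{2φ} = 1, the two
    -- r² terms cancel and only the remainders of h and of det h are left.
    have h1 : Asym D.pos false 1 fun p => (M.h p A' A'
        - p 1 ^ 2 * (if A' = A' then Real.exp (2 * M.φ (toScri p)) else 0))
        - (p 1)⁻¹ ^ 2 * (M.m (toScri p) * M.dRem p) :=
      (M.asym_hRem A' A').mono_pos.sub
        ((asym_r2 (D := D)).mul
          (Asym.scri_mul (D := D.pos) M.smooth_m M.asym_d.mono_pos)).isBigO
    refine (h1.mulO hd).congr fun p hp => ?_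
    have hr : p 1 ≠ 0 := by have := Region.one_lt_of_mem_pos hp; linarith
    have h0 := M.dh_pos (Region.bulk_pos_subset hp)
    have hm := M.m_mul_exp (toScri p)
    rw [eRem, he, dRem]
    simp only [if_true]
    field_simp
    linear_combination (-p 1 ^ 4 * Real.exp (2 * M.φ (toScri p))) * hm
  fin_cases A <;> fin_cases B
  · exact diag 0 1 fun p => by simp [hInv]
  · exact (M.asym_h01.neg.mono_pos.mulO hd).congr fun p _ => by simp [eRem, hInv]
  · exact (M.asym_h01.neg.mono_pos.mulO hd).congr fun p _ => by simp [eRem, hInv]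
  · exact diag 1 0 fun p => by simp [hInv]

/-- `½ ∂_i log |g| = 2 ∂_i φ + o(r⁻¹)` for the coordinates on Scri. -/
theorem asym_log_scri (i : Fin 3) : Asym D.pos true (-1) fun p =>
    1 / 2 * (M.dh p)⁻¹ * pd (up i) M.dh p - 2 * pd i M.φ (toScri p) := by
  have hd := M.asym_dh_inv.mono_pos
  have hε := M.asym_d.mono_pos
  have hi : up i ≠ 1 := by fin_cases i <;> decide
  -- Multiplied by 2 det h, the expression loses its r⁴ terms exactly; what remains involves `dRem`
  -- and its derivative only.
  have h1 : Asym D.pos true 3 fun p => pd (up i) M.dRem p - 4 * (pd i M.φ (toScri p) * M.dRem p) :=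
    (hε.pd_ne hi).sub ((Asym.scri_mul (D := D.pos) (M.smooth_pdφ i) hε).const_mul 4)
  refine ((hd.mulO h1 (l := -1)).const_mul (1 / 2)).congr fun p hp => ?_
  have hb := Region.bulk_pos_subset hp
  have h0 := M.dh_pos hb
  have d2 : DifferentiableAt ℝ (fun q => Real.exp (2 * M.φ q)) (toScri p) :=
    smooth_diff D.isOpen_scri M.smooth_exp hp.1
  have d3 : DifferentiableAt ℝ (fun x => Real.exp (2 * M.φ (toScri x))) p :=
    (Asym.comp_toScri M.smooth_exp).diff hb
  have d1 : DifferentiableAt ℝ (fun x : Pt => x 1 ^ 4) p := (differentiableAt_apply 1 p).fun_pow 4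
  have e : M.dh = fun x => x 1 ^ 4 * Real.exp (2 * M.φ (toScri x)) ^ 2 + M.dRem x := by
    funext x; simp [dRem]
  have e1 : pd (up i) M.dh p = p 1 ^ 4 * (4 * pd i M.φ (toScri p)
      * Real.exp (2 * M.φ (toScri p)) ^ 2) + pd (up i) M.dRem p := by
    have dφ := smooth_diff D.isOpen_scri M.smooth_φ hp.1
    have c1 : pd (up i) (fun x : Pt => x 1 ^ 4) p = 0 := by
      rw [pd_comp_deriv (φ := fun t => t ^ 4) _ (hasDerivAt_pow 4 _) (differentiableAt_apply 1 p),
        pd_coord, if_neg (Ne.symm hi), mul_zero]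
    have c2 : pd (up i) (fun x => Real.exp (2 * M.φ (toScri x))) p
        = Real.exp (2 * M.φ (toScri p)) * (2 * pd i M.φ (toScri p)) := by
      rw [pd_comp_toScri (a := fun q => Real.exp (2 * M.φ q)) i d2, pd_exp i (dφ.const_mul _),
        pd_const_mul i _ dφ]
    have c3 := pd_comp_deriv (φ := fun t => t ^ 2) (up i)
      (hasDerivAt_pow 2 (Real.exp (2 * M.φ (toScri p)))) d3
    rw [c2] at c3
    rw [e, pd_add (up i) (d1.fun_mul (d3.fun_pow 2)) (M.asym_d.diff hb),
      pd_mul (up i) d1 (d3.fun_pow 2), c1, c3]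
    push_cast
    ring
  rw [e1]
  have e2 : M.dRem p = M.dh p - p 1 ^ 4 * Real.exp (2 * M.φ (toScri p)) ^ 2 := rfl
  rw [e2]
  field_simp
  ring

/-- `½ ∂_r log |g| = 2 r⁻¹ + o(r⁻²)`. -/
theorem asym_log_one : Asym D.pos true (-2) fun p =>
    1 / 2 * (M.dh p)⁻¹ * pd 1 M.dh p - 2 * (p 1)⁻¹ := by
  have hd := M.asym_dh_inv.mono_pos
  have hε := M.asym_d.mono_pos
  -- Again the r⁴ e^{4φ} part drops out after multiplication by 2 det h, and both remaining terms
  -- are o(r²).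
  have h1 : Asym D.pos true 2 fun p => pd 1 M.dRem p - 4 * ((p 1)⁻¹ * M.dRem p) :=
    hε.pd_one.sub ((Asym.radius_inv.mulO hε).const_mul 4)
  refine ((hd.mulO h1 (l := -2)).const_mul (1 / 2)).congr fun p hp => ?_
  have hb := Region.bulk_pos_subset hp
  have h0 := M.dh_pos hb
  have hr : p 1 ≠ 0 := by have := Region.one_lt_of_mem_pos hp; linarith
  have sE : ContDiffOn ℝ (⊤ : ℕ∞) (fun q => Real.exp (2 * M.φ q) ^ 2) D.scri := M.smooth_exp.pow 2
  have d3 := (Asym.comp_toScri sE).diff hb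
  have d1 : DifferentiableAt ℝ (fun x : Pt => x 1 ^ 4) p := (differentiableAt_apply 1 p).fun_pow 4
  have e : M.dh = fun x => x 1 ^ 4 * Real.exp (2 * M.φ (toScri x)) ^ 2 + M.dRem x := by
    funext x; simp [dRem]
  have e1 : pd 1 M.dh p = 4 * p 1 ^ 3 * Real.exp (2 * M.φ (toScri p)) ^ 2 + pd 1 M.dRem p := by
    rw [e, pd_add 1 (d1.fun_mul d3) (M.asym_d.diff hb), pd_mul 1 d1 d3,
      pd_comp_deriv (φ := fun t => t ^ 4) _ (hasDerivAt_pow 4 _) (differentiableAt_apply 1 p),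
      pd_coord, pd_one_comp_toScri (a := fun q => Real.exp (2 * M.φ q) ^ 2)
        (smooth_diff D.isOpen_scri sE hp.1)]
    simp
  rw [e1]
  have e2 : M.dRem p = M.dh p - p 1 ^ 4 * Real.exp (2 * M.φ (toScri p)) ^ 2 := rfl
  rw [e2]
  field_simp
  ring

/-! ### Integrals of the metric functions along rays -/

theorem asym_tailV (A : Fin 2) : Asym D false (-1) (tail fun p => M.V p A) :=
  (M.asym_V A).tail le_rfl

theorem asym_tailE (A B : Fin 2) : Asym D false (-1) (tail (M.hInv A B)) :=
  (M.asym_hInv A B).tail le_rfl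

/-- The remainder in the expansion of `∫_r^∞ g^{AB} dr'`. -/
noncomputable def tRem (A B : Fin 2) : Pt → ℝ := tail (M.eRem A B)

theorem asym_t (A B : Fin 2) : Asym D.pos false (-2) (M.tRem A B) :=
  (M.asym_e A B).tail (by norm_num)

theorem tailE_eq (A B : Fin 2) (hp : p ∈ D.pos.bulk) :
    tail (M.hInv A B) p = (p 1)⁻¹ * (if A = B then M.m (toScri p) else 0) + M.tRem A B p := by
  have h0 : 0 < p 1 := by have := Region.one_lt_of_mem_pos hp; linarith
  have c : ContDiffOn ℝ (⊤ : ℕ∞) (fun q => if A = B then M.m q else 0) D.scri := by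
    by_cases h : A = B
    · simpa [h] using M.smooth_m
    · simpa [h] using contDiffOn_const
  have h1 : Asym D.pos false (-2) fun p => (p 1)⁻¹ ^ 2 * (if A = B then M.m (toScri p) else 0) :=
    (asym_r2 (D := D)).mulO (Asym.comp_toScri (D := D.pos) c)
  rw [tail_congr (D := D.pos) (fun p _ => M.hInv_eq A B p) hp,
    tail_add h1 le_rfl (M.asym_e A B) (by norm_num) hp,
    tail_inv_sq (fun q => if A = B then M.m q else 0) h0]
  rfl

end NUMetric

end NewmanUnti

namespace NewmanUnti

/-! ## Vector fields in Newman–Unti gauge -/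

namespace NUMetric
variable {D : Region} (M : NUMetric D)

/-- `∂_A f ∫_r^∞ V^A dr'`. -/
noncomputable def rho (f : ScriPt → ℝ) (p : Pt) : ℝ :=
  ∑ A : Fin 2, pd A.succ f (toScri p) * tail (fun x => M.V x A) p

/-- `∂_B f ∫_r^∞ g^{AB} dr'`. -/
noncomputable def sigma (f : ScriPt → ℝ) (A : Fin 2) (p : Pt) : ℝ :=
  ∑ B : Fin 2, pd B.succ f (toScri p) * tail (M.hInv A B) p

/-- The remainder in the expansion of `∂_B f ∫_r^∞ g^{AB} dr'`. -/
noncomputable def tau (f : ScriPt → ℝ) (A : Fin 2) (p : Pt) : ℝ :=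
  ∑ B : Fin 2, pd B.succ f (toScri p) * M.tRem A B p

/-- The general vector field in Newman–Unti gauge. -/
noncomputable def gen (f Z : ScriPt → ℝ) (Y : Fin 2 → ScriPt → ℝ) : VField := fun p =>
  Matrix.vecCons (f (toScri p)) <|
  Matrix.vecCons (-p 1 * pd 0 f (toScri p) + Z (toScri p) + M.rho f p) <|
  fun A : Fin 2 => Y A (toScri p) - M.sigma f A p

theorem gen_zero (f Z : ScriPt → ℝ) (Y : Fin 2 → ScriPt → ℝ) (p : Pt) :
    M.gen f Z Y p 0 = f (toScri p) := rfl

theorem gen_one (f Z : ScriPt → ℝ) (Y : Fin 2 → ScriPt → ℝ) (p : Pt) :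
    M.gen f Z Y p 1 = -p 1 * pd 0 f (toScri p) + Z (toScri p) + M.rho f p := rfl

theorem gen_ang (f Z : ScriPt → ℝ) (Y : Fin 2 → ScriPt → ℝ) (p : Pt) (A : Fin 2) :
    M.gen f Z Y p A.succ.succ = Y A (toScri p) - M.sigma f A p := rfl

end NUMetric

/-! ### Derivatives and orders of the general gauge field -/

section gen
variable {D : Region} {M : NUMetric D} {f Z : ScriPt → ℝ} {Y : Fin 2 → ScriPt → ℝ} {p : Pt}
  (hf : ContDiffOn ℝ (⊤ : ℕ∞) f D.scri) (hZ : ContDiffOn ℝ (⊤ : ℕ∞) Z D.scri)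
  (hY : ∀ A, ContDiffOn ℝ (⊤ : ℕ∞) (Y A) D.scri)

include hf

theorem smooth_pdf (i : Fin 3) : ContDiffOn ℝ (⊤ : ℕ∞) (pd i f) D.scri :=
  smooth_pd D.isOpen_scri i hf

theorem diff_pdf (i : Fin 3) {q : ScriPt} (hq : q ∈ D.scri) : DifferentiableAt ℝ (pd i f) q :=
  smooth_diff D.isOpen_scri (smooth_pdf hf i) hq

theorem asym_rho : Asym D false (-1) (M.rho f) :=
  Asym.sum _ fun A _ => Asym.scri_mul (smooth_pdf hf _) (M.asym_tailV A)

theorem asym_sigma (A : Fin 2) : Asym D false (-1) (M.sigma f A) :=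
  Asym.sum _ fun B _ => Asym.scri_mul (smooth_pdf hf _) (M.asym_tailE A B)

theorem asym_tau (A : Fin 2) : Asym D.pos false (-2) (M.tau f A) :=
  Asym.sum _ fun B _ => Asym.scri_mul (D := D.pos) (smooth_pdf hf _) (M.asym_t A B)

theorem pd_one_rho (hp : p ∈ D.bulk) :
    pd 1 (M.rho f) p = -∑ A : Fin 2, pd A.succ f (toScri p) * M.V p A := by
  have e : M.rho f = fun p => ∑ A : Fin 2, pd A.succ f (toScri p) * tail (fun x => M.V x A) p := rfl
  have d1 : ∀ A : Fin 2, DifferentiableAt ℝ (fun x => pd A.succ f (toScri x)) p := fun A =>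
    (Asym.comp_toScri (smooth_pdf hf A.succ)).diff hp
  rw [e, pd_sum _ _ fun A _ => (d1 A).fun_mul ((M.asym_tailV A).diff hp), ← Finset.sum_neg_distrib]
  refine Finset.sum_congr rfl fun A _ => ?_
  rw [pd_mul 1 (d1 A) ((M.asym_tailV A).diff hp), pd_one_comp_toScri (diff_pdf hf _ hp.1),
    pd_one_tail (M.asym_V A) le_rfl hp]
  ring

theorem pd_one_sigma (hp : p ∈ D.bulk) (A : Fin 2) :
    pd 1 (M.sigma f A) p = -∑ B : Fin 2, pd B.succ f (toScri p) * M.hInv A B p := by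
  have e : M.sigma f A = fun p => ∑ B : Fin 2, pd B.succ f (toScri p) * tail (M.hInv A B) p := rfl
  have d1 : ∀ A : Fin 2, DifferentiableAt ℝ (fun x => pd A.succ f (toScri x)) p := fun A =>
    (Asym.comp_toScri (smooth_pdf hf A.succ)).diff hp
  rw [e, pd_sum _ _ fun B _ => (d1 B).fun_mul ((M.asym_tailE A B).diff hp),
    ← Finset.sum_neg_distrib]
  refine Finset.sum_congr rfl fun B _ => ?_
  rw [pd_mul 1 (d1 B) ((M.asym_tailE A B).diff hp), pd_one_comp_toScri (diff_pdf hf _ hp.1),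
    pd_one_tail (M.asym_hInv A B) le_rfl hp]
  ring

omit hf in
theorem sigma_eq (f : ScriPt → ℝ) (hp : p ∈ D.pos.bulk) (A : Fin 2) :
    M.sigma f A p = (p 1)⁻¹ * (M.m (toScri p) * pd A.succ f (toScri p)) + M.tau f A p := by
  simp only [NUMetric.sigma, NUMetric.tau, M.tailE_eq _ _ hp, mul_add, Finset.sum_add_distrib]
  congr 1
  fin_cases A <;> simp <;> ring

theorem pd_scri_sigma (hp : p ∈ D.pos.bulk) (A : Fin 2) (i : Fin 3) :
    pd (up i) (M.sigma f A) p = (p 1)⁻¹ * (-2 * pd i M.φ (toScri p) * M.m (toScri p)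
      * pd A.succ f (toScri p) + M.m (toScri p) * pd i (pd A.succ f) (toScri p))
      + pd (up i) (M.tau f A) p := by
  have hi : up i ≠ 1 := by fin_cases i <;> decide
  have hr : p 1 ≠ 0 := by have := Region.one_lt_of_mem_pos hp; linarith
  have s1 : ContDiffOn ℝ (⊤ : ℕ∞) (fun q => M.m q * pd A.succ f q) D.scri :=
    M.smooth_m.mul (smooth_pdf hf A.succ)
  have d1 := (Asym.comp_toScri s1).diff (Region.bulk_pos_subset hp)
  have d2 := (Asym.radius_inv (D := D)).diff hp
  rw [pd_congr D.pos.isOpen_bulk (up i) (fun x hx => sigma_eq f hx A) hp,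
    pd_add _ (d2.fun_mul d1) ((asym_tau hf A).diff hp), pd_mul _ d2 d1,
    pd_inv _ (differentiableAt_apply 1 p) hr, pd_coord, if_neg (Ne.symm hi),
    pd_comp_toScri (a := fun q => M.m q * pd A.succ f q) i (smooth_diff D.isOpen_scri s1 hp.1),
    pd_mul i (smooth_diff D.isOpen_scri M.smooth_m hp.1) (diff_pdf hf _ hp.1), M.pd_m hp.1]
  ring

theorem pd_zero_sigma (hp : p ∈ D.pos.bulk) (A : Fin 2) :
    pd 0 (M.sigma f A) p = (p 1)⁻¹ * (-2 * pd 0 M.φ (toScri p) * M.m (toScri p)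
      * pd A.succ f (toScri p) + M.m (toScri p) * pd 0 (pd A.succ f) (toScri p))
      + pd 0 (M.tau f A) p := pd_scri_sigma hf hp A 0

theorem pd_ang_sigma (hp : p ∈ D.pos.bulk) (A B : Fin 2) :
    pd B.succ.succ (M.sigma f A) p = (p 1)⁻¹ * (-2 * pd B.succ M.φ (toScri p) * M.m (toScri p)
      * pd A.succ f (toScri p) + M.m (toScri p) * pd B.succ (pd A.succ f) (toScri p))
      + pd B.succ.succ (M.tau f A) p := by
  rw [← up_succ]
  exact pd_scri_sigma hf hp A B.succ

include hZ in
theorem smooth_gen_one : ContDiffOn ℝ (⊤ : ℕ∞) (fun p => M.gen f Z Y p 1) D.bulk :=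
  (((Asym.radius (D := D)).1.neg.mul (Asym.comp_toScri (smooth_pdf hf 0)).1).add
    (Asym.comp_toScri hZ).1).add (asym_rho hf).1

include hY in
theorem smooth_gen_ang (A : Fin 2) :
    ContDiffOn ℝ (⊤ : ℕ∞) (fun p => M.gen f Z Y p A.succ.succ) D.bulk :=
  (Asym.comp_toScri (hY A)).1.sub (asym_sigma hf A).1

include hZ hY in
theorem smooth_gen : ContDiffOn ℝ (⊤ : ℕ∞) (M.gen f Z Y) D.bulk := by
  rw [contDiffOn_pi, NUMetric.forall_fin_four]
  exact ⟨(Asym.comp_toScri hf).1, smooth_gen_one hf hZ, smooth_gen_ang hf hY⟩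

theorem pd_zero_gen_zero (hp : p ∈ D.bulk) :
    pd 0 (fun x => M.gen f Z Y x 0) p = pd 0 f (toScri p) :=
  pd_zero_scri (smooth_diff D.isOpen_scri hf hp.1)

theorem pd_one_gen_zero (hp : p ∈ D.bulk) : pd 1 (fun x => M.gen f Z Y x 0) p = 0 :=
  pd_one_comp_toScri (smooth_diff D.isOpen_scri hf hp.1)

theorem pd_ang_gen_zero (hp : p ∈ D.bulk) (A : Fin 2) :
    pd A.succ.succ (fun x => M.gen f Z Y x 0) p = pd A.succ f (toScri p) :=
  pd_ang_scri A (smooth_diff D.isOpen_scri hf hp.1)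

include hZ in
theorem pd_gen_one (hp : p ∈ D.bulk) (i : Fin 4) : pd i (fun x => M.gen f Z Y x 1) p
    = -(pd i (fun x => x 1) p * pd 0 f (toScri p) + p 1 * pd i (fun x => pd 0 f (toScri x)) p)
      + pd i (fun x => Z (toScri x)) p + pd i (M.rho f) p := by
  have d1 := (Asym.comp_toScri (smooth_pdf hf 0)).diff hp
  have d2 := (Asym.comp_toScri hZ).diff hp
  have d3 := (asym_rho (M := M) hf).diff hp
  have d4 : DifferentiableAt ℝ (fun x : Pt => x 1) p := differentiableAt_apply 1 p
  have d5 : DifferentiableAt ℝ (fun x : Pt => -x 1) p := d4.fun_neg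
  simp only [NUMetric.gen_one]
  rw [pd_add i ((d5.fun_mul d1).fun_add d2) d3, pd_add i (d5.fun_mul d1) d2, pd_mul i d5 d1,
    pd_neg]
  ring

include hZ in
theorem pd_zero_gen_one (hp : p ∈ D.bulk) : pd 0 (fun x => M.gen f Z Y x 1) p
    = -p 1 * pd 0 (pd 0 f) (toScri p) + pd 0 Z (toScri p) + pd 0 (M.rho f) p := by
  rw [pd_gen_one hf hZ hp, pd_coord, pd_zero_scri (diff_pdf hf 0 hp.1),
    pd_zero_scri (smooth_diff D.isOpen_scri hZ hp.1)]
  simp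

include hZ in
theorem pd_one_gen_one (hp : p ∈ D.bulk) : pd 1 (fun x => M.gen f Z Y x 1) p
    = -pd 0 f (toScri p) + pd 1 (M.rho f) p := by
  rw [pd_gen_one hf hZ hp, pd_coord, pd_one_comp_toScri (diff_pdf hf 0 hp.1),
    pd_one_comp_toScri (smooth_diff D.isOpen_scri hZ hp.1)]
  simp

include hZ in
theorem pd_ang_gen_one (hp : p ∈ D.bulk) (A : Fin 2) :
    pd A.succ.succ (fun x => M.gen f Z Y x 1) p
    = -p 1 * pd A.succ (pd 0 f) (toScri p) + pd A.succ Z (toScri p)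
      + pd A.succ.succ (M.rho f) p := by
  rw [pd_gen_one hf hZ hp, pd_coord, if_neg (succ_succ_ne_one A).symm,
    pd_ang_scri A (diff_pdf hf 0 hp.1), pd_ang_scri A (smooth_diff D.isOpen_scri hZ hp.1)]
  ring

include hY in
theorem pd_gen_ang (hp : p ∈ D.bulk) (A : Fin 2) (i : Fin 4) :
    pd i (fun x => M.gen f Z Y x A.succ.succ) p
      = pd i (fun x => Y A (toScri x)) p - pd i (M.sigma f A) p := by
  simp only [NUMetric.gen_ang]
  exact pd_sub i ((Asym.comp_toScri (hY A)).diff hp) ((asym_sigma hf A).diff hp)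

include hY in
theorem pd_zero_gen_ang (hp : p ∈ D.bulk) (A : Fin 2) :
    pd 0 (fun x => M.gen f Z Y x A.succ.succ) p
      = pd 0 (Y A) (toScri p) - pd 0 (M.sigma f A) p := by
  rw [pd_gen_ang hf hY hp, pd_zero_scri (smooth_diff D.isOpen_scri (hY A) hp.1)]

include hY in
theorem pd_one_gen_ang (hp : p ∈ D.bulk) (A : Fin 2) :
    pd 1 (fun x => M.gen f Z Y x A.succ.succ) p
      = ∑ B : Fin 2, pd B.succ f (toScri p) * M.hInv A B p := by
  rw [pd_gen_ang hf hY hp, pd_one_comp_toScri (smooth_diff D.isOpen_scri (hY A) hp.1),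
    pd_one_sigma hf hp]
  ring

include hY in
theorem pd_ang_gen_ang (hp : p ∈ D.bulk) (A B : Fin 2) :
    pd B.succ.succ (fun x => M.gen f Z Y x A.succ.succ) p
      = pd B.succ (Y A) (toScri p) - pd B.succ.succ (M.sigma f A) p := by
  rw [pd_gen_ang hf hY hp, pd_ang_scri B (smooth_diff D.isOpen_scri (hY A) hp.1)]

include hZ hY in
/-- The gauge conditions. -/
theorem gen_gauge (hp : p ∈ D.bulk) (μ : Fin 4) : pd 1 (fun x => M.gen f Z Y x μ) p
    = ∑ ν, M.ginv μ ν p * pd ν (fun x => M.gen f Z Y x 0) p := by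
  rw [sum_four, pd_zero_gen_zero hf hp, pd_one_gen_zero hf hp]
  simp only [pd_ang_gen_zero hf hp]
  revert μ
  rw [NUMetric.forall_fin_four]
  refine ⟨?_, ?_, fun A => ?_⟩
  · rw [pd_one_gen_zero hf hp]
    simp
  · rw [pd_one_gen_one hf hZ hp, pd_one_rho hf hp]
    simp [Fin.sum_univ_two]
    ring
  · rw [pd_one_gen_ang hf hY hp]
    simp [Fin.sum_univ_two]
    ring

include hZ in
theorem asym_gen_one : Asym D false 1 fun p => M.gen f Z Y p 1 :=
  ((((Asym.radius (D := D)).neg.mulO (Asym.comp_toScri (smooth_pdf hf 0)) (l := 1)).add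
    ((Asym.comp_toScri hZ).of_lt (by norm_num))).add ((asym_rho hf).of_lt (by norm_num)))

include hY in
theorem asym_gen_ang (A : Fin 2) : Asym D false 0 fun p => M.gen f Z Y p A.succ.succ :=
  (Asym.comp_toScri (hY A)).sub ((asym_sigma hf A).of_lt (by norm_num))

omit hf in
theorem asym_gen_zero (hf : ContDiffOn ℝ (⊤ : ℕ∞) f D.scri) :
    Asym D false 0 fun p => M.gen f Z Y p 0 := Asym.comp_toScri hf

end gen

end NewmanUnti

namespace NewmanUnti

/-! ## Asymptotic expansion of the symmetry conditions -/

section expansion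
variable {D : Region} {M : NUMetric D} {f Z : ScriPt → ℝ} {Y : Fin 2 → ScriPt → ℝ} {p : Pt}
  (hf : ContDiffOn ℝ (⊤ : ℕ∞) f D.scri) (hZ : ContDiffOn ℝ (⊤ : ℕ∞) Z D.scri)
  (hY : ∀ A, ContDiffOn ℝ (⊤ : ℕ∞) (Y A) D.scri)

theorem asym_sum_two {b : Bool} {n : ℤ} {F : Fin 2 → Pt → ℝ} (h : ∀ A, Asym D b n (F A)) :
    Asym D b n fun p => ∑ A, F A p := Asym.sum _ fun A _ => h A

include hf hZ hY

/-- The r⁻¹ terms cancel: -g^{AB} ∂_B ξ^r gives m ∂_A ∂_u f, ∂_u ξ^A gives -m ∂_u ∂_A f + 2 m ∂_u φ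
∂_A f, and the part -2 r ∂_u φ of W times ∂_r ξ^A gives -2 m ∂_u φ ∂_A f. What survives above r⁻² is
∂_u Y^A. -/
theorem asym_lieInv_1A (A : Fin 2) : Asym D.pos false (-2) fun p =>
    lieInv (M.gen f Z Y) M.g 1 A.succ.succ p - pd 0 (Y A) (toScri p) := by
  have x0 := (asym_gen_zero (M := M) (Z := Z) (Y := Y) hf).mono_pos
  have x1 := (asym_gen_one (M := M) (Y := Y) hf hZ).mono_pos
  have xa := fun B => (asym_gen_ang (M := M) (Z := Z) hf hY B).mono_pos
  have v := fun B => (M.asym_V B).mono_pos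
  have e := M.asym_e
  have t1 : Asym D.pos false (-2) fun p => -(M.gen f Z Y p 0 * pd 0 (fun x => M.V x A) p
        + M.gen f Z Y p 1 * pd 1 (fun x => M.V x A) p
        + ∑ B : Fin 2, M.gen f Z Y p B.succ.succ * pd B.succ.succ (fun x => M.V x A) p) :=
    Asym.neg (Asym.add (Asym.add (x0.mulO (v A).pd_zero) (x1.mulO (v A).pd_one))
      (asym_sum_two fun B => (xa B).mulO ((v A).pd_ang B)))
  have t2 : Asym D.pos false (-2) fun p => M.V p A * pd 1 (fun x => M.gen f Z Y x 1) p :=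
    (v A).mulO x1.pd_one
  have t3 : Asym D.pos false (-2) fun p =>
      ∑ B : Fin 2, M.eRem A B p * pd B.succ.succ (fun x => M.gen f Z Y x 1) p :=
    asym_sum_two fun B => (e A B).mulO (x1.pd_ang B)
  have t4 : Asym D.pos false (-2) fun p => (p 1)⁻¹ ^ 2 * (M.m (toScri p) *
      (pd A.succ Z (toScri p) + pd A.succ.succ (M.rho f) p)) :=
    NUMetric.asym_r2.mulO (Asym.scri_mul (D := D.pos) M.smooth_m (Asym.add
      (Asym.comp_toScri (D := D.pos) (smooth_pdf hZ A.succ))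
      (((asym_rho (M := M) hf).mono_pos.pd_ang A).of_lt (by norm_num))))
  have t5 : Asym D.pos false (-2) (pd 0 (M.tau f A)) := (asym_tau hf A).pd_zero
  have t6 : Asym D.pos false (-2) fun p => 2 * (p 1 * (pd 0 M.φ (toScri p)
      * ∑ B : Fin 2, pd B.succ f (toScri p) * M.eRem A B p)) :=
    Asym.const_mul 2 (Asym.radius.mulO (Asym.scri_mul (D := D.pos) (M.smooth_pdφ 0)
      (asym_sum_two fun B => Asym.scri_mul (D := D.pos) (smooth_pdf hf _) (e A B))))
  have t7 : Asym D.pos false (-2) fun p => (lap M.φ M.φ (toScri p) + M.wRem p)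
      * ∑ B : Fin 2, pd B.succ f (toScri p) * M.hInv A B p :=
    Asym.mulO (m := 0) (Asym.add (Asym.comp_toScri (D := D.pos) M.smooth_K)
      (M.asym_w.mono_pos.of_lt (by norm_num)))
      (asym_sum_two fun B => Asym.scri_mul (D := D.pos) (smooth_pdf hf _)
        (M.asym_hInv A B).mono_pos)
  have t8 : Asym D.pos false (-2) fun p =>
      ∑ B : Fin 2, M.V p B * pd B.succ.succ (fun x => M.gen f Z Y x A.succ.succ) p :=
    asym_sum_two fun B => (v B).mulO ((xa A).pd_ang B)
  refine (((((((t1.add t2).sub t3).sub t4).sub t5).sub t6).add t7).add t8).congr fun p hp => ?_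
  have hb := Region.bulk_pos_subset hp
  have hr : p 1 ≠ 0 := by have := Region.one_lt_of_mem_pos hp; linarith
  have hc := pd_comm D.isOpen_scri 0 A.succ hf hb.1
  rw [lieInv_1A (smooth_gen hf hZ hY) hb, pd_zero_gen_ang hf hY hb, pd_one_gen_ang hf hY hb,
    M.W_eq p, pd_zero_sigma hf hp, hc]
  simp only [pd_ang_gen_one hf hZ hb, Fin.sum_univ_two, M.hInv_eq]
  fin_cases A <;> simp <;> field_simp <;> ring

/-- At order r⁻² only the leading part r⁻² m δ^{AB} of the inverse metric contributes: it is
transported along f, -r ∂_u f and Y, and contracted with ∂Y. The function Z, the ray integrals, V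
and `eRem` first enter at order r⁻³. -/
theorem asym_lieInv_AB (A B : Fin 2) : Asym D.pos false (-3) fun p =>
    lieInv (M.gen f Z Y) M.g A.succ.succ B.succ.succ p
      - (p 1)⁻¹ ^ 2 * (M.m (toScri p) * ((if A = B then 2 * (pd 0 f (toScri p)
        - f (toScri p) * pd 0 M.φ (toScri p)
        - ∑ C : Fin 2, Y C (toScri p) * pd C.succ M.φ (toScri p)) else 0)
        - (pd A.succ (Y B) (toScri p) + pd B.succ (Y A) (toScri p)))) := by
  have x0 := (asym_gen_zero (M := M) (Z := Z) (Y := Y) hf).mono_pos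
  have x1 := (asym_gen_one (M := M) (Y := Y) hf hZ).mono_pos
  have xa := fun B => (asym_gen_ang (M := M) (Z := Z) hf hY B).mono_pos
  have v := fun B => (M.asym_V B).mono_pos
  have e := M.asym_e
  have σ := fun A => (asym_sigma (M := M) hf A).mono_pos
  have r2 := NUMetric.asym_r2 (D := D)
  have c : ContDiffOn ℝ (⊤ : ℕ∞) (fun q => if A = B then M.m q else 0) D.scri := by
    by_cases h : A = B
    · simpa [h] using M.smooth_m
    · simpa [h] using contDiffOn_const
  have t1 : Asym D.pos false (-3) fun p => M.gen f Z Y p 0 * pd 0 (M.eRem A B) p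
        + M.gen f Z Y p 1 * pd 1 (M.eRem A B) p
        + ∑ C : Fin 2, M.gen f Z Y p C.succ.succ * pd C.succ.succ (M.eRem A B) p :=
    Asym.add (Asym.add (x0.mulO (e A B).pd_zero) (x1.mulO (e A B).pd_one))
      (asym_sum_two fun C => (xa C).mulO ((e A B).pd_ang C))
  have t2 : Asym D.pos false (-3) fun p => 2 * ((p 1)⁻¹ * ((p 1)⁻¹ ^ 2 *
      ((if A = B then M.m (toScri p) else 0) * (Z (toScri p) + M.rho f p)))) :=
    Asym.const_mul 2 (Asym.radius_inv.mulO (r2.mul (Asym.scri_mul (D := D.pos) c (Asym.add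
      (Asym.comp_toScri (D := D.pos) hZ) ((asym_rho (M := M) hf).mono_pos.of_lt (by norm_num))))))
  have t3 : Asym D.pos false (-3) fun p => 2 * ((p 1)⁻¹ ^ 2 *
      ((if A = B then M.m (toScri p) else 0) *
        ∑ C : Fin 2, pd C.succ M.φ (toScri p) * M.sigma f C p)) :=
    Asym.const_mul 2 (r2.mulO (Asym.scri_mul (D := D.pos) c (asym_sum_two fun C =>
      Asym.scri_mul (D := D.pos) (M.smooth_pdφ _) (σ C))))
  have t4 : ∀ A B : Fin 2, Asym D.pos false (-3) fun p =>
      M.V p B * pd 1 (fun x => M.gen f Z Y x A.succ.succ) p := fun A B =>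
    (v B).mulO (xa A).pd_one
  have t5 : ∀ A B : Fin 2, Asym D.pos false (-3) fun p =>
      (p 1)⁻¹ ^ 2 * (M.m (toScri p) * pd B.succ.succ (M.sigma f A) p) := fun A B =>
    r2.mulO (Asym.scri_mul (D := D.pos) M.smooth_m ((σ A).pd_ang B))
  have t6 : ∀ A B : Fin 2, Asym D.pos false (-3) fun p =>
      ∑ C : Fin 2, M.eRem B C p * pd C.succ.succ (fun x => M.gen f Z Y x A.succ.succ) p :=
    fun A B => asym_sum_two fun C => (e B C).mulO ((xa A).pd_ang C)
  refine (((((t1.sub t2).add t3).add ((t4 A B).add (t4 B A))).add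
    ((t5 A B).add (t5 B A))).sub ((t6 A B).add (t6 B A))).congr fun p hp => ?_
  have hb := Region.bulk_pos_subset hp
  have hr : p 1 ≠ 0 := by have := Region.one_lt_of_mem_pos hp; linarith
  have dE : ∀ i, pd i (M.hInv A B) p = pd i (fun x : Pt => (x 1)⁻¹ ^ 2) p
      * (if A = B then M.m (toScri p) else 0) + (p 1)⁻¹ ^ 2
        * pd i (fun x => if A = B then M.m (toScri x) else 0) p + pd i (M.eRem A B) p := by
    intro i
    have d1 := r2.diff hp
    have d2 := (Asym.comp_toScri c).diff hb
    have e' : M.hInv A B = fun p => (p 1)⁻¹ ^ 2 * (if A = B then M.m (toScri p) else 0)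
      + M.eRem A B p := funext (M.hInv_eq A B)
    rw [e', pd_add i (d1.fun_mul d2) ((e A B).diff hp), pd_mul i d1 d2]
  have dm : ∀ i : Fin 3, pd (up i) (fun x => if A = B then M.m (toScri x) else 0) p
      = if A = B then -2 * pd i M.φ (toScri p) * M.m (toScri p) else 0 := by
    intro i
    by_cases h : A = B
    · simp only [h, if_true]
      rw [pd_comp_toScri i (smooth_diff D.isOpen_scri M.smooth_m hb.1), M.pd_m hb.1]
    · simp only [h, if_false, pd_const]
  have dm1 : pd 1 (fun x => if A = B then M.m (toScri x) else 0) p = 0 :=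
    pd_one_comp_toScri (a := fun q => if A = B then M.m q else 0)
      (smooth_diff D.isOpen_scri c hb.1)
  have dr : ∀ i, pd i (fun x : Pt => (x 1)⁻¹ ^ 2) p
      = -2 * (p 1)⁻¹ ^ 3 * pd i (fun x : Pt => x 1) p := by
    intro i
    have d0 : DifferentiableAt ℝ (fun x : Pt => x 1) p := differentiableAt_apply 1 p
    rw [pd_comp_deriv (φ := fun t => t ^ 2) i (hasDerivAt_pow 2 _) (d0.fun_inv hr),
      pd_inv i d0 hr]
    push_cast
    ring
  have dm0 := dm 0
  have dm2 := dm 1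
  have dm3 := dm 2
  rw [up_zero] at dm0
  rw [up_one] at dm2
  rw [up_two] at dm3
  have r0 := dr 0
  have r1 := dr 1
  have r2' := dr 2
  have r3 := dr 3
  rw [pd_coord, if_neg (by decide), mul_zero] at r0 r2' r3
  rw [pd_coord, if_pos rfl, mul_one] at r1
  rw [lieInv_AB (smooth_gen hf hZ hY) hb]
  simp only [pd_ang_gen_ang hf hY hb, dE, Fin.sum_univ_two, Fin.succ_zero_eq_one,
    Fin.succ_one_eq_two, show (1 : Fin 3).succ = (2 : Fin 4) from rfl,
    show (2 : Fin 3).succ = (3 : Fin 4) from rfl, dm0, dm1, dm2, dm3, r0, r1, r2', r3,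
    M.hInv_eq]
  have g0 : M.gen f Z Y p 0 = f (toScri p) := rfl
  have g1 : M.gen f Z Y p 1 = -p 1 * pd 0 f (toScri p) + Z (toScri p) + M.rho f p := rfl
  have g2 : M.gen f Z Y p 2 = Y 0 (toScri p) - M.sigma f 0 p := rfl
  have g3 : M.gen f Z Y p 3 = Y 1 (toScri p) - M.sigma f 1 p := rfl
  simp only [g0, g1, g2, g3]
  have hr' : p 1 * (p 1)⁻¹ = 1 := mul_inv_cancel₀ hr
  set s := (p 1)⁻¹
  fin_cases A <;> fin_cases B <;> simp
  · linear_combination (2 * s ^ 2 * M.m (toScri p) * pd 0 f (toScri p)) * hr'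
  · ring
  · ring
  · linear_combination (2 * s ^ 2 * M.m (toScri p) * pd 0 f (toScri p)) * hr'

/-- At order r⁻¹ the term 2 r⁻¹ ξ^r contributes 2 Z. The gradient terms ∂φ·∂f coming from ∂_A of the
ray integral and from its product with ½ ∂_A log |g| = 2 ∂_A φ cancel, which leaves -Δ̄ f. -/
theorem asym_divergence : Asym D.pos true (-1) fun p => divergence M.g (M.gen f Z Y) p
    - ((∑ A : Fin 2, pd A.succ (Y A) (toScri p) + 2 * f (toScri p) * pd 0 M.φ (toScri p)
      - 2 * pd 0 f (toScri p) + 2 * ∑ A : Fin 2, Y A (toScri p) * pd A.succ M.φ (toScri p))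
      + (p 1)⁻¹ * (2 * Z (toScri p) - lap M.φ f (toScri p))) := by
  have x1 := (asym_gen_one (M := M) (Y := Y) hf hZ).mono_pos
  have xa := fun B => (asym_gen_ang (M := M) (Z := Z) hf hY B).mono_pos
  have τ := asym_tau (M := M) hf
  have ρ := (asym_rho (M := M) hf).mono_pos
  have la : ∀ A : Fin 2, Asym D.pos true (-1) fun p =>
      1 / 2 * (M.dh p)⁻¹ * pd A.succ.succ M.dh p - 2 * pd A.succ M.φ (toScri p) := fun A => by
    have := M.asym_log_scri A.succ
    rwa [up_succ] at this
  have t1 : Asym D.pos true (-1) (pd 1 (M.rho f)) := ρ.pd_one.of_lt (by norm_num)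
  have t2 : Asym D.pos true (-1) fun p => ∑ A : Fin 2, pd A.succ.succ (M.tau f A) p :=
    asym_sum_two fun A => ((τ A).pd_ang A).of_lt (by norm_num)
  have t3 : Asym D.pos true (-1) fun p => f (toScri p) *
      (1 / 2 * (M.dh p)⁻¹ * pd 0 M.dh p - 2 * pd 0 M.φ (toScri p)) :=
    Asym.scri_mul (D := D.pos) hf (M.asym_log_scri 0)
  have t4 : Asym D.pos true (-1) fun p => M.gen f Z Y p 1 *
      (1 / 2 * (M.dh p)⁻¹ * pd 1 M.dh p - 2 * (p 1)⁻¹) := x1.mulO M.asym_log_one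
  have t5 : Asym D.pos true (-1) fun p => 2 * ((p 1)⁻¹ * M.rho f p) :=
    Asym.const_mul 2 ((Asym.radius_inv.mul ρ).of_lt (by norm_num))
  have t6 : Asym D.pos true (-1) fun p => ∑ A : Fin 2, M.gen f Z Y p A.succ.succ *
      (1 / 2 * (M.dh p)⁻¹ * pd A.succ.succ M.dh p - 2 * pd A.succ M.φ (toScri p)) :=
    asym_sum_two fun A => (xa A).mulO (la A)
  have t7 : Asym D.pos true (-1) fun p =>
      2 * ∑ A : Fin 2, pd A.succ M.φ (toScri p) * M.tau f A p :=
    Asym.const_mul 2 (asym_sum_two fun A =>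
      (Asym.scri_mul (D := D.pos) (M.smooth_pdφ _) (τ A)).of_lt (by norm_num))
  refine ((((((t1.sub t2).add t3).add t4).add t5).add t6).sub t7).congr fun p hp => ?_
  have hb := Region.bulk_pos_subset hp
  have hr : p 1 ≠ 0 := by have := Region.one_lt_of_mem_pos hp; linarith
  rw [divergence_eq (smooth_gen hf hZ hY) hb, sum_four, pd_zero_gen_zero hf hb,
    pd_one_gen_one hf hZ hb]
  simp only [pd_ang_gen_ang hf hY hb, pd_ang_sigma hf hp, Fin.sum_univ_two, lap]
  simp only [M.gen_zero, M.gen_one, M.gen_ang, sigma_eq f hp]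
  have hm : Real.exp (-2 * M.φ (toScri p)) = M.m (toScri p) := rfl
  rw [hm]
  have hr' : p 1 * (p 1)⁻¹ = 1 := mul_inv_cancel₀ hr
  set s := (p 1)⁻¹
  linear_combination (-2 * pd 0 f (toScri p)) * hr'

/-- The derivative ∂_r kills the order-zero coefficient, whatever it is, so that the condition only
sees 2 Z - Δ̄ f. -/
theorem asym_pd_divergence : Asym D.pos true (-2) fun p =>
    pd 1 (divergence M.g (M.gen f Z Y)) p
      + (p 1)⁻¹ ^ 2 * (2 * Z (toScri p) - lap M.φ f (toScri p)) := by
  have h := asym_divergence (M := M) hf hZ hY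
  have hl : ContDiffOn ℝ (⊤ : ℕ∞) (fun q => 2 * Z q - lap M.φ f q) D.scri :=
    (contDiffOn_const.mul hZ).sub (smooth_lap M.smooth_φ hf)
  have hφ := fun i => M.smooth_pdφ i
  have ha : ContDiffOn ℝ (⊤ : ℕ∞) (fun q => ∑ A : Fin 2, pd A.succ (Y A) q
      + 2 * f q * pd 0 M.φ q - 2 * pd 0 f q + 2 * ∑ A : Fin 2, Y A q * pd A.succ M.φ q) D.scri :=
    (((ContDiffOn.sum fun A _ => smooth_pd D.isOpen_scri _ (hY A)).add
      ((contDiffOn_const.mul hf).mul (hφ 0))).sub (contDiffOn_const.mul (smooth_pdf hf 0))).add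
      (contDiffOn_const.mul (ContDiffOn.sum fun A _ => (hY A).mul (hφ _)))
  refine h.pd_one.congr fun p hp => ?_
  have hb := Region.bulk_pos_subset hp
  have hr : p 1 ≠ 0 := by have := Region.one_lt_of_mem_pos hp; linarith
  have d1 := (Asym.comp_toScri ha).diff hb
  have d2 := (Asym.comp_toScri hl).diff hb
  have d3 := (Asym.radius_inv (D := D)).diff hp
  have d4 := d1.fun_add (d3.fun_mul d2)
  have d5 : DifferentiableAt ℝ (divergence M.g (M.gen f Z Y)) p := by
    have := (h.diff hp).fun_add d4
    simpa using this
  rw [pd_sub 1 d5 d4, pd_add 1 d1 (d3.fun_mul d2), pd_mul 1 d3 d2,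
    pd_inv 1 (differentiableAt_apply 1 p) hr, pd_coord,
    pd_one_comp_toScri (smooth_diff D.isOpen_scri ha hb.1),
    pd_one_comp_toScri (smooth_diff D.isOpen_scri hl hb.1), if_pos rfl]
  ring

/-- The ray integral of V and the remainder of W only matter at order r⁻¹. The ray integral of
g^{AB} does reach order zero: its leading part r⁻¹ m ∂_A f meets the term -2 r ∂_A ∂_u φ of ∂_A W,
the origin of the last product in the coefficient. -/
theorem asym_lieInv_11 : Asym D.pos false (-1) fun p => lieInv (M.gen f Z Y) M.g 1 1 p
    - (p 1 * (2 * (f (toScri p) * pd 0 (pd 0 M.φ) (toScri p)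
        + pd 0 f (toScri p) * pd 0 M.φ (toScri p)
        + ∑ A : Fin 2, Y A (toScri p) * pd A.succ (pd 0 M.φ) (toScri p)
        - pd 0 (pd 0 f) (toScri p)))
      + (2 * pd 0 Z (toScri p) + 2 * Z (toScri p) * pd 0 M.φ (toScri p)
        - f (toScri p) * pd 0 (lap M.φ M.φ) (toScri p)
        - 2 * lap M.φ M.φ (toScri p) * pd 0 f (toScri p)
        - ∑ A : Fin 2, (Y A (toScri p) * pd A.succ (lap M.φ M.φ) (toScri p)
          + 2 * M.m (toScri p) * pd A.succ f (toScri p) * pd A.succ (pd 0 M.φ) (toScri p)))) := by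
  have x0 := (asym_gen_zero (M := M) (Z := Z) (Y := Y) hf).mono_pos
  have x1 := (asym_gen_one (M := M) (Y := Y) hf hZ).mono_pos
  have xa := fun B => (asym_gen_ang (M := M) (Z := Z) hf hY B).mono_pos
  have v := fun B => (M.asym_V B).mono_pos
  have w := M.asym_w.mono_pos
  have ρ := (asym_rho (M := M) hf).mono_pos
  have τ := asym_tau (M := M) hf
  have σ := fun A => (asym_sigma (M := M) hf A).mono_pos
  have sK := M.smooth_K
  have sφ := fun i => smooth_pd D.isOpen_scri i (M.smooth_pdφ 0)
  have t1 : Asym D.pos false (-1) fun p => M.gen f Z Y p 0 * pd 0 M.wRem p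
        + M.gen f Z Y p 1 * pd 1 M.wRem p
        + ∑ C : Fin 2, M.gen f Z Y p C.succ.succ * pd C.succ.succ M.wRem p :=
    Asym.add (Asym.add (x0.mulO w.pd_zero) (x1.mulO w.pd_one))
      (asym_sum_two fun C => (xa C).mulO (w.pd_ang C))
  have t2 : Asym D.pos false (-1) fun p => 2 * (pd 0 M.φ (toScri p) * M.rho f p) :=
    Asym.const_mul 2 (Asym.scri_mul (D := D.pos) (M.smooth_pdφ 0) ρ)
  have t3 : Asym D.pos false (-1) fun p => 2 * (p 1 * ∑ A : Fin 2,
      pd A.succ (pd 0 M.φ) (toScri p) * M.tau f A p) :=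
    Asym.const_mul 2 (Asym.radius.mulO (asym_sum_two fun A =>
      Asym.scri_mul (D := D.pos) (sφ _) (τ A)))
  have t4 : Asym D.pos false (-1) fun p =>
      ∑ A : Fin 2, pd A.succ (lap M.φ M.φ) (toScri p) * M.sigma f A p :=
    asym_sum_two fun A => Asym.scri_mul (D := D.pos) (smooth_pd D.isOpen_scri _ sK) (σ A)
  have t5 : Asym D.pos false (-1) fun p => 2 * pd 0 (M.rho f) p := ρ.pd_zero.const_mul 2
  have t6 : Asym D.pos false (-1) fun p => 2 * (M.W p * pd 1 (M.rho f) p) := by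
    have aW : Asym D.pos false 1 M.W := Asym.congr (Asym.add (Asym.add (Asym.const_mul (-2)
      (Asym.radius.mulO (Asym.comp_toScri (D := D.pos) (M.smooth_pdφ 0))))
      ((Asym.comp_toScri (D := D.pos) sK).of_lt (by norm_num))) (w.of_lt (by norm_num)))
      fun p _ => by rw [M.W_eq p]; ring
    exact Asym.const_mul 2 (aW.mulO ρ.pd_one)
  have t7 : Asym D.pos false (-1) fun p => 2 * (pd 0 f (toScri p) * M.wRem p) :=
    Asym.const_mul 2 (Asym.scri_mul (D := D.pos) (smooth_pdf hf 0) w)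
  have t8 : Asym D.pos false (-1) fun p =>
      2 * ∑ A : Fin 2, M.V p A * pd A.succ.succ (fun x => M.gen f Z Y x 1) p :=
    Asym.const_mul 2 (asym_sum_two fun A => (v A).mulO (x1.pd_ang A))
  refine (((((((t2.sub t1).sub t3).add t4).add t5).add t6).sub t7).add t8).congr fun p hp => ?_
  have hb := Region.bulk_pos_subset hp
  have hr : p 1 ≠ 0 := by have := Region.one_lt_of_mem_pos hp; linarith
  have dW0 : pd 0 M.W p = -2 * p 1 * pd 0 (pd 0 M.φ) (toScri p)
      + pd 0 (lap M.φ M.φ) (toScri p) + pd 0 M.wRem p := by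
    rw [M.pd_W hb, pd_coord, pd_zero_scri (M.diff_φ hb.1 0),
      pd_zero_scri (smooth_diff D.isOpen_scri sK hb.1)]
    simp
    ring
  have dW1 : pd 1 M.W p = -2 * pd 0 M.φ (toScri p) + pd 1 M.wRem p := by
    rw [M.pd_W hb, pd_coord, pd_one_comp_toScri (M.diff_φ hb.1 0),
      pd_one_comp_toScri (smooth_diff D.isOpen_scri sK hb.1)]
    simp
  have dWA : ∀ A : Fin 2, pd A.succ.succ M.W p = -2 * p 1 * pd A.succ (pd 0 M.φ) (toScri p)
      + pd A.succ (lap M.φ M.φ) (toScri p) + pd A.succ.succ M.wRem p := by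
    intro A
    rw [M.pd_W hb, pd_coord, if_neg (succ_succ_ne_one A).symm, pd_ang_scri A (M.diff_φ hb.1 0),
      pd_ang_scri A (smooth_diff D.isOpen_scri sK hb.1)]
    ring
  rw [lieInv_11 (smooth_gen hf hZ hY) hb, dW0, dW1, pd_zero_gen_one hf hZ hb,
    pd_one_gen_one hf hZ hb]
  simp only [dWA, Fin.sum_univ_two, M.gen_zero, M.gen_one, M.gen_ang, sigma_eq f hp, M.W_eq p]
  have hr' : p 1 * (p 1)⁻¹ = 1 := mul_inv_cancel₀ hr
  set s := (p 1)⁻¹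
  linear_combination (-2 * M.m (toScri p) * (pd (Fin.succ 0) f (toScri p)
    * pd (Fin.succ 0) (pd 0 M.φ) (toScri p) + pd (Fin.succ 1) f (toScri p)
    * pd (Fin.succ 1) (pd 0 M.φ) (toScri p))) * hr'

end expansion

end NewmanUnti

namespace NewmanUnti

/-! ## Calculus on Scri -/

/-- The Laplacian of `dζ dζ̄`. -/
noncomputable def flap (F : ScriPt → ℝ) (q : ScriPt) : ℝ := ∑ A : Fin 2, pd A.succ (pd A.succ F) q

theorem lap_eq (φ F : ScriPt → ℝ) (q : ScriPt) : lap φ F q = Real.exp (-2 * φ q) * flap F q := rfl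

section scri
variable {D : Region} {M : NUMetric D} {a b : ScriPt → ℝ} {Y : Fin 2 → ScriPt → ℝ} {q : ScriPt}
  (ha : ContDiffOn ℝ (⊤ : ℕ∞) a D.scri) (hb : ContDiffOn ℝ (⊤ : ℕ∞) b D.scri)

include ha

theorem sdiff (hq : q ∈ D.scri) : DifferentiableAt ℝ a q := smooth_diff D.isOpen_scri ha hq

theorem smooth_flap : ContDiffOn ℝ (⊤ : ℕ∞) (flap a) D.scri :=
  ContDiffOn.sum fun _ _ => smooth_pdf (smooth_pdf ha _) _

theorem pd_comm_scri (i j : Fin 3) (hq : q ∈ D.scri) : pd i (pd j a) q = pd j (pd i a) q :=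
  pd_comm D.isOpen_scri i j ha hq

theorem pd_comm_three (i j : Fin 3) (hq : q ∈ D.scri) :
    pd i (pd j (pd j a)) q = pd j (pd j (pd i a)) q := by
  rw [pd_comm_scri (smooth_pdf ha j) i j hq]
  exact pd_congr D.isOpen_scri j (fun x hx => pd_comm_scri ha i j hx) hq

theorem pd_flap (i : Fin 3) (hq : q ∈ D.scri) : pd i (flap a) q = flap (pd i a) q := by
  have e : flap a = fun q => ∑ A : Fin 2, pd A.succ (pd A.succ a) q := rfl
  rw [e, pd_sum _ _ fun A _ => sdiff (smooth_pdf (smooth_pdf ha _) _) hq]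
  exact Finset.sum_congr rfl fun A _ => pd_comm_three ha i A.succ hq

theorem pd_lap (i : Fin 3) (hq : q ∈ D.scri) :
    pd i (lap M.φ a) q = M.m q * (flap (pd i a) q - 2 * pd i M.φ q * flap a q) := by
  have e : lap M.φ a = fun q => M.m q * flap a q := rfl
  rw [e, pd_mul i (sdiff M.smooth_m hq) (sdiff (smooth_flap ha) hq), M.pd_m hq, pd_flap ha i hq]
  ring

omit ha in
theorem flap_congr (h : ∀ q ∈ D.scri, a q = b q) (hq : q ∈ D.scri) : flap a q = flap b q :=
  Finset.sum_congr rfl fun _ _ => pd_congr D.isOpen_scri _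
    (fun _ hx => pd_congr D.isOpen_scri _ h hx) hq

omit ha in
theorem lap_congr {φ : ScriPt → ℝ} (h : ∀ q ∈ D.scri, a q = b q) (hq : q ∈ D.scri) :
    lap φ a q = lap φ b q := by
  rw [lap_eq, lap_eq, flap_congr h hq]

include hb

theorem flap_add (hq : q ∈ D.scri) : flap (fun x => a x + b x) q = flap a q + flap b q := by
  simp only [flap, ← Finset.sum_add_distrib]
  refine Finset.sum_congr rfl fun A _ => ?_
  rw [pd_congr D.isOpen_scri _ (fun x hx => pd_add _ (sdiff ha hx) (sdiff hb hx)) hq,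
    pd_add _ (sdiff (smooth_pdf ha _) hq) (sdiff (smooth_pdf hb _) hq)]

theorem flap_sub (hq : q ∈ D.scri) : flap (fun x => a x - b x) q = flap a q - flap b q := by
  simp only [flap, ← Finset.sum_sub_distrib]
  refine Finset.sum_congr rfl fun A _ => ?_
  rw [pd_congr D.isOpen_scri _ (fun x hx => pd_sub _ (sdiff ha hx) (sdiff hb hx)) hq,
    pd_sub _ (sdiff (smooth_pdf ha _) hq) (sdiff (smooth_pdf hb _) hq)]

theorem flap_mul (hq : q ∈ D.scri) : flap (fun x => a x * b x) q
    = flap a q * b q + 2 * ∑ A : Fin 2, pd A.succ a q * pd A.succ b q + a q * flap b q := by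
  simp only [flap, Finset.sum_mul, Finset.mul_sum, ← Finset.sum_add_distrib]
  refine Finset.sum_congr rfl fun A _ => ?_
  have da := sdiff ha hq
  have db := sdiff hb hq
  have da' := sdiff (smooth_pdf ha A.succ) hq
  have db' := sdiff (smooth_pdf hb A.succ) hq
  rw [pd_congr D.isOpen_scri _ (fun x hx => pd_mul _ (sdiff ha hx) (sdiff hb hx)) hq,
    pd_add _ (da'.fun_mul db) (da.fun_mul db'), pd_mul _ da' db, pd_mul _ da db']
  ring

omit hb in
theorem flap_const_mul (c : ℝ) (hq : q ∈ D.scri) : flap (fun x => c * a x) q = c * flap a q := by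
  simp only [flap, Finset.mul_sum]
  refine Finset.sum_congr rfl fun A _ => ?_
  rw [pd_congr D.isOpen_scri _ (fun x hx => pd_const_mul _ c (sdiff ha hx)) hq,
    pd_const_mul _ c (sdiff (smooth_pdf ha _) hq)]

end scri

/-- Smooth vector fields on Scri that are tangent to the sections of constant `u` and satisfy the
Cauchy–Riemann equations there. -/
structure IsConf (D : Region) (Y : Fin 2 → ScriPt → ℝ) : Prop where
  smooth : ∀ A, ContDiffOn ℝ (⊤ : ℕ∞) (Y A) D.scri
  cr : ∀ q ∈ D.scri, pd 1 (Y 0) q = pd 2 (Y 1) q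
  cr' : ∀ q ∈ D.scri, pd 2 (Y 0) q = -pd 1 (Y 1) q

/-- `∂_A Y^A`. -/
noncomputable def sdiv (Y : Fin 2 → ScriPt → ℝ) (q : ScriPt) : ℝ := ∑ A : Fin 2, pd A.succ (Y A) q

/-- `Y^A ∂_A a`. -/
noncomputable def along (Y : Fin 2 → ScriPt → ℝ) (a : ScriPt → ℝ) (q : ScriPt) : ℝ :=
  ∑ A : Fin 2, Y A q * pd A.succ a q

theorem sdiv_eq (Y : Fin 2 → ScriPt → ℝ) (q : ScriPt) :
    sdiv Y q = pd 1 (Y 0) q + pd 2 (Y 1) q := by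
  simp [sdiv, Fin.sum_univ_two]

theorem along_eq (Y : Fin 2 → ScriPt → ℝ) (a : ScriPt → ℝ) (q : ScriPt) :
    along Y a q = Y 0 q * pd 1 a q + Y 1 q * pd 2 a q := by
  simp [along, Fin.sum_univ_two]

theorem flap_eq (a : ScriPt → ℝ) (q : ScriPt) :
    flap a q = pd 1 (pd 1 a) q + pd 2 (pd 2 a) q := by
  simp [flap, Fin.sum_univ_two]

/-! ### Conformal Killing vectors and the Laplacian -/

section conf
variable {D : Region} {a b : ScriPt → ℝ} {Y : Fin 2 → ScriPt → ℝ} {q : ScriPt}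

theorem smooth_sdiv (hY : ∀ A, ContDiffOn ℝ (⊤ : ℕ∞) (Y A) D.scri) :
    ContDiffOn ℝ (⊤ : ℕ∞) (sdiv Y) D.scri :=
  ContDiffOn.sum fun A _ => smooth_pdf (hY A) _

theorem smooth_along (hY : ∀ A, ContDiffOn ℝ (⊤ : ℕ∞) (Y A) D.scri)
    (ha : ContDiffOn ℝ (⊤ : ℕ∞) a D.scri) : ContDiffOn ℝ (⊤ : ℕ∞) (along Y a) D.scri :=
  ContDiffOn.sum fun A _ => (hY A).mul (smooth_pdf ha _)

theorem pd_along (hY : ∀ A, ContDiffOn ℝ (⊤ : ℕ∞) (Y A) D.scri)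
    (ha : ContDiffOn ℝ (⊤ : ℕ∞) a D.scri) (i : Fin 3) (hq : q ∈ D.scri) :
    pd i (along Y a) q = along (fun A => pd i (Y A)) a q + along Y (pd i a) q := by
  have e : along Y a = fun q => ∑ A : Fin 2, Y A q * pd A.succ a q := rfl
  have d := fun A : Fin 2 => sdiff (hY A) hq
  have d' := fun A : Fin 2 => sdiff (smooth_pdf ha A.succ) hq
  rw [e, pd_sum _ _ fun A _ => (d A).fun_mul (d' A), along, along, ← Finset.sum_add_distrib]
  refine Finset.sum_congr rfl fun A _ => ?_
  rw [pd_mul i (d A) (d' A), pd_comm_scri ha i A.succ hq]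

theorem along_sub (Y : Fin 2 → ScriPt → ℝ) (ha : ContDiffOn ℝ (⊤ : ℕ∞) a D.scri)
    (hb : ContDiffOn ℝ (⊤ : ℕ∞) b D.scri) (hq : q ∈ D.scri) :
    along Y (fun x => a x - b x) q = along Y a q - along Y b q := by
  simp only [along, ← Finset.sum_sub_distrib]
  refine Finset.sum_congr rfl fun A _ => ?_
  rw [pd_sub _ (sdiff ha hq) (sdiff hb hq)]
  ring

theorem along_add (Y : Fin 2 → ScriPt → ℝ) (ha : ContDiffOn ℝ (⊤ : ℕ∞) a D.scri)
    (hb : ContDiffOn ℝ (⊤ : ℕ∞) b D.scri) (hq : q ∈ D.scri) :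
    along Y (fun x => a x + b x) q = along Y a q + along Y b q := by
  simp only [along, ← Finset.sum_add_distrib]
  refine Finset.sum_congr rfl fun A _ => ?_
  rw [pd_add _ (sdiff ha hq) (sdiff hb hq)]
  ring

theorem along_mul (Y : Fin 2 → ScriPt → ℝ) (ha : ContDiffOn ℝ (⊤ : ℕ∞) a D.scri)
    (hb : ContDiffOn ℝ (⊤ : ℕ∞) b D.scri) (hq : q ∈ D.scri) :
    along Y (fun x => a x * b x) q = along Y a q * b q + a q * along Y b q := by
  simp only [along, Finset.sum_mul, Finset.mul_sum, ← Finset.sum_add_distrib]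
  refine Finset.sum_congr rfl fun A _ => ?_
  rw [pd_mul _ (sdiff ha hq) (sdiff hb hq)]
  ring

theorem along_congr (Y : Fin 2 → ScriPt → ℝ) (h : ∀ x ∈ D.scri, a x = b x) (hq : q ∈ D.scri) :
    along Y a q = along Y b q :=
  Finset.sum_congr rfl fun _ _ => by rw [pd_congr D.isOpen_scri _ h hq]

namespace IsConf
variable (hY : IsConf D Y)
include hY

/-- The components of a conformal Killing vector are harmonic. -/
theorem flap_zero (hq : q ∈ D.scri) (A : Fin 2) : flap (Y A) q = 0 := by
  have h1 := fun i => pd_congr D.isOpen_scri i hY.cr hq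
  have h2 : ∀ i, pd i (pd 2 (Y 0)) q = -pd i (pd 1 (Y 1)) q := fun i => by
    rw [pd_congr D.isOpen_scri i hY.cr' hq, pd_neg]
  have c0 := pd_comm_scri (hY.smooth 0) 1 2 hq
  have c1 := pd_comm_scri (hY.smooth 1) 1 2 hq
  have a1 := h1 1
  have a2 := h1 2
  have b1 := h2 1
  have b2 := h2 2
  rw [flap_eq]
  fin_cases A <;> simp <;> linarith

/-- The flat Laplacian commutes with ∂_A and annihilates each component of Y. -/
theorem flap_sdiv (hq : q ∈ D.scri) : flap (sdiv Y) q = 0 := by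
  have e : flap (sdiv Y) q = ∑ A : Fin 2, flap (pd A.succ (Y A)) q := by
    have e' : sdiv Y = fun q => pd 1 (Y 0) q + pd 2 (Y 1) q := funext (sdiv_eq Y)
    rw [e', flap_add (smooth_pdf (hY.smooth 0) 1) (smooth_pdf (hY.smooth 1) 2) hq,
      Fin.sum_univ_two]
    simp
  rw [e]
  refine Finset.sum_eq_zero fun A _ => ?_
  rw [← pd_flap (hY.smooth A) _ hq, pd_congr (G := fun _ => 0) D.isOpen_scri _
    (fun x hx => hY.flap_zero hx A) hq, pd_const]

/-- The Laplacian commutes with a conformal Killing vector up to a rescaling. -/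
theorem flap_along (ha : ContDiffOn ℝ (⊤ : ℕ∞) a D.scri) (hq : q ∈ D.scri) :
    flap (along Y a) q = sdiv Y q * flap a q + along Y (flap a) q := by
  have s := fun A : Fin 2 => (hY.smooth A).mul (smooth_pdf ha A.succ)
  have e : along Y a = fun q => Y 0 q * pd 1 a q + Y 1 q * pd 2 a q := funext (along_eq Y a)
  rw [e, flap_add ((hY.smooth 0).mul (smooth_pdf ha 1)) ((hY.smooth 1).mul (smooth_pdf ha 2)) hq,
    flap_mul (hY.smooth 0) (smooth_pdf ha 1) hq, flap_mul (hY.smooth 1) (smooth_pdf ha 2) hq,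
    hY.flap_zero hq, hY.flap_zero hq, along_eq, sdiv_eq, pd_flap ha 1 hq, pd_flap ha 2 hq,
    flap_eq a]
  simp only [Fin.sum_univ_two, Fin.succ_zero_eq_one, Fin.succ_one_eq_two, hY.cr q hq, hY.cr' q hq,
    pd_comm_scri ha 1 2 hq]
  ring

end IsConf

end conf

/-! ## Characterization of the symmetries -/

section symmetry
variable {D : Region} {M : NUMetric D}

theorem BigO.congr {n : ℤ} {F G : Pt → ℝ} (h : BigO D n F) (e : ∀ p ∈ D.bulk, F p = G p) :
    BigO D n G := bigO_iff.2 fun k => (bigO_iff.1 h k).congr e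

theorem SmallO.congr {n : ℤ} {F G : Pt → ℝ} (h : SmallO D n F) (e : ∀ p ∈ D.bulk, F p = G p) :
    SmallO D n G := smallO_iff.2 fun k => (smallO_iff.1 h k).congr e

theorem pd_vec_congr {ξ η : VField} (h : ∀ p ∈ D.bulk, ξ p = η p) {p : Pt} (hp : p ∈ D.bulk)
    (i : Fin 4) : pd i ξ p = pd i η p := by
  have : ξ =ᶠ[𝓝 p] η := by filter_upwards [D.isOpen_bulk.mem_nhds hp] with x hx using h x hx
  simp [pd, this.fderiv_eq]

theorem lieInv_congr {ξ η : VField} (g : Tensor2) (h : ∀ p ∈ D.bulk, ξ p = η p) {p : Pt}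
    (hp : p ∈ D.bulk) (μ ν : Fin 4) : lieInv ξ g μ ν p = lieInv η g μ ν p := by
  simp only [lieInv, h p hp, pd_vec_congr h hp]

theorem divergence_congr {ξ η : VField} (g : Tensor2) (h : ∀ p ∈ D.bulk, ξ p = η p) {p : Pt}
    (hp : p ∈ D.bulk) : divergence g ξ p = divergence g η p := by
  simp only [divergence]
  congr 1
  refine Finset.sum_congr rfl fun ρ _ => pd_congr D.isOpen_bulk ρ (fun x hx => ?_) hp
  rw [h x hx]

theorem IsNUSymmetry.congr {ω : ScriPt → ℝ} {ξ η : VField} (hs : IsNUSymmetry M ω ξ)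
    (h : ∀ p ∈ D.bulk, ξ p = η p) : IsNUSymmetry M ω η where
  smooth := hs.smooth.congr fun p hp => (h p hp).symm
  uu p hp := by rw [← lieInv_congr M.g h hp]; exact hs.uu p hp
  uA p hp A := by rw [← lieInv_congr M.g h hp]; exact hs.uA p hp A
  ur p hp := by rw [← lieInv_congr M.g h hp]; exact hs.ur p hp
  div := hs.div.congr fun p hp =>
    pd_congr D.isOpen_bulk 1 (fun _ hx => divergence_congr M.g h hx) hp
  rA A := (hs.rA A).congr fun p hp => lieInv_congr M.g h hp _ _
  AB A B := (hs.AB A B).congr fun p hp => by rw [lieInv_congr M.g h hp]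
  rr := hs.rr.congr fun p hp => by rw [lieInv_congr M.g h hp]

variable {f Z ω : ScriPt → ℝ} {Y : Fin 2 → ScriPt → ℝ}

/-- The evolution equation of `f`. -/
def Evolves (M : NUMetric D) (f ω : ScriPt → ℝ) (Y : Fin 2 → ScriPt → ℝ) : Prop :=
  ∀ q ∈ D.scri, pd 0 f q = f q * pd 0 M.φ q + 1 / 2 * sdiv Y q + along Y M.φ q - ω q

/-- Supplies Δ̄ ∂_u f, which enters the r⁰ coefficient of L_ξ g^{rr} through ∂_u Z with Z = ½ Δ̄ f.
The divergence of Y drops out because it is harmonic. -/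
theorem flap_evolves (hf : ContDiffOn ℝ (⊤ : ℕ∞) f D.scri) (hω : ContDiffOn ℝ (⊤ : ℕ∞) ω D.scri)
    (hY : IsConf D Y) (he : Evolves M f ω Y) {q : ScriPt} (hq : q ∈ D.scri) :
    flap (pd 0 f) q = flap f q * pd 0 M.φ q
      + 2 * ∑ A : Fin 2, pd A.succ f q * pd A.succ (pd 0 M.φ) q + f q * flap (pd 0 M.φ) q
      + sdiv Y q * flap M.φ q + along Y (flap M.φ) q - flap ω q := by
  have s1 : ContDiffOn ℝ (⊤ : ℕ∞) (fun q => f q * pd 0 M.φ q) D.scri := hf.mul (M.smooth_pdφ 0)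
  have s2 : ContDiffOn ℝ (⊤ : ℕ∞) (fun q => 1 / 2 * sdiv Y q) D.scri :=
    contDiffOn_const.mul (smooth_sdiv hY.smooth)
  have s3 : ContDiffOn ℝ (⊤ : ℕ∞) (fun q => f q * pd 0 M.φ q + 1 / 2 * sdiv Y q) D.scri :=
    s1.add s2
  have s4 := smooth_along hY.smooth M.smooth_φ
  have s5 : ContDiffOn ℝ (⊤ : ℕ∞)
      (fun q => f q * pd 0 M.φ q + 1 / 2 * sdiv Y q + along Y M.φ q) D.scri := s3.add s4
  rw [flap_congr he hq, flap_sub s5 hω hq, flap_add s3 s4 hq, flap_add s1 s2 hq,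
    flap_mul hf (M.smooth_pdφ 0) hq, flap_const_mul (smooth_sdiv hY.smooth) _ hq,
    hY.flap_sdiv hq, hY.flap_along M.smooth_φ hq]
  ring

/-- The hypotheses make the leading coefficients in the expansions of g^{rA}, of g^{AB} and of the
divergence vanish or match. The condition on g^{rr} imposes nothing new: it follows from the
evolution equation, its u-derivative and its Laplacian. -/
theorem isNUSymmetry_gen (hf : ContDiffOn ℝ (⊤ : ℕ∞) f D.scri)
    (hω : ContDiffOn ℝ (⊤ : ℕ∞) ω D.scri) (hY : IsConf D Y)
    (hu : ∀ q ∈ D.scri, ∀ A, pd 0 (Y A) q = 0) (he : Evolves M f ω Y) :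
    IsNUSymmetry M ω (M.gen f (fun q => 1 / 2 * lap M.φ f q) Y) := by
  have hZ : ContDiffOn ℝ (⊤ : ℕ∞) (fun q => 1 / 2 * lap M.φ f q) D.scri :=
    contDiffOn_const.mul (smooth_lap M.smooth_φ hf)
  have hs := smooth_gen (M := M) hf hZ hY.smooth
  have hg := fun p (hp : p ∈ D.bulk) => (gauge_iff (M := M) hs hp).2
    (gen_gauge hf hZ hY.smooth hp)
  have hcr : ∀ q ∈ D.scri, ∀ A B : Fin 2, pd A.succ (Y B) q + pd B.succ (Y A) q
      = if A = B then sdiv Y q else 0 := by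
    intro q hq A B
    have h1 := hY.cr q hq
    have h2 := hY.cr' q hq
    rw [sdiv_eq]
    fin_cases A <;> fin_cases B <;> simp <;> linarith
  refine ⟨hs, fun p hp => (hg p hp).1, fun p hp => (hg p hp).2.2, fun p hp => (hg p hp).2.1,
    ?_, fun A => ?_, fun A B => ?_, ?_⟩
  · have h := asym_pd_divergence (M := M) hf hZ hY.smooth
    exact SmallO.congr (D := D.pos) h.smallO fun p _ => by ring
  · have h := asym_lieInv_1A (M := M) hf hZ hY.smooth A
    exact BigO.congr (D := D.pos) h.bigO fun p hp => by rw [hu _ hp.1, sub_zero]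
  -- Replacing g^{AB} by its leading part in the term -2 ω g^{AB} costs 2 ω `eRem`, which is O(r⁻³).
  · have h := (asym_lieInv_AB (M := M) hf hZ hY.smooth A B).add
      ((Asym.scri_mul (D := D.pos) hω (M.asym_e A B)).const_mul 2)
    refine BigO.congr (D := D.pos) h.bigO fun p hp => ?_
    have hb := Region.bulk_pos_subset hp
    have e1 := he _ hp.1
    have e2 := hcr _ hp.1 A B
    rw [along] at e1
    rw [M.inv_g hb, M.ginv_AB, M.hInv_eq, e2]
    by_cases hAB : A = B
    · simp only [hAB, if_true]
      rw [e1]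
      ring
    · simp only [hAB, if_false]
      ring
  · have h := asym_lieInv_11 (M := M) hf hZ hY.smooth
    refine BigO.congr (D := D.pos) h.bigO fun p hp => ?_
    have hq : toScri p ∈ D.scri := hp.1
    set q := toScri p
    -- The u-derivative of the evolution equation, which settles the coefficient of r; the terms
    -- with ∂_u Y vanish.
    have e1 : pd 0 (pd 0 f) q = pd 0 f q * pd 0 M.φ q + f q * pd 0 (pd 0 M.φ) q
        + along Y (pd 0 M.φ) q - pd 0 ω q := by
      have s4 := smooth_along hY.smooth M.smooth_φ
      have d0 := sdiff hf hq
      have d1 := sdiff (M.smooth_pdφ 0) hq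
      have d2 := sdiff (smooth_sdiv hY.smooth) hq
      have d3 := sdiff s4 hq
      have d4 := sdiff hω hq
      have z : pd 0 (sdiv Y) q = 0 := by
        have e' : sdiv Y = fun q => ∑ A : Fin 2, pd A.succ (Y A) q := rfl
        rw [e', pd_sum _ _ fun A _ => sdiff (smooth_pdf (hY.smooth A) _) hq]
        refine Finset.sum_eq_zero fun A _ => ?_
        rw [pd_comm_scri (hY.smooth A) 0 A.succ hq,
          pd_congr (G := fun _ => 0) D.isOpen_scri _ (fun x hx => hu x hx A) hq, pd_const]
      have z' : along (fun A => pd 0 (Y A)) M.φ q = 0 := by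
        simp [along, hu q hq]
      rw [pd_congr D.isOpen_scri 0 he hq,
        pd_sub 0 (((d0.fun_mul d1).fun_add (d2.const_mul _)).fun_add d3) d4,
        pd_add 0 ((d0.fun_mul d1).fun_add (d2.const_mul _)) d3,
        pd_add 0 (d0.fun_mul d1) (d2.const_mul _), pd_mul 0 d0 d1, pd_const_mul 0 _ d2, z,
        pd_along hY.smooth M.smooth_φ 0 hq, z']
      ring
    have e2 := flap_evolves hf hω hY he hq
    have e3 := he q hq
    have hK := M.smooth_K
    have hl := smooth_lap M.smooth_φ hf
    have e4 : ∀ i, pd i (fun q => 1 / 2 * lap M.φ f q) q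
        = 1 / 2 * (M.m q * (flap (pd i f) q - 2 * pd i M.φ q * flap f q)) := fun i => by
      rw [pd_const_mul i _ (sdiff hl hq), pd_lap hf i hq]
    have e5 := fun i => pd_lap (M := M) M.smooth_φ i hq
    have e6 : ∀ a, lap M.φ a q = M.m q * flap a q := fun a => rfl
    rw [e4, e1, e2, e5]
    simp only [e5, e6, along, Fin.sum_univ_two, pd_flap M.smooth_φ _ hq] at e3 ⊢
    -- With ∂_u² f and the Laplacian of ∂_u f substituted, the two sides differ by 2 Δ̄φ times the
    -- evolution equation itself.
    linear_combination (2 * M.m q * flap M.φ q) * e3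

end symmetry

end NewmanUnti

namespace NewmanUnti

/-! ## The conformal factor -/

section confFactor
variable {D : Region} {q : ScriPt}

theorem tendsto_div_sq {F : Pt → ℝ} {a : ScriPt → ℝ}
    (h : Asym D.pos false 1 fun p => F p - p 1 ^ 2 * a (toScri p)) (hq : q ∈ D.scri) :
    Tendsto (fun r => F (lift q r) / r ^ 2) atTop (𝓝 (a q)) := by
  have hi := Asym.radius_inv (D := D)
  have h1 := (hi.mulO hi (l := -2)).mulO h (l := -1)
  have h2 := (h1.tendsto_zero (D := D.pos) hq).add_const (a q)
  rw [zero_add] at h2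
  refine h2.congr' ?_
  filter_upwards [eventually_gt_atTop 0] with r hr
  simp only [lift_apply_one, toScri_lift]
  field_simp
  ring

/-- Stated for an arbitrary tensor because it also has to evaluate the conformal factor of the
varied metric, which is not packaged as an `NUMetric`. -/
theorem confFactor_of_asym {g : Tensor2} {a : ScriPt → ℝ}
    (h : Asym D.pos false 1 fun p => g p 2 2 + g p 3 3 - p 1 ^ 2 * a (toScri p))
    (hq : q ∈ D.scri) : confFactor g q = 1 / 2 * Real.log (a q / 2) := by
  have h1 := (tendsto_div_sq h hq).div_const 2
  have e : (fun r : ℝ => (g (lift q r) 2 2 + g (lift q r) 3 3) / r ^ 2 / 2)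
      = fun r => (g (lift q r) 2 2 + g (lift q r) 3 3) / (2 * r ^ 2) := by
    funext r
    rw [div_div, mul_comm]
  rw [e] at h1
  rw [confFactor, h1.limUnder_eq]

theorem NUMetric.asym_trace (M : NUMetric D) : Asym D.pos false 1 fun p =>
    M.g p 2 2 + M.g p 3 3 - p 1 ^ 2 * (2 * Real.exp (2 * M.φ (toScri p))) := by
  refine ((M.asym_hRem 0 0).add (M.asym_hRem 1 1)).mono_pos.congr fun p hp => ?_
  rw [M.g_eq (Region.bulk_pos_subset hp)]
  simp
  ring

theorem NUMetric.confFactor_g (M : NUMetric D) (hq : q ∈ D.scri) :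
    confFactor M.g q = M.φ q := by
  rw [confFactor_of_asym (a := fun q => 2 * Real.exp (2 * M.φ q)) M.asym_trace hq,
    mul_div_cancel_left₀ _ two_ne_zero, Real.log_exp]
  ring

end confFactor

/-! ## The functions `f` -/

/-- A vector field on the celestial sphere as a vector field on Scri. -/
def vec (Y : Ang → Ang) (A : Fin 2) (q : ScriPt) : ℝ := Y (ang q) A

section fFun
variable {D : Region} {Y : Ang → Ang} {T : Ang → ℝ} {φ φ' ω : ScriPt → ℝ} {q : ScriPt}

theorem diff_ckv (hY : Y ∈ ckv D) {x : Ang} (hx : x ∈ D.U) (A : Fin 2) :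
    DifferentiableAt ℝ (fun x => Y x A) x :=
  differentiableAt_pi.1 ((ckv_contDiffAt hY hx).differentiableAt (by simp)) A

theorem pd_succ_vec (hY : Y ∈ ckv D) (hq : q ∈ D.scri) (A B : Fin 2) :
    pd B.succ (vec Y A) q = pd B Y (ang q) A := by
  rw [pd_apply _ _ ((ckv_contDiffAt hY hq.2).differentiableAt (by simp)),
    ← pd_succ_comp_ang B (diff_ckv hY hq.2 A)]
  rfl

theorem pd_zero_vec (hY : Y ∈ ckv D) (hq : q ∈ D.scri) (A : Fin 2) : pd 0 (vec Y A) q = 0 :=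
  pd_zero_comp_ang (diff_ckv hY hq.2 A)

theorem smooth_comp_ang (hT : T ∈ smoothFns D.U) :
    ContDiffOn ℝ (⊤ : ℕ∞) (fun q => T (ang q)) D.scri :=
  hT.1.comp contDiff_ang.contDiffOn fun _ hq => hq.2

theorem isConf_vec (hY : Y ∈ ckv D) : IsConf D (vec Y) where
  smooth A := (contDiffOn_pi.1 hY.1 A).comp contDiff_ang.contDiffOn fun _ hq => hq.2
  cr q hq := by
    have h := hY.2.2 _ hq.2 0 0
    have e1 := pd_succ_vec hY hq 0 0
    have e2 := pd_succ_vec hY hq 1 1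
    simp only [flatDiv, Fin.sum_univ_two, if_true, ← e1, ← e2] at h
    simp only [Fin.succ_zero_eq_one, Fin.succ_one_eq_two] at h
    linarith
  cr' q hq := by
    have h := hY.2.2 _ hq.2 0 1
    have e1 := pd_succ_vec hY hq 0 1
    have e2 := pd_succ_vec hY hq 1 0
    simp only [zero_ne_one, if_false, ← e1, ← e2] at h
    simp only [Fin.succ_zero_eq_one, Fin.succ_one_eq_two] at h
    linarith

theorem sdiv_vec (hY : Y ∈ ckv D) (hq : q ∈ D.scri) : sdiv (vec Y) q = flatDiv Y (ang q) :=
  Finset.sum_congr rfl fun A _ => pd_succ_vec hY hq A A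

theorem psi_eq (φ : ScriPt → ℝ) (hY : Y ∈ ckv D) (hq : q ∈ D.scri) :
    psi Y φ q = sdiv (vec Y) q + 2 * along (vec Y) φ q := by
  rw [sdiv_vec hY hq]
  rfl

/-- The integrand in the definition of `f`. -/
noncomputable def source (Y : Ang → Ang) (ω φ : ScriPt → ℝ) (q : ScriPt) : ℝ :=
  Real.exp (-φ q) * (psi Y φ q - 2 * ω q)

theorem fFun_eq (Y : Ang → Ang) (T : Ang → ℝ) (ω φ : ScriPt → ℝ) (q : ScriPt) :
    fFun Y T ω φ q = Real.exp (φ q) * (T (ang q) + 1 / 2 * uInt (source Y ω φ) q) := rfl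

/-- The conformal factor read off from a metric is controlled on Scri only; this is enough because
the integration path from u = 0 stays inside Scri, and Scri is open. -/
theorem fFun_congr (Y : Ang → Ang) (T : Ang → ℝ) (ω : ScriPt → ℝ) (h : ∀ q ∈ D.scri, φ q = φ' q)
    (hq : q ∈ D.scri) : fFun Y T ω φ q = fFun Y T ω φ' q := by
  have e : ∀ x ∈ D.scri, source Y ω φ x = source Y ω φ' x := fun x hx => by
    simp only [source, psi, h x hx, pd_congr D.isOpen_scri _ h hx]
  rw [fFun_eq, fFun_eq, h q hq, uInt_congr e (mem_star_scri hq)]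

theorem killing_congr (Y : Ang → Ang) (g : Tensor2) {f f' : ScriPt → ℝ}
    (h : ∀ q ∈ D.scri, φ q = φ' q) (hf : ∀ q ∈ D.scri, f q = f' q) {p : Pt} (hp : p ∈ D.bulk) :
    killing Y φ f g p = killing Y φ' f' g p := by
  have e : lap φ f (toScri p) = lap φ' f' (toScri p) := by
    rw [lap_congr hf hp.1, lap_eq, lap_eq, h _ hp.1]
  simp only [killing, hf _ hp.1, pd_congr D.isOpen_scri _ hf hp.1, e]

variable (hY : Y ∈ ckv D) (hT : T ∈ smoothFns D.U) (hω : ContDiffOn ℝ (⊤ : ℕ∞) ω D.scri)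
  (hφ : ContDiffOn ℝ (⊤ : ℕ∞) φ D.scri)
include hY hω hφ

theorem smooth_source : ContDiffOn ℝ (⊤ : ℕ∞) (source Y ω φ) D.scri := by
  have hs := (isConf_vec hY).smooth
  have h1 : ContDiffOn ℝ (⊤ : ℕ∞) (psi Y φ) D.scri :=
    ((smooth_sdiv hs).add (contDiffOn_const.mul (smooth_along hs hφ))).congr
      fun q hq => psi_eq φ hY hq
  exact hφ.neg.exp.mul (h1.sub (contDiffOn_const.mul hω))

theorem smooth_uInt_source : ContDiffOn ℝ (⊤ : ℕ∞) (uInt (source Y ω φ)) D.scri :=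
  (contDiffOn_uInt D.isOpen_scri (smooth_source hY hω hφ)).mono fun _ hq => mem_star_scri hq

include hT

theorem smooth_fFun : ContDiffOn ℝ (⊤ : ℕ∞) (fFun Y T ω φ) D.scri :=
  hφ.exp.mul ((smooth_comp_ang hT).add (contDiffOn_const.mul (smooth_uInt_source hY hω hφ)))

/-- Variation of constants: differentiating the prefactor e^φ gives f ∂_u φ, and differentiating the
integral gives the source ½ (ψ - 2 ω). -/
theorem pd_zero_fFun (hq : q ∈ D.scri) : pd 0 (fFun Y T ω φ) q
    = fFun Y T ω φ q * pd 0 φ q + 1 / 2 * sdiv (vec Y) q + along (vec Y) φ q - ω q := by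
  have d1 := sdiff hφ hq
  have d2 := sdiff (smooth_comp_ang hT) hq
  have d3 := sdiff (smooth_uInt_source hY hω hφ) hq
  have e : fFun Y T ω φ
    = fun q => Real.exp (φ q) * (T (ang q) + 1 / 2 * uInt (source Y ω φ) q) := rfl
  rw [e, pd_mul _ d1.exp (d2.fun_add (d3.const_mul _)), pd_add _ d2 (d3.const_mul _),
    pd_const_mul _ _ d3, pd_exp _ d1,
    pd_zero_uInt D.isOpen_scri (smooth_source hY hω hφ) (mem_star_scri hq),
    pd_zero_comp_ang ((fns_contDiffAt hT hq.2).differentiableAt (by simp)), source,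
    psi_eq φ hY hq, Real.exp_neg]
  have h0 := (Real.exp_pos (φ q)).ne'
  field_simp
  ring

end fFun

theorem fFun_at_zero (Y : Ang → Ang) (T : Ang → ℝ) (ω φ : ScriPt → ℝ) {q : ScriPt}
    (hq : q 0 = 0) : fFun Y T ω φ q = Real.exp (φ q) * T (ang q) := by
  simp [fFun, hq]

/-! ## The asymptotic Killing vectors -/

section akv
variable {D : Region} (M : NUMetric D) {p : Pt}

theorem Rescaling.smooth (w : Rescaling D) : ContDiffOn ℝ (⊤ : ℕ∞) w.fn D.scri := w.2.1

/-- The `u`-component of `ξ[Y, T, ω; g]`. -/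
noncomputable def NUMetric.F (a : ExtBMS4 D) : ScriPt → ℝ := fFun a.1.Y a.1.T a.2.fn M.φ

theorem NUMetric.smooth_F (a : ExtBMS4 D) : ContDiffOn ℝ (⊤ : ℕ∞) (M.F a) D.scri :=
  smooth_fFun a.1.1.2 a.1.2.2 a.2.smooth M.smooth_φ

theorem NUMetric.evolves_F (a : ExtBMS4 D) : Evolves M (M.F a) a.2.fn (vec a.1.Y) :=
  fun _ hq => pd_zero_fFun a.1.1.2 a.1.2.2 a.2.smooth M.smooth_φ hq

/-- The `r⁰`-term of the radial component of `ξ[Y, T, ω; g]`. -/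
noncomputable def NUMetric.Z (f : ScriPt → ℝ) (q : ScriPt) : ℝ := 1 / 2 * lap M.φ f q

theorem NUMetric.smooth_Z {f : ScriPt → ℝ} (hf : ContDiffOn ℝ (⊤ : ℕ∞) f D.scri) :
    ContDiffOn ℝ (⊤ : ℕ∞) (M.Z f) D.scri :=
  contDiffOn_const.mul (smooth_lap M.smooth_φ hf)

theorem killing_eq_gen (Y : Ang → Ang) (f : ScriPt → ℝ) (hp : p ∈ D.bulk) :
    killing Y M.φ f M.g p = M.gen f (M.Z f) (vec Y) p := by
  have hV : ∀ A : Fin 2, ∫ s in Set.Ioi (p 1), -(M.g (Function.update p 1 s))⁻¹ 1 A.succ.succ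
      = tail (fun x => M.V x A) p := fun A =>
    MeasureTheory.setIntegral_congr_fun measurableSet_Ioi fun s hs => by
      simp only [M.inv_g (Region.update_one_mem hp (le_of_lt hs)), M.ginv_1A, neg_neg]
  have hE : ∀ A B : Fin 2,
      ∫ s in Set.Ioi (p 1), (M.g (Function.update p 1 s))⁻¹ A.succ.succ B.succ.succ
      = tail (M.hInv A B) p := fun A B =>
    MeasureTheory.setIntegral_congr_fun measurableSet_Ioi fun s hs => by
      simp only [M.inv_g (Region.update_one_mem hp (le_of_lt hs)), M.ginv_AB]
  simp only [killing, hV, hE]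
  rfl

theorem akv_eq (a : ExtBMS4 D) (hp : p ∈ D.bulk) :
    akv a M.g p = M.gen (M.F a) (M.Z (M.F a)) (vec a.1.Y) p := by
  rw [← killing_eq_gen M a.1.Y (M.F a) hp]
  exact killing_congr _ _ (fun q hq => M.confFactor_g hq)
    (fun q hq => fFun_congr _ _ _ (fun q hq => M.confFactor_g hq) hq) hp

theorem isNUSymmetry_akv (a : ExtBMS4 D) : IsNUSymmetry M a.2.fn (akv a M.g) :=
  (isNUSymmetry_gen (M.smooth_F a) a.2.smooth (isConf_vec a.1.1.2)
    (fun _ hq A => pd_zero_vec a.1.1.2 hq A) (M.evolves_F a)).congr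
    fun _ hp => (akv_eq M a hp).symm

/-! ### Linearity and injectivity -/

theorem source_linear (a b : ExtBMS4 D) (c : ℝ) {q : ScriPt} (hq : q ∈ D.scri) :
    source (a + c • b).1.Y (a + c • b).2.fn M.φ q
      = source a.1.Y a.2.fn M.φ q + c * source b.1.Y b.2.fn M.φ q := by
  have d1 := (a.1.Y_smooth hq.2).differentiableAt (by simp)
  have d2 := (b.1.Y_smooth hq.2).differentiableAt (by simp)
  have eY : (a + c • b).1.Y = a.1.Y + c • b.1.Y := rfl
  have ew : (a + c • b).2.fn = a.2.fn + c • b.2.fn := rfl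
  have e : flatDiv (a.1.Y + c • b.1.Y) (ang q)
      = flatDiv a.1.Y (ang q) + c * flatDiv b.1.Y (ang q) := by
    simp [flatDiv, pd, fderiv_add d1 (d2.const_smul c), fderiv_const_smul d2 c]
    ring
  rw [eY, ew]
  simp only [source, psi, e, Fin.sum_univ_two, Pi.add_apply, Pi.smul_apply, smul_eq_mul]
  ring

theorem NUMetric.F_linear (a b : ExtBMS4 D) (c : ℝ) {q : ScriPt} (hq : q ∈ D.scri) :
    M.F (a + c • b) q = M.F a q + c * M.F b q := by
  have sa : ContinuousOn (source a.1.Y a.2.fn M.φ) D.scri :=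
    (smooth_source a.1.1.2 a.2.smooth M.smooth_φ).continuousOn
  have sb : ContinuousOn (fun x => c * source b.1.Y b.2.fn M.φ x) D.scri :=
    continuousOn_const.mul (smooth_source b.1.1.2 b.2.smooth M.smooth_φ).continuousOn
  have eT : (a + c • b).1.T (ang q) = a.1.T (ang q) + c * b.1.T (ang q) := rfl
  have hs : uInt (source (a + c • b).1.Y (a + c • b).2.fn M.φ) q
      = uInt (source a.1.Y a.2.fn M.φ) q + c * uInt (source b.1.Y b.2.fn M.φ) q := by
    rw [uInt_congr (fun x hx => source_linear M a b c hx) (mem_star_scri hq),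
      uInt_add sa sb (mem_star_scri hq), uInt_const_mul]
  simp only [NUMetric.F, fFun_eq, hs, eT]
  ring

theorem gen_linear {f f₁ f₂ : ScriPt → ℝ} {Y Y₁ Y₂ : Ang → Ang} {c : ℝ}
    (h₁ : ContDiffOn ℝ (⊤ : ℕ∞) f₁ D.scri) (h₂ : ContDiffOn ℝ (⊤ : ℕ∞) f₂ D.scri)
    (hf : ∀ q ∈ D.scri, f q = f₁ q + c * f₂ q) (hY : Y = Y₁ + c • Y₂) (hp : p ∈ D.bulk) :
    M.gen f (M.Z f) (vec Y) p
      = M.gen f₁ (M.Z f₁) (vec Y₁) p + c • M.gen f₂ (M.Z f₂) (vec Y₂) p := by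
  have hd : ∀ i, pd i f (toScri p) = pd i f₁ (toScri p) + c * pd i f₂ (toScri p) := fun i => by
    rw [pd_congr D.isOpen_scri i hf hp.1, pd_add i (sdiff h₁ hp.1) ((sdiff h₂ hp.1).const_mul c),
      pd_const_mul i c (sdiff h₂ hp.1)]
  have hl : flap f (toScri p) = flap f₁ (toScri p) + c * flap f₂ (toScri p) := by
    have h₂' : ContDiffOn ℝ (⊤ : ℕ∞) (fun x => c * f₂ x) D.scri := contDiffOn_const.mul h₂
    rw [flap_congr hf hp.1, flap_add h₁ h₂' hp.1, flap_const_mul h₂ c hp.1]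
  funext μ
  revert μ
  rw [NUMetric.forall_fin_four]
  refine ⟨?_, ?_, fun A => ?_⟩
  · simp only [Pi.add_apply, Pi.smul_apply, NUMetric.gen_zero, hf _ hp.1, smul_eq_mul]
  · simp only [Pi.add_apply, Pi.smul_apply, NUMetric.gen_one, NUMetric.Z, NUMetric.rho, lap_eq,
      hd, hl, Fin.sum_univ_two, smul_eq_mul]
    ring
  · simp only [Pi.add_apply, Pi.smul_apply, NUMetric.gen_ang, NUMetric.sigma, vec, hY, hd,
      Fin.sum_univ_two, smul_eq_mul]
    ring

theorem akv_linear (a b : ExtBMS4 D) (c : ℝ) (hp : p ∈ D.bulk) :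
    akv (a + c • b) M.g p = akv a M.g p + c • akv b M.g p := by
  rw [akv_eq M _ hp, akv_eq M a hp, akv_eq M b hp]
  exact gen_linear M (M.smooth_F a) (M.smooth_F b) (fun q hq => M.F_linear a b c hq) rfl hp

theorem akv_zero (hp : p ∈ D.bulk) : akv (0 : ExtBMS4 D) M.g p = 0 := by
  have h := akv_linear M (0 : ExtBMS4 D) 0 1 hp
  simpa using h

/-- The linear map `(Y, T, ω) ↦ ξ[Y, T, ω; g]`. -/
noncomputable def akvMap : ExtBMS4 D →ₗ[ℝ] VField where
  toFun a := D.bulk.indicator (akv a M.g)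
  map_add' a b := by
    funext p
    by_cases hp : p ∈ D.bulk
    · have h := akv_linear M a b 1 hp
      simp only [one_smul] at h
      simp [hp, h]
    · simp [hp]
  map_smul' c b := by
    funext p
    by_cases hp : p ∈ D.bulk
    · have h := akv_linear M 0 b c hp
      rw [zero_add, akv_zero M hp, zero_add] at h
      simp [hp, h]
    · simp [hp]

theorem akvMap_apply (a : ExtBMS4 D) : akvMap M a = D.bulk.indicator (akv a M.g) := rfl

/-- One point on each ray suffices. The u-component gives f = 0, so the ray integrals vanish and the
angular components give Y = 0; at u = 0 one has f = e^φ T, whence T = 0; the evolution equation then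
leaves ω = 0. -/
theorem eq_zero_of_akv_eq_zero {a : ExtBMS4 D} (h : ∀ p ∈ D.bulk, akv a M.g p = 0) : a = 0 := by
  have hm : ∀ q ∈ D.scri, lift q (D.R q + 1) ∈ D.bulk := fun q hq =>
    Region.lift_mem hq (lt_add_one _)
  have hg : ∀ q ∈ D.scri, ∀ μ, M.gen (M.F a) (M.Z (M.F a)) (vec a.1.Y) (lift q (D.R q + 1)) μ = 0 :=
    fun q hq μ => by rw [← akv_eq M a (hm q hq), h _ (hm q hq)]; rfl
  have hF : ∀ q ∈ D.scri, M.F a q = 0 := fun q hq => by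
    simpa [NUMetric.gen_zero] using hg q hq 0
  have hd : ∀ q ∈ D.scri, ∀ i, pd i (M.F a) q = 0 := fun q hq i => by
    rw [pd_congr (G := fun _ => 0) D.isOpen_scri i hF hq, pd_const]
  have hvY : ∀ q ∈ D.scri, ∀ A, vec a.1.Y A q = 0 := fun q hq A => by
    have := hg q hq A.succ.succ
    rw [NUMetric.gen_ang] at this
    simpa [NUMetric.sigma, hd q hq] using this
  have h0 : ∀ x ∈ D.U, (Fin.cons 0 x : ScriPt) ∈ D.scri := fun x hx => ⟨D.zero_mem_J, hx⟩
  have hY : a.1.Y = 0 := by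
    funext x
    by_cases hx : x ∈ D.U
    · exact funext fun A => hvY _ (h0 x hx) A
    · exact a.1.Y_off hx
  have hT : a.1.T = 0 := by
    funext x
    by_cases hx : x ∈ D.U
    · have h1 := hF _ (h0 x hx)
      rw [NUMetric.F, fFun_at_zero _ _ _ _ rfl] at h1
      exact (mul_eq_zero.1 h1).resolve_left (Real.exp_pos _).ne'
    · exact a.1.T_off hx
  refine Prod.ext (BMS4.ext' hY hT) (Subtype.ext (funext fun q => ?_))
  by_cases hq : q ∈ D.scri
  · have h1 := M.evolves_F a q hq
    have e1 : sdiv (vec a.1.Y) q = 0 := Finset.sum_eq_zero fun A _ => by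
      rw [pd_congr (G := fun _ => 0) D.isOpen_scri _ (fun q hq => hvY q hq A) hq, pd_const]
    have e2 : along (vec a.1.Y) M.φ q = 0 := Finset.sum_eq_zero fun A _ => by
      rw [hvY q hq, zero_mul]
    rw [hd q hq, hF q hq, e1, e2] at h1
    have : a.2.fn q = 0 := by linarith
    exact this
  · exact a.2.2.2 q hq

theorem injective_akvMap : Function.Injective (akvMap M) := by
  refine (injective_iff_map_eq_zero _).2 fun a ha => eq_zero_of_akv_eq_zero M fun p hp => ?_
  have := congrFun ha p
  simpa [akvMap_apply, hp] using this

end akv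

end NewmanUnti

namespace NewmanUnti

/-! ## Every symmetry is an asymptotic Killing vector -/

section surjective
variable {D : Region} {M : NUMetric D}

/-- A smooth function in the bulk that is constant along the rays is a smooth function on Scri. -/
theorem exists_scri_of_pd_one {F : Pt → ℝ} (hF : ContDiffOn ℝ (⊤ : ℕ∞) F D.bulk)
    (h : ∀ p ∈ D.bulk, pd 1 F p = 0) : ∃ a : ScriPt → ℝ, ContDiffOn ℝ (⊤ : ℕ∞) a D.scri ∧
      ∀ p ∈ D.bulk, F p = a (toScri p) := by
  refine ⟨fun q => F (lift q (D.R q + 1)), fun q hq => ?_, fun p hp => ?_⟩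
  · have hl : ContDiff ℝ (⊤ : ℕ∞) fun x : ScriPt => lift x (D.R q + 1) :=
      contDiff_lift.comp (contDiff_id.prodMk contDiff_const)
    have hm : lift q (D.R q + 1) ∈ D.bulk := Region.lift_mem hq (lt_add_one _)
    have h1 := (hF.contDiffAt (D.isOpen_bulk.mem_nhds hm)).comp q hl.contDiffAt
    -- `D.R` is merely continuous, so evaluation at radius `D.R x + 1` is not visibly smooth in x.
    -- Near `q` the radius is frozen at `D.R q + 1`, which changes nothing because F is constant
    -- along the rays.
    refine (h1.congr_of_eventuallyEq ?_).contDiffWithinAt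
    filter_upwards [D.isOpen_scri.mem_nhds hq,
      (D.continuousOn_R'.continuousAt (D.isOpen_scri.mem_nhds hq)).eventually
        (gt_mem_nhds (lt_add_one (D.R q)))] with x hx hR
    exact eq_of_pd_one_eq_zero hF h hx (lt_add_one _) hR
  · have := eq_of_pd_one_eq_zero hF h hp.1 hp.2 (lt_add_one _)
    rwa [lift_toScri] at this

theorem gen_congr {f f' Z Z' : ScriPt → ℝ} {Y Y' : Fin 2 → ScriPt → ℝ}
    (hf : ∀ q ∈ D.scri, f q = f' q) (hZ : ∀ q ∈ D.scri, Z q = Z' q)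
    (hY : ∀ q ∈ D.scri, ∀ A, Y A q = Y' A q) {p : Pt} (hp : p ∈ D.bulk) :
    M.gen f Z Y p = M.gen f' Z' Y' p := by
  simp only [NUMetric.gen, NUMetric.rho, NUMetric.sigma, hf _ hp.1, hZ _ hp.1, hY _ hp.1,
    pd_congr D.isOpen_scri _ hf hp.1]

/-- Solution of the gauge conditions. -/
theorem exists_gen {ξ : VField} (hξ : ContDiffOn ℝ (⊤ : ℕ∞) ξ D.bulk)
    (hg : ∀ p ∈ D.bulk, ∀ μ, pd 1 (fun x => ξ x μ) p
      = ∑ ν, M.ginv μ ν p * pd ν (fun x => ξ x 0) p) :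
    ∃ (f Z : ScriPt → ℝ) (Y : Fin 2 → ScriPt → ℝ), ContDiffOn ℝ (⊤ : ℕ∞) f D.scri ∧
      ContDiffOn ℝ (⊤ : ℕ∞) Z D.scri ∧ (∀ A, ContDiffOn ℝ (⊤ : ℕ∞) (Y A) D.scri) ∧
      ∀ p ∈ D.bulk, ξ p = M.gen f Z Y p := by
  have hc := smooth_comp hξ
  have d0 : ∀ p ∈ D.bulk, pd 1 (fun x => ξ x 0) p = 0 := by
    intro p hp
    have h := hg p hp 0
    rw [sum_four] at h
    simp only [NUMetric.ginv_00, NUMetric.ginv_01, NUMetric.ginv_0A, zero_mul,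
      Finset.sum_const_zero] at h
    linarith
  obtain ⟨f, hf, ef⟩ := exists_scri_of_pd_one (hc 0) d0
  -- The right-hand side of the gauge equations depends on ξ^u = f only, so ξ and `gen f 0 0` have
  -- the same r-derivative and differ by functions on Scri.
  have hF : ∀ p ∈ D.bulk, ∀ μ, pd 1 (fun x => ξ x μ) p
      = pd 1 (fun x => M.gen f 0 0 x μ) p := by
    intro p hp μ
    rw [hg p hp μ, gen_gauge (Z := 0) (Y := 0) hf contDiffOn_const (fun _ => contDiffOn_const) hp]
    refine Finset.sum_congr rfl fun ν _ => ?_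
    congr 1
    exact pd_congr D.isOpen_bulk ν ef hp
  have hs : ContDiffOn ℝ (⊤ : ℕ∞) (M.gen f 0 0) D.bulk :=
    smooth_gen hf contDiffOn_const (fun _ => contDiffOn_const)
  have key : ∀ μ, ∃ a : ScriPt → ℝ, ContDiffOn ℝ (⊤ : ℕ∞) a D.scri ∧
      ∀ p ∈ D.bulk, ξ p μ - M.gen f 0 0 p μ = a (toScri p) := fun μ => by
    refine exists_scri_of_pd_one (F := fun p => ξ p μ - M.gen f 0 0 p μ)
      ((hc μ).sub (smooth_comp hs μ)) fun p hp => ?_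
    rw [pd_sub 1 (smooth_diff D.isOpen_bulk (hc μ) hp)
      (smooth_diff D.isOpen_bulk (smooth_comp hs μ) hp), hF p hp, sub_self]
  choose a ha ea using key
  refine ⟨f, a 1, fun A => a A.succ.succ, hf, ha 1, fun A => ha _, fun p hp => funext fun μ => ?_⟩
  revert μ
  rw [NUMetric.forall_fin_four]
  refine ⟨ef p hp, ?_, fun A => ?_⟩
  · have h := ea 1 p hp
    rw [M.gen_one] at h ⊢
    simp only [Pi.zero_apply] at h
    linarith
  · have h := ea A.succ.succ p hp
    rw [M.gen_ang] at h ⊢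
    simp only [Pi.zero_apply] at h
    linarith

theorem eq_zero_of_asym {a : ScriPt → ℝ} {n : ℕ}
    (h : Asym D.pos true (-n) fun p => (p 1)⁻¹ ^ n * a (toScri p)) {q : ScriPt}
    (hq : q ∈ D.scri) : a q = 0 := by
  refine Asym.coeff_eq_zero (D := D.pos) (n := -n) hq fun k => ?_
  have := h.2 k
  simpa only [zpow_neg, zpow_natCast, inv_pow] using this

/-- The conditions on the functions that determine a vector field in Newman–Unti gauge. -/
theorem conditions_of_isNUSymmetry {f Z ω : ScriPt → ℝ} {Y : Fin 2 → ScriPt → ℝ}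
    (hf : ContDiffOn ℝ (⊤ : ℕ∞) f D.scri) (hZ : ContDiffOn ℝ (⊤ : ℕ∞) Z D.scri)
    (hY : ∀ A, ContDiffOn ℝ (⊤ : ℕ∞) (Y A) D.scri) (hω : ContDiffOn ℝ (⊤ : ℕ∞) ω D.scri)
    (h : IsNUSymmetry M ω (M.gen f Z Y)) :
    (∀ q ∈ D.scri, ∀ A, pd 0 (Y A) q = 0) ∧ (∀ q ∈ D.scri, Z q = M.Z f q) ∧ IsConf D Y ∧
      Evolves M f ω Y := by
  have hs := smooth_gen (M := M) hf hZ hY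
  have h1 : ∀ q ∈ D.scri, ∀ A, pd 0 (Y A) q = 0 := by
    intro q hq A
    have e1 : Asym D false (-2) (lieInv (M.gen f Z Y) M.g 1 A.succ.succ) :=
      ⟨lieInv_smooth hs _ _, bigO_iff.1 (h.rA A)⟩
    have e2 := e1.mono_pos.sub (asym_lieInv_1A (M := M) hf hZ hY A)
    refine eq_zero_of_asym (n := 0) ?_ hq
    exact (e2.congr fun p _ => by simp).of_lt (by norm_num)
  have h2 : ∀ q ∈ D.scri, Z q = M.Z f q := by
    intro q hq
    have e1 := asym_pd_divergence (M := M) hf hZ hY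
    have s2 : ContDiffOn ℝ (⊤ : ℕ∞) (fun q => 2 * Z q - lap M.φ f q) D.scri :=
      (contDiffOn_const.mul hZ).sub (smooth_lap M.smooth_φ hf)
    have e3 : Asym D.pos false (-2) fun p =>
        (p 1)⁻¹ ^ 2 * (2 * Z (toScri p) - lap M.φ f (toScri p)) :=
      NUMetric.asym_r2.mulO (Asym.comp_toScri (D := D.pos) s2)
    have e4 : Asym D.pos true (-2) (pd 1 (divergence M.g (M.gen f Z Y))) :=
      ⟨(e1.1.sub e3.1).congr fun p _ => by simp, (smallO_iff (D := D.pos)).1 h.div⟩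
    have e5 := e1.sub e4
    have e6 := eq_zero_of_asym (a := fun q => 2 * Z q - lap M.φ f q) (n := 2)
      (e5.congr fun p _ => by ring) hq
    simp only [NUMetric.Z]
    linarith
  have h3 : ∀ q ∈ D.scri, ∀ A B : Fin 2, (if A = B then 2 * (pd 0 f q - f q * pd 0 M.φ q
      - ∑ C : Fin 2, Y C q * pd C.succ M.φ q) + 2 * ω q else 0)
      - (pd A.succ (Y B) q + pd B.succ (Y A) q) = 0 := by
    intro q hq A B
    have e0 : ContDiffOn ℝ (⊤ : ℕ∞) (fun p => lieInv (M.gen f Z Y) M.g A.succ.succ B.succ.succ p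
        - (-2 * ω (toScri p) * (M.g p)⁻¹ A.succ.succ B.succ.succ)) D.bulk := by
      refine (lieInv_smooth hs _ _).sub ((contDiffOn_const.mul (Asym.comp_toScri hω).1).mul ?_)
      exact (M.smooth_ginv A.succ.succ B.succ.succ).congr fun p hp => M.inv_g hp _ _
    have e1 : Asym D false (-3) fun p => lieInv (M.gen f Z Y) M.g A.succ.succ B.succ.succ p
        - (-2 * ω (toScri p) * (M.g p)⁻¹ A.succ.succ B.succ.succ) :=
      ⟨e0, bigO_iff.1 (h.AB A B)⟩
    have e2 := (e1.mono_pos.sub (asym_lieInv_AB (M := M) hf hZ hY A B)).sub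
      ((Asym.scri_mul (D := D.pos) hω (M.asym_e A B)).const_mul 2)
    have e3 := eq_zero_of_asym (n := 2) (a := fun q => M.m q * ((if A = B then
        2 * (pd 0 f q - f q * pd 0 M.φ q - ∑ C : Fin 2, Y C q * pd C.succ M.φ q) + 2 * ω q
        else 0) - (pd A.succ (Y B) q + pd B.succ (Y A) q)))
      ((e2.of_lt (by norm_num)).congr fun p hp => by
        have hb := Region.bulk_pos_subset hp
        rw [M.inv_g hb, M.ginv_AB, M.hInv_eq]
        by_cases hAB : A = B
        · simp only [hAB, if_true]
          ring
        · simp only [hAB, if_false]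
          ring) hq
    exact (mul_eq_zero.1 e3).resolve_left (Real.exp_pos _).ne'
  -- The difference of the two diagonal equations and the off-diagonal one are the Cauchy–Riemann
  -- equations; the sum of the diagonal ones is the evolution equation.
  refine ⟨h1, h2, ⟨hY, fun q hq => ?_, fun q hq => ?_⟩, fun q hq => ?_⟩
  · have a0 := h3 q hq 0 0
    have a1 := h3 q hq 1 1
    simp only [if_true, Fin.succ_zero_eq_one, Fin.succ_one_eq_two] at a0 a1
    linarith
  · have a0 := h3 q hq 0 1
    simp only [zero_ne_one, if_false, Fin.succ_zero_eq_one, Fin.succ_one_eq_two] at a0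
    linarith
  · have a0 := h3 q hq 0 0
    have a1 := h3 q hq 1 1
    simp only [if_true, Fin.succ_zero_eq_one, Fin.succ_one_eq_two] at a0 a1
    rw [sdiv_eq, along]
    linarith

/-- The section `u = 0` of Scri. -/
def section₀ (x : Ang) : ScriPt := Fin.cons 0 x

theorem contDiff_section₀ : ContDiff ℝ (⊤ : ℕ∞) section₀ := by
  rw [contDiff_pi]
  refine Fin.cases contDiff_const fun A => ?_
  exact contDiff_apply ℝ ℝ A

theorem section₀_mem {x : Ang} (hx : x ∈ D.U) : section₀ x ∈ D.scri := ⟨D.zero_mem_J, hx⟩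

theorem section₀_ang (q : ScriPt) : section₀ (ang q) = Function.update q 0 0 := by
  ext i
  refine Fin.cases ?_ (fun A => ?_) i <;> simp [section₀, ang]

open Classical in
/-- A function on Scri, restricted to `u = 0` and extended by zero. -/
noncomputable def restrict₀ (D : Region) (a : ScriPt → ℝ) (x : Ang) : ℝ :=
  if x ∈ D.U then a (section₀ x) else 0

theorem smooth_restrict₀ {a : ScriPt → ℝ} (ha : ContDiffOn ℝ (⊤ : ℕ∞) a D.scri) :
    ContDiffOn ℝ (⊤ : ℕ∞) (restrict₀ D a) D.U :=
  (ha.comp contDiff_section₀.contDiffOn fun _ hx => section₀_mem hx).congr fun x hx => by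
    simp [restrict₀, hx]

theorem restrict₀_ang {a : ScriPt → ℝ} {q : ScriPt} (hq : q ∈ D.scri) :
    restrict₀ D a (ang q) = a (Function.update q 0 0) := by
  rw [restrict₀, if_pos hq.2, section₀_ang]

/-- A field with ∂_u Y = 0 equals its restriction to u = 0, since `J` is connected and contains 0;
the Cauchy–Riemann equations are inherited by the restriction. -/
theorem exists_ckv {Y : Fin 2 → ScriPt → ℝ} (hY : IsConf D Y)
    (hu : ∀ q ∈ D.scri, ∀ A, pd 0 (Y A) q = 0) :
    ∃ y ∈ ckv D, ∀ q ∈ D.scri, ∀ A, Y A q = vec y A q := by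
  have e : ∀ q ∈ D.scri, ∀ A, Y A q = restrict₀ D (Y A) (ang q) := fun q hq A => by
    rw [restrict₀_ang hq]
    exact eq_of_pd_zero_eq (hY.smooth A) (fun q hq => hu q hq A) hq
  have sm := fun A => smooth_restrict₀ (hY.smooth A)
  have hsm : ContDiffOn ℝ (⊤ : ℕ∞) (fun x A => restrict₀ D (Y A) x) D.U := contDiffOn_pi.2 sm
  refine ⟨fun x A => restrict₀ D (Y A) x, ⟨hsm, fun x hx => ?_, fun x hx A B => ?_⟩, e⟩
  · funext A
    simp [restrict₀, hx]
  · have hq := section₀_mem (D := D) hx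
    have hpd : ∀ A B : Fin 2, pd A (fun x A => restrict₀ D (Y A) x) x B
        = pd A.succ (Y B) (section₀ x) := fun A B => by
      rw [pd_apply A B ((hsm.contDiffAt (D.isOpen_U.mem_nhds hx)).differentiableAt (by simp)),
        pd_congr D.isOpen_scri _ (fun q hq => e q hq B) hq]
      exact (pd_succ_comp_ang (q := section₀ x) A (smooth_diff D.isOpen_U (sm B) hx)).symm
    have c1 := hY.cr _ hq
    have c2 := hY.cr' _ hq
    simp only [flatDiv, hpd, Fin.sum_univ_two]
    fin_cases A <;> fin_cases B <;> simp <;> linarith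

/-- The evolution equation determines `f` from its values at `u = 0`. -/
theorem Evolves.unique {f f' ω : ScriPt → ℝ} {Y : Fin 2 → ScriPt → ℝ} (h : Evolves M f ω Y)
    (h' : Evolves M f' ω Y) (hf : ContDiffOn ℝ (⊤ : ℕ∞) f D.scri)
    (hf' : ContDiffOn ℝ (⊤ : ℕ∞) f' D.scri) (h0 : ∀ q ∈ D.scri, q 0 = 0 → f q = f' q)
    {q : ScriPt} (hq : q ∈ D.scri) : f q = f' q := by
  -- The inhomogeneous terms cancel in f - f', and e^{-φ} is the integrating factor of the
  -- homogeneous equation, so this product does not depend on u.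
  have hk : ContDiffOn ℝ (⊤ : ℕ∞) (fun q => Real.exp (-M.φ q) * (f q - f' q)) D.scri :=
    M.smooth_φ.neg.exp.mul (hf.sub hf')
  have e := eq_of_pd_zero_eq hk (fun q hq => by
    have d : DifferentiableAt ℝ (fun q => -M.φ q) q := (sdiff M.smooth_φ hq).neg
    rw [pd_mul 0 d.exp ((sdiff hf hq).fun_sub (sdiff hf' hq)),
      pd_exp 0 d, pd_neg, pd_sub 0 (sdiff hf hq) (sdiff hf' hq), h q hq, h' q hq]
    ring) hq
  rw [h0 _ (Region.update_zero_mem hq D.zero_mem_J) (by simp), sub_self, mul_zero] at e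
  have := (mul_eq_zero.1 e).resolve_left (Real.exp_pos _).ne'
  linarith

/-- The functions f, Z, Y that parametrize ξ in the gauge are matched with those of an asymptotic
Killing vector: Y descends to U, Z is determined by f, and f by its values at u = 0. -/
theorem exists_akv {w : Rescaling D} {ξ : VField} (h : IsNUSymmetry M w.fn ξ) :
    ∃ c : BMS4 D, ∀ p ∈ D.bulk, ξ p = akv (c, w) M.g p := by
  obtain ⟨f, Z, Y, hf, hZ, hY, e⟩ := exists_gen h.smooth
    fun p hp => (gauge_iff h.smooth hp).1 ⟨h.uu p hp, h.ur p hp, h.uA p hp⟩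
  obtain ⟨hu, hZf, hc, hev⟩ := conditions_of_isNUSymmetry hf hZ hY w.smooth (h.congr e)
  obtain ⟨y, hy, ey⟩ := exists_ckv hc hu
  have hT : ContDiffOn ℝ (⊤ : ℕ∞) (fun q => Real.exp (-M.φ q) * f q) D.scri :=
    M.smooth_φ.neg.exp.mul hf
  -- The relation f = e^φ T at u = 0 dictates the supertranslation.
  let c : BMS4 D := (⟨y, hy⟩, ⟨restrict₀ D fun q => Real.exp (-M.φ q) * f q,
    smooth_restrict₀ hT, fun x hx => by simp [restrict₀, hx]⟩)
  have hev' : Evolves M f w.fn (vec y) := fun q hq => by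
    rw [hev q hq]
    simp only [sdiv, along, ey q hq,
      fun A B => pd_congr D.isOpen_scri B (fun q hq => ey q hq A) hq]
  have hF : ∀ q ∈ D.scri, f q = M.F (c, w) q := fun q hq =>
    hev'.unique (M.evolves_F (c, w)) hf (M.smooth_F (c, w)) (fun q hq h0 => by
      have eT : (c, w).1.T (ang q) = restrict₀ D (fun q => Real.exp (-M.φ q) * f q) (ang q) := rfl
      rw [NUMetric.F, fFun_at_zero _ _ _ _ h0, eT, restrict₀_ang hq, ← h0,
        Function.update_eq_self, ← mul_assoc, ← Real.exp_add]
      simp) hq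
  refine ⟨c, fun p hp => ?_⟩
  rw [e p hp, akv_eq M _ hp]
  refine gen_congr hF (fun q hq => ?_) ey hp
  rw [hZf q hq, NUMetric.Z, NUMetric.Z, lap_congr hF hq]

variable (M) in
theorem range_akvMap : Set.range (akvMap M) = {ξ | (∀ p ∉ D.bulk, ξ p = 0) ∧
    ∃ w : Rescaling D, IsNUSymmetry M w.fn ξ} := by
  ext ξ
  constructor
  · rintro ⟨a, rfl⟩
    exact ⟨fun p hp => by simp [akvMap_apply, hp], a.2, (isNUSymmetry_akv M a).congr fun p hp => by
      simp [akvMap_apply, hp]⟩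
  · rintro ⟨h0, w, hw⟩
    obtain ⟨c, hc⟩ := exists_akv hw
    refine ⟨(c, w), funext fun p => ?_⟩
    by_cases hp : p ∈ D.bulk
    · simp [akvMap_apply, hp, hc p hp]
    · simp [akvMap_apply, hp, h0 p hp]

end surjective

end NewmanUnti

namespace NewmanUnti

open MeasureTheory

/-! ## The variation of the metric -/

section lieMetric
variable {D : Region} {M : NUMetric D} {ξ : VField} {p : Pt}

theorem NUMetric.g_mul_inv (M : NUMetric D) (hp : p ∈ D.bulk) : M.g p * (M.g p)⁻¹ = 1 :=
  Matrix.mul_nonsing_inv _ (M.isUnit_det hp)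

theorem NUMetric.inv_mul_g (M : NUMetric D) (hp : p ∈ D.bulk) : (M.g p)⁻¹ * M.g p = 1 :=
  Matrix.nonsing_inv_mul _ (M.isUnit_det hp)

theorem NUMetric.pd_g_mul_inv (M : NUMetric D) (hp : p ∈ D.bulk) (ρ μ ν : Fin 4) :
    ∑ σ, (pd ρ (fun x => M.g x μ σ) p * (M.g p)⁻¹ σ ν
      + M.g p μ σ * pd ρ (fun x => (M.g x)⁻¹ σ ν) p) = 0 := by
  have d1 : ∀ σ, DifferentiableAt ℝ (fun x => M.g x μ σ) p := fun σ =>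
    smooth_diff D.isOpen_bulk (M.smooth_g μ σ) hp
  have d2 : ∀ σ, DifferentiableAt ℝ (fun x => (M.g x)⁻¹ σ ν) p := fun σ =>
    smooth_diff D.isOpen_bulk ((M.smooth_ginv σ ν).congr fun x hx => M.inv_g hx σ ν) hp
  have h : pd ρ (fun x => ∑ σ, M.g x μ σ * (M.g x)⁻¹ σ ν) p = 0 := by
    rw [pd_congr (G := fun _ => (1 : Matrix (Fin 4) (Fin 4) ℝ) μ ν) D.isOpen_bulk ρ (fun x hx => by
      rw [← M.g_mul_inv hx, Matrix.mul_apply]) hp, pd_const]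
  rw [pd_sum _ _ fun σ _ => (d1 σ).fun_mul (d2 σ)] at h
  rw [← h]
  exact Finset.sum_congr rfl fun σ _ => (pd_mul ρ (d1 σ) (d2 σ)).symm

/-- The Lie derivatives of the metric and of its inverse as matrices. -/
noncomputable def lieInvMatrix (ξ : VField) (g : Tensor2) (p : Pt) : Matrix (Fin 4) (Fin 4) ℝ :=
  Matrix.of fun μ ν => lieInv ξ g μ ν p

/-- Leibniz rule for g g⁻¹ = 1. In matrix form L g = X(g) + Jᵀ g + g J and L g⁻¹ = X(g⁻¹) - J g⁻¹ -
g⁻¹ Jᵀ with the Jacobian J of ξ, so the Jacobian terms cancel. -/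
theorem lieMetric_mul_inv (hp : p ∈ D.bulk) :
    lieMetric ξ M.g p * (M.g p)⁻¹ + M.g p * lieInvMatrix ξ M.g p = 0 := by
  set G := M.g p
  set E := (M.g p)⁻¹
  let J : Matrix (Fin 4) (Fin 4) ℝ := Matrix.of fun μ ν => pd ν ξ p μ
  let XG : Matrix (Fin 4) (Fin 4) ℝ :=
    Matrix.of fun μ ν => ∑ ρ, ξ p ρ * pd ρ (fun x => M.g x μ ν) p
  let XE : Matrix (Fin 4) (Fin 4) ℝ :=
    Matrix.of fun μ ν => ∑ ρ, ξ p ρ * pd ρ (fun x => (M.g x)⁻¹ μ ν) p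
  have e1 : lieMetric ξ M.g p = XG + J.transpose * G + G * J := by
    ext μ ν
    simp only [lieMetric, Matrix.of_apply, Matrix.add_apply, Matrix.mul_apply,
      Matrix.transpose_apply, XG, J, ← Finset.sum_add_distrib]
    exact Finset.sum_congr rfl fun ρ _ => by ring
  have e2 : lieInvMatrix ξ M.g p = XE - J * E - E * J.transpose := by
    ext μ ν
    simp only [lieInvMatrix, lieInv, Matrix.of_apply, Matrix.sub_apply, Matrix.mul_apply,
      Matrix.transpose_apply, XE, J, ← Finset.sum_sub_distrib]
    exact Finset.sum_congr rfl fun ρ _ => by ring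
  have e3 : XG * E + G * XE = 0 := by
    ext μ ν
    simp only [Matrix.add_apply, Matrix.mul_apply, Matrix.of_apply, XG, XE, Finset.sum_mul,
      Finset.mul_sum, ← Finset.sum_add_distrib, Matrix.zero_apply]
    rw [Finset.sum_comm]
    refine Finset.sum_eq_zero fun ρ _ => ?_
    rw [← mul_zero (ξ p ρ), ← M.pd_g_mul_inv hp ρ μ ν, Finset.mul_sum]
    exact Finset.sum_congr rfl fun σ _ => by ring
  have e4 : G * E = 1 := M.g_mul_inv hp
  rw [e1, e2]
  calc (XG + J.transpose * G + G * J) * E + G * (XE - J * E - E * J.transpose)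
      = (XG * E + G * XE) + J.transpose * (G * E) - (G * E) * J.transpose := by noncomm_ring
    _ = 0 := by rw [e3, e4]; noncomm_ring

theorem lieMetric_eq (hp : p ∈ D.bulk) :
    lieMetric ξ M.g p = -(M.g p * lieInvMatrix ξ M.g p * M.g p) := by
  have h := lieMetric_mul_inv (M := M) (ξ := ξ) hp
  calc lieMetric ξ M.g p = lieMetric ξ M.g p * ((M.g p)⁻¹ * M.g p) := by
        rw [M.inv_mul_g hp, mul_one]
    _ = (lieMetric ξ M.g p * (M.g p)⁻¹ + M.g p * lieInvMatrix ξ M.g p) * M.g p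
        - M.g p * lieInvMatrix ξ M.g p * M.g p := by noncomm_ring
    _ = _ := by rw [h]; noncomm_ring

theorem lieInvMatrix_eq (hp : p ∈ D.bulk) :
    lieInvMatrix ξ M.g p = -((M.g p)⁻¹ * lieMetric ξ M.g p * (M.g p)⁻¹) := by
  have h := lieMetric_mul_inv (M := M) (ξ := ξ) hp
  calc lieInvMatrix ξ M.g p = ((M.g p)⁻¹ * M.g p) * lieInvMatrix ξ M.g p := by
        rw [M.inv_mul_g hp, one_mul]
    _ = (M.g p)⁻¹ * (lieMetric ξ M.g p * (M.g p)⁻¹ + M.g p * lieInvMatrix ξ M.g p)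
        - (M.g p)⁻¹ * lieMetric ξ M.g p * (M.g p)⁻¹ := by noncomm_ring
    _ = _ := by rw [h]; noncomm_ring

theorem NUMetric.g_01 (M : NUMetric D) (hp : p ∈ D.bulk) : M.g p 0 1 = -1 := by
  rw [M.g_eq hp]; rfl
theorem NUMetric.g_11 (M : NUMetric D) (hp : p ∈ D.bulk) : M.g p 1 1 = 0 := by
  rw [M.g_eq hp]; rfl
theorem NUMetric.g_1A (M : NUMetric D) (hp : p ∈ D.bulk) (A : Fin 2) :
    M.g p 1 A.succ.succ = 0 := by
  rw [M.g_eq hp]; fin_cases A <;> rfl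
theorem NUMetric.g_A1 (M : NUMetric D) (hp : p ∈ D.bulk) (A : Fin 2) :
    M.g p A.succ.succ 1 = 0 := by
  rw [M.g_eq hp]; fin_cases A <;> rfl
theorem NUMetric.g_AB (M : NUMetric D) (hp : p ∈ D.bulk) (A B : Fin 2) :
    M.g p A.succ.succ B.succ.succ = M.h p A B := by
  have hs := M.h_symm hp
  rw [M.g_eq hp]; fin_cases A <;> fin_cases B <;> simp [hs]
theorem NUMetric.g_0A (M : NUMetric D) (hp : p ∈ D.bulk) (A : Fin 2) :
    M.g p 0 A.succ.succ = -∑ B : Fin 2, M.h p A B * M.V p B := by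
  have hs := M.h_symm hp
  rw [M.g_eq hp]; fin_cases A <;> simp [hs]

theorem NUMetric.asym_g0A (M : NUMetric D) (A : Fin 2) :
    Asym D false 0 fun p => M.g p 0 A.succ.succ :=
  (asym_sum_two fun B => (M.asym_h A B).mulO (M.asym_V B) (l := 0)).neg.congr
    fun _ hp => M.g_0A hp A

theorem NUMetric.sum_h_hInv (M : NUMetric D) (hp : p ∈ D.bulk) (A B : Fin 2) :
    ∑ C : Fin 2, M.hInv A C p * M.h p C B = if A = B then 1 else 0 := by
  have hs := M.h_symm hp
  have hd := mul_inv_cancel₀ (M.dh_pos hp).ne'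
  rw [NUMetric.dh] at hd
  fin_cases A <;> fin_cases B <;> simp [Fin.sum_univ_two, NUMetric.hInv, NUMetric.dh, hs] <;>
    first | ring1 | linear_combination hd

theorem lieMetric_apply (hp : p ∈ D.bulk) (μ ν : Fin 4) : lieMetric ξ M.g p μ ν
    = -∑ α, ∑ β, M.g p μ α * lieInv ξ M.g α β p * M.g p β ν := by
  rw [lieMetric_eq hp, Matrix.neg_apply, Matrix.mul_apply]
  simp only [Matrix.mul_apply, Finset.sum_mul]
  rw [Finset.sum_comm]
  rfl

theorem lieMetric_symm (hp : p ∈ D.bulk) (μ ν : Fin 4) :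
    lieMetric ξ M.g p μ ν = lieMetric ξ M.g p ν μ := by
  simp only [lieMetric, Matrix.of_apply]
  refine Finset.sum_congr rfl fun ρ _ => ?_
  rw [pd_congr D.isOpen_bulk ρ (fun x hx => M.g_symm hx μ ν) hp, M.g_symm hp ρ ν, M.g_symm hp μ ρ]
  ring

end lieMetric

/-! ### The variation of the metric along a symmetry -/

namespace IsNUSymmetry
variable {D : Region} {M : NUMetric D} {ξ : VField} {ω : ScriPt → ℝ} {p : Pt}
  (h : IsNUSymmetry M ω ξ)
include h

theorem lieInv_zero_left (hp : p ∈ D.bulk) (μ : Fin 4) : lieInv ξ M.g 0 μ p = 0 := by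
  revert μ
  rw [NUMetric.forall_fin_four]
  exact ⟨h.uu p hp, h.ur p hp, h.uA p hp⟩

theorem lieInv_zero_right (hp : p ∈ D.bulk) (μ : Fin 4) : lieInv ξ M.g μ 0 p = 0 := by
  rw [lieInv_symm h.smooth hp, h.lieInv_zero_left hp]

/-- The gauge conditions L_ξ g^{uμ} = 0 lowered to covariant components. They ensure that g + s L_ξ
g keeps g_{rr} = g_{rA} = 0 and g_{ur} = -1 for every s. -/
theorem lieMetric_one_right (hp : p ∈ D.bulk) (μ : Fin 4) : lieMetric ξ M.g p μ 1 = 0 := by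
  rw [lieMetric_apply hp]
  simp only [sum_four, M.g_01 hp, M.g_11 hp, M.g_A1 hp, h.lieInv_zero_right hp]
  simp

theorem lieMetric_AB (hp : p ∈ D.bulk) (A B : Fin 2) :
    lieMetric ξ M.g p A.succ.succ B.succ.succ
      = -∑ C : Fin 2, ∑ E : Fin 2,
        M.h p A C * lieInv ξ M.g C.succ.succ E.succ.succ p * M.h p E B := by
  rw [lieMetric_apply hp]
  simp only [sum_four (fun α => _), M.g_A1 hp, M.g_1A hp, M.g_AB hp, h.lieInv_zero_left hp,
    h.lieInv_zero_right hp]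
  simp

theorem lieMetric_0A (hp : p ∈ D.bulk) (A : Fin 2) :
    lieMetric ξ M.g p 0 A.succ.succ
      = ∑ B : Fin 2, lieInv ξ M.g 1 B.succ.succ p * M.h p B A
        - ∑ C : Fin 2, ∑ B : Fin 2, M.g p 0 C.succ.succ
          * lieInv ξ M.g C.succ.succ B.succ.succ p * M.h p B A := by
  rw [lieMetric_apply hp]
  simp only [sum_four (fun α => _), M.g_01 hp, M.g_1A hp, M.g_AB hp, h.lieInv_zero_left hp,
    h.lieInv_zero_right hp]
  simp
  ring

theorem asym_1A (A : Fin 2) : Asym D false (-2) (lieInv ξ M.g 1 A.succ.succ) :=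
  ⟨lieInv_smooth h.smooth _ _, bigO_iff.1 (h.rA A)⟩

variable (hω : ContDiffOn ℝ (⊤ : ℕ∞) ω D.scri)
include hω

theorem asym_AB_rem (A B : Fin 2) : Asym D false (-3) fun p =>
    lieInv ξ M.g A.succ.succ B.succ.succ p + 2 * (ω (toScri p) * M.hInv A B p) := by
  have e0 : ContDiffOn ℝ (⊤ : ℕ∞) (fun p => lieInv ξ M.g A.succ.succ B.succ.succ p
      + 2 * (ω (toScri p) * M.hInv A B p)) D.bulk :=
    (lieInv_smooth h.smooth _ _).add ((Asym.scri_mul hω (M.asym_hInv A B)).const_mul 2).1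
  refine ⟨e0, fun k => (bigO_iff.1 (h.AB A B) k).congr fun p hp => ?_⟩
  rw [M.inv_g hp, M.ginv_AB]
  ring

theorem asym_AB (A B : Fin 2) : Asym D false (-2) (lieInv ξ M.g A.succ.succ B.succ.succ) :=
  (((h.asym_AB_rem hω A B).of_lt (by norm_num)).sub
    ((Asym.scri_mul hω (M.asym_hInv A B)).const_mul 2)).congr fun p _ => by ring

/-- On the angular block L h = -h (L h⁻¹) h, and L h⁻¹ = -2 ω h⁻¹ + O(r⁻³); the two outer factors
raise the error to O(r). -/
theorem asym_lieMetric_rem (A B : Fin 2) : Asym D false 1 fun p =>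
    lieMetric ξ M.g p A.succ.succ B.succ.succ - 2 * ω (toScri p) * M.h p A B := by
  have h1 : Asym D false 1 fun p => -∑ C : Fin 2, ∑ E : Fin 2, M.h p A C *
      (lieInv ξ M.g C.succ.succ E.succ.succ p + 2 * (ω (toScri p) * M.hInv C E p)) * M.h p E B :=
    (asym_sum_two fun C => asym_sum_two fun E => Asym.mulO (m := -1)
      ((M.asym_h A C).mulO (h.asym_AB_rem hω C E)) (M.asym_h E B)).neg
  refine h1.congr fun p hp => ?_
  have e : ∑ C : Fin 2, ∑ E : Fin 2, M.h p A C * M.hInv C E p * M.h p E B = M.h p A B := by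
    simp only [mul_assoc, ← Finset.mul_sum, M.sum_h_hInv hp]
    simp
  rw [h.lieMetric_AB hp, ← e]
  simp only [Fin.sum_univ_two]
  ring

theorem asym_lieMetric_AB (A B : Fin 2) : Asym D false 2 fun p =>
    lieMetric ξ M.g p A.succ.succ B.succ.succ :=
  (((h.asym_lieMetric_rem hω A B).of_lt (by norm_num)).add
    ((Asym.scri_mul hω (M.asym_h A B)).const_mul 2)).congr fun p _ => by ring

/-- Keeps the varied g^{rA} at order r⁻²: the varied cofactors over det h are O(r⁻²), so the mixed
components must stay bounded. -/
theorem asym_lieMetric_0A (A : Fin 2) : Asym D false 0 fun p =>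
    lieMetric ξ M.g p 0 A.succ.succ :=
  ((asym_sum_two fun B => (h.asym_1A B).mulO (M.asym_h B A) (l := 0)).sub
    (asym_sum_two fun C => asym_sum_two fun B => Asym.mulO (m := -2)
      ((M.asym_g0A C).mulO (h.asym_AB hω C B)) (M.asym_h B A))).congr
    fun _ hp => h.lieMetric_0A hp A

/-- The conformal factor of the varied metric. -/
theorem confFactor_add_smul (s : ℝ) {q : ScriPt} (hq : q ∈ D.scri) :
    confFactor (M.g + s • lieMetric ξ M.g) q
      = 1 / 2 * Real.log (Real.exp (2 * M.φ q) * (1 + 2 * s * ω q)) := by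
  have h1 := (M.asym_trace).add (((h.asym_lieMetric_rem hω 0 0).add
    (h.asym_lieMetric_rem hω 1 1)).mono_pos.const_mul s)
  -- Exchanges the angular metric for r² e^{2φ} in the rescaling term 2 s ω h_{AA}, at the cost of
  -- O(r).
  have h2 := h1.add ((Asym.scri_mul (D := D.pos) hω
    ((M.asym_hRem 0 0).add (M.asym_hRem 1 1)).mono_pos).const_mul (2 * s))
  have h3 := confFactor_of_asym (g := M.g + s • lieMetric ξ M.g)
    (a := fun q => 2 * (Real.exp (2 * M.φ q) * (1 + 2 * s * ω q)))
    (h2.congr fun p _ => by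
      simp only [Pi.add_apply, Pi.smul_apply, Matrix.add_apply, Matrix.smul_apply, smul_eq_mul,
        if_true, Fin.succ_zero_eq_one, Fin.succ_one_eq_two]
      change M.g p 2 2 + s * lieMetric ξ M.g p 2 2 + (M.g p 3 3 + s * lieMetric ξ M.g p 3 3) - _
        = _ + s * (lieMetric ξ M.g p 2 2 - _ + (lieMetric ξ M.g p 3 3 - _)) + _
      ring) hq
  rw [h3, mul_div_cancel_left₀ _ two_ne_zero]

end IsNUSymmetry

end NewmanUnti

namespace NewmanUnti

open MeasureTheory

/-! ## Derivatives of ray integrals of the inverse metric -/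

section ratio
variable {D : Region} {p : Pt}

theorem Asym.exists_bound_shift {b : Bool} {F : Pt → ℝ} (h : Asym D b 0 F) (hp : p ∈ D.bulk) :
    ∃ K, 0 ≤ K ∧ ∀ t, 0 ≤ t → |F (shift t p)| ≤ K := by
  have h1 : F =O[nearScri (toScri p)] fun p => p 1 ^ (0 : ℤ) := (h.2 0 _ hp.1).isBigO
  obtain ⟨C, hC⟩ := h1.bound
  obtain ⟨r₀, N, hN, hb⟩ := eventually_nearScri.1 hC
  have hc : ContinuousOn (fun t => F (shift t p)) (Set.Icc 0 (r₀ - p 1)) :=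
    h.1.continuousOn.comp (continuous_shift_left p).continuousOn fun t ht => shift_mem hp ht.1
  obtain ⟨B, hB⟩ := isCompact_Icc.exists_bound_of_continuousOn hc
  refine ⟨max |B| |C|, le_max_of_le_left (abs_nonneg _), fun t ht => ?_⟩
  by_cases htr : t ≤ r₀ - p 1
  · exact ((hB t ⟨ht, htr⟩).trans (le_abs_self B)).trans (le_max_left _ _)
  · have h2 := hb (shift t p) (by rw [shift_one]; linarith) (by simpa using mem_of_mem_nhds hN)
    simp only [zpow_zero, norm_one, mul_one] at h2
    exact (h2.trans (le_abs_self C)).trans (le_max_right _ _)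

theorem Asym.exists_bound_shift_sq {b : Bool} {F : Pt → ℝ} (h : Asym D b (-2) F)
    (hp : p ∈ D.bulk) :
    ∃ C, 0 ≤ C ∧ ∀ t, 0 ≤ t → |F (shift t p)| ≤ C * (1 + t ^ 2)⁻¹ := by
  obtain ⟨s, hs, -, C, hC⟩ := exists_dominated h.1.continuousOn (h.bd_neg_two le_rfl) hp
  refine ⟨|C|, abs_nonneg C, fun t ht => (hC p (mem_of_mem_nhds hs) t ht).trans ?_⟩
  exact mul_le_mul_of_nonneg_right (le_abs_self C) (by positivity)

/-- The derivative of the rational function `(a₀ + s a₁ + s² a₂) / (1 + s b₁ + s² b₂)` of `s`. -/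
theorem hasDerivAt_ratio (a₀ a₁ a₂ b₁ b₂ : ℝ) {s : ℝ} (h : 1 + s * b₁ + s ^ 2 * b₂ ≠ 0) :
    HasDerivAt (fun s => (a₀ + s * a₁ + s ^ 2 * a₂) / (1 + s * b₁ + s ^ 2 * b₂))
      (((a₁ + 2 * s * a₂) * (1 + s * b₁ + s ^ 2 * b₂)
        - (a₀ + s * a₁ + s ^ 2 * a₂) * (b₁ + 2 * s * b₂)) / (1 + s * b₁ + s ^ 2 * b₂) ^ 2) s := by
  have key : ∀ c₀ c₁ c₂ : ℝ, HasDerivAt (fun s : ℝ => c₀ + s * c₁ + s ^ 2 * c₂)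
      (c₁ + 2 * s * c₂) s := fun c₀ c₁ c₂ => by
    have h1 := ((hasDerivAt_id s).mul_const c₁).const_add c₀
    have h2 := ((hasDerivAt_id s).fun_pow 2).mul_const c₂
    have h3 := h1.fun_add h2
    simpa using h3
  exact (key a₀ a₁ a₂).fun_div (key 1 b₁ b₂) h

/-- For |s| ≤ 1/(4K) each of the two correction terms is at most 1/4 in absolute value. -/
theorem ratio_denominator {b₁ b₂ K s : ℝ} (hK : 1 ≤ K) (h₁ : |b₁| ≤ K) (h₂ : |b₂| ≤ K)
    (hs : |s| ≤ (4 * K)⁻¹) : 1 / 2 ≤ 1 + s * b₁ + s ^ 2 * b₂ := by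
  have k0 : 0 < K := by linarith
  have hs1 : |s| * K ≤ 1 / 4 := by
    calc |s| * K ≤ (4 * K)⁻¹ * K := by gcongr
      _ = 1 / 4 := by field_simp
  have hs2 : |s| ≤ 1 := by nlinarith [abs_nonneg s]
  have e1 : |s * b₁| ≤ 1 / 4 := by
    rw [abs_mul]
    exact (mul_le_mul_of_nonneg_left h₁ (abs_nonneg s)).trans hs1
  have e2 : |s ^ 2 * b₂| ≤ 1 / 4 := by
    rw [abs_mul, abs_pow, sq, mul_assoc]
    calc |s| * (|s| * |b₂|) ≤ 1 * (|s| * K) := by gcongr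
      _ ≤ 1 / 4 := by linarith
  have := neg_abs_le (s * b₁)
  have := neg_abs_le (s ^ 2 * b₂)
  linarith

/-- Along a ray the varied g^{AB} and g^{rA} are quotients of polynomials in s of degree at most
two, with numerators of order r⁻² and, after division by det h, bounded denominator coefficients.
Bounds uniform along the whole ray make one range of s and one integrable majorant work for all r' >
r. -/
theorem hasDerivAt_tail_ratio {a₀ a₁ a₂ b₁ b₂ : Pt → ℝ} (h₀ : Asym D false (-2) a₀)
    (h₁ : Asym D false (-2) a₁) (h₂ : Asym D false (-2) a₂) (k₁ : Asym D false 0 b₁)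
    (k₂ : Asym D false 0 b₂) (hp : p ∈ D.bulk) :
    HasDerivAt (fun s : ℝ => tail (fun x => (a₀ x + s * a₁ x + s ^ 2 * a₂ x)
      / (1 + s * b₁ x + s ^ 2 * b₂ x)) p) (tail (fun x => a₁ x - a₀ x * b₁ x) p) 0 := by
  obtain ⟨C₀, C₀0, hC₀⟩ := h₀.exists_bound_shift_sq hp
  obtain ⟨C₁, C₁0, hC₁⟩ := h₁.exists_bound_shift_sq hp
  obtain ⟨C₂, C₂0, hC₂⟩ := h₂.exists_bound_shift_sq hp
  obtain ⟨K₁, K₁0, hK₁⟩ := k₁.exists_bound_shift hp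
  obtain ⟨K₂, K₂0, hK₂⟩ := k₂.exists_bound_shift hp
  set K := 1 + K₁ + K₂
  have K1 : 1 ≤ K := by linarith
  have k0 : 0 < K := by linarith
  have den : ∀ s : ℝ, |s| ≤ (4 * K)⁻¹ → ∀ t, 0 ≤ t →
      1 / 2 ≤ 1 + s * b₁ (shift t p) + s ^ 2 * b₂ (shift t p) := fun s hs t ht =>
    ratio_denominator K1 ((hK₁ t ht).trans (by linarith)) ((hK₂ t ht).trans (by linarith)) hs
  have hε : Metric.closedBall (0 : ℝ) (4 * K)⁻¹ ∈ 𝓝 (0 : ℝ) :=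
    Metric.closedBall_mem_nhds _ (by positivity)
  have hb : ∀ s ∈ Metric.closedBall (0 : ℝ) (4 * K)⁻¹, |s| ≤ (4 * K)⁻¹ := fun s hs => by
    simpa using hs
  have hb1 : ∀ s ∈ Metric.closedBall (0 : ℝ) (4 * K)⁻¹, |s| ≤ 1 := fun s hs => by
    refine (hb s hs).trans (inv_le_one_of_one_le₀ (by linarith))
  have cont : ∀ {F : Pt → ℝ} {b : Bool} {n : ℤ}, Asym D b n F →
      ContinuousOn (fun t => F (shift t p)) (Set.Ioi 0) := fun h =>
    h.1.continuousOn.comp (continuous_shift_left p).continuousOn fun t ht =>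
      shift_mem hp (le_of_lt ht)
  set S := C₀ + C₁ + C₂
  have key := hasDerivAt_integral_of_dominated_loc_of_deriv_le
    (μ := volume.restrict (Set.Ioi (0 : ℝ))) (x₀ := (0 : ℝ)) hε
    (F := fun s t => (a₀ (shift t p) + s * a₁ (shift t p) + s ^ 2 * a₂ (shift t p))
      / (1 + s * b₁ (shift t p) + s ^ 2 * b₂ (shift t p)))
    (F' := fun s t => ((a₁ (shift t p) + 2 * s * a₂ (shift t p))
        * (1 + s * b₁ (shift t p) + s ^ 2 * b₂ (shift t p))
        - (a₀ (shift t p) + s * a₁ (shift t p) + s ^ 2 * a₂ (shift t p))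
          * (b₁ (shift t p) + 2 * s * b₂ (shift t p)))
        / (1 + s * b₁ (shift t p) + s ^ 2 * b₂ (shift t p)) ^ 2)
    -- For |s| ≤ 1 the numerator is at most S (1 + t²)⁻¹ and its s-derivative twice that; the
    -- denominator and its s-derivative are at most 3K. The factor 4 bounds the inverse square of a
    -- denominator that is at least 1/2.
    (bound := fun t => (2 * S * (3 * K) + S * (3 * K)) * 4 * (1 + t ^ 2)⁻¹)
    ?_ ?_ ?_ ?_ (integrableOn_bound _) ?_
  · have h2 := key.2
    have e : ∀ t : ℝ, ((a₁ (shift t p) + 2 * 0 * a₂ (shift t p))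
        * (1 + 0 * b₁ (shift t p) + 0 ^ 2 * b₂ (shift t p))
        - (a₀ (shift t p) + 0 * a₁ (shift t p) + 0 ^ 2 * a₂ (shift t p))
          * (b₁ (shift t p) + 2 * 0 * b₂ (shift t p)))
        / (1 + 0 * b₁ (shift t p) + 0 ^ 2 * b₂ (shift t p)) ^ 2
        = a₁ (shift t p) - a₀ (shift t p) * b₁ (shift t p) := fun t => by simp
    simp only [e] at h2
    simpa only [tail_eq] using h2
  · filter_upwards [hε] with s hs
    refine ContinuousOn.aestronglyMeasurable (ContinuousOn.div ?_ ?_ fun t ht => ?_)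
      measurableSet_Ioi
    · exact ((cont h₀).add (continuousOn_const.mul (cont h₁))).add
        (continuousOn_const.mul (cont h₂))
    · exact (continuousOn_const.add (continuousOn_const.mul (cont k₁))).add
        (continuousOn_const.mul (cont k₂))
    · have := den s (hb s hs) t (le_of_lt ht)
      linarith
  · have h := h₀.integrableOn_shift le_rfl hp
    rw [IntegrableOn] at h
    simpa using h
  · refine ContinuousOn.aestronglyMeasurable ?_ measurableSet_Ioi
    have h := (cont h₁).fun_sub ((cont h₀).fun_mul (cont k₁))
    simpa using h
  · refine (ae_restrict_iff' measurableSet_Ioi).2 (Eventually.of_forall fun t ht s hs => ?_)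
    have ht0 : (0 : ℝ) ≤ t := le_of_lt ht
    have hd := den s (hb s hs) t ht0
    have hs1 := hb1 s hs
    have hρ : 0 < (1 + t ^ 2)⁻¹ := by positivity
    have e₀ := hC₀ t ht0
    have e₁ := hC₁ t ht0
    have e₂ := hC₂ t ht0
    have f₁ := hK₁ t ht0
    have f₂ := hK₂ t ht0
    have hsq : |s| ^ 2 ≤ 1 := pow_le_one₀ (abs_nonneg s) hs1
    set ρ := (1 + t ^ 2)⁻¹
    have A1 : |a₁ (shift t p) + 2 * s * a₂ (shift t p)| ≤ 2 * S * ρ := by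
      calc |a₁ (shift t p) + 2 * s * a₂ (shift t p)|
          ≤ |a₁ (shift t p)| + 2 * |s| * |a₂ (shift t p)| := by
            refine (abs_add_le _ _).trans (le_of_eq ?_)
            rw [abs_mul, abs_mul, abs_two]
        _ ≤ C₁ * ρ + 2 * 1 * (C₂ * ρ) := by gcongr
        _ ≤ 2 * S * ρ := by nlinarith [mul_nonneg C₀0 hρ.le, mul_nonneg C₁0 hρ.le]
    have A2 : |a₀ (shift t p) + s * a₁ (shift t p) + s ^ 2 * a₂ (shift t p)| ≤ S * ρ := by
      calc |a₀ (shift t p) + s * a₁ (shift t p) + s ^ 2 * a₂ (shift t p)|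
          ≤ |a₀ (shift t p)| + |s| * |a₁ (shift t p)| + |s| ^ 2 * |a₂ (shift t p)| := by
            refine (abs_add_three _ _ _).trans (le_of_eq ?_)
            rw [abs_mul, abs_mul, abs_pow]
        _ ≤ C₀ * ρ + 1 * (C₁ * ρ) + 1 * (C₂ * ρ) := by gcongr
        _ = S * ρ := by ring
    have A3 : |1 + s * b₁ (shift t p) + s ^ 2 * b₂ (shift t p)| ≤ 3 * K := by
      calc |1 + s * b₁ (shift t p) + s ^ 2 * b₂ (shift t p)|
          ≤ |1| + |s| * |b₁ (shift t p)| + |s| ^ 2 * |b₂ (shift t p)| := by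
            refine (abs_add_three _ _ _).trans (le_of_eq ?_)
            rw [abs_mul, abs_mul, abs_pow]
        _ ≤ |1| + 1 * K₁ + 1 * K₂ := by gcongr
        _ ≤ 3 * K := by rw [abs_one]; linarith
    have A4 : |b₁ (shift t p) + 2 * s * b₂ (shift t p)| ≤ 3 * K := by
      calc |b₁ (shift t p) + 2 * s * b₂ (shift t p)|
          ≤ |b₁ (shift t p)| + 2 * |s| * |b₂ (shift t p)| := by
            refine (abs_add_le _ _).trans (le_of_eq ?_)
            rw [abs_mul, abs_mul, abs_two]
        _ ≤ K₁ + 2 * 1 * K₂ := by gcongr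
        _ ≤ 3 * K := by linarith
    set d := 1 + s * b₁ (shift t p) + s ^ 2 * b₂ (shift t p)
    have hd2 : (1 : ℝ) / 4 ≤ d ^ 2 := by nlinarith
    have hS : 0 ≤ S := by linarith
    rw [Real.norm_eq_abs, abs_div, abs_of_pos (by positivity : (0 : ℝ) < d ^ 2),
      div_le_iff₀ (by linarith)]
    calc _ ≤ |a₁ (shift t p) + 2 * s * a₂ (shift t p)| * |d|
          + |a₀ (shift t p) + s * a₁ (shift t p) + s ^ 2 * a₂ (shift t p)|
            * |b₁ (shift t p) + 2 * s * b₂ (shift t p)| := by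
          refine (abs_sub _ _).trans (le_of_eq ?_)
          rw [abs_mul, abs_mul]
      _ ≤ 2 * S * ρ * (3 * K) + S * ρ * (3 * K) := by gcongr
      _ = (2 * S * (3 * K) + S * (3 * K)) * 4 * ρ * (1 / 4) := by ring
      _ ≤ _ := by gcongr
  · refine (ae_restrict_iff' measurableSet_Ioi).2 (Eventually.of_forall fun t ht s hs => ?_)
    refine hasDerivAt_ratio _ _ _ _ _ ?_
    have := den s (hb s hs) t (le_of_lt ht)
    linarith

end ratio

/-- The cofactors of the angular part of a symmetric matrix. -/
def cof (G : Matrix (Fin 4) (Fin 4) ℝ) (A B : Fin 2) : ℝ :=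
  (!![G 3 3, -G 2 3; -G 2 3, G 2 2] : Matrix (Fin 2) (Fin 2) ℝ) A B

/-- The determinant of the angular part of a symmetric matrix. -/
def angDet (G : Matrix (Fin 4) (Fin 4) ℝ) : ℝ := G 2 2 * G 3 3 - G 2 3 * G 2 3

theorem cof_add_smul (G K : Matrix (Fin 4) (Fin 4) ℝ) (s : ℝ) (A B : Fin 2) :
    cof (G + s • K) A B = cof G A B + s * cof K A B := by
  fin_cases A <;> fin_cases B <;> simp [cof] <;> ring

theorem angDet_add_smul (G K : Matrix (Fin 4) (Fin 4) ℝ) (s : ℝ) : angDet (G + s • K)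
    = angDet G + s * (G 2 2 * K 3 3 + G 3 3 * K 2 2 - 2 * (G 2 3 * K 2 3)) + s ^ 2 * angDet K := by
  simp [angDet]
  ring

/-- The components `g^{AB}` and `g^{rA}` of the inverse of a matrix in Newman–Unti form, regular
or not. -/
theorem inv_apply_of_nuForm {G : Matrix (Fin 4) (Fin 4) ℝ} (hs : ∀ μ ν, G μ ν = G ν μ)
    (h01 : G 0 1 = -1) (h11 : G 1 1 = 0) (h12 : G 1 2 = 0) (h13 : G 1 3 = 0) :
    (∀ A B : Fin 2, G⁻¹ A.succ.succ B.succ.succ = cof G A B / angDet G) ∧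
    ∀ A : Fin 2, G⁻¹ 1 A.succ.succ
      = (cof G A 0 * G 0 2 + cof G A 1 * G 0 3) / angDet G := by
  -- In the singular case the matrix inverse and the quotients are both zero by convention. The
  -- formulas thus hold for every s, with no question of where the varied metric degenerates.
  by_cases hd : angDet G = 0
  · have hdet : G.det = 0 := by
      have h10 := hs 1 0
      have h20 := hs 2 0
      have h30 := hs 3 0
      have h21 := hs 2 1
      have h31 := hs 3 1
      have h32 := hs 3 2
      rw [h01] at h10
      rw [h12] at h21
      rw [h13] at h31
      rw [angDet] at hd
      simp [Matrix.det_succ_row_zero, Fin.sum_univ_succ, Fin.succAbove, h01, h10, h11, h12, h13,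
        h20, h30, h21, h31, h32]
      linear_combination -hd
    have hG : G⁻¹ = 0 := Matrix.nonsing_inv_apply_not_isUnit G (by simp [hdet])
    simp [hG, hd]
  · have h := inv_of_nuForm hs h01 h11 h12 h13 (d := (angDet G)⁻¹) (inv_mul_cancel₀ hd)
    constructor
    · intro A B
      rw [h, div_eq_mul_inv]
      fin_cases A <;> fin_cases B <;> simp [cof]
    · intro A
      rw [h, div_eq_mul_inv]
      fin_cases A
      · change (G 3 3 * G 0 2 - G 2 3 * G 0 3) * _ = (G 3 3 * G 0 2 + -G 2 3 * G 0 3) * _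
        ring
      · change (G 2 2 * G 0 3 - G 2 3 * G 0 2) * _ = (-G 2 3 * G 0 2 + G 2 2 * G 0 3) * _
        ring

/-! ### The varied inverse metric -/

section inverse
variable {D : Region} {M : NUMetric D} {ξ : VField} {ω : ScriPt → ℝ} {p : Pt}

theorem NUMetric.angDet_g (M : NUMetric D) (hp : p ∈ D.bulk) : angDet (M.g p) = M.dh p := by
  rw [angDet, M.g_eq hp]
  rfl

theorem NUMetric.cof_g (M : NUMetric D) (hp : p ∈ D.bulk) (A B : Fin 2) :
    cof (M.g p) A B = M.hInv A B p * M.dh p := by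
  rw [NUMetric.hInv, inv_mul_cancel_right₀ (M.dh_pos hp).ne', cof, M.g_eq hp]
  rfl

theorem NUMetric.sum_hInv_g0A (M : NUMetric D) (hp : p ∈ D.bulk) (A : Fin 2) :
    ∑ B : Fin 2, M.hInv A B p * M.g p 0 B.succ.succ = -M.V p A := by
  simp only [M.g_0A hp, mul_neg, Finset.mul_sum, Finset.sum_neg_distrib]
  rw [Finset.sum_comm]
  simp only [← mul_assoc, ← Finset.sum_mul, M.sum_h_hInv hp]
  simp

/-- `∂_s (det h_s / det h)` at `s = 0`. -/
noncomputable def detVar (M : NUMetric D) (K : Tensor2) (p : Pt) : ℝ :=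
  (M.h p 0 0 * K p 3 3 + M.h p 1 1 * K p 2 2 - 2 * (M.h p 0 1 * K p 2 3)) * (M.dh p)⁻¹

/-- Factoring out det h normalizes the denominator to the form 1 + s b₁ + s² b₂ required by
`hasDerivAt_tail_ratio`. -/
theorem angDet_var (K : Tensor2) (s : ℝ) (hp : p ∈ D.bulk) : angDet ((M.g + s • K) p)
    = M.dh p * (1 + s * detVar M K p + s ^ 2 * (angDet (K p) * (M.dh p)⁻¹)) := by
  have h0 := (M.dh_pos hp).ne'
  have e : (M.g + s • K) p = M.g p + s • K p := rfl
  have e1 : M.g p 2 2 = M.h p 0 0 := M.g_AB hp 0 0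
  have e2 : M.g p 3 3 = M.h p 1 1 := M.g_AB hp 1 1
  have e3 : M.g p 2 3 = M.h p 0 1 := M.g_AB hp 0 1
  rw [e, angDet_add_smul, M.angDet_g hp, e1, e2, e3, detVar]
  field_simp

theorem cof_var (K : Tensor2) (s : ℝ) (hp : p ∈ D.bulk) (A B : Fin 2) : cof ((M.g + s • K) p) A B
    = M.dh p * (M.hInv A B p + s * (cof (K p) A B * (M.dh p)⁻¹)) := by
  have h0 := (M.dh_pos hp).ne'
  have e : (M.g + s • K) p = M.g p + s • K p := rfl
  rw [e, cof_add_smul, M.cof_g hp]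
  field_simp

variable (h : IsNUSymmetry M ω ξ)
include h

theorem nuForm_var (s : ℝ) (hp : p ∈ D.bulk) :
    (∀ A B : Fin 2, ((M.g + s • lieMetric ξ M.g) p)⁻¹ A.succ.succ B.succ.succ
      = cof ((M.g + s • lieMetric ξ M.g) p) A B / angDet ((M.g + s • lieMetric ξ M.g) p)) ∧
    ∀ A : Fin 2, ((M.g + s • lieMetric ξ M.g) p)⁻¹ 1 A.succ.succ
      = (cof ((M.g + s • lieMetric ξ M.g) p) A 0 * (M.g + s • lieMetric ξ M.g) p 0 2
        + cof ((M.g + s • lieMetric ξ M.g) p) A 1 * (M.g + s • lieMetric ξ M.g) p 0 3)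
        / angDet ((M.g + s • lieMetric ξ M.g) p) := by
  have e : ∀ μ ν, (M.g + s • lieMetric ξ M.g) p μ ν
      = M.g p μ ν + s * lieMetric ξ M.g p μ ν := fun _ _ => rfl
  have k1 := fun μ => h.lieMetric_one_right hp μ
  have k1' : ∀ μ, lieMetric ξ M.g p 1 μ = 0 := fun μ => by rw [lieMetric_symm hp, k1]
  refine inv_apply_of_nuForm (fun μ ν => ?_) ?_ ?_ ?_ ?_
  · rw [e, e, M.g_symm hp μ ν, lieMetric_symm hp μ ν]
  · rw [e, M.g_01 hp, k1]; ring
  · rw [e, M.g_11 hp, k1]; ring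
  · rw [e, k1', show M.g p 1 2 = 0 from M.g_1A hp 0]; ring
  · rw [e, k1', show M.g p 1 3 = 0 from M.g_1A hp 1]; ring

/-- Identifies the Lie derivative with what the quotient rule gives for the s-derivative of the
varied g^{AB}; the content is δ(g⁻¹) = -g⁻¹ (δg) g⁻¹, written out for a 2 × 2 block. -/
theorem lieInv_AB_eq (hp : p ∈ D.bulk) (A B : Fin 2) :
    lieInv ξ M.g A.succ.succ B.succ.succ p = cof (lieMetric ξ M.g p) A B * (M.dh p)⁻¹
      - M.hInv A B p * detVar M (lieMetric ξ M.g) p := by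
  have e : lieInv ξ M.g A.succ.succ B.succ.succ p = -∑ C : Fin 2, ∑ E : Fin 2,
      M.hInv A E p * lieMetric ξ M.g p E.succ.succ C.succ.succ * M.hInv C B p := by
    have h1 := congrFun (congrFun (lieInvMatrix_eq (M := M) (ξ := ξ) hp) A.succ.succ) B.succ.succ
    simp only [lieInvMatrix, Matrix.of_apply, Matrix.neg_apply, Matrix.mul_apply, sum_four,
      M.inv_g hp, M.ginv_0A, M.ginv_A0, M.ginv_A1, M.ginv_1A, M.ginv_AB, h.lieMetric_one_right hp,
      lieMetric_symm hp 1] at h1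
    rw [h1]
    simp only [Fin.sum_univ_two]
    ring
  have h0 := (M.dh_pos hp).ne'
  have hs : lieMetric ξ M.g p 3 2 = lieMetric ξ M.g p 2 3 := lieMetric_symm hp 3 2
  have i1 : M.hInv 0 0 p = M.h p 1 1 * (M.dh p)⁻¹ := rfl
  have i2 : M.hInv 0 1 p = -M.h p 0 1 * (M.dh p)⁻¹ := rfl
  have i3 : M.hInv 1 0 p = -M.h p 0 1 * (M.dh p)⁻¹ := rfl
  have i4 : M.hInv 1 1 p = M.h p 0 0 * (M.dh p)⁻¹ := rfl
  have hd : (M.h p 0 0 * M.h p 1 1 - M.h p 0 1 * M.h p 0 1) * (M.dh p)⁻¹ = 1 :=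
    mul_inv_cancel₀ h0
  rw [e]
  set d := (M.dh p)⁻¹
  simp only [Fin.sum_univ_two, Fin.succ_zero_eq_one, Fin.succ_one_eq_two]
  change -(M.hInv A 0 p * lieMetric ξ M.g p 2 2 * M.hInv 0 B p
      + M.hInv A 1 p * lieMetric ξ M.g p 3 2 * M.hInv 0 B p
      + (M.hInv A 0 p * lieMetric ξ M.g p 2 3 * M.hInv 1 B p
      + M.hInv A 1 p * lieMetric ξ M.g p 3 3 * M.hInv 1 B p)) = _
  rw [hs]
  fin_cases A <;> fin_cases B <;> simp only [Fin.mk_one, Fin.zero_eta, i1, i2, i3, i4, cof, detVar,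
    Matrix.of_apply, Matrix.cons_val', Matrix.cons_val_zero, Matrix.cons_val_one,
    Matrix.cons_val_fin_one]
  · linear_combination lieMetric ξ M.g p 3 3 * d * hd
  · linear_combination -lieMetric ξ M.g p 2 3 * d * hd
  · linear_combination -lieMetric ξ M.g p 2 3 * d * hd
  · linear_combination lieMetric ξ M.g p 2 2 * d * hd

/-- The same identification for g^{rA}: row u of (L g) g⁻¹ + g (L g⁻¹) = 0 can be solved for L
g^{rA} because g_{ur} = -1. -/
theorem lieInv_1A_eq (hp : p ∈ D.bulk) (A : Fin 2) :
    lieInv ξ M.g 1 A.succ.succ p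
      = (∑ B : Fin 2, (cof (lieMetric ξ M.g p) A B * (M.dh p)⁻¹ * M.g p 0 B.succ.succ
        + M.hInv A B p * lieMetric ξ M.g p 0 B.succ.succ))
        - -M.V p A * detVar M (lieMetric ξ M.g) p := by
  have h1 := congrFun (congrFun (lieMetric_mul_inv (M := M) (ξ := ξ) hp) 0) A.succ.succ
  simp only [Matrix.add_apply, Matrix.mul_apply, sum_four, M.inv_g hp, M.ginv_0A, M.ginv_1A,
    M.ginv_AB, h.lieMetric_one_right hp, lieInvMatrix, Matrix.of_apply, M.g_01 hp,
    h.lieInv_zero_left hp, Matrix.zero_apply] at h1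
  have h2 : ∀ B : Fin 2, cof (lieMetric ξ M.g p) A B * (M.dh p)⁻¹
      = lieInv ξ M.g A.succ.succ B.succ.succ p
        + M.hInv A B p * detVar M (lieMetric ξ M.g) p := fun B => by
    rw [lieInv_AB_eq h hp]; ring
  have h3 := M.sum_hInv_g0A hp A
  simp only [h2, Fin.sum_univ_two, lieInv_symm h.smooth hp A.succ.succ, M.hInv_symm A] at h1 h3 ⊢
  linear_combination -h1 - detVar M (lieMetric ξ M.g) p * h3

variable (hω : ContDiffOn ℝ (⊤ : ℕ∞) ω D.scri)
include hω

theorem asym_cof (A B : Fin 2) :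
    Asym D false (-2) fun p => cof (lieMetric ξ M.g p) A B * (M.dh p)⁻¹ := by
  have hd := M.asym_dh_inv
  have hk := h.asym_lieMetric_AB hω
  fin_cases A <;> fin_cases B
  · exact (hk 1 1).mulO hd
  · exact (hk 0 1).neg.mulO hd
  · exact (hk 0 1).neg.mulO hd
  · exact (hk 0 0).mulO hd

theorem asym_detVar : Asym D false 0 (detVar M (lieMetric ξ M.g)) := by
  have hk := h.asym_lieMetric_AB hω
  refine Asym.mulO (m := 4) (Asym.sub (Asym.add ?_ ?_) (Asym.const_mul 2 ?_)) M.asym_dh_inv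
  · exact (M.asym_h 0 0).mulO (hk 1 1)
  · exact (M.asym_h 1 1).mulO (hk 0 0)
  · exact (M.asym_h 0 1).mulO (hk 0 1)

theorem asym_angDet : Asym D false 0 fun p => angDet (lieMetric ξ M.g p) * (M.dh p)⁻¹ := by
  have hk := h.asym_lieMetric_AB hω
  refine Asym.mulO (m := 4) (Asym.sub ?_ ?_) M.asym_dh_inv
  · exact (hk 0 0).mulO (hk 1 1)
  · exact (hk 0 1).mulO (hk 0 1)

theorem hasDerivAt_tail_inv_AB (hp : p ∈ D.bulk) (A B : Fin 2) :
    HasDerivAt (fun s : ℝ => tail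
      (fun x => ((M.g + s • lieMetric ξ M.g) x)⁻¹ A.succ.succ B.succ.succ) p)
      (tail (lieInv ξ M.g A.succ.succ B.succ.succ) p) 0 := by
  have key := hasDerivAt_tail_ratio (M.asym_hInv A B) (asym_cof h hω A B)
    (Asym.zero (D := D) (b := false) (n := -2)) (asym_detVar h hω) (asym_angDet h hω) hp
  rw [tail_congr (fun x hx => lieInv_AB_eq h hx A B) hp]
  refine key.congr_of_eventuallyEq (Eventually.of_forall fun s => tail_congr (fun x hx => ?_) hp)
  rw [(nuForm_var h s hx).1, cof_var _ s hx, angDet_var _ s hx,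
    mul_div_mul_left _ _ (M.dh_pos hx).ne', mul_zero, add_zero]

theorem hasDerivAt_tail_inv_1A (hp : p ∈ D.bulk) (A : Fin 2) :
    HasDerivAt (fun s : ℝ => tail
      (fun x => ((M.g + s • lieMetric ξ M.g) x)⁻¹ 1 A.succ.succ) p)
      (tail (lieInv ξ M.g 1 A.succ.succ) p) 0 := by
  have h1 : Asym D false (-2) fun p =>
      ∑ B : Fin 2, (cof (lieMetric ξ M.g p) A B * (M.dh p)⁻¹ * M.g p 0 B.succ.succ
        + M.hInv A B p * lieMetric ξ M.g p 0 B.succ.succ) :=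
    asym_sum_two fun B => ((asym_cof h hω A B).mulO (M.asym_g0A B)).add
      ((M.asym_hInv A B).mulO (h.asym_lieMetric_0A hω B))
  have h2 : Asym D false (-2) fun p => ∑ B : Fin 2,
      cof (lieMetric ξ M.g p) A B * (M.dh p)⁻¹ * lieMetric ξ M.g p 0 B.succ.succ :=
    asym_sum_two fun B => (asym_cof h hω A B).mulO (h.asym_lieMetric_0A hω B)
  have key := hasDerivAt_tail_ratio (M.asym_V A).neg h1 h2 (asym_detVar h hω) (asym_angDet h hω) hp
  rw [tail_congr (fun x hx => lieInv_1A_eq h hx A) hp]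
  refine key.congr_of_eventuallyEq (Eventually.of_forall fun s => tail_congr (fun x hx => ?_) hp)
  have h3 := M.sum_hInv_g0A hx A
  have e : ∀ B : Fin 2, (M.g + s • lieMetric ξ M.g) x 0 B.succ.succ
      = M.g x 0 B.succ.succ + s * lieMetric ξ M.g x 0 B.succ.succ := fun _ => rfl
  have e0 := e 0
  have e1 := e 1
  rw [(nuForm_var h s hx).2, cof_var _ s hx, cof_var _ s hx, angDet_var _ s hx,
    ← mul_div_mul_left _ (1 + _ + _) (M.dh_pos hx).ne', ← h3]
  congr 1
  simp only [Fin.sum_univ_two, Fin.succ_zero_eq_one, Fin.succ_one_eq_two] at e0 e1 ⊢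
  change (M.g + s • lieMetric ξ M.g) x 0 2 = M.g x 0 2 + s * lieMetric ξ M.g x 0 2 at e0
  change (M.g + s • lieMetric ξ M.g) x 0 3 = M.g x 0 3 + s * lieMetric ξ M.g x 0 3 at e1
  rw [e0, e1]
  change _ = M.dh x * (M.hInv A 0 x * M.g x 0 2 + M.hInv A 1 x * M.g x 0 3 + s *
    (cof (lieMetric ξ M.g x) A 0 * (M.dh x)⁻¹ * M.g x 0 2 + M.hInv A 0 x * lieMetric ξ M.g x 0 2
    + (cof (lieMetric ξ M.g x) A 1 * (M.dh x)⁻¹ * M.g x 0 3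
      + M.hInv A 1 x * lieMetric ξ M.g x 0 3)) + s ^ 2 *
    (cof (lieMetric ξ M.g x) A 0 * (M.dh x)⁻¹ * lieMetric ξ M.g x 0 2
      + cof (lieMetric ξ M.g x) A 1 * (M.dh x)⁻¹ * lieMetric ξ M.g x 0 3))
  ring

end inverse

end NewmanUnti

namespace NewmanUnti

/-! ## The variation of `f`

The parameter `s` of a variation of the conformal factor is put in the place of the radial
coordinate, so that the varied objects are functions of `(u, s, x¹, x²)`. -/

theorem hasDerivAt_lift {H : Pt → ℝ} {q : ScriPt} {s : ℝ} (hH : DifferentiableAt ℝ H (lift q s)) :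
    HasDerivAt (fun t => H (lift q t)) (pd 1 H (lift q s)) s := by
  have h := hasDerivAt_pd 1 hH
  simpa only [update_one_eq_lift, toScri_lift, lift_apply_one] using h

section variation
variable {D : Region} {φ ω : ScriPt → ℝ} {p : Pt} {q : ScriPt}

/-- The conformal factor along the variation `δφ = ω`. -/
noncomputable def varφ (φ ω : ScriPt → ℝ) (p : Pt) : ℝ :=
  1 / 2 * Real.log (Real.exp (2 * φ (toScri p)) * (1 + 2 * p 1 * ω (toScri p)))

/-- The domain on which the varied conformal factor is regular. -/
def varDom (D : Region) (ω : ScriPt → ℝ) : Set Pt :=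
  {p | toScri p ∈ D.scri ∧ 0 < 1 + 2 * p 1 * ω (toScri p)}

theorem varφ_eq (hp : p ∈ varDom D ω) :
    varφ φ ω p = φ (toScri p) + 1 / 2 * Real.log (1 + 2 * p 1 * ω (toScri p)) := by
  rw [varφ, Real.log_mul (Real.exp_pos _).ne' hp.2.ne', Real.log_exp]
  ring

theorem varφ_lift_zero (q : ScriPt) : varφ φ ω (lift q 0) = φ q := by
  simp [varφ]

theorem lift_zero_mem (hq : q ∈ D.scri) : lift q 0 ∈ star (varDom D ω) := by
  intro t ht
  rw [squeeze_apply, update_lift_zero]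
  refine ⟨?_, by simp⟩
  have h := mem_star_scri hq t ht
  rw [squeeze_apply] at h
  rw [toScri_lift]
  exact h

variable (hω : ContDiffOn ℝ (⊤ : ℕ∞) ω D.scri) (hφ : ContDiffOn ℝ (⊤ : ℕ∞) φ D.scri)

theorem smooth_comp_toScri {a : ScriPt → ℝ} (ha : ContDiffOn ℝ (⊤ : ℕ∞) a D.scri) :
    ContDiffOn ℝ (⊤ : ℕ∞) (fun p => a (toScri p)) (varDom D ω) :=
  ha.comp contDiff_toScri.contDiffOn fun _ hp => hp.1

include hω

theorem smooth_varArg :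
    ContDiffOn ℝ (⊤ : ℕ∞) (fun p : Pt => 1 + 2 * p 1 * ω (toScri p)) (varDom D ω) :=
  contDiffOn_const.add ((contDiffOn_const.mul (contDiff_apply ℝ ℝ (1 : Fin 4)).contDiffOn).mul
    (smooth_comp_toScri hω))

theorem isOpen_varDom : IsOpen (varDom D ω) := by
  have h1 : IsOpen (toScri ⁻¹' D.scri) := D.isOpen_scri.preimage continuous_toScri
  have h2 : ContinuousOn (fun p : Pt => 1 + 2 * p 1 * ω (toScri p)) (toScri ⁻¹' D.scri) :=
    continuousOn_const.add ((continuousOn_const.mul (continuous_apply 1).continuousOn).mul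
      (hω.continuousOn.comp continuous_toScri.continuousOn fun _ hp => hp))
  exact h2.isOpen_inter_preimage h1 isOpen_Ioi

include hφ

theorem smooth_varφ : ContDiffOn ℝ (⊤ : ℕ∞) (varφ φ ω) (varDom D ω) :=
  ((smooth_comp_toScri hφ).add (contDiffOn_const.mul
    ((smooth_varArg hω).log fun _ hp => hp.2.ne'))).congr fun _ hp => varφ_eq hp

theorem pd_one_varφ (hp : p ∈ varDom D ω) :
    pd 1 (varφ φ ω) p = ω (toScri p) * (1 + 2 * p 1 * ω (toScri p))⁻¹ := by
  have d0 := smooth_diff (isOpen_varDom hω) (smooth_comp_toScri (ω := ω) hφ) hp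
  have d1 := smooth_diff (isOpen_varDom hω) (smooth_varArg hω) hp
  have d2 := smooth_diff (isOpen_varDom hω) (smooth_comp_toScri (ω := ω) hω) hp
  have d3 : DifferentiableAt ℝ (fun x : Pt => 2 * x 1) p :=
    (differentiableAt_apply 1 p).const_mul 2
  have e : pd 1 (fun p : Pt => 1 + 2 * p 1 * ω (toScri p)) p = 2 * ω (toScri p) := by
    rw [pd_add 1 (differentiableAt_const _) (d3.fun_mul d2), pd_const, pd_mul 1 d3 d2,
      pd_const_mul 1 _ (differentiableAt_apply 1 p), pd_coord,
      pd_one_comp_toScri (sdiff hω hp.1)]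
    simp
  have d4 : DifferentiableAt ℝ (fun p : Pt => Real.log (1 + 2 * p 1 * ω (toScri p))) p :=
    d1.log hp.2.ne'
  rw [pd_congr (isOpen_varDom hω) 1 (fun x hx => varφ_eq hx) hp, pd_add 1 d0 (d4.const_mul _),
    pd_one_comp_toScri (sdiff hφ hp.1), pd_const_mul 1 _ d4,
    pd_comp_deriv 1 (Real.hasDerivAt_log hp.2.ne') d1, e]
  ring

theorem pd_one_varφ_zero (hq : q ∈ D.scri) : pd 1 (varφ φ ω) (lift q 0) = ω q := by
  rw [pd_one_varφ hω hφ (star_subset (lift_zero_mem hq))]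
  simp

theorem pd_varφ_zero (hq : q ∈ D.scri) (i : Fin 3) :
    pd (up i) (varφ φ ω) (lift q 0) = pd i φ q := by
  rw [← pd_comp_lift i (smooth_diff (isOpen_varDom hω) (smooth_varφ hω hφ)
    (star_subset (lift_zero_mem hq)))]
  simp only [varφ_lift_zero]

/-- Mixed derivatives in s and the coordinates commute, and the s-derivative of the conformal factor
at s = 0 is ω. -/
theorem pd_one_pd_varφ_zero (hq : q ∈ D.scri) (i : Fin 3) :
    pd 1 (pd (up i) (varφ φ ω)) (lift q 0) = pd i ω q := by
  have hm := star_subset (lift_zero_mem (ω := ω) hq)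
  have ho := isOpen_varDom hω
  rw [pd_comm ho 1 (up i) (smooth_varφ hω hφ) hm,
    ← pd_comp_lift i (smooth_diff ho (smooth_pd ho 1 (smooth_varφ hω hφ)) hm)]
  exact pd_congr D.isOpen_scri i (fun x hx => pd_one_varφ_zero hω hφ hx) hq

end variation

/-- The varied integrand in the definition of `f`. -/
noncomputable def varSource (Y : Ang → Ang) (ω₂ φ ω : ScriPt → ℝ) (p : Pt) : ℝ :=
  Real.exp (-varφ φ ω p) * (flatDiv Y (ang (toScri p))
    + 2 * ∑ A : Fin 2, vec Y A (toScri p) * pd A.succ.succ (varφ φ ω) p - 2 * ω₂ (toScri p))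

/-- The varied function `f`. -/
noncomputable def varF (Y : Ang → Ang) (T : Ang → ℝ) (ω₂ φ ω : ScriPt → ℝ) (p : Pt) : ℝ :=
  Real.exp (varφ φ ω p) * (T (ang (toScri p)) + 1 / 2 * uInt (varSource Y ω₂ φ ω) p)

/-- The variation of `f`. -/
noncomputable def deltaF (Y : Ang → Ang) (T : Ang → ℝ) (ω₂ φ ω : ScriPt → ℝ) (q : ScriPt) : ℝ :=
  pd 1 (varF Y T ω₂ φ ω) (lift q 0)

section deltaF
variable {D : Region} {Y : Ang → Ang} {T : Ang → ℝ} {ω₂ φ ω : ScriPt → ℝ} {p : Pt} {q : ScriPt}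
  (hω : ContDiffOn ℝ (⊤ : ℕ∞) ω D.scri) (hφ : ContDiffOn ℝ (⊤ : ℕ∞) φ D.scri)
  (hY : Y ∈ ckv D) (hT : T ∈ smoothFns D.U) (hω₂ : ContDiffOn ℝ (⊤ : ℕ∞) ω₂ D.scri)
include hω hφ

/-- For fixed s, derivatives along Scri agree with those in (u, s, x), so the varied f is a slice of
one jointly smooth function. Differentiability in s, also of derivatives of f, is then a matter of
partial derivatives of `varF`. -/
theorem fFun_varφ (Y : Ang → Ang) (T : Ang → ℝ) (ω₂ : ScriPt → ℝ) {s : ℝ}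
    (hq : lift q s ∈ star (varDom D ω)) :
    fFun Y T ω₂ (fun x => varφ φ ω (lift x s)) q = varF Y T ω₂ φ ω (lift q s) := by
  simp only [fFun_eq, varF, toScri_lift]
  congr 3
  refine intervalIntegral.integral_congr fun v hv => ?_
  have hm := update_mem_star hq hv
  rw [update_lift_zero] at hm
  have hd : ∀ A : Fin 2, pd A.succ (fun x => varφ φ ω (lift x s)) (Function.update q 0 v)
      = pd A.succ.succ (varφ φ ω) (lift (Function.update q 0 v) s) := fun A => by
    rw [pd_comp_lift A.succ (smooth_diff (isOpen_varDom hω) (smooth_varφ hω hφ) hm), up_succ]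
  refine Eq.trans ?_ (congrArg (varSource Y ω₂ φ ω) (update_lift_zero q s v)).symm
  simp only [source, varSource, psi, toScri_lift, hd, vec]

include hY hω₂

theorem smooth_varSource : ContDiffOn ℝ (⊤ : ℕ∞) (varSource Y ω₂ φ ω) (varDom D ω) := by
  have hs := (isConf_vec hY).smooth
  have h0 : ContDiffOn ℝ (⊤ : ℕ∞) (fun q => flatDiv Y (ang q)) D.scri :=
    (smooth_sdiv hs).congr fun q hq => (sdiv_vec hY hq).symm
  have h1 := smooth_varφ hω hφ
  exact h1.neg.exp.mul (((smooth_comp_toScri h0).add (contDiffOn_const.mul (ContDiffOn.sum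
    fun A _ => (smooth_comp_toScri (hs A)).mul (smooth_pd (isOpen_varDom hω) _ h1)))).sub
      (contDiffOn_const.mul (smooth_comp_toScri hω₂)))

include hT

theorem smooth_varF : ContDiffOn ℝ (⊤ : ℕ∞) (varF Y T ω₂ φ ω) (star (varDom D ω)) :=
  ((smooth_varφ hω hφ).mono star_subset).exp.mul
    (((smooth_comp_toScri (smooth_comp_ang hT)).mono star_subset).add (contDiffOn_const.mul
      (contDiffOn_uInt (isOpen_varDom hω) (smooth_varSource hω hφ hY hω₂))))

theorem smooth_deltaF : ContDiffOn ℝ (⊤ : ℕ∞) (deltaF Y T ω₂ φ ω) D.scri :=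
  (smooth_pd (isOpen_star (isOpen_varDom hω)) 1 (smooth_varF hω hφ hY hT hω₂)).comp
    (contDiff_lift.comp (contDiff_id.prodMk contDiff_const)).contDiffOn
    fun _ hq => lift_zero_mem hq

/-- The evolution equation of f, for all s at once, so that it may be differentiated in s. -/
theorem pd_zero_varF (hp : p ∈ star (varDom D ω)) : pd 0 (varF Y T ω₂ φ ω) p
    = varF Y T ω₂ φ ω p * pd 0 (varφ φ ω) p + (1 / 2 * flatDiv Y (ang (toScri p)) +
      ∑ A : Fin 2, vec Y A (toScri p) * pd A.succ.succ (varφ φ ω) p - ω₂ (toScri p)) := by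
  have hp' := star_subset hp
  have ho := isOpen_varDom hω
  have d1 := smooth_diff ho (smooth_varφ hω hφ) hp'
  have d2 := smooth_diff ho (smooth_comp_toScri (ω := ω) (smooth_comp_ang hT)) hp'
  have d3 := smooth_diff (isOpen_star ho) (contDiffOn_uInt ho (smooth_varSource hω hφ hY hω₂)) hp
  have e : varF Y T ω₂ φ ω = fun p => Real.exp (varφ φ ω p) *
    (T (ang (toScri p)) + 1 / 2 * uInt (varSource Y ω₂ φ ω) p) := rfl
  have h0 := (Real.exp_pos (varφ φ ω p)).ne'
  rw [e, pd_mul 0 d1.exp (d2.fun_add (d3.const_mul _)), pd_add 0 d2 (d3.const_mul _),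
    pd_const_mul 0 _ d3, pd_exp 0 d1, pd_zero_uInt ho (smooth_varSource hω hφ hY hω₂) hp,
    pd_zero_scri (a := fun q => T (ang q)) (sdiff (smooth_comp_ang hT) hp'.1),
    pd_zero_comp_ang ((fns_contDiffAt hT hp'.1.2).differentiableAt (by simp)), varSource,
    Real.exp_neg]
  field_simp
  ring

/-- The evolution equation of the variation of `f`. -/
theorem pd_zero_deltaF (hq : q ∈ D.scri) : pd 0 (deltaF Y T ω₂ φ ω) q
    = deltaF Y T ω₂ φ ω q * pd 0 φ q + fFun Y T ω₂ φ q * pd 0 ω q + along (vec Y) ω q := by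
  have hm := lift_zero_mem (ω := ω) hq
  have hm' := star_subset hm
  have ho := isOpen_varDom hω
  have hs := smooth_varF hω hφ hY hT hω₂
  have hv := smooth_varφ hω hφ
  have hf : varF Y T ω₂ φ ω (lift q 0) = fFun Y T ω₂ φ q := by
    rw [← fFun_varφ hω hφ Y T ω₂ hm]
    simp only [varφ_lift_zero]
  -- Interchanging ∂_u with ∂_s reduces the claim to the s-derivative of the evolution equation.
  have e1 : pd 0 (deltaF Y T ω₂ φ ω) q = pd 1 (pd 0 (varF Y T ω₂ φ ω)) (lift q 0) := by
    rw [pd_comm (isOpen_star ho) 1 0 hs hm]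
    exact pd_comp_lift 0 (smooth_diff (isOpen_star ho) (smooth_pd (isOpen_star ho) 1 hs) hm)
  have sY := (isConf_vec hY).smooth
  have h0 : ContDiffOn ℝ (⊤ : ℕ∞) (fun q => flatDiv Y (ang q)) D.scri :=
    (smooth_sdiv sY).congr fun q hq => (sdiv_vec hY hq).symm
  have d1 := smooth_diff (isOpen_star ho) hs hm
  have d2 := smooth_diff ho (smooth_pd ho 0 hv) hm'
  have d3 := smooth_diff ho (smooth_comp_toScri (ω := ω) h0) hm'
  have d4 := fun A : Fin 2 => smooth_diff ho (smooth_comp_toScri (ω := ω) (sY A)) hm'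
  have d5 := fun A : Fin 2 => smooth_diff ho (smooth_pd ho A.succ.succ hv) hm'
  have d6 := smooth_diff ho (smooth_comp_toScri (ω := ω) hω₂) hm'
  have d7 : DifferentiableAt ℝ (fun p => ∑ A : Fin 2, vec Y A (toScri p)
      * pd A.succ.succ (varφ φ ω) p) (lift q 0) :=
    DifferentiableAt.fun_sum fun A _ => (d4 A).fun_mul (d5 A)
  have sq : toScri (lift q 0) ∈ D.scri := by simpa using hq
  rw [e1, pd_congr (isOpen_star ho) 1 (fun x hx => pd_zero_varF hω hφ hY hT hω₂ hx) hm,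
    pd_add 1 (d1.fun_mul d2) (((d3.const_mul _).fun_add d7).fun_sub d6), pd_mul 1 d1 d2,
    pd_sub 1 ((d3.const_mul _).fun_add d7) d6, pd_add 1 (d3.const_mul _) d7, pd_const_mul 1 _ d3,
    pd_sum _ _ fun A _ => (d4 A).fun_mul (d5 A),
    pd_one_comp_toScri (a := fun q => flatDiv Y (ang q)) (sdiff h0 sq),
    pd_one_comp_toScri (sdiff hω₂ sq), hf, show (0 : Fin 4) = up 0 from rfl,
    pd_varφ_zero hω hφ hq, pd_one_pd_varφ_zero hω hφ hq]
  have e2 : ∀ A : Fin 2, pd 1 (fun p => vec Y A (toScri p) * pd A.succ.succ (varφ φ ω) p) (lift q 0)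
      = vec Y A q * pd A.succ ω q := fun A => by
    rw [pd_mul 1 (d4 A) (d5 A), pd_one_comp_toScri (sdiff (sY A) sq), ← up_succ,
      pd_one_pd_varφ_zero hω hφ hq]
    simp
  simp only [e2, along, deltaF]
  ring

/-- At u = 0 the integral is absent for every s, so f = e^φ T there and only the prefactor varies.
-/
theorem deltaF_at_zero (hq : q ∈ D.scri) (h0 : q 0 = 0) :
    deltaF Y T ω₂ φ ω q = ω q * fFun Y T ω₂ φ q := by
  have hm := lift_zero_mem (ω := ω) hq
  have hm' := star_subset hm
  have ho := isOpen_varDom hω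
  have h1 := hasDerivAt_lift (smooth_diff (isOpen_star ho) (smooth_varF hω hφ hY hT hω₂) hm)
  have h2 := (hasDerivAt_lift (smooth_diff ho (smooth_varφ hω hφ) hm')).exp.mul_const (T (ang q))
  have e : ∀ t, varF Y T ω₂ φ ω (lift q t) = Real.exp (varφ φ ω (lift q t)) * T (ang q) := by
    intro t
    have : uInt (varSource Y ω₂ φ ω) (lift q t) = 0 := by
      have : lift q t 0 = 0 := h0
      simp [uInt, this]
    simp [varF, this]
  simp only [e] at h1
  have h3 := h1.unique h2
  rw [deltaF, h3, pd_one_varφ_zero hω hφ hq, varφ_lift_zero, fFun_at_zero _ _ _ _ h0]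
  ring

/-! ### Derivatives with respect to the parameter -/

theorem pd_fFun_varφ {s : ℝ} (i : Fin 3) (hq : lift q s ∈ star (varDom D ω)) :
    pd i (fFun Y T ω₂ (fun x => varφ φ ω (lift x s))) q
      = pd (up i) (varF Y T ω₂ φ ω) (lift q s) := by
  have ho := isOpen_star (isOpen_varDom hω)
  have hl : Continuous fun x : ScriPt => lift x s :=
    continuous_lift.comp (continuous_id.prodMk continuous_const)
  rw [pd_congr (ho.preimage hl) i (fun x hx => fFun_varφ hω hφ Y T ω₂ hx) hq,
    pd_comp_lift i (smooth_diff ho (smooth_varF hω hφ hY hT hω₂) hq)]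

theorem flap_fFun_varφ {s : ℝ} (hq : lift q s ∈ star (varDom D ω)) :
    flap (fFun Y T ω₂ (fun x => varφ φ ω (lift x s))) q
      = ∑ A : Fin 2, pd (up A.succ) (pd (up A.succ) (varF Y T ω₂ φ ω)) (lift q s) := by
  have ho := isOpen_star (isOpen_varDom hω)
  have hl : Continuous fun x : ScriPt => lift x s :=
    continuous_lift.comp (continuous_id.prodMk continuous_const)
  refine Finset.sum_congr rfl fun A _ => ?_
  rw [pd_congr (ho.preimage hl) A.succ
    (fun x hx => pd_fFun_varφ hω hφ hY hT hω₂ A.succ hx) hq,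
    pd_comp_lift A.succ (smooth_diff ho (smooth_pd ho _ (smooth_varF hω hφ hY hT hω₂)) hq)]

omit hω hφ hY hT hω₂ in
theorem eventually_lift_mem {Ω : Set Pt} (hΩ : IsOpen Ω) (hq : lift q 0 ∈ Ω) :
    ∀ᶠ s in 𝓝 (0 : ℝ), lift q s ∈ Ω := by
  have hl : Continuous fun s : ℝ => lift q s :=
    continuous_lift.comp (continuous_const.prodMk continuous_id)
  exact hl.continuousAt.eventually (hΩ.mem_nhds hq)

theorem hasDerivAt_fFun_varφ (hq : q ∈ D.scri) :
    HasDerivAt (fun s => fFun Y T ω₂ (fun x => varφ φ ω (lift x s)) q) (deltaF Y T ω₂ φ ω q) 0 := by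
  have ho := isOpen_star (isOpen_varDom hω)
  have hm := lift_zero_mem (ω := ω) hq
  refine (hasDerivAt_lift (smooth_diff ho (smooth_varF hω hφ hY hT hω₂)
    hm)).congr_of_eventuallyEq ?_
  filter_upwards [eventually_lift_mem ho hm] with s hs using fFun_varφ hω hφ Y T ω₂ hs

theorem pd_deltaF (i : Fin 3) (hq : q ∈ D.scri) : pd i (deltaF Y T ω₂ φ ω) q
    = pd 1 (pd (up i) (varF Y T ω₂ φ ω)) (lift q 0) := by
  have ho := isOpen_star (isOpen_varDom hω)
  have hm := lift_zero_mem (ω := ω) hq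
  have hs := smooth_varF hω hφ hY hT hω₂
  rw [pd_comm ho 1 (up i) hs hm]
  exact pd_comp_lift i (smooth_diff ho (smooth_pd ho 1 hs) hm)

theorem hasDerivAt_pd_fFun_varφ (i : Fin 3) (hq : q ∈ D.scri) :
    HasDerivAt (fun s => pd i (fFun Y T ω₂ (fun x => varφ φ ω (lift x s))) q)
      (pd i (deltaF Y T ω₂ φ ω) q) 0 := by
  have ho := isOpen_star (isOpen_varDom hω)
  have hm := lift_zero_mem (ω := ω) hq
  have hs := smooth_varF hω hφ hY hT hω₂
  rw [pd_deltaF hω hφ hY hT hω₂ i hq]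
  refine (hasDerivAt_lift (smooth_diff ho (smooth_pd ho _ hs) hm)).congr_of_eventuallyEq ?_
  filter_upwards [eventually_lift_mem ho hm] with s hs using pd_fFun_varφ hω hφ hY hT hω₂ i hs

theorem hasDerivAt_flap_fFun_varφ (hq : q ∈ D.scri) :
    HasDerivAt (fun s => flap (fFun Y T ω₂ (fun x => varφ φ ω (lift x s))) q)
      (flap (deltaF Y T ω₂ φ ω) q) 0 := by
  have ho := isOpen_star (isOpen_varDom hω)
  have hm := lift_zero_mem (ω := ω) hq
  have hs := smooth_varF hω hφ hY hT hω₂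
  have e : flap (deltaF Y T ω₂ φ ω) q = ∑ A : Fin 2,
      pd 1 (pd (up A.succ) (pd (up A.succ) (varF Y T ω₂ φ ω))) (lift q 0) := by
    refine Finset.sum_congr rfl fun A _ => ?_
    have hs1 := smooth_pd ho (up A.succ) hs
    rw [pd_comm ho 1 (up A.succ) hs1 hm,
      ← pd_comp_lift A.succ (smooth_diff ho (smooth_pd ho 1 hs1) hm)]
    exact pd_congr D.isOpen_scri _ (fun x hx => pd_deltaF hω hφ hY hT hω₂ A.succ hx) hq
  rw [e]
  have h := HasDerivAt.fun_sum fun (A : Fin 2) (_ : A ∈ Finset.univ) =>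
    hasDerivAt_lift (smooth_diff ho (smooth_pd ho (up A.succ) (smooth_pd ho (up A.succ) hs)) hm)
  refine h.congr_of_eventuallyEq ?_
  filter_upwards [eventually_lift_mem ho hm] with s hs using flap_fFun_varφ hω hφ hY hT hω₂ hs

/-- Besides f, the prefactor e^{-2φ} of the Laplacian varies, which accounts for the term with -2 ω.
-/
theorem hasDerivAt_lap_fFun_varφ (hq : q ∈ D.scri) :
    HasDerivAt (fun s => lap (fun x => varφ φ ω (lift x s))
      (fFun Y T ω₂ (fun x => varφ φ ω (lift x s))) q)
      (lap φ (deltaF Y T ω₂ φ ω) q - 2 * ω q * lap φ (fFun Y T ω₂ φ) q) 0 := by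
  have hm := star_subset (lift_zero_mem (ω := ω) hq)
  have h1 := hasDerivAt_lift (smooth_diff (isOpen_varDom hω) (smooth_varφ hω hφ) hm)
  have h2 := ((h1.const_mul (-2)).exp).fun_mul (hasDerivAt_flap_fFun_varφ hω hφ hY hT hω₂ hq)
  simp only [varφ_lift_zero, pd_one_varφ_zero hω hφ hq] at h2
  refine h2.congr_deriv ?_
  rw [lap_eq, lap_eq]
  ring

end deltaF

end NewmanUnti

namespace NewmanUnti

open MeasureTheory

/-! ## The variation of the asymptotic Killing vectors -/

section variation
variable {D : Region} (M : NUMetric D) (a b : ExtBMS4 D) {p : Pt}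

/-- The variation of `f_b` generated by `a`. -/
noncomputable def NUMetric.dF : ScriPt → ℝ := deltaF b.1.Y b.1.T b.2.fn M.φ a.2.fn

theorem NUMetric.smooth_dF : ContDiffOn ℝ (⊤ : ℕ∞) (M.dF a b) D.scri :=
  smooth_deltaF a.2.smooth M.smooth_φ b.1.1.2 b.1.2.2 b.2.smooth

/-- The `r⁰`-term of the radial component of the variation. -/
noncomputable def NUMetric.dZ (q : ScriPt) : ℝ :=
  M.Z (M.dF a b) q - 2 * a.2.fn q * M.Z (M.F b) q

theorem NUMetric.smooth_dZ : ContDiffOn ℝ (⊤ : ℕ∞) (M.dZ a b) D.scri :=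
  (M.smooth_Z (M.smooth_dF a b)).sub
    ((contDiffOn_const.mul a.2.smooth).mul (M.smooth_Z (M.smooth_F b)))

/-- The contribution of the variation of the inverse metric to the variation of `ξ_b`. -/
noncomputable def NUMetric.extra (p : Pt) : Pt := fun μ =>
  ∑ B : Fin 2, pd B.succ (M.F b) (toScri p) * tail (lieInv (akv a M.g) M.g μ B.succ.succ) p

theorem asym_lieInv_akv (μ : Fin 4) (B : Fin 2) :
    Asym D false (-2) (lieInv (akv a M.g) M.g μ B.succ.succ) := by
  have h := isNUSymmetry_akv M a
  revert μ
  rw [NUMetric.forall_fin_four]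
  exact ⟨Asym.zero.congr fun p hp => h.lieInv_zero_left hp _, h.asym_1A B,
    fun A => h.asym_AB a.2.smooth A B⟩

theorem NUMetric.asym_extra (μ : Fin 4) : Asym D false (-1) fun p => M.extra a b p μ :=
  asym_sum_two fun B => Asym.scri_mul (smooth_pdf (M.smooth_F b) _)
    ((asym_lieInv_akv M a μ B).tail le_rfl)

theorem NUMetric.extra_zero (hp : p ∈ D.bulk) : M.extra a b p 0 = 0 :=
  Finset.sum_eq_zero fun B _ => by
    rw [tail_congr (G := fun _ => 0)
      (fun x hx => (isNUSymmetry_akv M a).lieInv_zero_left hx _) hp]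
    simp [tail]

/-- Product rule in s. Varying f yields a field of the shape `gen`, whose angular function is 0
because Y is kept fixed; varying the inverse metric under the ray integrals yields `extra`. The
minus sign is common to both components because V^A = -g^{rA}. -/
theorem hasDerivAt_akv (hp : p ∈ D.bulk) :
    HasDerivAt (fun s : ℝ => akv b (M.g + s • lieMetric (akv a M.g) M.g) p)
      (M.gen (M.dF a b) (M.dZ a b) 0 p - M.extra a b p) 0 := by
  have h := isNUSymmetry_akv M a
  have hω := a.2.smooth
  have hq : toScri p ∈ D.scri := hp.1
  have hE := fun A B => hasDerivAt_tail_inv_AB h hω hp A B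
  have hV := fun A => hasDerivAt_tail_inv_1A h hω hp A
  have h0 := hasDerivAt_fFun_varφ (Y := b.1.Y) (T := b.1.T) hω M.smooth_φ b.1.1.2
    b.1.2.2 b.2.smooth hq
  have h1 := fun i => hasDerivAt_pd_fFun_varφ (Y := b.1.Y) (T := b.1.T) hω M.smooth_φ
    b.1.1.2 b.1.2.2 b.2.smooth i hq
  have h2 := hasDerivAt_lap_fFun_varφ (Y := b.1.Y) (T := b.1.T) hω M.smooth_φ b.1.1.2
    b.1.2.2 b.2.smooth hq
  have e : ∀ s : ℝ, akv b (M.g + s • lieMetric (akv a M.g) M.g) p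
      = killing b.1.Y (fun x => varφ M.φ a.2.fn (lift x s))
        (fFun b.1.Y b.1.T b.2.fn (fun x => varφ M.φ a.2.fn (lift x s)))
        (M.g + s • lieMetric (akv a M.g) M.g) p := fun s => by
    have hc : ∀ q ∈ D.scri, confFactor (M.g + s • lieMetric (akv a M.g) M.g) q
        = varφ M.φ a.2.fn (lift q s) := fun q hq => by
      rw [h.confFactor_add_smul hω s hq, varφ, toScri_lift, lift_apply_one]
    exact killing_congr _ _ hc (fun q hq => fFun_congr _ _ _ hc hq) hp
  simp only [e]
  have z : fFun b.1.Y b.1.T b.2.fn (fun x => varφ M.φ a.2.fn (lift x 0)) = M.F b := by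
    simp only [varφ_lift_zero]
    rfl
  have tE : ∀ A B : Fin 2, tail (fun x => ((M.g + (0 : ℝ) • lieMetric (akv a M.g) M.g) x)⁻¹
      A.succ.succ B.succ.succ) p = tail (M.hInv A B) p := fun A B =>
    tail_congr (fun x hx => by rw [zero_smul, add_zero, M.inv_g hx, M.ginv_AB]) hp
  have tV : ∀ A : Fin 2, tail (fun x => ((M.g + (0 : ℝ) • lieMetric (akv a M.g) M.g) x)⁻¹
      1 A.succ.succ) p = -tail (fun x => M.V x A) p := fun A => by
    rw [tail_congr (G := fun x => -M.V x A) (fun x hx => by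
      rw [zero_smul, add_zero, M.inv_g hx, M.ginv_1A]) hp]
    exact integral_neg _
  rw [hasDerivAt_pi, NUMetric.forall_fin_four]
  refine ⟨?_, ?_, fun A => ?_⟩
  · refine h0.congr_deriv ?_
    rw [Pi.sub_apply, M.extra_zero a b hp, sub_zero]
    rfl
  · have k := (((h1 0).const_mul (-p 1)).fun_add (h2.const_mul (1 / 2))).fun_add
      (HasDerivAt.fun_sum fun (A : Fin 2) (_ : A ∈ Finset.univ) =>
        (h1 A.succ).fun_mul (hV A).fun_neg)
    refine (k.congr_of_eventuallyEq (Eventually.of_forall fun s => ?_)).congr_deriv ?_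
    · have hn : ∀ A : Fin 2, ∫ t in Set.Ioi (p 1), -((M.g + s • lieMetric (akv a M.g) M.g)
          (Function.update p 1 t))⁻¹ 1 A.succ.succ = -tail (fun x =>
          ((M.g + s • lieMetric (akv a M.g) M.g) x)⁻¹ 1 A.succ.succ) p := fun A => integral_neg _
      simp only [← hn]
      rfl
    · simp only [Pi.sub_apply, M.gen_one, NUMetric.extra, NUMetric.rho, NUMetric.dZ, NUMetric.Z, z,
        tV, Fin.sum_univ_two]
      simp only [NUMetric.dF, NUMetric.F]
      ring
  · have k := (HasDerivAt.fun_sum fun (B : Fin 2) (_ : B ∈ Finset.univ) =>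
        (h1 B.succ).fun_mul (hE A B)).const_sub (b.1.Y (ang (toScri p)) A)
    refine (k.congr_of_eventuallyEq (Eventually.of_forall fun s => ?_)).congr_deriv ?_
    · rfl
    · simp only [Pi.sub_apply, M.gen_ang, NUMetric.extra, NUMetric.sigma, z, tE, Fin.sum_univ_two,
        Pi.zero_apply]
      simp only [NUMetric.dF]
      ring

end variation

/-! ## The modified bracket -/

/-- The algebraic identity behind `[X, E df] = (L_X E) df + E d(X f)`. -/
theorem gauge_identity (x v₁ v₂ : Fin 4 → ℝ) (J₁ J₂ H E : Fin 4 → Fin 4 → ℝ)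
    (DE : Fin 4 → Fin 4 → Fin 4 → ℝ) (hH : ∀ ρ ν, H ρ ν = H ν ρ) (μ : Fin 4) :
    ∑ ρ, ((∑ ν, E ρ ν * v₁ ν) * J₂ ρ μ + x ρ * ∑ ν, (DE ρ μ ν * v₂ ν + E μ ν * H ρ ν))
      - ∑ ν, (∑ ρ, (x ρ * DE ρ μ ν - E ρ ν * J₁ ρ μ - E μ ρ * J₁ ρ ν)) * v₂ ν
    = ∑ ν, E μ ν * ∑ ρ, (J₁ ν ρ * v₂ ρ + x ρ * H ν ρ)
      + ∑ ρ, ((∑ ν, E ρ ν * v₁ ν) * J₂ ρ μ + (∑ ν, E ρ ν * v₂ ν) * J₁ ρ μ) := by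
  have h1 : ∑ ρ, x ρ * ∑ ν, (DE ρ μ ν * v₂ ν + E μ ν * H ρ ν)
      = ∑ ν, (∑ ρ, x ρ * DE ρ μ ν) * v₂ ν + ∑ ν, E μ ν * ∑ ρ, x ρ * H ν ρ := by
    simp only [Finset.mul_sum, Finset.sum_mul]
    rw [Finset.sum_comm, ← Finset.sum_add_distrib]
    refine Finset.sum_congr rfl fun ν _ => ?_
    rw [← Finset.sum_add_distrib]
    exact Finset.sum_congr rfl fun ρ _ => by rw [hH ρ ν]; ring
  have h2 : ∑ ν, (∑ ρ, E ρ ν * J₁ ρ μ) * v₂ ν = ∑ ρ, (∑ ν, E ρ ν * v₂ ν) * J₁ ρ μ := by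
    simp only [Finset.sum_mul]
    rw [Finset.sum_comm]
    exact Finset.sum_congr rfl fun ν _ => Finset.sum_congr rfl fun ρ _ => by ring
  have h3 : ∑ ν, (∑ ρ, E μ ρ * J₁ ρ ν) * v₂ ν = ∑ ν, E μ ν * ∑ ρ, J₁ ν ρ * v₂ ρ := by
    simp only [Finset.sum_mul, Finset.mul_sum]
    rw [Finset.sum_comm]
    exact Finset.sum_congr rfl fun ν _ => Finset.sum_congr rfl fun ρ _ => by ring
  simp only [Finset.sum_sub_distrib, Finset.sum_add_distrib, sub_mul, mul_add] at h1 h2 h3 ⊢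
  rw [h2, h3]
  linarith

section bracket
variable {D : Region} (M : NUMetric D) (a b : ExtBMS4 D) {p : Pt}

theorem smooth_akv : ContDiffOn ℝ (⊤ : ℕ∞) (akv a M.g) D.bulk := (isNUSymmetry_akv M a).smooth

/-- `X_a^ρ ∂_ρ X_b^μ - (δ_a X_b)^μ`. -/
noncomputable def NUMetric.half (μ : Fin 4) (p : Pt) : ℝ :=
  ∑ ρ, akv a M.g p ρ * pd ρ (fun x => akv b M.g x μ) p
    - (M.gen (M.dF a b) (M.dZ a b) 0 p μ - M.extra a b p μ)

theorem modBracket_eq (hp : p ∈ D.bulk) (μ : Fin 4) :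
    modBracket (akv a) (akv b) M.g p μ = M.half a b μ p - M.half b a μ p := by
  have h1 : ∀ a b : ExtBMS4 D, fderiv ℝ (akv b M.g) p (akv a M.g p) μ
      = ∑ ρ, akv a M.g p ρ * pd ρ (fun x => akv b M.g x μ) p := fun a b => by
    rw [clm_eq_sum, Finset.sum_apply]
    refine Finset.sum_congr rfl fun ρ _ => ?_
    rw [← pd_comp (smooth_akv M b) hp]
    rfl
  have h2 : ∀ a b : ExtBMS4 D, variation (akv b) M.g (lieMetric (akv a M.g) M.g) p
      = M.gen (M.dF a b) (M.dZ a b) 0 p - M.extra a b p := fun a b =>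
    (hasDerivAt_akv M a b hp).deriv
  simp only [modBracket, VectorField.lieBracket, Pi.add_apply, Pi.sub_apply, h1, h2, NUMetric.half]
  ring

theorem smooth_gen_dF (μ : Fin 4) :
    ContDiffOn ℝ (⊤ : ℕ∞) (fun p => M.gen (M.dF a b) (M.dZ a b) 0 p μ) D.bulk :=
  smooth_comp (smooth_gen (M.smooth_dF a b) (M.smooth_dZ a b) fun _ => contDiffOn_const) μ

theorem NUMetric.smooth_half (μ : Fin 4) : ContDiffOn ℝ (⊤ : ℕ∞) (M.half a b μ) D.bulk :=
  (ContDiffOn.sum fun ρ _ => (smooth_comp (smooth_akv M a) ρ).mul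
    (smooth_pd D.isOpen_bulk ρ (smooth_comp (smooth_akv M b) μ))).sub
    ((smooth_gen_dF M a b μ).sub (M.asym_extra a b μ).1)

theorem akv_gauge (hp : p ∈ D.bulk) (μ : Fin 4) : pd 1 (fun x => akv a M.g x μ) p
    = ∑ ν, M.ginv μ ν p * pd ν (fun x => akv a M.g x 0) p := by
  have h := isNUSymmetry_akv M a
  exact (gauge_iff h.smooth hp).1 ⟨h.uu p hp, h.ur p hp, h.uA p hp⟩ μ

theorem pd_akv_zero (hp : p ∈ D.bulk) (ν : Fin 4) : pd ν (fun x => akv a M.g x 0) p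
    = pd ν (fun x => M.F a (toScri x)) p :=
  pd_congr D.isOpen_bulk ν (fun x hx => by rw [akv_eq M a hx, M.gen_zero]) hp

/-- Fundamental theorem of calculus along the ray. The sum extends to all ν since L g^{μu} = 0 and
∂_r f = 0; in this form it cancels the term (L_X g^{-1}) df in `pd_one_half`. -/
theorem pd_one_extra (hp : p ∈ D.bulk) (μ : Fin 4) : pd 1 (fun x => M.extra a b x μ) p
    = -∑ ν, lieInv (akv a M.g) M.g μ ν p * pd ν (fun x => akv b M.g x 0) p := by
  have h := isNUSymmetry_akv M a
  have hF := M.smooth_F b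
  have d1 : ∀ B : Fin 2, DifferentiableAt ℝ (fun x => pd B.succ (M.F b) (toScri x)) p := fun B =>
    (Asym.comp_toScri (smooth_pdf hF B.succ)).diff hp
  have d2 : ∀ B : Fin 2,
      DifferentiableAt ℝ (tail (lieInv (akv a M.g) M.g μ B.succ.succ)) p := fun B =>
    ((asym_lieInv_akv M a μ B).tail le_rfl).diff hp
  have e : pd 1 (fun x => M.extra a b x μ) p = -∑ B : Fin 2,
      pd B.succ (M.F b) (toScri p) * lieInv (akv a M.g) M.g μ B.succ.succ p := by
    simp only [NUMetric.extra]
    rw [pd_sum _ _ fun B _ => (d1 B).fun_mul (d2 B), ← Finset.sum_neg_distrib]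
    refine Finset.sum_congr rfl fun B _ => ?_
    rw [pd_mul 1 (d1 B) (d2 B), pd_one_comp_toScri (diff_pdf hF _ hp.1),
      pd_one_tail (asym_lieInv_akv M a μ B) le_rfl hp]
    ring
  rw [e, sum_four, h.lieInv_zero_right hp, pd_akv_zero M b hp, pd_akv_zero M b hp,
    pd_one_comp_toScri (sdiff hF hp.1)]
  simp only [pd_akv_zero M b hp, fun B => pd_ang_scri B (sdiff hF hp.1)]
  simp only [Fin.sum_univ_two]
  ring

theorem pd_half_zero (hp : p ∈ D.bulk) (ν : Fin 4) : pd ν (M.half a b 0) p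
    = ∑ ρ, (pd ν (fun x => akv a M.g x ρ) p * pd ρ (fun x => akv b M.g x 0) p
      + akv a M.g p ρ * pd ν (pd ρ (fun x => akv b M.g x 0)) p)
      - pd ν (fun x => M.gen (M.dF a b) (M.dZ a b) 0 x 0) p := by
  have e : ∀ x ∈ D.bulk, M.half a b 0 x
      = ∑ ρ, akv a M.g x ρ * pd ρ (fun x => akv b M.g x 0) x
        - M.gen (M.dF a b) (M.dZ a b) 0 x 0 := fun x hx => by
    rw [NUMetric.half, M.extra_zero a b hx, sub_zero]
  have d1 := fun ρ => smooth_diff D.isOpen_bulk (smooth_comp (smooth_akv M a) ρ) hp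
  have d2 := fun ρ => smooth_diff D.isOpen_bulk
    (smooth_pd D.isOpen_bulk ρ (smooth_comp (smooth_akv M b) 0)) hp
  rw [pd_congr D.isOpen_bulk ν e hp, pd_sub ν
    (DifferentiableAt.fun_sum fun ρ _ => (d1 ρ).fun_mul (d2 ρ))
    (smooth_diff D.isOpen_bulk (smooth_gen_dF M a b 0) hp),
    pd_sum _ _ fun ρ _ => (d1 ρ).fun_mul (d2 ρ)]
  congr 1
  exact Finset.sum_congr rfl fun ρ _ => pd_mul ν (d1 ρ) (d2 ρ)

/-- Writing the angular and radial components through ∂_r ξ_b = g⁻¹ df_b, the failure of X_a to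
commute with g⁻¹ is L_{X_a} g⁻¹, which `extra` compensates. The leftover sum is symmetric in a and b
and disappears in the modified bracket. -/
theorem pd_one_half (hp : p ∈ D.bulk) (μ : Fin 4) : pd 1 (M.half a b μ) p
    = ∑ ν, M.ginv μ ν p * pd ν (M.half a b 0) p
      + ∑ ρ, (pd 1 (fun x => akv a M.g x ρ) p * pd ρ (fun x => akv b M.g x μ) p
        + pd 1 (fun x => akv b M.g x ρ) p * pd ρ (fun x => akv a M.g x μ) p) := by
  have sa := fun ρ => smooth_comp (smooth_akv M a) ρ
  have sb := fun ρ => smooth_comp (smooth_akv M b) ρ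
  have d1 := fun ρ => smooth_diff D.isOpen_bulk (sa ρ) hp
  have d2 := fun ρ => smooth_diff D.isOpen_bulk (smooth_pd D.isOpen_bulk ρ (sb μ)) hp
  have d3 := smooth_diff D.isOpen_bulk (smooth_gen_dF M a b μ) hp
  have d4 := (M.asym_extra a b μ).diff hp
  have dE := fun ν => smooth_diff D.isOpen_bulk (M.smooth_ginv μ ν) hp
  have dv := fun ν => smooth_diff D.isOpen_bulk (smooth_pd D.isOpen_bulk ν (sb 0)) hp
  have e1 : pd 1 (M.half a b μ) p = ∑ ρ, (pd 1 (fun x => akv a M.g x ρ) p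
      * pd ρ (fun x => akv b M.g x μ) p
      + akv a M.g p ρ * pd 1 (pd ρ (fun x => akv b M.g x μ)) p)
      - (pd 1 (fun x => M.gen (M.dF a b) (M.dZ a b) 0 x μ) p
        - pd 1 (fun x => M.extra a b x μ) p) := by
    have e : M.half a b μ = fun x => ∑ ρ, akv a M.g x ρ * pd ρ (fun x => akv b M.g x μ) x
      - (M.gen (M.dF a b) (M.dZ a b) 0 x μ - M.extra a b x μ) := rfl
    rw [e, pd_sub 1 (DifferentiableAt.fun_sum fun ρ _ => (d1 ρ).fun_mul (d2 ρ)) (d3.fun_sub d4),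
      pd_sub 1 d3 d4, pd_sum _ _ fun ρ _ => (d1 ρ).fun_mul (d2 ρ)]
    congr 1
    exact Finset.sum_congr rfl fun ρ _ => pd_mul 1 (d1 ρ) (d2 ρ)
  have e2 : ∀ ρ, pd 1 (pd ρ (fun x => akv b M.g x μ)) p
      = ∑ ν, (pd ρ (M.ginv μ ν) p * pd ν (fun x => akv b M.g x 0) p
        + M.ginv μ ν p * pd ρ (pd ν (fun x => akv b M.g x 0)) p) := fun ρ => by
    rw [pd_comm D.isOpen_bulk 1 ρ (sb μ) hp,
      pd_congr D.isOpen_bulk ρ (fun x hx => akv_gauge M b hx μ) hp,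
      pd_sum _ _ fun ν _ => (dE ν).fun_mul (dv ν)]
    exact Finset.sum_congr rfl fun ν _ => pd_mul ρ (dE ν) (dv ν)
  have key := gauge_identity (akv a M.g p) (fun ν => pd ν (fun x => akv a M.g x 0) p)
    (fun ν => pd ν (fun x => akv b M.g x 0) p) (fun ρ μ => pd ρ (fun x => akv a M.g x μ) p)
    (fun ρ μ => pd ρ (fun x => akv b M.g x μ) p)
    (fun ρ ν => pd ρ (pd ν (fun x => akv b M.g x 0)) p) (fun μ ν => M.ginv μ ν p)
    (fun ρ μ ν => pd ρ (M.ginv μ ν) p)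
    (fun ρ ν => pd_comm D.isOpen_bulk ρ ν (sb 0) hp) μ
  simp only [← lieInv_eq (smooth_akv M a) hp, ← akv_gauge M a hp, ← akv_gauge M b hp, ← e2] at key
  rw [e1, gen_gauge (Y := 0) (M.smooth_dF a b) (M.smooth_dZ a b) (fun _ => contDiffOn_const) hp,
    pd_one_extra M a b hp]
  simp only [pd_half_zero M a b hp, mul_sub, Finset.sum_sub_distrib]
  linarith

/-- The modified bracket satisfies the gauge conditions. -/
theorem pd_one_modBracket (hp : p ∈ D.bulk) (μ : Fin 4) :
    pd 1 (fun x => M.half a b μ x - M.half b a μ x) p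
      = ∑ ν, M.ginv μ ν p * pd ν (fun x => M.half a b 0 x - M.half b a 0 x) p := by
  have d := fun a b μ => smooth_diff D.isOpen_bulk (M.smooth_half a b μ) hp
  rw [pd_sub 1 (d a b μ) (d b a μ), pd_one_half M a b hp, pd_one_half M b a hp]
  simp only [fun ν => pd_sub ν (d a b 0) (d b a 0), mul_sub, Finset.sum_sub_distrib,
    Finset.sum_add_distrib]
  ring

end bracket

end NewmanUnti

namespace NewmanUnti

/-! ## The bracket on Scri -/

section scri
variable {D : Region} {M : NUMetric D} {f ω : ScriPt → ℝ} {X Y : Fin 2 → ScriPt → ℝ} {q : ScriPt}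

theorem along_const_mul (Y : Fin 2 → ScriPt → ℝ) (c : ℝ) (hf : ContDiffOn ℝ (⊤ : ℕ∞) f D.scri)
    (hq : q ∈ D.scri) : along Y (fun x => c * f x) q = c * along Y f q := by
  simp only [along, Finset.mul_sum]
  refine Finset.sum_congr rfl fun A _ => ?_
  rw [pd_const_mul _ c (sdiff hf hq)]
  ring

/-- `Y^A ∂_A` applied to the evolution equation. -/
theorem Evolves.along_pd_zero (he : Evolves M f ω Y) (hf : ContDiffOn ℝ (⊤ : ℕ∞) f D.scri)
    (hω : ContDiffOn ℝ (⊤ : ℕ∞) ω D.scri) (hY : ∀ A, ContDiffOn ℝ (⊤ : ℕ∞) (Y A) D.scri)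
    (X : Fin 2 → ScriPt → ℝ) (hq : q ∈ D.scri) : along X (pd 0 f) q
      = along X f q * pd 0 M.φ q + f q * along X (pd 0 M.φ) q + 1 / 2 * along X (sdiv Y) q
        + along X (along Y M.φ) q - along X ω q := by
  have s1 : ContDiffOn ℝ (⊤ : ℕ∞) (fun q => f q * pd 0 M.φ q) D.scri := hf.mul (M.smooth_pdφ 0)
  have s2 : ContDiffOn ℝ (⊤ : ℕ∞) (fun q => 1 / 2 * sdiv Y q) D.scri :=
    contDiffOn_const.mul (smooth_sdiv hY)
  have s3 : ContDiffOn ℝ (⊤ : ℕ∞) (fun q => f q * pd 0 M.φ q + 1 / 2 * sdiv Y q) D.scri :=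
    s1.add s2
  have s4 := smooth_along hY M.smooth_φ
  have s5 : ContDiffOn ℝ (⊤ : ℕ∞)
      (fun q => f q * pd 0 M.φ q + 1 / 2 * sdiv Y q + along Y M.φ q) D.scri := s3.add s4
  rw [along_congr X he hq, along_sub X s5 hω hq, along_add X s3 s4 hq, along_add X s1 s2 hq,
    along_mul X hf (M.smooth_pdφ 0) hq, along_const_mul X _ (smooth_sdiv hY) hq]

/-- The commutator of two vector fields on the sections of constant `u`. -/
noncomputable def comm (X Y : Fin 2 → ScriPt → ℝ) (A : Fin 2) (q : ScriPt) : ℝ :=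
  along X (Y A) q - along Y (X A) q

theorem along_comm (hX : ∀ A, ContDiffOn ℝ (⊤ : ℕ∞) (X A) D.scri)
    (hY : ∀ A, ContDiffOn ℝ (⊤ : ℕ∞) (Y A) D.scri) (hf : ContDiffOn ℝ (⊤ : ℕ∞) f D.scri)
    (hq : q ∈ D.scri) :
    along (comm X Y) f q = along X (along Y f) q - along Y (along X f) q := by
  simp only [along_eq X (along Y f), along_eq Y (along X f), pd_along hY hf _ hq,
    pd_along hX hf _ hq, along_eq, comm, pd_comm_scri hf 2 1 hq]
  ring

theorem sdiv_comm (hX : ∀ A, ContDiffOn ℝ (⊤ : ℕ∞) (X A) D.scri)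
    (hY : ∀ A, ContDiffOn ℝ (⊤ : ℕ∞) (Y A) D.scri) (hq : q ∈ D.scri) :
    sdiv (comm X Y) q = along X (sdiv Y) q - along Y (sdiv X) q := by
  have e : ∀ A, comm X Y A = fun q => along X (Y A) q - along Y (X A) q := fun _ => rfl
  have eX : ∀ {X : Fin 2 → ScriPt → ℝ}, (∀ A, ContDiffOn ℝ (⊤ : ℕ∞) (X A) D.scri) → ∀ i,
      pd i (sdiv X) q = pd i (pd 1 (X 0)) q + pd i (pd 2 (X 1)) q := fun {X} hX i => by
    rw [show sdiv X = fun q => pd 1 (X 0) q + pd 2 (X 1) q from funext (sdiv_eq X),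
      pd_add i (sdiff (smooth_pdf (hX 0) 1) hq) (sdiff (smooth_pdf (hX 1) 2) hq)]
  have h : ∀ A i, pd i (comm X Y A) q = along (fun B => pd i (X B)) (Y A) q
      + along X (pd i (Y A)) q - (along (fun B => pd i (Y B)) (X A) q
      + along Y (pd i (X A)) q) := fun A i => by
    rw [e, pd_sub i (sdiff (smooth_along hX (hY A)) hq) (sdiff (smooth_along hY (hX A)) hq),
      pd_along hX (hY A) i hq, pd_along hY (hX A) i hq]
  rw [sdiv_eq, h, h]
  simp only [along_eq, eX hX, eX hY]
  ring

end scri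

section bracket
variable {D : Region} (M : NUMetric D) (a b : ExtBMS4 D) {q : ScriPt}

theorem BMS4.Y_mem (a : BMS4 D) : a.Y ∈ ckv D := a.1.2

theorem smooth_vec (a : ExtBMS4 D) (A : Fin 2) : ContDiffOn ℝ (⊤ : ℕ∞) (vec a.1.Y A) D.scri :=
  (isConf_vec a.1.Y_mem).smooth A

theorem vec_lie (hq : q ∈ D.scri) (A : Fin 2) :
    vec ⁅a, b⁆.1.Y A q = comm (vec a.1.Y) (vec b.1.Y) A q := by
  have h : ∀ a b : ExtBMS4 D, fderiv ℝ b.1.Y (ang q) (a.1.Y (ang q)) A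
      = along (vec a.1.Y) (vec b.1.Y A) q := fun a b => by
    rw [clm_eq_sum, Finset.sum_apply, along]
    refine Finset.sum_congr rfl fun B _ => ?_
    rw [pd_succ_vec b.1.Y_mem hq]
    rfl
  rw [comm, ← h, ← h]
  rfl

/-- `f_a ∂_u f_b + Y_a^A ∂_A f_b - δ_a f_b`. -/
noncomputable def NUMetric.G (q : ScriPt) : ℝ :=
  M.F a q * pd 0 (M.F b) q + along (vec a.1.Y) (M.F b) q - M.dF a b q

theorem NUMetric.smooth_G : ContDiffOn ℝ (⊤ : ℕ∞) (M.G a b) D.scri :=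
  (((M.smooth_F a).mul (smooth_pdf (M.smooth_F b) 0)).add
    (smooth_along (smooth_vec a) (M.smooth_F b))).sub (M.smooth_dF a b)

theorem along_pd_zero_vec (f : ScriPt → ℝ) (hq : q ∈ D.scri) :
    along (fun A => pd 0 (vec a.1.Y A)) f q = 0 :=
  Finset.sum_eq_zero fun A _ => by
    simp only [pd_zero_vec a.1.Y_mem hq, zero_mul]

theorem pd_zero_sdiv_vec (hq : q ∈ D.scri) : pd 0 (sdiv (vec a.1.Y)) q = 0 := by
  have e : sdiv (vec a.1.Y) = fun q => ∑ A : Fin 2, pd A.succ (vec a.1.Y A) q := rfl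
  rw [e, pd_sum _ _ fun A _ => sdiff (smooth_pdf (smooth_vec a A) _) hq]
  refine Finset.sum_eq_zero fun A _ => ?_
  rw [pd_comm_scri (smooth_vec a A) 0 A.succ hq,
    pd_congr (G := fun _ => 0) D.isOpen_scri _ (fun x hx => pd_zero_vec a.1.Y_mem hx A) hq, pd_const]

theorem pd_zero_pd_zero_F (hq : q ∈ D.scri) : pd 0 (pd 0 (M.F a)) q
    = pd 0 (M.F a) q * pd 0 M.φ q + M.F a q * pd 0 (pd 0 M.φ) q
      + along (vec a.1.Y) (pd 0 M.φ) q - pd 0 a.2.fn q := by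
  have d0 := sdiff (M.smooth_F a) hq
  have d1 := sdiff (M.smooth_pdφ 0) hq
  have d2 := sdiff (smooth_sdiv (smooth_vec a)) hq
  have d3 := sdiff (smooth_along (smooth_vec a) M.smooth_φ) hq
  have d4 := sdiff a.2.smooth hq
  rw [pd_congr D.isOpen_scri 0 (M.evolves_F a) hq,
    pd_sub 0 (((d0.fun_mul d1).fun_add (d2.const_mul _)).fun_add d3) d4,
    pd_add 0 ((d0.fun_mul d1).fun_add (d2.const_mul _)) d3,
    pd_add 0 (d0.fun_mul d1) (d2.const_mul _), pd_mul 0 d0 d1, pd_const_mul 0 _ d2,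
    pd_zero_sdiv_vec a hq, pd_along (smooth_vec a) M.smooth_φ 0 hq, along_pd_zero_vec a _ hq]
  ring

theorem pd_zero_dF (hq : q ∈ D.scri) : pd 0 (M.dF a b) q
    = M.dF a b q * pd 0 M.φ q + M.F b q * pd 0 a.2.fn q + along (vec b.1.Y) a.2.fn q :=
  pd_zero_deltaF a.2.smooth M.smooth_φ b.1.Y_mem b.1.2.2 b.2.smooth hq

theorem pd_zero_G (hq : q ∈ D.scri) : pd 0 (M.G a b) q
    = pd 0 (M.F a) q * pd 0 (M.F b) q + M.F a q * pd 0 (pd 0 (M.F b)) q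
      + along (vec a.1.Y) (pd 0 (M.F b)) q - pd 0 (M.dF a b) q := by
  have d0 := sdiff (M.smooth_F a) hq
  have d1 := sdiff (smooth_pdf (M.smooth_F b) 0) hq
  have d2 := sdiff (smooth_along (smooth_vec a) (M.smooth_F b)) hq
  have e : M.G a b
    = fun q => M.F a q * pd 0 (M.F b) q + along (vec a.1.Y) (M.F b) q - M.dF a b q := rfl
  rw [e, pd_sub 0 ((d0.fun_mul d1).fun_add d2) (sdiff (M.smooth_dF a b) hq),
    pd_add 0 (d0.fun_mul d1) d2, pd_mul 0 d0 d1, pd_along (smooth_vec a) (M.smooth_F b) 0 hq,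
    along_pd_zero_vec a _ hq]
  ring

theorem flap_G (hq : q ∈ D.scri) : flap (M.G a b) q
    = flap (M.F a) q * pd 0 (M.F b) q
      + 2 * ∑ A : Fin 2, pd A.succ (M.F a) q * pd A.succ (pd 0 (M.F b)) q
      + M.F a q * flap (pd 0 (M.F b)) q + sdiv (vec a.1.Y) q * flap (M.F b) q
      + along (vec a.1.Y) (flap (M.F b)) q - flap (M.dF a b) q := by
  have s0 : ContDiffOn ℝ (⊤ : ℕ∞) (fun q => M.F a q * pd 0 (M.F b) q) D.scri :=
    (M.smooth_F a).mul (smooth_pdf (M.smooth_F b) 0)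
  have s1 := smooth_along (smooth_vec a) (M.smooth_F b)
  have s2 : ContDiffOn ℝ (⊤ : ℕ∞)
      (fun q => M.F a q * pd 0 (M.F b) q + along (vec a.1.Y) (M.F b) q) D.scri := s0.add s1
  have e : M.G a b
    = fun q => M.F a q * pd 0 (M.F b) q + along (vec a.1.Y) (M.F b) q - M.dF a b q := rfl
  rw [e, flap_sub s2 (M.smooth_dF a b) hq, flap_add s0 s1 hq,
    flap_mul (M.smooth_F a) (smooth_pdf (M.smooth_F b) 0) hq,
    (isConf_vec a.1.Y_mem).flap_along (M.smooth_F b) hq]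
  ring

/-- In the antisymmetrized u-derivative the terms f_a ∂_u ω_b + f_b ∂_u ω_a and Y_a ω_b + Y_b ω_a,
to which the variations δf contribute one half each, are symmetric and cancel. This is why the
bracket carries no rescaling. -/
theorem evolves_G : Evolves M (fun q => M.G a b q - M.G b a q) (fun _ => 0)
    (comm (vec a.1.Y) (vec b.1.Y)) := fun q hq => by
  have ha := (M.evolves_F a).along_pd_zero (M.smooth_F a) a.2.smooth (smooth_vec a)
    (vec b.1.Y) hq
  have hb := (M.evolves_F b).along_pd_zero (M.smooth_F b) b.2.smooth (smooth_vec b)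
    (vec a.1.Y) hq
  rw [pd_sub 0 (sdiff (M.smooth_G a b) hq) (sdiff (M.smooth_G b a) hq), pd_zero_G M a b hq,
    pd_zero_G M b a hq, pd_zero_pd_zero_F M a hq, pd_zero_pd_zero_F M b hq, pd_zero_dF M a b hq,
    pd_zero_dF M b a hq, ha, hb, sdiv_comm (smooth_vec a) (smooth_vec b) hq,
    along_comm (smooth_vec a) (smooth_vec b) M.smooth_φ hq]
  simp only [NUMetric.G]
  ring

theorem evolves_F_lie : Evolves M (M.F ⁅a, b⁆) (fun _ => 0)
    (comm (vec a.1.Y) (vec b.1.Y)) := fun q hq => by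
  rw [M.evolves_F ⁅a, b⁆ q hq]
  have e := fun A q hq => vec_lie a b (q := q) hq A
  simp only [sdiv, along, e _ q hq, fun A i => pd_congr D.isOpen_scri i (e A) hq]
  rfl

theorem along_F_at_zero (Y : Fin 2 → ScriPt → ℝ) (hq : q ∈ D.scri) (h0 : q 0 = 0) :
    along Y (M.F a) q = M.F a q * along Y M.φ q
      + Real.exp (M.φ q) * ∑ A : Fin 2, Y A q * pd A a.1.T (ang q) := by
  have hs := smooth_source (Y := a.1.Y) a.1.Y_mem a.2.smooth M.smooth_φ
  have d1 := sdiff M.smooth_φ hq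
  have d2 := sdiff (smooth_comp_ang (T := a.1.T) a.1.2.2) hq
  have d3 := sdiff (smooth_uInt_source (Y := a.1.Y) a.1.Y_mem a.2.smooth M.smooth_φ) hq
  have e : M.F a = fun q => Real.exp (M.φ q) *
    (a.1.T (ang q) + 1 / 2 * uInt (source a.1.Y a.2.fn M.φ) q) := rfl
  have h : ∀ A : Fin 2, pd A.succ (M.F a) q
      = M.F a q * pd A.succ M.φ q + Real.exp (M.φ q) * pd A a.1.T (ang q) := fun A => by
    have z : uInt (pd A.succ (source a.1.Y a.2.fn M.φ)) q = 0 := by simp [uInt, h0]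
    rw [e, pd_mul _ d1.exp (d2.fun_add (d3.const_mul _)), pd_add _ d2 (d3.const_mul _),
      pd_const_mul _ _ d3, pd_exp _ d1, pd_succ_uInt D.isOpen_scri hs (mem_star_scri hq), z,
      pd_succ_comp_ang A ((a.1.T_smooth hq.2).differentiableAt (by simp))]
    ring
  simp only [along, h, Fin.sum_univ_two]
  ring

/-- At u = 0 one has f = e^φ T and δ_a f_b = ω_a f_b. With the evolution equation inserted, all
terms containing ω or derivatives of φ are symmetric in a and b; the rest is e^φ times the
supertranslation bracket. -/
theorem G_at_zero (hq : q ∈ D.scri) (h0 : q 0 = 0) :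
    M.G a b q - M.G b a q = M.F ⁅a, b⁆ q := by
  have hd : ∀ a b, M.dF a b q = a.2.fn q * M.F b q := fun a b =>
    deltaF_at_zero a.2.smooth M.smooth_φ b.1.Y_mem b.1.2.2 b.2.smooth hq h0
  have hF : ∀ a, M.F a q = Real.exp (M.φ q) * a.1.T (ang q) := fun a =>
    fFun_at_zero _ _ _ _ h0
  have eT : ⁅a, b⁆.1.T (ang q) = stBracket a.1.Y a.1.T b.1.Y b.1.T (ang q) := rfl
  simp only [NUMetric.G, hd, M.evolves_F _ q hq, along_F_at_zero M _ _ hq h0, hF, eT, stBracket,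
    sdiv_vec a.1.Y_mem hq, sdiv_vec b.1.Y_mem hq, Fin.sum_univ_two, vec]
  ring

theorem G_sub_G (hq : q ∈ D.scri) : M.G a b q - M.G b a q = M.F ⁅a, b⁆ q :=
  (evolves_G M a b).unique (evolves_F_lie M a b) ((M.smooth_G a b).sub (M.smooth_G b a))
    (M.smooth_F _) (fun _ hq h0 => G_at_zero M a b hq h0) hq

end bracket

end NewmanUnti

namespace NewmanUnti

/-! ## The bracket in the bulk -/

section bulk
variable {D : Region} (M : NUMetric D) (a b : ExtBMS4 D) {p : Pt}

theorem pd_akv (hp : p ∈ D.bulk) (μ ν : Fin 4) : pd ν (fun x => akv a M.g x μ) p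
    = pd ν (fun x => M.gen (M.F a) (M.Z (M.F a)) (vec a.1.Y) x μ) p :=
  pd_congr D.isOpen_bulk ν (fun x hx => by rw [akv_eq M a hx]) hp

theorem half_eq (hp : p ∈ D.bulk) (μ : Fin 4) : M.half a b μ p
    = M.F a (toScri p) * pd 0 (fun x => M.gen (M.F b) (M.Z (M.F b)) (vec b.1.Y) x μ) p
      + (-p 1 * pd 0 (M.F a) (toScri p) + M.Z (M.F a) (toScri p) + M.rho (M.F a) p)
        * pd 1 (fun x => M.gen (M.F b) (M.Z (M.F b)) (vec b.1.Y) x μ) p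
      + ∑ B : Fin 2, (vec a.1.Y B (toScri p) - M.sigma (M.F a) B p)
        * pd B.succ.succ (fun x => M.gen (M.F b) (M.Z (M.F b)) (vec b.1.Y) x μ) p
      - (M.gen (M.dF a b) (M.dZ a b) 0 p μ - M.extra a b p μ) := by
  rw [NUMetric.half, sum_four]
  simp only [akv_eq M a hp, pd_akv M b hp, M.gen_zero, M.gen_one, M.gen_ang]

theorem half_zero (hp : p ∈ D.bulk) : M.half a b 0 p = M.G a b (toScri p)
    - ∑ B : Fin 2, M.sigma (M.F a) B p * pd B.succ (M.F b) (toScri p) := by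
  rw [half_eq M a b hp, pd_zero_gen_zero (M.smooth_F b) hp, pd_one_gen_zero (M.smooth_F b) hp,
    M.gen_zero, M.extra_zero a b hp]
  simp only [pd_ang_gen_zero (M.smooth_F b) hp, NUMetric.G, along, Fin.sum_univ_two]
  ring

/-- The bulk correction to `G` is ∂_A f_a ∂_B f_b contracted with the ray integral of g^{AB}, hence
symmetric. The agreement of u-components is therefore exact in the bulk, as the gauge argument
requires. -/
theorem half_zero_sub (hp : p ∈ D.bulk) :
    M.half a b 0 p - M.half b a 0 p = M.F ⁅a, b⁆ (toScri p) := by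
  have e : M.hInv 1 0 = M.hInv 0 1 := funext (M.hInv_symm 1 0)
  rw [half_zero M a b hp, half_zero M b a hp, ← G_sub_G M a b hp.1]
  simp only [NUMetric.sigma, Fin.sum_univ_two, e]
  ring

theorem asym_half_ang (A : Fin 2) : Asym D false (-1) fun p => M.half a b A.succ.succ p
    - along (vec a.1.Y) (vec b.1.Y A) (toScri p) := by
  have sa := M.smooth_F a
  have sb := M.smooth_F b
  have ss := asym_sigma (M := M) sb A
  have h1 : Asym D false (-1) fun p => M.F a (toScri p) * -pd 0 (M.sigma (M.F b) A) p :=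
    Asym.scri_mul sa ss.pd_zero.neg
  have h2 : Asym D false (-1) fun p =>
      (-p 1 * pd 0 (M.F a) (toScri p) + M.Z (M.F a) (toScri p) + M.rho (M.F a) p)
        * ∑ B : Fin 2, pd B.succ (M.F b) (toScri p) * M.hInv A B p :=
    (asym_gen_one (Y := 0) sa (M.smooth_Z sa)).mulO
      (asym_sum_two fun B => Asym.scri_mul (smooth_pdf sb _) (M.asym_hInv A B))
  have h3 : Asym D false (-1) fun p => ∑ B : Fin 2,
      (-(vec a.1.Y B (toScri p) * pd B.succ.succ (M.sigma (M.F b) A) p)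
        - pd B.succ (vec b.1.Y A) (toScri p) * M.sigma (M.F a) B p
        + M.sigma (M.F a) B p * pd B.succ.succ (M.sigma (M.F b) A) p) :=
    asym_sum_two fun B => ((Asym.scri_mul (smooth_vec a B) (ss.pd_ang B)).neg.sub
      (Asym.scri_mul (smooth_pdf (smooth_vec b A) _) (asym_sigma sa B))).add
      ((asym_sigma sa B).mulO (ss.pd_ang B))
  refine (((h1.add h2).add h3).add ((asym_sigma (M := M) (M.smooth_dF a b) A).add
    (M.asym_extra a b A.succ.succ))).congr fun p hp => ?_
  rw [half_eq M a b hp, pd_zero_gen_ang sb (smooth_vec b) hp, pd_one_gen_ang sb (smooth_vec b) hp,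
    pd_zero_vec b.1.Y_mem hp.1, M.gen_ang]
  simp only [pd_ang_gen_ang sb (smooth_vec b) hp, Fin.sum_univ_two, along, Pi.zero_apply]
  ring

/-- The leading terms have the radial shape -r ∂_u G + ½ Δ̄ G, apart from products of the two
functions f that are symmetric in a and b; these are kept explicit here and cancel on
antisymmetrization. -/
theorem asym_half_one : Asym D.pos false (-1) fun p => M.half a b 1 p
    - (p 1 * (2 * (pd 0 (M.F a) (toScri p) * pd 0 (M.F b) (toScri p))
        - pd 0 (M.G a b) (toScri p))
      + (M.Z (M.G a b) (toScri p) - M.m (toScri p) * (pd 0 (M.F a) (toScri p)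
        * flap (M.F b) (toScri p) + flap (M.F a) (toScri p) * pd 0 (M.F b) (toScri p)))) := by
  have sa := M.smooth_F a
  have sb := M.smooth_F b
  have sZ := M.smooth_Z sa
  have sZb := M.smooth_Z sb
  have ra := (asym_rho (M := M) sa).mono_pos
  have rb := (asym_rho (M := M) sb).mono_pos
  have hr := Asym.radius (D := D.pos)
  have h1 : Asym D.pos false (-1) fun p => M.F a (toScri p) * pd 0 (M.rho (M.F b)) p :=
    Asym.scri_mul (D := D.pos) sa rb.pd_zero
  have h2 : Asym D.pos false (-1) fun p =>
      (-p 1 * pd 0 (M.F a) (toScri p) + M.Z (M.F a) (toScri p) + M.rho (M.F a) p)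
        * pd 1 (M.rho (M.F b)) p :=
    (asym_gen_one (Y := 0) sa sZ).mono_pos.mulO rb.pd_one
  have h3 : Asym D.pos false (-1) fun p => pd 0 (M.F b) (toScri p) * M.rho (M.F a) p :=
    Asym.scri_mul (D := D.pos) (smooth_pdf sb 0) ra
  have s4 : ∀ B : Fin 2, ContDiffOn ℝ (⊤ : ℕ∞) (fun q => M.m q * pd B.succ (M.F a) q) D.scri :=
    fun B => M.smooth_m.mul (smooth_pdf sa _)
  have h4 : Asym D.pos false (-1) fun p => ∑ B : Fin 2,
      (vec a.1.Y B (toScri p) * pd B.succ.succ (M.rho (M.F b)) p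
        + M.tau (M.F a) B p * (p 1 * pd B.succ (pd 0 (M.F b)) (toScri p))
        - M.sigma (M.F a) B p * (pd B.succ (M.Z (M.F b)) (toScri p)
          + pd B.succ.succ (M.rho (M.F b)) p)) :=
    asym_sum_two fun B => ((Asym.scri_mul (D := D.pos) (smooth_vec a B) (rb.pd_ang B)).add
      ((asym_tau sa B).mulO (hr.mulO (Asym.comp_toScri (D := D.pos)
        (smooth_pdf (smooth_pdf sb 0) B.succ)) (l := 1)))).sub
      ((asym_sigma sa B).mono_pos.mulO ((Asym.comp_toScri (D := D.pos) (smooth_pdf sZb _)).add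
        ((rb.pd_ang B).of_lt (by norm_num))))
  have h5 := ((asym_rho (M := M) (M.smooth_dF a b)).sub (M.asym_extra a b 1)).mono_pos
  refine (((h1.add h2).sub h3).add (h4.sub h5)).congr fun p hp => ?_
  have hb := Region.bulk_pos_subset hp
  have hq : toScri p ∈ D.scri := hp.1
  have hr0 : p 1 ≠ 0 := by have := Region.one_lt_of_mem_pos hp; linarith
  have eZ : ∀ i, pd i (M.Z (M.F b)) (toScri p) = 1 / 2 * (M.m (toScri p)
      * (flap (pd i (M.F b)) (toScri p)
        - 2 * pd i M.φ (toScri p) * flap (M.F b) (toScri p))) := fun i => by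
    have e : M.Z (M.F b) = fun q => 1 / 2 * lap M.φ (M.F b) q := rfl
    rw [e, pd_const_mul i _ (sdiff (smooth_lap M.smooth_φ sb) hq), pd_lap sb i hq]
  have eL : ∀ f, M.Z f (toScri p) = 1 / 2 * (M.m (toScri p) * flap f (toScri p)) := fun _ => rfl
  have eS := fun B => sigma_eq (M := M) (M.F a) hp B
  have eT : ∀ B : Fin 2, M.tau (M.F a) B p = M.sigma (M.F a) B p
      - (p 1)⁻¹ * (M.m (toScri p) * pd B.succ (M.F a) (toScri p)) := fun B => by
    rw [eS]; ring
  have ev := M.evolves_F a _ hq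
  rw [half_eq M a b hb, pd_zero_gen_one sb sZb hb, pd_one_gen_one sb sZb hb, M.gen_one,
    pd_zero_G M a b hq, eL (M.G a b), flap_G M a b hq]
  simp only [pd_ang_gen_one sb sZb hb, Fin.sum_univ_two, along, NUMetric.dZ, eL, eT, eZ,
    pd_flap sb _ hq] at ev ⊢
  have hi : p 1 * (p 1)⁻¹ = 1 := mul_inv_cancel₀ hr0
  -- The evolution equation of f_a trades the ω_a in the variation -2 ω_a Z_b for ∂_u f_a and the
  -- transport of φ; the second term uses r r⁻¹ = 1 in r ∂_B ∂_u f_b times the leading part of the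
  -- ray integral.
  linear_combination (M.m (toScri p) * flap (M.F b) (toScri p)) * ev
    + (M.m (toScri p) * (pd (Fin.succ 0) (M.F a) (toScri p)
      * pd (Fin.succ 0) (pd 0 (M.F b)) (toScri p) + pd (Fin.succ 1) (M.F a) (toScri p)
      * pd (Fin.succ 1) (pd 0 (M.F b)) (toScri p))) * hi

theorem asym_half_sub (μ : Fin 4) : Asym D.pos false (-1) fun p =>
    M.half a b μ p - M.half b a μ p - akv ⁅a, b⁆ M.g p μ := by
  have sF := M.smooth_F ⁅a, b⁆
  revert μ
  rw [NUMetric.forall_fin_four]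
  refine ⟨Asym.zero.congr fun p hp => ?_, ?_, fun A => ?_⟩
  · have hb := Region.bulk_pos_subset hp
    rw [half_zero_sub M a b hb, akv_eq M _ hb, M.gen_zero, sub_self]
  · refine (((asym_half_one M a b).sub (asym_half_one M b a)).sub
      (asym_rho (M := M) sF).mono_pos).congr fun p hp => ?_
    have hb := Region.bulk_pos_subset hp
    have hq : toScri p ∈ D.scri := hp.1
    have e := fun q hq => G_sub_G M a b (q := q) hq
    have e1 := pd_congr D.isOpen_scri 0 e hq
    have e2 := flap_congr e hq
    rw [pd_sub 0 (sdiff (M.smooth_G a b) hq) (sdiff (M.smooth_G b a) hq)] at e1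
    rw [flap_sub (M.smooth_G a b) (M.smooth_G b a) hq] at e2
    rw [akv_eq M _ hb, M.gen_one]
    simp only [NUMetric.Z, lap_eq] at e2 ⊢
    linear_combination (-p 1) * e1 + (1 / 2 * Real.exp (-2 * M.φ (toScri p))) * e2
  · refine (((asym_half_ang M a b A).sub (asym_half_ang M b a A)).add
      (asym_sigma (M := M) sF A)).mono_pos.congr fun p hp => ?_
    have hb := Region.bulk_pos_subset hp
    rw [akv_eq M _ hb, M.gen_ang, vec_lie a b hb.1, comm]
    ring

/-- Both fields satisfy ∂_r ξ^μ = g^{μν} ∂_ν ξ^u, and their u-components coincide. -/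
theorem pd_one_half_sub (hp : p ∈ D.bulk) (μ : Fin 4) :
    pd 1 (fun p => M.half a b μ p - M.half b a μ p - akv ⁅a, b⁆ M.g p μ) p = 0 := by
  have s := fun μ => (M.smooth_half a b μ).sub (M.smooth_half b a μ)
  rw [pd_sub 1 (smooth_diff D.isOpen_bulk (s μ) hp)
    (smooth_diff D.isOpen_bulk (smooth_comp (smooth_akv M _) μ) hp), pd_one_modBracket M a b hp,
    akv_gauge M _ hp, sub_eq_zero]
  refine Finset.sum_congr rfl fun ν _ => ?_
  rw [pd_akv_zero M _ hp, pd_congr D.isOpen_bulk ν (fun x hx => half_zero_sub M a b hx) hp]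

/-- The vectors `ξ[Y, T, ω; g]` realize extended `bms₄` in the modified bracket. -/
theorem modBracket_akv (hp : p ∈ D.bulk) :
    modBracket (akv a) (akv b) M.g p = akv ⁅a, b⁆ M.g p := by
  funext μ
  rw [modBracket_eq M a b hp, ← sub_eq_zero]
  have hs : ContDiffOn ℝ (⊤ : ℕ∞)
      (fun p => M.half a b μ p - M.half b a μ p - akv ⁅a, b⁆ M.g p μ) D.bulk :=
    ((M.smooth_half a b μ).sub (M.smooth_half b a μ)).sub (smooth_comp (smooth_akv M _) μ)
  -- The difference tends to zero at infinity along the ray through `p` and is constant along it,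
  -- hence it vanishes at `p`.
  have h := (asym_half_sub M a b μ).tendsto_zero (D := D.pos) (q := toScri p) hp.1
  refine tendsto_nhds_unique (tendsto_const_nhds.congr' ?_) h
  filter_upwards [eventually_gt_atTop (D.R (toScri p))] with r hr
  have e := eq_of_pd_one_eq_zero hs (fun x hx => pd_one_half_sub M a b hx μ) hp.1 hp.2 hr
  rwa [lift_toScri] at e

end bulk

end NewmanUnti

/-! ### Assembly of the theorem -/

theorem mainTheorem1 (D : NewmanUnti.Region) (M : NewmanUnti.NUMetric D) :
    -- the vectors `ξ[Y, T, ω; g]` solve the symmetry conditions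
    (∀ a : NewmanUnti.ExtBMS4 D, NewmanUnti.IsNUSymmetry M a.2.fn (NewmanUnti.akv a M.g)) ∧
    -- they realize extended `bms₄` in the modified bracket, at every point of the bulk
    (∀ a b : NewmanUnti.ExtBMS4 D, ∀ p ∈ D.bulk,
      DifferentiableAt ℝ (fun s : ℝ => NewmanUnti.akv b
        (M.g + s • NewmanUnti.lieMetric (NewmanUnti.akv a M.g) M.g) p) 0 ∧
      NewmanUnti.modBracket (NewmanUnti.akv a) (NewmanUnti.akv b) M.g p
        = NewmanUnti.akv ⁅a, b⁆ M.g p) ∧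
    -- extended `bms₄` is mapped linearly and bijectively onto the space of all solutions
    (∃ Ψ : NewmanUnti.ExtBMS4 D →ₗ[ℝ] NewmanUnti.VField,
      (∀ a, Ψ a = D.bulk.indicator (NewmanUnti.akv a M.g)) ∧
      Function.Injective Ψ ∧
      Set.range Ψ = {ξ | (∀ p ∉ D.bulk, ξ p = 0) ∧
        ∃ w : NewmanUnti.Rescaling D, NewmanUnti.IsNUSymmetry M w.fn ξ}) ∧
    -- for a fixed conformal factor the symmetry algebra is isomorphic to `bms₄`
    (∃ Φ : NewmanUnti.BMS4 D →ₗ[ℝ] NewmanUnti.VField,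
      (∀ a, Φ a = D.bulk.indicator (NewmanUnti.akv (a, 0) M.g)) ∧
      Function.Injective Φ ∧
      Set.range Φ = {ξ | (∀ p ∉ D.bulk, ξ p = 0) ∧
        NewmanUnti.IsNUSymmetry M (fun _ => 0) ξ} ∧
      ∀ a b : NewmanUnti.BMS4 D, ∀ p ∈ D.bulk,
        NewmanUnti.modBracket (NewmanUnti.akv (a, 0)) (NewmanUnti.akv (b, 0)) M.g p
          = Φ ⁅a, b⁆ p) := by
  have hB : ∀ a b : NewmanUnti.ExtBMS4 D, ∀ p ∈ D.bulk,
      DifferentiableAt ℝ (fun s : ℝ => NewmanUnti.akv b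
        (M.g + s • NewmanUnti.lieMetric (NewmanUnti.akv a M.g) M.g) p) 0 ∧
      NewmanUnti.modBracket (NewmanUnti.akv a) (NewmanUnti.akv b) M.g p
        = NewmanUnti.akv ⁅a, b⁆ M.g p := fun a b p hp =>
    ⟨(NewmanUnti.hasDerivAt_akv M a b hp).differentiableAt, NewmanUnti.modBracket_akv M a b hp⟩
  refine ⟨NewmanUnti.isNUSymmetry_akv M, hB,
    ⟨NewmanUnti.akvMap M, NewmanUnti.akvMap_apply M, NewmanUnti.injective_akvMap M,
      NewmanUnti.range_akvMap M⟩,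
    -- Restricting to ω = 0 is composition with the inclusion of the first summand; linearity and
    -- injectivity are inherited.
    (NewmanUnti.akvMap M).comp (LinearMap.inl ℝ _ _), fun a => rfl,
    (NewmanUnti.injective_akvMap M).comp LinearMap.inl_injective, ?_, fun a b p hp => ?_⟩
  · ext ξ
    constructor
    · rintro ⟨a, rfl⟩
      exact ⟨fun p hp => by simp [NewmanUnti.akvMap_apply, hp],
        (NewmanUnti.isNUSymmetry_akv M (a, 0)).congr fun p hp => by
          simp [NewmanUnti.akvMap_apply, hp]⟩
    · rintro ⟨h0, hw⟩
      -- The zero rescaling unfolds to the zero function on Scri, so `hw` is the hypothesis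
      -- required.
      obtain ⟨c, hc⟩ := NewmanUnti.exists_akv (w := 0) hw
      refine ⟨c, funext fun p => ?_⟩
      by_cases hp : p ∈ D.bulk
      · simp [NewmanUnti.akvMap_apply, hp, hc p hp]
      · simp [NewmanUnti.akvMap_apply, hp, h0 p hp]
  · have e : (⁅((a, 0) : NewmanUnti.ExtBMS4 D), (b, 0)⁆ : NewmanUnti.ExtBMS4 D)
        = (⁅a, b⁆, 0) := rfl
    rw [(hB (a, 0) (b, 0) p hp).2, e]
    simp [NewmanUnti.akvMap_apply, hp]
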